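/- **Setting.** Everything is smooth and finite dimensional. Let $G$ be a Lie group with Lie algebra $\mathfrak g$, $M$ an $n$-dimensional manifold with volume form $\mu_M$, and $\pi:P_M\to M$ a right principal $G$-bundle with action $\Phi_g$ and infinitesimal generators $\xi_P$. Put $X=\mathbb R\times M$, $\mu=dt\wedge\mu_M$, and $P_X=\mathbb R\times P_M\to X$. Let $J^1P_X$ be the first jet bundle, with fibre $\{\gamma_p\in L(T_xX,T_pP_X): T\pi\circ\gamma_p=\mathrm{id}\}$ at $p$; it splits as $\gamma_{(t,p)}=(t,a_p,\gamma_p)$ with $a_p\in V_pP_M$, $\gamma_p\in J^1_pP_M$, where $\gamma_{(t,p)}(v,u)=(v,\,v\,a_p+\gamma_p(u))$. Let $\mathcal L=\bar{\mathcal L}\,\mu:J^1P_X\to\Lambda^{n+1}X$ be a $G$-invariant Lagrangian density and $\ell=\bar\ell\,\mu$ the induced density on $J^1P_X/G$. For $V\subset M$ open write $P_V=\pi^{-1}(V)$. Let $\mathcal Gau(P_V)$ be the group of gauge transformations and $\mathcal Conn(P_V)$ the space of principal connections; $\mathfrak{gau}(P_V)$ is identified with the space $\mathcal F_G(P_V,\mathfrak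 g)$ of equivariant maps $\mathcal U$ through $U(p)=(\mathcal U(p))_P(p)$, and also with the space of sections of $\operatorname{Ad}P_V$ through $m\mapsto[p,\mathcal U(p)]_G$. With $\operatorname{Hor}^\Gamma_p$ the horizontal lift of a connection $\Gamma$, set $$L^{\mathcal L}(t,\varphi,\dot\varphi,\Gamma)=\int\bar{\mathcal L}\big(t,\dot\varphi(p),\operatorname{Hor}^{\varphi_*\Gamma}_{\varphi(p)}\big)\mu_M,\qquad l^{\mathcal L}(t,U,\Gamma)=\int\bar\ell\big(t,[U(p)],[\operatorname{Hor}^\Gamma_p]\big)\mu_M ,$$ where the integrands depend only on $m=\pi(p)$, and $L^{\mathcal L}_{\Gamma_0}=L^{\mathcal L}(\cdot,\cdot,\cdot,\Gamma_0)$. **Data.** Let $I\subset\mathbb R$ and $V\subset M$ be open, $U=I\times V$, let $s:U\to P_X$, $s(t,m)=(t,s_t(m))$, be a local section, and let $\xi_0:P_V\to G$ satisfy $\xi_0(\Phi_g(p))=\xi_0(p)g$. Define the connection $\Gamma_0=TL_{\xi_0^{-1}}T\xi_0$ on $P_V$, which also induces a connection $((t,v),u)\mapsto\Gamma_0(u)$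 on $P_U=I\times P_V$, and $$\varphi_t(p)=\Phi_{\xi_0(p)}\big(s_t(\pi(p))\big)\in\mathcal Gau(P_V),\qquad U_t=\dot\varphi_t\circ\varphi_t^{-1},\qquad \Gamma_t=(\varphi_t)_*\Gamma_0,$$ $$\sigma(x)=[T_xs]\in J^1P_X/G,\qquad \sigma^{\Gamma_0}(x)=[s(x),\Gamma_0\circ T_xs]_G\in L(T_xX,\operatorname{Ad}P_x).$$ In the variational principles below all variations are smooth and vanish outside a compact subset ($K\subset V$ in (i)–(iii), $K\subset U$ in (v), (vii)), and the integrals over $V$, respectively $U$, are taken over such a compact set $K$. **Theorem.** The following are equivalent. (i) Hamilton's principle $\delta\int_{t_1}^{t_2}L^{\mathcal L}_{\Gamma_0}(t,\varphi_t,\dot\varphi_t)\,dt=0$ holds for all $[t_1,t_2]\subset I$ and all variations of $\varphi$ in $\mathcal Gau(P_V)$ vanishing at the endpoints. (ii) $\varphi_t$ satisfies the Euler–Lagrange equations for $L^{\mathcal L}_{\Gamma_0}$ on $\mathcal Gau(P_V)$, that is, $\frac{d}{dt}\big\langle\partial L^{\mathcal L}_{\Gamma_0}/\partial\dot\varphi,\delta\varphi\big\rangle=\delta\big(L^{\mathcal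 L}_{\Gamma_0}(t,\varphi_t,\dot\varphi_t)\big)$ on $I$ for all variations of $\varphi$. (iii) $\delta\int_{t_1}^{t_2}l^{\mathcal L}(t,U_t,\Gamma_t)\,dt=0$ for all $[t_1,t_2]\subset I$ and all variations $\delta\mathcal U=\dot\zeta-[\mathcal U,\zeta]$, $\delta\Gamma=-\mathbf d^\Gamma\zeta$, where $\zeta_t\in\mathcal F_G(P_V,\mathfrak g)$ vanishes at the endpoints and $\mathbf d^\Gamma\zeta=\mathbf d\zeta+[\Gamma,\zeta]$. (iv) The affine Euler–Poincaré equations hold on $I$: $$\frac{\partial}{\partial t}\frac{\delta l^{\mathcal L}}{\delta\mathcal U}=-\operatorname{ad}^*_{\mathcal U}\frac{\delta l^{\mathcal L}}{\delta\mathcal U}+\operatorname{div}^{\Gamma}\frac{\delta l^{\mathcal L}}{\delta\Gamma}\quad\text{at }(U_t,\Gamma_t).$$ Here the functional derivatives are the smooth sections of $\operatorname{Ad}P_V^*$ and $L(TV,\operatorname{Ad}P_V)^*$ that represent the first variation of $l^{\mathcal L}$ through the pairing $\int\langle\cdot,\cdot\rangle\mu_M$, and $\operatorname{div}^\Gamma$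 is minus the adjoint of the covariant derivative $\nabla^\Gamma$ for this pairing. (v) $\delta\int_U\mathcal L(j^1s)=0$ for all variations of $s$ through sections, with compact support. (vi) $s$ satisfies the covariant Euler–Lagrange equations for $\mathcal L$, that is, $\delta\big(\bar{\mathcal L}(j^1s)\big)=\operatorname{div}_\mu W$ on $U$ for all variations of $s$, where $W$ is the vector field with $\beta(W)=\frac{d}{d\varepsilon}\big|_{0}\bar{\mathcal L}(j^1s+\varepsilon\,\beta\otimes\delta s)$ for all covectors $\beta$. (vii) $\delta\int_U\ell(\sigma)=0$ for all variations $\delta\sigma=\nabla^{\Gamma_0}\eta-[\sigma^{\Gamma_0},\eta]$ with $\eta$ a compactly supported section of $\operatorname{Ad}P_U$. (viii) The covariant Euler–Poincaré equations hold on $U$: $$\operatorname{div}^{\Gamma_0}\frac{\delta\bar\ell}{\delta\sigma}=-\operatorname{Tr}\Big(\operatorname{ad}^*_{\sigma^{\Gamma_0}}\frac{\delta\bar\ell}{\delta\sigma}\Big).$$ Here $\frac{\delta\bar\ell}{\delta\sigma}(\zeta)=\frac{d}{d\varepsilon}\big|_0\bar\ell(\sigma+\varepsilon\zeta)$ for $\zeta\in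 L(T_xX,\operatorname{Ad}P_x)$, and the covariant divergence is defined by $\operatorname{div}_\mu(w\cdot\eta)=(\operatorname{div}^{\Gamma_0}w)\cdot\eta+w\cdot\nabla^{\Gamma_0}\eta$ for all sections $\eta$ of $\operatorname{Ad}P_U$. -/

import Mathlib

open Set Filter Topology MeasureTheory
open scoped Manifold ContDiff

noncomputable section

namespace GaugeField

/-! ### Lie algebra of the structure group

`G` is a Lie group modelled on `EG`; the normed space `EG` is the tangent space at the identity,
i.e. the Lie algebra of `G`. -/

section LieAlgebra

variable {EG : Type*} [NormedAddCommGroup EG] [NormedSpace ℝ EG]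
  (G : Type*) [TopologicalSpace G] [ChartedSpace EG G] [Group G]

/-- The adjoint representation `Ad_g`, the derivative at the identity of `h ↦ g h g⁻¹`. -/
def Ad (g : G) : EG →L[ℝ] EG :=
  mfderiv 𝓘(ℝ, EG) 𝓘(ℝ, EG) (fun h : G => g * h * g⁻¹) 1

instance instLieGroupMinSmoothness [LieGroup 𝓘(ℝ, EG) ∞ G] :
    LieGroup 𝓘(ℝ, EG) (minSmoothness ℝ 3) G := by
  rw [minSmoothness_of_isRCLikeNormedField]
  infer_instance

/-- `ad_ξ η = [ξ, η]`, with the bracket of left invariant vector fields. -/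
def ad [FiniteDimensional ℝ EG] [LieGroup 𝓘(ℝ, EG) ∞ G] (ξ : EG) : EG →L[ℝ] EG :=
  haveI : LieGroup 𝓘(ℝ, EG) (minSmoothness ℝ 3) G := instLieGroupMinSmoothness G
  LinearMap.toContinuousLinearMap
    ((LieAlgebra.ad ℝ (GroupLieAlgebra 𝓘(ℝ, EG) G) ξ : _ →ₗ[ℝ] _) : EG →ₗ[ℝ] EG)

end LieAlgebra

/-! ### Principal bundles -/

/-- A projection `P → X` together with a map `P × G → P`, `(p, g) ↦ Φ_g(p)`. -/
structure BundleMaps (X P G : Type*) where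
  proj : P → X
  act : P → G → P

namespace BundleMaps

variable {X P G : Type*}

/-- `P_U`, the part of `P` over `U`. -/
def part (B : BundleMaps X P G) (U : Set X) : Set P := B.proj ⁻¹' U

/-- `ℝ × P → ℝ × X`, with `G` acting on the second factor. -/
def timesLine (B : BundleMaps X P G) : BundleMaps (ℝ × X) (ℝ × P) G where
  proj q := (q.1, B.proj q.2)
  act q g := (q.1, B.act q.2 g)

/-- The value `f(p)`, `π(p) = x`, of a function `f` on `P` that is constant along the fibres
(for such an `f` the choice of `p` does not matter; `0` if the fibre is empty). -/
def descend {F : Type*} [Zero F] (B : BundleMaps X P G) (f : P → F) (x : X) : F := by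
  classical
  exact if h : ∃ p, B.proj p = x then f h.choose else 0

/-- The group element `g` with `Φ_g(q) = p`, for `p` and `q` in the same fibre. -/
def transl [One G] (B : BundleMaps X P G) (q p : P) : G := by
  classical
  exact if h : ∃ g, B.act q g = p then h.choose else 1

end BundleMaps

/-- The inverse of a map which is a bijection of `S` onto itself. -/
def locInv {P : Type*} (S : Set P) (φ : P → P) (q : P) : P := by
  classical
  exact if h : ∃ p, p ∈ S ∧ φ p = q then h.choose else q

section Bundle

variable
  {EX : Type*} [NormedAddCommGroup EX] [NormedSpace ℝ EX]
  {HX : Type*} [TopologicalSpace HX] (IX : ModelWithCorners ℝ EX HX)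
  {X : Type*} [TopologicalSpace X] [ChartedSpace HX X] [IsManifold IX ∞ X]
  {EP : Type*} [NormedAddCommGroup EP] [NormedSpace ℝ EP]
  {HP : Type*} [TopologicalSpace HP] (IP : ModelWithCorners ℝ EP HP)
  {P : Type*} [TopologicalSpace P] [ChartedSpace HP P] [IsManifold IP ∞ P]
  {EG : Type*} [NormedAddCommGroup EG] [NormedSpace ℝ EG]
  {G : Type*} [TopologicalSpace G] [ChartedSpace EG G] [Group G]
  (B : BundleMaps X P G)

/-- `π : P → X` is a smooth right principal `G`-bundle: a smooth right action preserving the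
fibres, with local `G`-equivariant trivializations `p ↦ (π p, ξ p)` onto `W × G`. -/
structure IsPrincipal : Prop where
  smooth_proj : ContMDiff IP IX ∞ B.proj
  smooth_act : ContMDiff (IP.prod 𝓘(ℝ, EG)) IP ∞ (fun z : P × G => B.act z.1 z.2)
  act_one : ∀ p, B.act p 1 = p
  act_mul : ∀ p g h, B.act (B.act p g) h = B.act p (g * h)
  proj_act : ∀ p g, B.proj (B.act p g) = B.proj p
  locally_trivial : ∀ x : X, ∃ W : Set X, IsOpen W ∧ x ∈ W ∧
    ∃ (ξ : P → G) (ψ : X × G → P),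
      ContMDiffOn IP 𝓘(ℝ, EG) ∞ ξ (B.part W) ∧
      ContMDiffOn (IX.prod 𝓘(ℝ, EG)) IP ∞ ψ (W ×ˢ univ) ∧
      (∀ p ∈ B.part W, ∀ g, ξ (B.act p g) = ξ p * g) ∧
      (∀ p ∈ B.part W, ψ (B.proj p, ξ p) = p) ∧
      (∀ y ∈ W, ∀ g, B.proj (ψ (y, g)) = y ∧ ξ (ψ (y, g)) = g)

/-- The infinitesimal generator `ξ ↦ ξ_P(p)`, the derivative at `1` of `g ↦ Φ_g(p)`. -/
def infGen (p : P) : EG →L[ℝ] TangentSpace IP p :=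
  mfderiv 𝓘(ℝ, EG) IP (B.act p) 1

/-- The element `ξ` of the Lie algebra with `ξ_P(p) = v`, for a vertical vector `v` at `p`. -/
def generator (p : P) (v : TangentSpace IP p) : EG := by
  classical
  exact if h : ∃ ξ : EG, infGen IP B p ξ = v then h.choose else 0

/-- The vector field `p ↦ (f(p))_P(p)` of a Lie algebra valued function `f`. -/
def fundField (f : P → EG) (p : P) : TangentSpace IP p := infGen IP B p (f p)

/-! ### Jets, Lagrangian densities and their reduction -/

/-- The first jet bundle `J¹P`: linear maps `γ : T_{π(p)}X → T_pP` with `Tπ ∘ γ = id`. -/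
structure Jet where
  pt : P
  lin : TangentSpace IX (B.proj pt) →L[ℝ] TangentSpace IP pt
  proj_lin : (mfderiv IP IX B.proj pt).comp lin = ContinuousLinearMap.id ℝ _

/-- `j'` is obtained from `j` by the action of some `g`: `γ' = TΦ_g ∘ γ`. -/
def JetRel (j j' : Jet IX IP B) : Prop :=
  ∃ g : G, j'.pt = B.act j.pt g ∧
    ∀ u : EX, (j'.lin u : EP) = mfderiv IP IP (fun p => B.act p g) j.pt (j.lin u)

/-- The reduced jet bundle `J¹P/G`. -/
def RedJet : Type _ := Quot (JetRel IX IP B)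

/-- Smoothness of a function on `J¹P`: it is smooth along every smooth finite dimensional family
of jets. Smoothness of a family is that of its base point and of its components. -/
def SmoothOnJets (L : Jet IX IP B → ℝ) : Prop :=
  ∀ (k : ℕ) (c : EuclideanSpace ℝ (Fin k) → Jet IX IP B) (z : EuclideanSpace ℝ (Fin k)),
    ContMDiffAt (𝓡 k) IP ∞ (fun y => (c y).pt) z →
    ContMDiffAt (𝓡 k) 𝓘(ℝ, EX →L[ℝ] EP) ∞
      (inTangentCoordinates IX IP (fun y => B.proj (c y).pt) (fun y => (c y).pt)
        (fun y => (c y).lin) z) z →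
    ContMDiffAt (𝓡 k) 𝓘(ℝ, ℝ) ∞ (fun y => L (c y)) z

/-- `G`-invariance of a function on `J¹P`. -/
def Invariant (L : Jet IX IP B → ℝ) : Prop := ∀ j j', JetRel IX IP B j j' → L j = L j'

/-- The function on `J¹P/G` induced by an invariant function on `J¹P`. -/
def reduce (L : Jet IX IP B → ℝ) (hL : Invariant IX IP B L) : RedJet IX IP B → ℝ :=
  Quot.lift L hL

variable {IX IP B} in
/-- The value of a function on `J¹P` at the jet `γ` at `p` (`0` if `γ` is not a jet). -/
def jetEval (L : Jet IX IP B → ℝ) (p : P)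
    (γ : TangentSpace IX (B.proj p) →L[ℝ] TangentSpace IP p) : ℝ := by
  classical
  exact if h : (mfderiv IP IX B.proj p).comp γ = ContinuousLinearMap.id ℝ _ then L ⟨p, γ, h⟩ else 0

variable {IX IP B} in
/-- The value of a function on `J¹P/G` at the class `[γ]` of the jet `γ` at `p`
(`0` if `γ` is not a jet). -/
def redEval (ℓ : RedJet IX IP B → ℝ) (p : P)
    (γ : TangentSpace IX (B.proj p) →L[ℝ] TangentSpace IP p) : ℝ := by
  classical
  exact if h : (mfderiv IP IX B.proj p).comp γ = ContinuousLinearMap.id ℝ _ then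
      ℓ (Quot.mk _ ⟨p, γ, h⟩) else 0

/-! ### Equivariant functions and forms, connections

Sections over `U` of the adjoint bundle `Ad P = (P × 𝔤)/G` are the equivariant functions
`f : P_U → 𝔤`, through `x ↦ [p, f(p)]_G`. Sections of `L(TX, Ad P)` are the equivariant families
`α(p) : T_{π(p)}X → 𝔤`, sections of `Ad P*` are the equivariant functions with values in `𝔤*`,
and sections of `L(TX, Ad P)* = L(T*X, Ad P*)` are the equivariant families of linear forms on
`L(T_{π(p)}X, 𝔤)`. All these functions are only relevant on `P_U`. -/

/-- `f` is a smooth section over `U` of the adjoint bundle. -/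
structure IsAdSection (U : Set X) (f : P → EG) : Prop where
  smooth : ContMDiffOn IP 𝓘(ℝ, EG) ∞ f (B.part U)
  equivariant : ∀ p ∈ B.part U, ∀ g, f (B.act p g) = Ad G g⁻¹ (f p)

/-- `N` is a smooth section over `U` of the coadjoint bundle. -/
structure IsCoadSection (U : Set X) (N : P → (EG →L[ℝ] ℝ)) : Prop where
  smooth : ContMDiffOn IP 𝓘(ℝ, EG →L[ℝ] ℝ) ∞ N (B.part U)
  equivariant : ∀ p ∈ B.part U, ∀ g, (N (B.act p g)).comp (Ad G g⁻¹) = N p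

/-- Smoothness over `S` of a one-form on `P` with values in the Lie algebra. -/
def SmoothForm (S : Set P) (A : ∀ p : P, TangentSpace IP p →L[ℝ] EG) : Prop :=
  ContMDiffOn IP.tangent 𝓘(ℝ, EG) ∞ (fun v : TangentBundle IP P => A v.1 v.2) {v | v.1 ∈ S}

/-- `A` is a smooth principal connection on `P_U`. -/
structure IsConnection (U : Set X) (A : ∀ p : P, TangentSpace IP p →L[ℝ] EG) : Prop where
  smooth : SmoothForm IP (B.part U) A
  vertical : ∀ p ∈ B.part U, ∀ ξ : EG, A p (infGen IP B p ξ) = ξ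
  equivariant : ∀ p ∈ B.part U, ∀ (g : G) (v : TangentSpace IP p),
    A (B.act p g) (mfderiv IP IP (fun q => B.act q g) p v) = Ad G g⁻¹ (A p v)

/-- `α` is a smooth section over `U` of `L(TX, Ad P)`; the corresponding horizontal equivariant
one-form on `P_U` is `p ↦ α(p) ∘ T_pπ`. -/
structure IsAdForm (U : Set X) (α : ∀ p : P, TangentSpace IX (B.proj p) →L[ℝ] EG) : Prop where
  smooth : SmoothForm IP (B.part U) (fun p => (α p).comp (mfderiv IP IX B.proj p))
  equivariant : ∀ p ∈ B.part U, ∀ (g : G) (u : EX),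
    α (B.act p g) u = Ad G g⁻¹ (α p u)

/-- `χ` is a smooth section over `U` of `L(TX, Ad P)*`. -/
structure IsCoadField (U : Set X)
    (χ : ∀ p : P, (TangentSpace IX (B.proj p) →L[ℝ] EG) →L[ℝ] ℝ) : Prop where
  smooth : ∀ α : (∀ p : P, TangentSpace IX (B.proj p) →L[ℝ] EG), IsAdForm IX IP B U α →
    ContMDiffOn IP 𝓘(ℝ, ℝ) ∞ (fun p => χ p (α p)) (B.part U)
  equivariant : ∀ p ∈ B.part U, ∀ (g : G) (α : EX →L[ℝ] EG),
    χ (B.act p g) ((Ad G g⁻¹).comp α) = χ p α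

/-- The horizontal lift `Hor_p : T_{π(p)}X → T_pP` of a connection `A`. -/
def horLift (A : ∀ p : P, TangentSpace IP p →L[ℝ] EG) (p : P) :
    TangentSpace IX (B.proj p) →L[ℝ] TangentSpace IP p := by
  classical
  exact if h : ∃ γ : TangentSpace IX (B.proj p) →L[ℝ] TangentSpace IP p,
      (mfderiv IP IX B.proj p).comp γ = ContinuousLinearMap.id ℝ _ ∧ (A p).comp γ = 0
    then h.choose else 0

variable (G) in
/-- The covariant differential `d^A f = df + [A, f]`, a one-form on `P`. -/
def covDiff [FiniteDimensional ℝ EG] [LieGroup 𝓘(ℝ, EG) ∞ G]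
    (A : ∀ p : P, TangentSpace IP p →L[ℝ] EG) (f : P → EG) (p : P) :
    TangentSpace IP p →L[ℝ] EG :=
  let df : TangentSpace IP p →L[ℝ] EG := mfderiv IP 𝓘(ℝ, EG) f p
  df - (ad G (f p)).comp (A p)

/-- The covariant derivative `∇^A` on sections of the adjoint bundle:
`∇^A_v f (p) = d^A f(p)(v_p)` for any `v_p` over `v`, here the horizontal lift. -/
def covDeriv [FiniteDimensional ℝ EG] [LieGroup 𝓘(ℝ, EG) ∞ G]
    (A : ∀ p : P, TangentSpace IP p →L[ℝ] EG) (f : P → EG) (p : P) :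
    TangentSpace IX (B.proj p) →L[ℝ] EG :=
  (covDiff IP G A f p).comp (horLift IX IP B A p)

/-! ### Local sections and their reduced jet extensions -/

/-- `s` is a smooth local section over `U`. -/
structure IsLocalSection (U : Set X) (s : X → P) : Prop where
  smooth : ContMDiffOn IX IP ∞ s U
  proj_eq : ∀ x ∈ U, B.proj (s x) = x

/-- The first jet extension `j¹s(x) = T_xs`. -/
def jetExt (s : X → P) (x : X) : TangentSpace IX x →L[ℝ] TangentSpace IP (s x) :=
  mfderiv IX IP s x

/-- The representative at `p` of the reduced jet extension `σ(x) = [j¹s(x)]`, `x = π(p)`,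
namely `TΦ_g ∘ T_xs` with `Φ_g(s(x)) = p`. -/
def redJetExt (s : X → P) (p : P) : TangentSpace IX (B.proj p) →L[ℝ] TangentSpace IP p :=
  let x := B.proj p
  let Tact : EP →L[ℝ] EP := mfderiv IP IP (fun q => B.act q (B.transl (s x) p)) (s x)
  let Ts : EX →L[ℝ] EP := jetExt IX IP s x
  Tact.comp Ts

/-- `σ^A(x) = [s(x), A ∘ T_xs]_G`, a section of `L(TX, Ad P)`: its value at `p = Φ_g(s(x))` is
`Ad_{g⁻¹} ∘ A ∘ T_xs`. -/
def redJetForm (A : ∀ p : P, TangentSpace IP p →L[ℝ] EG) (s : X → P) (p : P) :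
    TangentSpace IX (B.proj p) →L[ℝ] EG :=
  (Ad G (B.transl (s (B.proj p)) p)⁻¹).comp
    ((A (s (B.proj p))).comp (jetExt IX IP s (B.proj p)))

/-- A smooth one-parameter family `S` of local sections over `U`, with `S 0 = s`. -/
structure IsSectionVariation (U : Set X) (s : X → P) (S : ℝ → X → P) : Prop where
  smooth : ContMDiffOn (𝓘(ℝ, ℝ).prod IX) IP ∞ (fun z : ℝ × X => S z.1 z.2) (univ ×ˢ U)
  proj_eq : ∀ ε, ∀ x ∈ U, B.proj (S ε x) = x
  zero : ∀ x ∈ U, S 0 x = s x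

/-! ### Divergence -/

/-- The vector `W` with `β(W) = F(β)` for all covectors `β`, for a linear `F`. -/
def vecOf [FiniteDimensional ℝ EX] (F : (EX →L[ℝ] ℝ) → ℝ) : EX :=
  ∑ i, F (LinearMap.toContinuousLinearMap ((Module.finBasis ℝ EX).coord i)) •
    Module.finBasis ℝ EX i

/-- The divergence at `x` of a vector field `W` with respect to a volume form whose coefficient
in the chart at `x` is the function `ρ x` on the model space: `ρ⁻¹ ∑ᵢ ∂ᵢ(ρ Wⁱ)`. -/
def divergence (ρ : X → EX → ℝ) (W : ∀ x : X, TangentSpace IX x) (x : X) : ℝ :=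
  (ρ x (extChartAt IX x x))⁻¹ *
    LinearMap.trace ℝ EX (fderiv ℝ (fun y : EX => ρ x y •
      (mfderiv IX 𝓘(ℝ, EX) (extChartAt IX x) ((extChartAt IX x).symm y)
        (W ((extChartAt IX x).symm y)) : EX)) (extChartAt IX x x)).toLinearMap

/-- `div^A w = D` over `U`, for a section `w` of `L(TX, Ad P)*` and a section `D` of `Ad P*`:
`div(w · η) = D · η + w · ∇^A η` for all sections `η` of `Ad P`. Here `w · η` is the vector field
with `β(w · η) = w(β ⊗ η)` for all covectors `β`. -/
def HasCovDiv [FiniteDimensional ℝ EX] [FiniteDimensional ℝ EG] [LieGroup 𝓘(ℝ, EG) ∞ G]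
    (ρ : X → EX → ℝ) (U : Set X) (A : ∀ p : P, TangentSpace IP p →L[ℝ] EG)
    (w : ∀ p : P, (TangentSpace IX (B.proj p) →L[ℝ] EG) → ℝ) (D : P → EG → ℝ) : Prop :=
  ∀ η : P → EG, IsAdSection IP B U η → ∀ p ∈ B.part U,
    divergence IX ρ
        (fun x => B.descend (fun q => vecOf (EX := EX) (fun β : EX →L[ℝ] ℝ =>
          w q (β.smulRight (η q) : EX →L[ℝ] EG))) x)
        (B.proj p) =
      D p (η p) + w p (covDeriv IX IP B A η p)

/-! ### Covariant variational principles and equations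

`L` and `ℓ` are the functions on `J¹P` and `J¹P/G` obtained from the Lagrangian densities by
division by the volume form, `μ` is the measure of the volume form and `ρ` its coefficients. -/

/-- `δ ∫_U L(j¹s) = 0` for variations with compact support in `U`. As usual the integral is taken
over a compact set `K` outside which the section is not varied. -/
def CovariantHamilton [MeasurableSpace X] (μ : Measure X) (L : Jet IX IP B → ℝ)
    (U : Set X) (s : X → P) : Prop :=
  ∀ K : Set X, IsCompact K → K ⊆ U → ∀ S : ℝ → X → P, IsSectionVariation IX IP B U s S →
    (∀ ε, ∀ x ∈ U \ K, S ε x = s x) →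
    HasDerivAt (fun ε => ∫ x in K, jetEval L (S ε x) (jetExt IX IP (S ε) x) ∂μ) 0 0

/-- The covariant Euler-Lagrange equations, without coordinates: for every variation `δs` of `s`,
`d/dε L(j¹s_ε) = div(∂L/∂j¹s · δs)`, the vector field on the right being characterized by
`β(∂L/∂j¹s · δs) = d/dε L(j¹s + ε β ⊗ δs)` for covectors `β`. In fibred coordinates this says that
`(∂L/∂yᵃ - ρ⁻¹ ∂_μ(ρ ∂L/∂yᵃ_μ)) δyᵃ = 0` for all `δy`. -/
def CovariantEulerLagrange [FiniteDimensional ℝ EX] (ρ : X → EX → ℝ) (L : Jet IX IP B → ℝ)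
    (U : Set X) (s : X → P) : Prop :=
  ∀ S : ℝ → X → P, IsSectionVariation IX IP B U s S → ∀ x ∈ U,
    HasDerivAt (fun ε => jetEval L (S ε x) (jetExt IX IP (S ε) x))
      (divergence IX ρ (fun y => vecOf (EX := EX) (fun β : EX →L[ℝ] ℝ =>
        let j : EX →L[ℝ] EP := jetExt IX IP s y
        let δs : EP := mfderiv 𝓘(ℝ, ℝ) IP (fun ε => S ε y) 0 (1 : ℝ)
        deriv (fun ε : ℝ => jetEval L (s y) (j + ε • β.smulRight δs)) 0)) x) 0

/-- `δ ∫_U ℓ(σ) = 0` for variations `δσ = ∇^A η - [σ^A, η]`, with `η` a section of `Ad P_U` with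
compact support. The affine structure of `J¹P/G` is `[γ_p] + α = [γ_p + (α(p)(·))_P(p)]`. -/
def CovariantReducedPrinciple [FiniteDimensional ℝ EG] [LieGroup 𝓘(ℝ, EG) ∞ G]
    [MeasurableSpace X] (μ : Measure X) (ℓ : RedJet IX IP B → ℝ)
    (U : Set X) (A : ∀ p : P, TangentSpace IP p →L[ℝ] EG) (s : X → P) : Prop :=
  ∀ K : Set X, IsCompact K → K ⊆ U → ∀ η : P → EG, IsAdSection IP B U η →
    (∀ p ∈ B.part (U \ K), η p = 0) →
    HasDerivAt (fun ε : ℝ => ∫ x in K, B.descend (fun p => redEval ℓ p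
      (redJetExt IX IP B s p + ε • (infGen IP B p).comp
        (covDeriv IX IP B A η p + (ad G (η p)).comp (redJetForm IX IP B A s p)))) x ∂μ) 0 0

/-- The fibre derivative `δℓ/δσ(ζ) = d/dε ℓ(σ + ε ζ)`, `ζ ∈ L(T_xX, Ad P_x)`. -/
def fibreDeriv (ℓ : RedJet IX IP B → ℝ) (s : X → P) (p : P)
    (ζ : TangentSpace IX (B.proj p) →L[ℝ] EG) : ℝ :=
  deriv (fun ε : ℝ => redEval ℓ p (redJetExt IX IP B s p + ε • (infGen IP B p).comp ζ)) 0

/-- The covariant Euler-Poincaré equations `div^A (δℓ/δσ) = -Tr(ad*_{σ^A} δℓ/δσ)`, where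
`Tr(ad*_σ w)` is the linear form `ξ ↦ w([σ(·), ξ])`. -/
def CovariantEulerPoincare [FiniteDimensional ℝ EX] [FiniteDimensional ℝ EG]
    [LieGroup 𝓘(ℝ, EG) ∞ G] (ρ : X → EX → ℝ) (ℓ : RedJet IX IP B → ℝ)
    (U : Set X) (A : ∀ p : P, TangentSpace IP p →L[ℝ] EG) (s : X → P) : Prop :=
  HasCovDiv IX IP B ρ U A (fibreDeriv IX IP B ℓ s) (fun p ξ =>
    - fibreDeriv IX IP B ℓ s p (- (ad G ξ).comp (redJetForm IX IP B A s p)))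

/-! ### Gauge transformations -/

/-- `φ` restricts to a gauge transformation of `P_V`: a diffeomorphism of `P_V` which covers the
identity and commutes with the action of `G`. -/
structure IsGauge (V : Set X) (φ : P → P) : Prop where
  smooth : ContMDiffOn IP IP ∞ φ (B.part V)
  proj_eq : ∀ p ∈ B.part V, B.proj (φ p) = B.proj p
  equivariant : ∀ p ∈ B.part V, ∀ g, φ (B.act p g) = B.act (φ p) g
  bijOn : BijOn φ (B.part V) (B.part V)
  smooth_inv : ContMDiffOn IP IP ∞ (locInv (B.part V) φ) (B.part V)

/-- The push-forward `φ_*Γ = (φ⁻¹)^*Γ` of a one-form on `P_V`. -/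
def pushForm (V : Set X) (φ : P → P) (Γ : ∀ p : P, TangentSpace IP p →L[ℝ] EG) (q : P) :
    TangentSpace IP q →L[ℝ] EG :=
  (Γ (locInv (B.part V) φ q)).comp (mfderiv IP IP (locInv (B.part V) φ) q)

/-- The velocity `dφ_t/dt`, a vector field along `φ_t`. -/
def velocity (φ : ℝ → P → P) (t : ℝ) (p : P) : TangentSpace IP (φ t p) :=
  mfderiv 𝓘(ℝ, ℝ) IP (fun τ => φ τ p) t (1 : ℝ)

/-- The Eulerian velocity `dφ_t/dt ∘ φ_t⁻¹`, as an equivariant function with values in the Lie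
algebra. -/
def bodyVelocity (V : Set X) (φ : ℝ → P → P) (t : ℝ) (q : P) : EG :=
  generator IP B q (velocity IP φ t (locInv (B.part V) (φ t) q) : EP)

/-- A smooth one-parameter family `F` of curves of gauge transformations of `P_V`, defined for
times in `J`, with `F 0 = φ`, and which differs from `φ` only over `K`. -/
structure IsGaugeVariation (J : Set ℝ) (V K : Set X) (φ : ℝ → P → P) (F : ℝ → ℝ → P → P) :
    Prop where
  smooth : ContMDiffOn (𝓘(ℝ, ℝ).prod (𝓘(ℝ, ℝ).prod IP)) IP ∞
    (fun z : ℝ × ℝ × P => F z.1 z.2.1 z.2.2) (univ ×ˢ (J ×ˢ B.part V))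
  gauge : ∀ ε, ∀ t ∈ J, IsGauge IP B V (F ε t)
  zero : ∀ t ∈ J, ∀ p ∈ B.part V, F 0 t p = φ t p
  support : ∀ ε, ∀ t ∈ J, ∀ p ∈ B.part (V \ K), F ε t p = φ t p

/-! ### The instantaneous Lagrangian and its reduction -/

/-- The jet of `ℝ × P` given by a vertical vector `a` at `p` and a jet `γ` of `P` at `p`:
`(v, u) ↦ (v, v a + γ(u))`. -/
def splitJet (p : P) (a : TangentSpace IP p)
    (γ : TangentSpace IX (B.proj p) →L[ℝ] TangentSpace IP p) : ℝ × EX →L[ℝ] ℝ × EP :=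
  (ContinuousLinearMap.fst ℝ ℝ EX).prod
    ((ContinuousLinearMap.fst ℝ ℝ EX).smulRight (a : EP) +
      (γ : EX →L[ℝ] EP).comp (ContinuousLinearMap.snd ℝ ℝ EX))

/-- The instantaneous Lagrangian
`(t, φ, φ', Γ) ↦ ∫_K L(t, φ'(p), Hor_{φ(p)}^{φ_*Γ}) μ` on `T Gau(P_V) × Conn(P_V)`. -/
def instLagrangian [MeasurableSpace X] (μ : Measure X)
    (L : Jet (𝓘(ℝ, ℝ).prod IX) (𝓘(ℝ, ℝ).prod IP) B.timesLine → ℝ) (V K : Set X) (t : ℝ)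
    (φ : P → P) (φ' : ∀ p : P, TangentSpace IP (φ p))
    (Γ : ∀ p : P, TangentSpace IP p →L[ℝ] EG) : ℝ :=
  ∫ m in K, B.descend (fun p => jetEval L (t, φ p)
    (splitJet IX IP B (φ p) (φ' p) (horLift IX IP B (pushForm IP B V φ Γ) (φ p)))) m ∂μ

/-- The reduced Lagrangian `(t, U, Γ) ↦ ∫_K ℓ(t, [U(p)], [Hor_p^Γ]) μ`, where `U = f_P` for the
equivariant function `f`. -/
def redLagrangian [MeasurableSpace X] (μ : Measure X)
    (ℓ : RedJet (𝓘(ℝ, ℝ).prod IX) (𝓘(ℝ, ℝ).prod IP) B.timesLine → ℝ) (K : Set X) (t : ℝ)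
    (f : P → EG) (Γ : ∀ p : P, TangentSpace IP p →L[ℝ] EG) : ℝ :=
  ∫ m in K, B.descend (fun p => redEval ℓ (t, p)
    (splitJet IX IP B p (fundField IP B f p) (horLift IX IP B Γ p))) m ∂μ

/-! ### Dynamic variational principles and equations -/

/-- Hamilton's principle `δ ∫_{t₁}^{t₂} L_{Γ₀}(t, φ_t, φ'_t) dt = 0` for variations vanishing at
the endpoints. -/
def DynamicHamilton [MeasurableSpace X] (μ : Measure X)
    (L : Jet (𝓘(ℝ, ℝ).prod IX) (𝓘(ℝ, ℝ).prod IP) B.timesLine → ℝ) (J : Set ℝ) (V : Set X)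
    (Γ₀ : ∀ p : P, TangentSpace IP p →L[ℝ] EG) (φ : ℝ → P → P) : Prop :=
  ∀ t₁ t₂ : ℝ, t₁ < t₂ → Icc t₁ t₂ ⊆ J → ∀ K : Set X, IsCompact K → K ⊆ V →
    ∀ F : ℝ → ℝ → P → P, IsGaugeVariation IP B J V K φ F →
    (∀ ε, ∀ p ∈ B.part V, F ε t₁ p = φ t₁ p ∧ F ε t₂ p = φ t₂ p) →
    HasDerivAt (fun ε => ∫ t in t₁..t₂,
      instLagrangian IX IP B μ L V K t (F ε t) (velocity IP (F ε) t) Γ₀) 0 0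

/-- The Euler-Lagrange equations on the gauge group, without coordinates: for every variation
`δφ` of `φ`, `d/dt ⟨∂L/∂φ', δφ⟩ = d/dε L(t, φ^ε, φ'^ε)`, where `∂L/∂φ'` is the derivative along the
fibre of the tangent bundle. In a chart this says
`⟨d/dt ∂L/∂φ' - ∂L/∂φ, δφ⟩ = 0` for all `δφ`. -/
def DynamicEulerLagrange [MeasurableSpace X] (μ : Measure X)
    (L : Jet (𝓘(ℝ, ℝ).prod IX) (𝓘(ℝ, ℝ).prod IP) B.timesLine → ℝ) (J : Set ℝ) (V : Set X)
    (Γ₀ : ∀ p : P, TangentSpace IP p →L[ℝ] EG) (φ : ℝ → P → P) : Prop :=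
  ∀ K : Set X, IsCompact K → K ⊆ V →
    ∀ F : ℝ → ℝ → P → P, IsGaugeVariation IP B J V K φ F → ∀ t ∈ J,
    HasDerivAt
      (fun τ => deriv (fun ε : ℝ => instLagrangian IX IP B μ L V K τ (φ τ)
        (fun p =>
          let v : EP := velocity IP φ τ p
          let δφ : EP := mfderiv 𝓘(ℝ, ℝ) IP (fun ε' => F ε' τ p) 0 (1 : ℝ)
          v + ε • δφ) Γ₀) 0)
      (deriv (fun ε : ℝ => instLagrangian IX IP B μ L V K t (F ε t) (velocity IP (F ε) t) Γ₀) 0)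
      t

/-- The constrained principle `δ ∫_{t₁}^{t₂} l(t, U_t, Γ_t) dt = 0` for variations
`δU = ζ' - [U, ζ]`, `δΓ = - d^Γ ζ`, with `ζ` vanishing at the endpoints. -/
def AffineReducedPrinciple [FiniteDimensional ℝ EG] [LieGroup 𝓘(ℝ, EG) ∞ G]
    [MeasurableSpace X] (μ : Measure X)
    (ℓ : RedJet (𝓘(ℝ, ℝ).prod IX) (𝓘(ℝ, ℝ).prod IP) B.timesLine → ℝ) (J : Set ℝ) (V : Set X)
    (f : ℝ → P → EG) (Γ : ℝ → ∀ p : P, TangentSpace IP p →L[ℝ] EG) : Prop :=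
  ∀ t₁ t₂ : ℝ, t₁ < t₂ → Icc t₁ t₂ ⊆ J → ∀ K : Set X, IsCompact K → K ⊆ V →
    ∀ ζ : ℝ → P → EG,
    ContMDiffOn (𝓘(ℝ, ℝ).prod IP) 𝓘(ℝ, EG) ∞ (fun z : ℝ × P => ζ z.1 z.2) (J ×ˢ B.part V) →
    (∀ t ∈ J, IsAdSection IP B V (ζ t)) →
    (∀ t ∈ J, ∀ p ∈ B.part (V \ K), ζ t p = 0) →
    (∀ p ∈ B.part V, ζ t₁ p = 0 ∧ ζ t₂ p = 0) →
    HasDerivAt (fun ε : ℝ => ∫ t in t₁..t₂, redLagrangian IX IP B μ ℓ K t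
      (fun p => f t p + ε • (deriv (fun τ => ζ τ p) t - ad G (f t p) (ζ t p)))
      (fun p => Γ t p - ε • covDiff IP G (Γ t) (ζ t) p)) 0 0

/-- `N` is the functional derivative `δl/δU` at `(t, f, Γ)`. -/
def HasFuncDerivVel [MeasurableSpace X] (μ : Measure X)
    (ℓ : RedJet (𝓘(ℝ, ℝ).prod IX) (𝓘(ℝ, ℝ).prod IP) B.timesLine → ℝ) (V : Set X) (t : ℝ)
    (f : P → EG) (Γ : ∀ p : P, TangentSpace IP p →L[ℝ] EG) (N : P → (EG →L[ℝ] ℝ)) : Prop :=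
  IsCoadSection IP B V N ∧
  ∀ K : Set X, IsCompact K → K ⊆ V → ∀ θ : P → EG, IsAdSection IP B V θ →
    (∀ p ∈ B.part (V \ K), θ p = 0) →
    HasDerivAt (fun ε : ℝ => redLagrangian IX IP B μ ℓ K t (fun p => f p + ε • θ p) Γ)
      (∫ m in K, B.descend (fun p => N p (θ p)) m ∂μ) 0

/-- `χ` is the functional derivative `δl/δΓ` at `(t, f, Γ)`. -/
def HasFuncDerivConn [MeasurableSpace X] (μ : Measure X)
    (ℓ : RedJet (𝓘(ℝ, ℝ).prod IX) (𝓘(ℝ, ℝ).prod IP) B.timesLine → ℝ) (V : Set X) (t : ℝ)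
    (f : P → EG) (Γ : ∀ p : P, TangentSpace IP p →L[ℝ] EG)
    (χ : ∀ p : P, (TangentSpace IX (B.proj p) →L[ℝ] EG) →L[ℝ] ℝ) : Prop :=
  IsCoadField IX IP B V χ ∧
  ∀ K : Set X, IsCompact K → K ⊆ V →
    ∀ α : (∀ p : P, TangentSpace IX (B.proj p) →L[ℝ] EG), IsAdForm IX IP B V α →
    (∀ p ∈ B.part (V \ K), α p = 0) →
    HasDerivAt (fun ε : ℝ => redLagrangian IX IP B μ ℓ K t f
        (fun p => Γ p + ε • (α p).comp (mfderiv IP IX B.proj p)))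
      (∫ m in K, B.descend (fun p => χ p (α p)) m ∂μ) 0

/-- `div^Γ χ = D` over `V`, the covariant divergence being minus the `L²` adjoint of the covariant
derivative `∇^Γ`. -/
def HasAdjointDiv [FiniteDimensional ℝ EG] [LieGroup 𝓘(ℝ, EG) ∞ G]
    [MeasurableSpace X] (μ : Measure X) (V : Set X)
    (Γ : ∀ p : P, TangentSpace IP p →L[ℝ] EG)
    (χ : ∀ p : P, (TangentSpace IX (B.proj p) →L[ℝ] EG) →L[ℝ] ℝ) (D : P → (EG →L[ℝ] ℝ)) : Prop :=
  IsCoadSection IP B V D ∧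
  ∀ K : Set X, IsCompact K → K ⊆ V → ∀ θ : P → EG, IsAdSection IP B V θ →
    (∀ p ∈ B.part (V \ K), θ p = 0) →
    ∫ m in K, B.descend (fun p => D p (θ p)) m ∂μ =
      - ∫ m in K, B.descend (fun p => χ p (covDeriv IX IP B Γ θ p)) m ∂μ

/-- The affine Euler-Poincaré equations `∂/∂t δl/δU = -ad*_U δl/δU + div^Γ δl/δΓ`. -/
def AffineEulerPoincare [FiniteDimensional ℝ EG] [LieGroup 𝓘(ℝ, EG) ∞ G]
    [MeasurableSpace X] (μ : Measure X)
    (ℓ : RedJet (𝓘(ℝ, ℝ).prod IX) (𝓘(ℝ, ℝ).prod IP) B.timesLine → ℝ) (J : Set ℝ) (V : Set X)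
    (f : ℝ → P → EG) (Γ : ℝ → ∀ p : P, TangentSpace IP p →L[ℝ] EG) : Prop :=
  ∃ (N : ℝ → P → (EG →L[ℝ] ℝ))
    (χ : ℝ → ∀ p : P, (TangentSpace IX (B.proj p) →L[ℝ] EG) →L[ℝ] ℝ)
    (D : ℝ → P → (EG →L[ℝ] ℝ)),
    ∀ t ∈ J,
      HasFuncDerivVel IX IP B μ ℓ V t (f t) (Γ t) (N t) ∧
      HasFuncDerivConn IX IP B μ ℓ V t (f t) (Γ t) (χ t) ∧
      HasAdjointDiv IX IP B μ V (Γ t) (χ t) (D t) ∧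
      ∀ p ∈ B.part V,
        HasDerivAt (fun τ => N τ p) (- (N t p).comp (ad G (f t p)) + D t p) t

/-! ### The objects attached to a local trivialization and a local section -/

/-- The flat connection `Γ₀ = TL_{ξ₀⁻¹} ∘ Tξ₀` of an equivariant map `ξ₀ : P_V → G`. -/
def flatConnection (ξ₀ : P → G) (p : P) : TangentSpace IP p →L[ℝ] EG :=
  (mfderiv 𝓘(ℝ, EG) 𝓘(ℝ, EG) (fun g : G => (ξ₀ p)⁻¹ * g) (ξ₀ p)).comp
    (mfderiv IP 𝓘(ℝ, EG) ξ₀ p)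

/-- The connection `(v, u) ↦ A(u)` on `ℝ × P` induced by a connection `A` on `P`. -/
def timesLineConnection (A : ∀ p : P, TangentSpace IP p →L[ℝ] EG) (q : ℝ × P) :
    TangentSpace (𝓘(ℝ, ℝ).prod IP) q →L[ℝ] EG :=
  (A q.2 : EP →L[ℝ] EG).comp (ContinuousLinearMap.snd ℝ ℝ EP)

/-- The curve `φ_t = Φ_{ξ₀} ∘ s_t ∘ π`, i.e. `φ_t(p) = Φ_{ξ₀(p)}(s_t(π(p)))`, where
`s(t, m) = (t, s_t(m))`. -/
def gaugeCurve (ξ₀ : P → G) (s : ℝ × X → ℝ × P) (t : ℝ) (p : P) : P :=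
  B.act (s (t, B.proj p)).2 (ξ₀ p)

end Bundle

/-! ### Volume forms -/

section Volume

variable {n : ℕ} {M : Type*} [TopologicalSpace M] [ChartedSpace (EuclideanSpace ℝ (Fin n)) M]

/-- The coefficient of an `n`-form in the coordinates of the chart at `m₀`. -/
def chartCoeff (vol : ∀ m : M, TangentSpace (𝓡 n) m [⋀^Fin n]→L[ℝ] ℝ) (m₀ : M)
    (y : EuclideanSpace ℝ (Fin n)) : ℝ :=
  vol ((extChartAt (𝓡 n) m₀).symm y) (fun i =>
    mfderiv 𝓘(ℝ, EuclideanSpace ℝ (Fin n)) (𝓡 n) (extChartAt (𝓡 n) m₀).symm y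
      (EuclideanSpace.single i (1 : ℝ)))

/-- A volume form: a smooth nowhere vanishing `n`-form on the `n`-dimensional manifold `M`. -/
structure IsVolumeForm (vol : ∀ m : M, TangentSpace (𝓡 n) m [⋀^Fin n]→L[ℝ] ℝ) : Prop where
  ne_zero : ∀ m, vol m ≠ 0
  smooth : ∀ m₀, ContDiffOn ℝ ∞ (chartCoeff vol m₀) (extChartAt (𝓡 n) m₀).target

/-- The measure of a volume form: in every chart it is `|coefficient|` times Lebesgue measure.
It is the least measure which dominates the measures so defined on the chart domains. -/
def volumeMeasure [MeasurableSpace M]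
    (vol : ∀ m : M, TangentSpace (𝓡 n) m [⋀^Fin n]→L[ℝ] ℝ) : Measure M :=
  ⨆ m₀ : M, Measure.map (extChartAt (𝓡 n) m₀).symm
    ((volume.restrict (extChartAt (𝓡 n) m₀).target).withDensity
      (fun y => ENNReal.ofReal |chartCoeff vol m₀ y|))

/-- The coefficient of the volume form `dt ∧ vol` on `ℝ × M` in the product chart. -/
def spacetimeCoeff (vol : ∀ m : M, TangentSpace (𝓡 n) m [⋀^Fin n]→L[ℝ] ℝ) (x₀ : ℝ × M)
    (y : ℝ × EuclideanSpace ℝ (Fin n)) : ℝ :=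
  chartCoeff vol x₀.2 y.2

end Volume

end GaugeField

end

open GaugeField

/-!
A `G`-valued map `ξ₀` on `P` over `V` with `ξ₀(p g) = ξ₀(p) g` trivializes the bundle over `V`
(`IsPrincipal.exists_isTrivialized`): `e` denotes the section on which `ξ₀ = 1`. In this
trivialization every object is read off from the right logarithmic derivative `rlog`. For a section
`s` of the bundle over space-time put `ν = d(ξ₀ ∘ s) (ξ₀ ∘ s)⁻¹`, a one-form on `J × V` with values
in the Lie algebra (`lineLog`). An invariant Lagrangian depends on the jet of `s` only through the
base point and `ν`, that is, `L(j¹s) = Λ(x, ν)` with `Λ = trivLag` (`IsTrivialized.jetEval_eq`). The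
reduced jet of `s` for the flat connection is `ν` itself, and for the curve of gauge transformations
of `s` the velocity and the pushed forward connection are the time and space components of `ν`
(`bodyVelocity_gaugeCurve`, `pushForm_gaugeCurve`).

The one identity behind the reduction is the formula `δν = dη + [η, ν]` for the variation of `ν`
when `ξ₀ ∘ s` varies with velocity `η` (`hasDerivAt_rlog`); it rests on the cocycle property of
`rlog` and on the derivative of `Ad` being `ad` (`der_Ad_one`). The unreduced principles vary `s`,
and every `η` occurs as a velocity (`exists_variation`); the constrained variations of the reduced
principles are `dη + [η, ν]`, written with the covariant derivative or split into time and space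
components. So each principle and each equation turns into a condition on `Λ` and `ν` only:

* `WeakEquation`, for the two covariant variational principles,
* `StrongEquation`, for the covariant Euler–Lagrange and Euler–Poincaré equations,
* `EndpointEquation`, for the two dynamic variational principles,
* `EvolutionEquation`, for the Euler–Lagrange equations of the curve of gauge transformations and
  the affine Euler–Poincaré equations. For the latter the functional derivatives are the components
  of the fibre derivative of `Λ`, which are unique as far as this matters.

These four conditions are equivalent. The first two are so by the divergence theorem and the
fundamental lemma of the calculus of variations (`weakEquation_iff_strongEquation`). The weak
equation implies the evolution equation by integration by parts in time
(`WeakEquation.evolutionEquation`), which integrates to the endpoint equation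
(`EvolutionEquation.endpointEquation`), and this gives back the strong equation by localization in
time (`EndpointEquation.strongEquation`). The divergence of the statement is computed in the chart
at each point; it is tied to the measure because the coefficients of a volume form in charts are the
densities of its measure (`hasChartDensity_spacetime`), and then the divergence theorem, proved in
charts, shows that it does not depend on the chart (`divergence_eq_chartDiv_of_mem`).
-/

noncomputable section

set_option linter.unusedSectionVars false

namespace GaugeField

/-! ### Derivatives, the right logarithmic derivative, the adjoint representation -/

section Der

variable {E : Type*} [NormedAddCommGroup E] [NormedSpace ℝ E]
  {H : Type*} [TopologicalSpace H] {I : ModelWithCorners ℝ E H}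
  {X : Type*} [TopologicalSpace X] [ChartedSpace H X]
  {E' : Type*} [NormedAddCommGroup E'] [NormedSpace ℝ E']
  {H' : Type*} [TopologicalSpace H'] {I' : ModelWithCorners ℝ E' H'}
  {Y : Type*} [TopologicalSpace Y] [ChartedSpace H' Y]
  {F : Type*} [NormedAddCommGroup F] [NormedSpace ℝ F]
  {HF : Type*} [TopologicalSpace HF] {J : ModelWithCorners ℝ F HF}
  {Z : Type*} [TopologicalSpace Z] [ChartedSpace HF Z]

variable (I I') in
/-- The derivative of a map of manifolds, as a linear map between the model spaces. -/
def der (f : X → Y) (x : X) : E →L[ℝ] E' := mfderiv I I' f x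

theorem der_comp {g : Y → Z} {f : X → Y} {x : X} (hg : MDifferentiableAt I' J g (f x))
    (hf : MDifferentiableAt I I' f x) :
    der I J (fun y => g (f y)) x = (der I' J g (f x)).comp (der I I' f x) :=
  mfderiv_comp x hg hf

theorem der_comp_of_eq {g : Y → Z} {f : X → Y} {x : X} {y : Y} (hg : MDifferentiableAt I' J g y)
    (hf : MDifferentiableAt I I' f x) (h : f x = y) :
    der I J (fun y => g (f y)) x = (der I' J g y).comp (der I I' f x) := by
  subst h; exact der_comp hg hf

theorem der_congr {f g : X → Y} {x : X} (h : f =ᶠ[𝓝 x] g) : der I I' f x = der I I' g x :=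
  h.mfderiv_eq

theorem der_const (c : Y) (x : X) : der I I' (fun _ => c) x = 0 := mfderiv_const

theorem der_id (x : X) : der I I (fun y => y) x = ContinuousLinearMap.id ℝ E := mfderiv_id

theorem der_eq_fderiv (f : E → E') (x : E) : der 𝓘(ℝ, E) 𝓘(ℝ, E') f x = fderiv ℝ f x :=
  mfderiv_eq_fderiv

theorem der_fst (x : X × Y) :
    der (I.prod I') I (fun z : X × Y => z.1) x = ContinuousLinearMap.fst ℝ E E' := mfderiv_fst

theorem der_snd (x : X × Y) :
    der (I.prod I') I' (fun z : X × Y => z.2) x = ContinuousLinearMap.snd ℝ E E' := mfderiv_snd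

theorem der_prodMk {f : X → Y} {g : X → Z} {x : X} (hf : MDifferentiableAt I I' f x)
    (hg : MDifferentiableAt I J g x) :
    der I (I'.prod J) (fun y => (f y, g y)) x = (der I I' f x).prod (der I J g x) :=
  mfderiv_prodMk hf hg

theorem der_prod_apply {f : X × Y → Z} {p : X × Y} (hf : MDifferentiableAt (I.prod I') J f p)
    (v : E × E') :
    der (I.prod I') J f p v =
      der I J (fun x => f (x, p.2)) p.1 v.1 + der I' J (fun y => f (p.1, y)) p.2 v.2 :=
  mfderiv_prod_eq_add_apply hf

theorem contMDiffAt_der_of_const [IsManifold I 1 X] [IsManifold I' 1 Y]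
    {W : Type*} [TopologicalSpace W] [ChartedSpace HF W] [IsManifold J 1 W]
    (f : W → X → Y) (a : X) (b : Y) {w : W}
    (hf : ContMDiffAt (J.prod I) I' ∞ (fun z : W × X => f z.1 z.2) (w, a))
    (hb : ∀ v, f v a = b) :
    ContMDiffAt J 𝓘(ℝ, E →L[ℝ] E') ∞ (fun v => der I I' (f v) a) w := by
  have h : ContMDiffAt J 𝓘(ℝ, E →L[ℝ] E') ∞ (inTangentCoordinates I I' (fun _ => a)
      (fun v => f v a) (fun v => der I I' (f v) a) w) w :=
    ContMDiffAt.mfderiv (m := ∞) (n := ∞) f (fun _ => a) hf contMDiffAt_const (by simp)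
  refine h.congr_of_eventuallyEq (Eventually.of_forall fun v => ?_)
  rw [inTangentCoordinates_eq]
  · ext u
    simp only [ContinuousLinearMap.comp_apply]
    rw [(tangentBundleCore I X).coordChange_self _ _ (by simp), hb, hb,
      (tangentBundleCore I' Y).coordChange_self _ _ (by simp)]
  · simp
  · rw [hb, hb]; simp

end Der

section Lie

variable {E : Type*} [NormedAddCommGroup E] [NormedSpace ℝ E]
  {H : Type*} [TopologicalSpace H] {I : ModelWithCorners ℝ E H}
  {X : Type*} [TopologicalSpace X] [ChartedSpace H X]
  {E' : Type*} [NormedAddCommGroup E'] [NormedSpace ℝ E']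
  {H' : Type*} [TopologicalSpace H'] {I' : ModelWithCorners ℝ E' H'}
  {Y : Type*} [TopologicalSpace Y] [ChartedSpace H' Y]
  {EG : Type*} [NormedAddCommGroup EG] [NormedSpace ℝ EG]
  {G : Type*} [TopologicalSpace G] [ChartedSpace EG G] [Group G]

variable (I EG) in
/-- The right logarithmic derivative `dk k⁻¹` of a map into a Lie group. -/
def rlog (k : X → G) (x : X) : E →L[ℝ] EG := der I 𝓘(ℝ, EG) (fun y => k y * (k x)⁻¹) x

variable [LieGroup 𝓘(ℝ, EG) ∞ G]

theorem mdiff_mul (a b : G) :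
    MDifferentiableAt (𝓘(ℝ, EG).prod 𝓘(ℝ, EG)) 𝓘(ℝ, EG) (fun z : G × G => z.1 * z.2) (a, b) :=
  (contMDiff_mul 𝓘(ℝ, EG) ∞).mdifferentiableAt (by simp)

theorem MDiffAt.mulG {a b : X → G} {x : X} (ha : MDifferentiableAt I 𝓘(ℝ, EG) a x)
    (hb : MDifferentiableAt I 𝓘(ℝ, EG) b x) :
    MDifferentiableAt I 𝓘(ℝ, EG) (fun y => a y * b y) x :=
  (mdiff_mul (a x) (b x)).comp x (ha.prodMk hb)

theorem MDiffAt.mul_const {a : X → G} {x : X} (ha : MDifferentiableAt I 𝓘(ℝ, EG) a x) (g : G) :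
    MDifferentiableAt I 𝓘(ℝ, EG) (fun y => a y * g) x :=
  MDiffAt.mulG ha mdifferentiableAt_const

theorem MDiffAt.const_mul {a : X → G} {x : X} (g : G) (ha : MDifferentiableAt I 𝓘(ℝ, EG) a x) :
    MDifferentiableAt I 𝓘(ℝ, EG) (fun y => g * a y) x :=
  MDiffAt.mulG mdifferentiableAt_const ha

theorem der_mul_of_one {a b : X → G} {x : X} (ha : MDifferentiableAt I 𝓘(ℝ, EG) a x)
    (hb : MDifferentiableAt I 𝓘(ℝ, EG) b x) (ha1 : a x = 1) (hb1 : b x = 1) :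
    der I 𝓘(ℝ, EG) (fun y => a y * b y) x = der I 𝓘(ℝ, EG) a x + der I 𝓘(ℝ, EG) b x := by
  have h := der_comp (g := fun z : G × G => z.1 * z.2) (f := fun y => (a y, b y))
    (mdiff_mul (EG := EG) (a x) (b x)) (ha.prodMk hb)
  rw [der_prodMk ha hb] at h
  ext u
  change der I 𝓘(ℝ, EG) (fun y => (fun z : G × G => z.1 * z.2) (a y, b y)) x u = _
  rw [h, ContinuousLinearMap.comp_apply, der_prod_apply (mdiff_mul _ _)]
  simp only [ha1, hb1, mul_one, one_mul, der_id]
  simp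

theorem Ad_eq (g : G) :
    Ad G g = der 𝓘(ℝ, EG) 𝓘(ℝ, EG) (fun h : G => g * h * g⁻¹) 1 := rfl

theorem mdiff_conj (g a : G) :
    MDifferentiableAt 𝓘(ℝ, EG) 𝓘(ℝ, EG) (fun h : G => g * h * g⁻¹) a :=
  MDiffAt.mul_const (MDiffAt.const_mul g mdifferentiableAt_id) _

theorem Ad_one : Ad G (1 : G) = ContinuousLinearMap.id ℝ EG := by
  rw [Ad_eq]; simpa using der_id (I := 𝓘(ℝ, EG)) (1 : G)

theorem Ad_mul (g h : G) : Ad G (g * h) = (Ad G g).comp (Ad G h : EG →L[ℝ] EG) := by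
  rw [Ad_eq, Ad_eq, Ad_eq, ← der_comp_of_eq (mdiff_conj g 1) (mdiff_conj h 1) (by simp)]
  congr 1; ext x; group

theorem Ad_inv_Ad (g : G) (ξ : EG) : Ad G g⁻¹ (Ad G g ξ) = ξ := by
  rw [← ContinuousLinearMap.comp_apply, ← Ad_mul]; simp [Ad_one]

theorem Ad_Ad_inv (g : G) (ξ : EG) : Ad G g (Ad G g⁻¹ ξ) = ξ := by
  rw [← ContinuousLinearMap.comp_apply, ← Ad_mul]; simp [Ad_one]

theorem Ad_mul_apply (g h : G) (ξ : EG) : Ad G (g * h) ξ = Ad G g (Ad G h ξ) := by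
  rw [Ad_mul]; rfl

theorem rlog_congr {h k : X → G} {x : X} (e : h =ᶠ[𝓝 x] k) : rlog I EG h x = rlog I EG k x := by
  refine der_congr ?_
  filter_upwards [e] with y hy
  rw [hy, e.self_of_nhds]

theorem rlog_const (g : G) (x : X) : rlog I EG (fun _ : X => g) x = 0 := der_const _ _

theorem rlog_of_eq_one {k : X → G} {x : X} (h : k x = 1) :
    rlog I EG k x = der I 𝓘(ℝ, EG) k x := by
  rw [rlog, h]; simp

theorem rlog_comp {k : Y → G} {f : X → Y} {x : X} (hk : MDifferentiableAt I' 𝓘(ℝ, EG) k (f x))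
    (hf : MDifferentiableAt I I' f x) :
    rlog I EG (fun y => k (f y)) x = (rlog I' EG k (f x)).comp (der I I' f x) :=
  der_comp (g := fun y => k y * (k (f x))⁻¹) (MDiffAt.mul_const hk _) hf

/-- The cocycle identity of the right logarithmic derivative. -/
theorem rlog_mul {h k : X → G} {x : X} (hh : MDifferentiableAt I 𝓘(ℝ, EG) h x)
    (hk : MDifferentiableAt I 𝓘(ℝ, EG) k x) :
    rlog I EG (fun y => h y * k y) x =
      rlog I EG h x + (Ad G (h x)).comp (rlog I EG k x) := by
  rw [rlog, rlog, rlog, Ad_eq, ← der_comp_of_eq (mdiff_conj (h x) 1)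
    (MDiffAt.mul_const hk _) (by simp), ← der_mul_of_one (MDiffAt.mul_const hh _)
    (MDiffAt.mul_const (MDiffAt.const_mul _ (MDiffAt.mul_const hk _)) _) (by simp) (by simp)]
  congr 1; ext x; group

theorem rlog_mul_const {h : X → G} {x : X} (hh : MDifferentiableAt I 𝓘(ℝ, EG) h x) (g : G) :
    rlog I EG (fun y => h y * g) x = rlog I EG h x := by
  rw [rlog_mul hh mdifferentiableAt_const, rlog_const]; simp

theorem contMDiff_Ad : ContMDiff 𝓘(ℝ, EG) 𝓘(ℝ, EG →L[ℝ] EG) ∞ (fun g : G => Ad (EG := EG) G g) := by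
  intro g
  have : IsManifold 𝓘(ℝ, EG) 1 G := IsManifold.of_le (n := ∞) (by simp)
  refine contMDiffAt_der_of_const (J := 𝓘(ℝ, EG)) (fun g h : G => g * h * g⁻¹) 1 1 ?_ (by simp)
  have h1 : ContMDiff (𝓘(ℝ, EG).prod 𝓘(ℝ, EG)) 𝓘(ℝ, EG) ∞ (fun z : G × G => z.1) := contMDiff_fst
  have h2 : ContMDiff (𝓘(ℝ, EG).prod 𝓘(ℝ, EG)) 𝓘(ℝ, EG) ∞ (fun z : G × G => z.2) := contMDiff_snd
  exact ((h1.mul h2).mul h1.inv).contMDiffAt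

end Lie

/-! ### Mixed second derivatives, local groups, derivatives of charts -/

section Calculus

variable {E F F' : Type*} [NormedAddCommGroup E] [NormedSpace ℝ E] [NormedAddCommGroup F]
  [NormedSpace ℝ F] [NormedAddCommGroup F'] [NormedSpace ℝ F']

theorem fderiv_right_apply {f : E × F → F'} {p : E × F} (hf : DifferentiableAt ℝ f p) (η : F) :
    fderiv ℝ (fun z => f (p.1, z)) p.2 η = fderiv ℝ f p (0, η) := by
  have h : HasFDerivAt (fun z : F => (p.1, z)) (ContinuousLinearMap.inr ℝ E F) p.2 :=
    hasFDerivAt_prodMk_right p.1 p.2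
  have := (HasFDerivAt.comp (g := f) p.2 hf.hasFDerivAt h).fderiv
  change fderiv ℝ (f ∘ fun z => (p.1, z)) p.2 η = _
  rw [this]; simp

theorem fderiv_left_apply {f : E × F → F'} {p : E × F} (hf : DifferentiableAt ℝ f p) (ξ : E) :
    fderiv ℝ (fun y => f (y, p.2)) p.1 ξ = fderiv ℝ f p (ξ, 0) := by
  have h : HasFDerivAt (fun y : E => (y, p.2)) (ContinuousLinearMap.inl ℝ E F) p.1 :=
    hasFDerivAt_prodMk_left p.1 p.2
  have := (HasFDerivAt.comp (g := f) p.1 hf.hasFDerivAt h).fderiv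
  change fderiv ℝ (f ∘ fun y => (y, p.2)) p.1 ξ = _
  rw [this]; simp

theorem contDiffAt_fderiv_of_infty {f : E → F} {a : E} (hf : ContDiffAt ℝ ∞ f a) :
    ContDiffAt ℝ ∞ (fderiv ℝ f) a := hf.fderiv_right (by simp)

theorem eventually_differentiableAt {f : E → F} {a : E} (hf : ContDiffAt ℝ ∞ f a) :
    ∀ᶠ y in 𝓝 a, DifferentiableAt ℝ f y :=
  ((hf.of_le (m := 1) (by simp)).eventually (by simp)).mono
    fun _ h => h.differentiableAt (by simp)

theorem contDiffAt_partial_right {f : E × F → F'} {a : E} {b : F}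
    (hf : ContDiffAt ℝ ∞ f (a, b)) (η : F) :
    ContDiffAt ℝ ∞ (fun y => fderiv ℝ (fun z => f (y, z)) b η) a := by
  have h1 : ContDiffAt ℝ ∞ (fun y : E => fderiv ℝ f (y, b) (0, η)) a :=
    ContDiffAt.clm_apply (ContDiffAt.comp a (g := fderiv ℝ f) (contDiffAt_fderiv_of_infty hf)
      (contDiffAt_id.prodMk contDiffAt_const)) contDiffAt_const
  refine h1.congr_of_eventuallyEq ?_
  have : Tendsto (fun y : E => (y, b)) (𝓝 a) (𝓝 (a, b)) := by
    exact (Continuous.prodMk_left b).tendsto a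
  filter_upwards [this.eventually (eventually_differentiableAt hf)] with y hy
  exact fderiv_right_apply hy η

theorem contDiffAt_partial_left {f : E × F → F'} {a : E} {b : F}
    (hf : ContDiffAt ℝ ∞ f (a, b)) (ξ : E) :
    ContDiffAt ℝ ∞ (fun z => fderiv ℝ (fun y => f (y, z)) a ξ) b := by
  have h : ContDiffAt ℝ ∞ (fun p : F × E => f (p.2, p.1)) (b, a) :=
    ContDiffAt.comp (b, a) (g := f) hf (contDiffAt_snd.prodMk contDiffAt_fst)
  exact contDiffAt_partial_right h ξ

theorem fderiv_fderiv_right {f : E × F → F'} {a : E} {b : F} (hf : ContDiffAt ℝ ∞ f (a, b))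
    (ξ : E) (η : F) :
    fderiv ℝ (fun y => fderiv ℝ (fun z => f (y, z)) b η) a ξ =
      fderiv ℝ (fderiv ℝ f) (a, b) (ξ, 0) (0, η) := by
  have hT : Tendsto (fun y : E => (y, b)) (𝓝 a) (𝓝 (a, b)) :=
    (Continuous.prodMk_left b).tendsto a
  have hev : (fun y => fderiv ℝ (fun z => f (y, z)) b η) =ᶠ[𝓝 a]
      fun y => fderiv ℝ f (y, b) (0, η) := by
    filter_upwards [hT.eventually (eventually_differentiableAt hf)] with y hy
    exact fderiv_right_apply hy η
  have hd : DifferentiableAt ℝ (fun p => fderiv ℝ f p (0, η)) (a, b) :=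
    ((contDiffAt_fderiv_of_infty hf).differentiableAt (by simp)).clm_apply
      (differentiableAt_const _)
  rw [hev.fderiv_eq, fderiv_left_apply (f := fun p => fderiv ℝ f p (0, η)) (p := (a, b)) hd,
    fderiv_clm_apply ((contDiffAt_fderiv_of_infty hf).differentiableAt (by simp))
      (differentiableAt_const _)]
  simp

/-- Mixed partial derivatives commute. -/
theorem fderiv_partial_comm {f : E × F → F'} {a : E} {b : F} (hf : ContDiffAt ℝ ∞ f (a, b))
    (ξ : E) (η : F) :
    fderiv ℝ (fun y => fderiv ℝ (fun z => f (y, z)) b η) a ξ =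
      fderiv ℝ (fun z => fderiv ℝ (fun y => f (y, z)) a ξ) b η := by
  have hT : Tendsto (fun z : F => (a, z)) (𝓝 b) (𝓝 (a, b)) :=
    (Continuous.prodMk_right a).tendsto b
  have hev : (fun z => fderiv ℝ (fun y => f (y, z)) a ξ) =ᶠ[𝓝 b]
      fun z => fderiv ℝ f (a, z) (ξ, 0) := by
    filter_upwards [hT.eventually (eventually_differentiableAt hf)] with y hy
    exact fderiv_left_apply hy ξ
  have hd : DifferentiableAt ℝ (fun p => fderiv ℝ f p (ξ, 0)) (a, b) :=
    ((contDiffAt_fderiv_of_infty hf).differentiableAt (by simp)).clm_apply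
      (differentiableAt_const _)
  rw [fderiv_fderiv_right hf, hev.fderiv_eq,
    fderiv_right_apply (f := fun p => fderiv ℝ f p (ξ, 0)) (p := (a, b)) hd,
    fderiv_clm_apply ((contDiffAt_fderiv_of_infty hf).differentiableAt (by simp))
      (differentiableAt_const _)]
  have hs : IsSymmSndFDerivAt ℝ f (a, b) :=
    hf.isSymmSndFDerivAt (by
      rw [minSmoothness_of_isRCLikeNormedField]
      exact WithTop.coe_le_coe.2 (le_top (a := (2 : ℕ∞))))
  simpa using hs (ξ, 0) (0, η)

/-- The derivative at the identity of the conjugation representation of a local group `M` with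
inverse `i` is the commutator of the mixed second derivatives of the multiplication. -/
theorem fderiv_conj_local (M : F × F → F) (i : F → F) (y₀ : F)
    (hM : ContDiffAt ℝ ∞ M (y₀, y₀)) (hi : ContDiffAt ℝ ∞ i y₀)
    (h1 : ∀ᶠ y in 𝓝 y₀, M (y, y₀) = y) (h2 : ∀ᶠ z in 𝓝 y₀, M (y₀, z) = z)
    (h3 : ∀ᶠ y in 𝓝 y₀, M (y, i y) = y₀) (hi0 : i y₀ = y₀) (ξ η : F) :
    fderiv ℝ (fun y => fderiv ℝ (fun z => M (M (y, z), i y)) y₀ η) y₀ ξ =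
      fderiv ℝ (fun y => fderiv ℝ (fun z => M (y, z)) y₀ η) y₀ ξ -
      fderiv ℝ (fun y => fderiv ℝ (fun z => M (y, z)) y₀ ξ) y₀ η := by
  have hM0 : M (y₀, y₀) = y₀ := h1.self_of_nhds
  have hf : ContDiffAt ℝ ∞ (fun p : F × F => M (M p, i p.1)) (y₀, y₀) := by
    have ha : ContDiffAt ℝ ∞ (fun p : F × F => (M p, i p.1)) (y₀, y₀) :=
      hM.prodMk (ContDiffAt.comp (y₀, y₀) (g := i) hi contDiffAt_fst)
    refine ContDiffAt.comp (y₀, y₀) (g := M) ?_ ha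
    simpa [hM0, hi0] using hM
  -- Differentiate in `y` first: with `z` fixed, the derivative at `y = y₀` only involves the first
  -- order behaviour of `M` along the axes through `(y₀, z)` and `(z, y₀)`.
  rw [fderiv_partial_comm (f := fun p : F × F => M (M p, i p.1)) hf ξ η]
  -- differentiate `M (y, i y) = y₀`
  have hi' : fderiv ℝ i y₀ ξ = -ξ := by
    have hd : HasFDerivAt (fun y => M (y, i y))
        ((fderiv ℝ M (y₀, y₀)).comp ((ContinuousLinearMap.id ℝ F).prod (fderiv ℝ i y₀))) y₀ := by
      have hMd : HasFDerivAt M (fderiv ℝ M (y₀, y₀)) (y₀, i y₀) := by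
        rw [hi0]; exact (hM.differentiableAt (by simp)).hasFDerivAt
      exact HasFDerivAt.comp (g := M) y₀ hMd
        ((hasFDerivAt_id y₀).prodMk (hi.differentiableAt (by simp)).hasFDerivAt)
    have h0 : fderiv ℝ (fun y => M (y, i y)) y₀ = 0 := by
      have h3' : (fun y => M (y, i y)) =ᶠ[𝓝 y₀] fun _ => y₀ := h3
      rw [h3'.fderiv_eq]; simp
    have h4 := congrArg (fun A => A ξ) (hd.fderiv.symm.trans h0)
    have e : ((ξ, fderiv ℝ i y₀ ξ) : F × F) = (ξ, 0) + (0, fderiv ℝ i y₀ ξ) := by simp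
    simp only [ContinuousLinearMap.comp_apply, ContinuousLinearMap.prod_apply,
      ContinuousLinearMap.id_apply, _root_.zero_apply] at h4
    have hMdd := hM.differentiableAt (n := ∞) (by simp)
    rw [e, map_add, ← fderiv_left_apply (p := (y₀, y₀)) hMdd,
      ← fderiv_right_apply (p := (y₀, y₀)) hMdd] at h4
    have e1 : (fun y => M (y, y₀)) =ᶠ[𝓝 y₀] fun y => y := h1
    have e2 : (fun y => M (y₀, y)) =ᶠ[𝓝 y₀] fun y => y := h2
    simp only [e1.fderiv_eq, e2.fderiv_eq, fderiv_fun_id, ContinuousLinearMap.id_apply] at h4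
    exact eq_neg_of_add_eq_zero_right h4
  have hT1 : Tendsto (fun z : F => (z, y₀)) (𝓝 y₀) (𝓝 (y₀, y₀)) :=
    (Continuous.prodMk_left y₀).tendsto y₀
  have hT2 : Tendsto (fun z : F => (y₀, z)) (𝓝 y₀) (𝓝 (y₀, y₀)) :=
    (Continuous.prodMk_right y₀).tendsto y₀
  have hev : (fun z => fderiv ℝ (fun y => M (M (y, z), i y)) y₀ ξ) =ᶠ[𝓝 y₀]
      fun z => fderiv ℝ (fun y => M (y, z)) y₀ ξ - fderiv ℝ (fun w => M (z, w)) y₀ ξ := by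
    filter_upwards [h1.eventually_nhds, h2,
      hT1.eventually (eventually_differentiableAt hM),
      hT2.eventually (eventually_differentiableAt hM)] with z hz1 hz2 hd1 hd2
    have hin : HasFDerivAt (fun y => (M (y, z), i y))
        (((fderiv ℝ M (y₀, z)).comp (ContinuousLinearMap.inl ℝ F F)).prod (fderiv ℝ i y₀)) y₀ :=
      (HasFDerivAt.comp (g := M) y₀ hd2.hasFDerivAt (hasFDerivAt_prodMk_left y₀ z)).prodMk
        (hi.differentiableAt (by simp)).hasFDerivAt
    have hout : HasFDerivAt M (fderiv ℝ M (z, y₀)) (M (y₀, z), i y₀) := by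
      rw [hz2, hi0]; exact hd1.hasFDerivAt
    have h := HasFDerivAt.comp (g := M) y₀ hout hin
    have h' : fderiv ℝ (fun y => M (M (y, z), i y)) y₀ = _ := h.fderiv
    rw [h']
    have e : ((fderiv ℝ M (y₀, z) (ξ, 0), -ξ) : F × F) =
        (fderiv ℝ M (y₀, z) (ξ, 0), 0) - (0, ξ) := by simp
    simp only [ContinuousLinearMap.comp_apply, ContinuousLinearMap.prod_apply, hi',
      ContinuousLinearMap.inl_apply]
    rw [e, map_sub, ← fderiv_left_apply (p := (z, y₀)) hd1, ← fderiv_right_apply (p := (z, y₀)) hd1,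
      ← fderiv_left_apply (p := (y₀, z)) hd2]
    have e1 : (fun y => M (y, y₀)) =ᶠ[𝓝 z] fun y => y := hz1
    simp [e1.fderiv_eq]
  rw [hev.fderiv_eq, fderiv_fun_sub ((contDiffAt_partial_left hM ξ).differentiableAt (by simp))
    ((contDiffAt_partial_right hM ξ).differentiableAt (by simp)), fderiv_partial_comm hM ξ η]
  rfl

end Calculus

section LieBracket

variable {EG : Type*} [NormedAddCommGroup EG] [NormedSpace ℝ EG]
  {G : Type*} [TopologicalSpace G] [ChartedSpace EG G]

variable {E : Type*} [NormedAddCommGroup E] [NormedSpace ℝ E]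
  {H : Type*} [TopologicalSpace H] {I : ModelWithCorners ℝ E H}
  {X : Type*} [TopologicalSpace X] [ChartedSpace H X] [IsManifold I ∞ X] 

theorem der_extChartAt_self (x : X) :
    der I 𝓘(ℝ, E) (extChartAt I x) x = ContinuousLinearMap.id ℝ E := by
  have : IsManifold I 1 X := IsManifold.of_le (n := ∞) (by simp)
  have hd : MDifferentiableAt I 𝓘(ℝ, E) (extChartAt I x) x :=
    (contMDiffAt_extChartAt (n := ∞)).mdifferentiableAt (by simp)
  have h : der I 𝓘(ℝ, E) (extChartAt I x) x =
      fderivWithin ℝ (writtenInExtChartAt I 𝓘(ℝ, E) x (extChartAt I x)) (range I)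
        (extChartAt I x x) := hd.mfderiv
  have h2 : writtenInExtChartAt I 𝓘(ℝ, E) x (extChartAt I x) =ᶠ[𝓝[range I] (extChartAt I x x)]
      fun y => y := by
    filter_upwards [extChartAt_target_mem_nhdsWithin (I := I) x] with y hy
    exact writtenInExtChartAt_extChartAt hy
  rw [h, h2.fderivWithin_eq (writtenInExtChartAt_extChartAt (mem_extChartAt_target x))]
  exact fderivWithin_fun_id I.uniqueDiffWithinAt_image

variable [I.Boundaryless]

theorem contMDiffAt_extChartAt_symm {x : X} {y : E} (hy : y ∈ (extChartAt I x).target) :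
    ContMDiffAt 𝓘(ℝ, E) I ∞ (extChartAt I x).symm y :=
  (contMDiffOn_extChartAt_symm x).contMDiffAt ((isOpen_extChartAt_target x).mem_nhds hy)

theorem der_extChartAt_comp_symm {x : X} {y : E} (hy : y ∈ (extChartAt I x).target) :
    (der I 𝓘(ℝ, E) (extChartAt I x) ((extChartAt I x).symm y)).comp
      (der 𝓘(ℝ, E) I (extChartAt I x).symm y) = ContinuousLinearMap.id ℝ E := by
  rw [← der_comp (contMDiffAt_extChartAt' (n := ∞) (by
      rw [← extChartAt_source I]; exact (extChartAt I x).map_target hy)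
      |>.mdifferentiableAt (by simp)) ((contMDiffAt_extChartAt_symm hy).mdifferentiableAt (by simp)),
    ← der_id (I := 𝓘(ℝ, E)) y]
  refine der_congr ?_
  filter_upwards [(isOpen_extChartAt_target x).mem_nhds hy] with z hz
  exact (extChartAt I x).right_inv hz

theorem der_symm_comp_extChartAt {x z : X} (hz : z ∈ (extChartAt I x).source) :
    (der 𝓘(ℝ, E) I (extChartAt I x).symm (extChartAt I x z)).comp
      (der I 𝓘(ℝ, E) (extChartAt I x) z) = ContinuousLinearMap.id ℝ E := by
  rw [← der_comp ((contMDiffAt_extChartAt_symm ((extChartAt I x).map_source hz)).mdifferentiableAt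
      (by simp)) (contMDiffAt_extChartAt' (n := ∞) (by
      rwa [← extChartAt_source I]) |>.mdifferentiableAt (by simp)), ← der_id (I := I) z]
  refine der_congr ?_
  filter_upwards [(isOpen_extChartAt_source (I := I) x).mem_nhds hz] with w hw
  exact (extChartAt I x).left_inv hw

theorem der_extChartAt_symm_self (x : X) :
    der 𝓘(ℝ, E) I (extChartAt I x).symm (extChartAt I x x) = ContinuousLinearMap.id ℝ E := by
  have h := der_symm_comp_extChartAt (I := I) (mem_extChartAt_source (I := I) x)
  rwa [der_extChartAt_self, ContinuousLinearMap.comp_id] at h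

end LieBracket

/-! ### The derivative of `Ad` is `ad` -/

section AdDerivative

variable {EG : Type*} [NormedAddCommGroup EG] [NormedSpace ℝ EG]
  {G : Type*} [TopologicalSpace G] [ChartedSpace EG G] [Group G] [LieGroup 𝓘(ℝ, EG) ∞ G]

variable (EG G) in
/-- The multiplication of `G` in the chart at the identity. -/
def chartMul (p : EG × EG) : EG :=
  extChartAt 𝓘(ℝ, EG) (1 : G) ((extChartAt 𝓘(ℝ, EG) (1 : G)).symm p.1 *
    (extChartAt 𝓘(ℝ, EG) (1 : G)).symm p.2)

variable (EG G) in
/-- The inversion of `G` in the chart at the identity. -/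
def chartInv (y : EG) : EG :=
  extChartAt 𝓘(ℝ, EG) (1 : G) ((extChartAt 𝓘(ℝ, EG) (1 : G)).symm y)⁻¹

local notation "φ₁" => extChartAt 𝓘(ℝ, EG) (1 : G)

theorem symm_chart_one : (φ₁).symm (φ₁ 1) = (1 : G) :=
  (φ₁).left_inv (mem_extChartAt_source (I := 𝓘(ℝ, EG)) (1 : G))

theorem contMDiffAt_symm_one : ContMDiffAt 𝓘(ℝ, EG) 𝓘(ℝ, EG) ∞ (φ₁).symm (φ₁ 1) :=
  contMDiffAt_extChartAt_symm (mem_extChartAt_target (I := 𝓘(ℝ, EG)) (1 : G))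

theorem contDiffAt_chartMul : ContDiffAt ℝ ∞ (chartMul EG G) (φ₁ 1, φ₁ 1) := by
  rw [← contMDiffAt_iff_contDiffAt]
  have h1 : ContMDiffAt 𝓘(ℝ, EG × EG) 𝓘(ℝ, EG) ∞
      (fun p : EG × EG => (φ₁).symm p.1) (φ₁ 1, φ₁ 1) :=
    ContMDiffAt.comp (φ₁ 1, φ₁ 1) (g := (φ₁).symm) contMDiffAt_symm_one
      contDiffAt_fst.contMDiffAt
  have h2 : ContMDiffAt 𝓘(ℝ, EG × EG) 𝓘(ℝ, EG) ∞
      (fun p : EG × EG => (φ₁).symm p.2) (φ₁ 1, φ₁ 1) :=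
    ContMDiffAt.comp (φ₁ 1, φ₁ 1) (g := (φ₁).symm) contMDiffAt_symm_one
      contDiffAt_snd.contMDiffAt
  refine ContMDiffAt.comp (φ₁ 1, φ₁ 1) (g := φ₁) ?_ (h1.mul h2)
  simp only [symm_chart_one, mul_one]
  exact contMDiffAt_extChartAt

theorem contDiffAt_chartInv : ContDiffAt ℝ ∞ (chartInv EG G) (φ₁ 1) := by
  rw [← contMDiffAt_iff_contDiffAt]
  refine ContMDiffAt.comp (φ₁ 1) (g := φ₁) ?_ contMDiffAt_symm_one.inv
  simp only [symm_chart_one, inv_one]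
  exact contMDiffAt_extChartAt

theorem tendsto_symm_one : Tendsto (φ₁).symm (𝓝 (φ₁ 1)) (𝓝 (1 : G)) := by
  have := (contMDiffAt_symm_one (EG := EG) (G := G)).continuousAt
  rwa [ContinuousAt, symm_chart_one] at this

theorem source_mem : (φ₁).source ∈ 𝓝 (1 : G) := extChartAt_source_mem_nhds _

theorem target_mem : (φ₁).target ∈ 𝓝 (φ₁ (1 : G)) := extChartAt_target_mem_nhds _

theorem mdiff_chart {g : G} (hg : g ∈ (φ₁).source) :
    MDifferentiableAt 𝓘(ℝ, EG) 𝓘(ℝ, EG) φ₁ g :=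
  (contMDiffAt_extChartAt' (n := ∞) (by rwa [← extChartAt_source 𝓘(ℝ, EG)])).mdifferentiableAt
    (by simp)

theorem mdiff_symm_one : MDifferentiableAt 𝓘(ℝ, EG) 𝓘(ℝ, EG) (φ₁).symm (φ₁ (1 : G)) :=
  contMDiffAt_symm_one.mdifferentiableAt (by simp)

/-- The left invariant vector fields in the chart at the identity. -/
theorem der_chart_leftMul {g : G} (hg : g ∈ (φ₁).source) (η : EG) :
    der 𝓘(ℝ, EG) 𝓘(ℝ, EG) φ₁ g (der 𝓘(ℝ, EG) 𝓘(ℝ, EG) (fun h => g * h) 1 η) =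
      fderiv ℝ (fun z => chartMul EG G (φ₁ g, z)) (φ₁ 1) η := by
  have h1 : MDifferentiableAt 𝓘(ℝ, EG) 𝓘(ℝ, EG) (fun h => g * h) ((φ₁).symm (φ₁ 1)) :=
    MDiffAt.const_mul g mdifferentiableAt_id
  have h2 := der_comp h1 (mdiff_symm_one (EG := EG) (G := G))
  rw [der_extChartAt_symm_self, ContinuousLinearMap.comp_id, symm_chart_one] at h2
  have h3 : MDifferentiableAt 𝓘(ℝ, EG) 𝓘(ℝ, EG) (fun z => g * (φ₁).symm z) (φ₁ 1) :=
    h1.comp (φ₁ 1) mdiff_symm_one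
  rw [← h2, ← ContinuousLinearMap.comp_apply, ← der_comp_of_eq (mdiff_chart hg) h3
    (by simp), der_eq_fderiv]
  simp only [chartMul, (φ₁).left_inv hg]

/-- A left invariant vector field in the chart at the identity. -/
theorem pullback_leftInvariant {y : EG} (hy : y ∈ (φ₁ : PartialEquiv G EG).target) (η : EG) :
    ContinuousLinearMap.inverse
        (der 𝓘(ℝ, EG) 𝓘(ℝ, EG) (φ₁ : PartialEquiv G EG).symm y)
        (der 𝓘(ℝ, EG) 𝓘(ℝ, EG) (fun h : G => (φ₁).symm y * h) 1 η) =
      fderiv ℝ (fun z => chartMul EG G (y, z)) (φ₁ (1 : G)) η := by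
  have hs := (φ₁ : PartialEquiv G EG).map_target hy
  have h1 := der_extChartAt_comp_symm (I := 𝓘(ℝ, EG)) hy
  have h2 := der_symm_comp_extChartAt (I := 𝓘(ℝ, EG)) hs
  rw [(φ₁ : PartialEquiv G EG).right_inv hy] at h2
  rw [ContinuousLinearMap.inverse_eq h2 h1, der_chart_leftMul hs,
    (φ₁ : PartialEquiv G EG).right_inv hy]

variable [FiniteDimensional ℝ EG]

/-- The Lie bracket of left invariant vector fields, as the commutator of the mixed second
derivatives of the multiplication in the chart at the identity. -/
theorem ad_eq_fderiv (ξ η : EG) :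
    ad G ξ η =
      fderiv ℝ (fun y => fderiv ℝ (fun z => chartMul EG G (y, z)) (φ₁ (1 : G)) η) (φ₁ (1 : G)) ξ -
      fderiv ℝ (fun y => fderiv ℝ (fun z => chartMul EG G (y, z)) (φ₁ (1 : G)) ξ)
        (φ₁ (1 : G)) η := by
  -- The left invariant fields in the chart, in the form in which they occur in
  -- `VectorField.mlieBracket`.
  let V : EG → EG → EG := fun ξ y => ContinuousLinearMap.inverse
    (mfderivWithin 𝓘(ℝ, EG) 𝓘(ℝ, EG) (φ₁ : PartialEquiv G EG).symm (range 𝓘(ℝ, EG)) y :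
      EG →L[ℝ] EG) (der 𝓘(ℝ, EG) 𝓘(ℝ, EG) (fun h : G => (φ₁).symm y * h) 1 ξ)
  have h0 : ad G ξ η = ContinuousLinearMap.inverse
      (der 𝓘(ℝ, EG) 𝓘(ℝ, EG) (φ₁ : PartialEquiv G EG) 1)
      (VectorField.lieBracketWithin ℝ (V ξ) (V η) ((φ₁ : PartialEquiv G EG).symm ⁻¹' univ ∩
        range 𝓘(ℝ, EG)) (φ₁ (1 : G))) := rfl
  have hV : ∀ ξ, V ξ =ᶠ[𝓝 (φ₁ (1 : G))]
      fun y => fderiv ℝ (fun z => chartMul EG G (y, z)) (φ₁ (1 : G)) ξ := by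
    intro ξ
    filter_upwards [target_mem (EG := EG) (G := G)] with y hy
    have e : (mfderivWithin 𝓘(ℝ, EG) 𝓘(ℝ, EG) (φ₁ : PartialEquiv G EG).symm
        (range 𝓘(ℝ, EG)) y : EG →L[ℝ] EG) = der 𝓘(ℝ, EG) 𝓘(ℝ, EG)
        (φ₁ : PartialEquiv G EG).symm y := by
      rw [modelWithCornersSelf_coe, range_id, mfderivWithin_univ]; rfl
    change ContinuousLinearMap.inverse (mfderivWithin 𝓘(ℝ, EG) 𝓘(ℝ, EG)
      (φ₁ : PartialEquiv G EG).symm (range 𝓘(ℝ, EG)) y : EG →L[ℝ] EG) _ = _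
    rw [e]
    exact pullback_leftInvariant hy ξ
  rw [h0, der_extChartAt_self, ContinuousLinearMap.inverse_id, preimage_univ,
    modelWithCornersSelf_coe, range_id, inter_univ, VectorField.lieBracketWithin_univ,
    ContinuousLinearMap.id_apply, VectorField.lieBracket, (hV ξ).self_of_nhds,
    (hV η).self_of_nhds, (hV ξ).fderiv_eq, (hV η).fderiv_eq]
  have hc : ∀ ζ : EG, fderiv ℝ (fun z => chartMul EG G (φ₁ (1 : G), z)) (φ₁ (1 : G)) ζ = ζ := by
    intro ζ
    rw [← der_chart_leftMul (mem_extChartAt_source (I := 𝓘(ℝ, EG)) (1 : G))]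
    simp only [one_mul, der_id, der_extChartAt_self, ContinuousLinearMap.id_apply]
  simp only [hc]

/-- Near the identity, `Ad` is the derivative of the conjugation of the local group given by
`chartMul` and `chartInv`. -/
theorem Ad_symm_eventuallyEq (η : EG) :
    (fun y => Ad (EG := EG) G ((φ₁).symm y) η) =ᶠ[𝓝 (φ₁ (1 : G))]
      fun y => fderiv ℝ (fun z => chartMul EG G (chartMul EG G (y, z), chartInv EG G y))
        (φ₁ (1 : G)) η := by
  have hM := contDiffAt_chartMul (EG := EG) (G := G)
  have hgood : ∀ᶠ g in 𝓝 (1 : G), g ∈ (φ₁ : PartialEquiv G EG).source := source_mem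
  have hinv : ∀ᶠ y in 𝓝 (φ₁ (1 : G)), ((φ₁ : PartialEquiv G EG).symm y)⁻¹ ∈
      (φ₁ : PartialEquiv G EG).source := by
    have : Tendsto (fun y => ((φ₁ : PartialEquiv G EG).symm y)⁻¹) (𝓝 (φ₁ (1 : G))) (𝓝 1) := by
      have h := (contMDiffAt_symm_one (EG := EG) (G := G)).inv.continuousAt
      rwa [ContinuousAt, symm_chart_one, inv_one] at h
    exact this hgood
  filter_upwards [target_mem (EG := EG) (G := G), hinv, tendsto_symm_one hgood] with y hy hy' hys
  set g : G := (φ₁).symm y with hg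
  have hcont : ContinuousAt (fun z => g * (φ₁ : PartialEquiv G EG).symm z) (φ₁ (1 : G)) :=
    (MDiffAt.const_mul g (mdiff_symm_one (EG := EG) (G := G))).continuousAt
  have hmem : ∀ᶠ z in 𝓝 (φ₁ (1 : G)), g * (φ₁ : PartialEquiv G EG).symm z ∈
      (φ₁ : PartialEquiv G EG).source := by
    have hg1 : g * (φ₁ : PartialEquiv G EG).symm (φ₁ 1) ∈ (φ₁ : PartialEquiv G EG).source := by
      rw [symm_chart_one, mul_one]; exact hys
    exact hcont ((isOpen_extChartAt_source (I := 𝓘(ℝ, EG)) (1 : G)).mem_nhds hg1)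
  have e : (fun z => chartMul EG G (chartMul EG G (y, z), chartInv EG G y)) =ᶠ[𝓝 (φ₁ (1 : G))]
      fun z => φ₁ ((fun h : G => g * h * g⁻¹) ((φ₁).symm z)) := by
    filter_upwards [hmem] with z hz
    simp only [chartMul, chartInv]
    rw [← hg, (φ₁ : PartialEquiv G EG).left_inv hz, (φ₁ : PartialEquiv G EG).left_inv hy']
  rw [e.fderiv_eq, ← der_eq_fderiv, Ad_eq]
  have h1 : MDifferentiableAt 𝓘(ℝ, EG) 𝓘(ℝ, EG) (fun z => g * (φ₁).symm z * g⁻¹) (φ₁ (1 : G)) :=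
    MDiffAt.mul_const (MDiffAt.const_mul g mdiff_symm_one) _
  rw [der_comp_of_eq (g := φ₁) (mdiff_chart (mem_extChartAt_source (I := 𝓘(ℝ, EG)) (1 : G))) h1
    (by simp), der_extChartAt_self, ContinuousLinearMap.id_comp,
    der_comp_of_eq (g := fun h => g * h * g⁻¹) (mdiff_conj g 1) mdiff_symm_one symm_chart_one,
    der_extChartAt_symm_self, ContinuousLinearMap.comp_id]

/-- The derivative of the adjoint representation at the identity is `ad`. -/
theorem der_Ad_one (ξ : EG) :
    der 𝓘(ℝ, EG) 𝓘(ℝ, EG →L[ℝ] EG) (fun g : G => Ad (EG := EG) G g) 1 ξ = ad G ξ := by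
  ext η
  have hAd : ∀ g, MDifferentiableAt 𝓘(ℝ, EG) 𝓘(ℝ, EG →L[ℝ] EG)
      (fun g : G => Ad (EG := EG) G g) g := fun g => contMDiff_Ad.mdifferentiableAt (by simp)
  have h1 := der_comp_of_eq (hAd 1) (mdiff_symm_one (EG := EG) (G := G)) symm_chart_one
  rw [der_extChartAt_symm_self, ContinuousLinearMap.comp_id, der_eq_fderiv] at h1
  have hd : DifferentiableAt ℝ (fun y => Ad (EG := EG) G ((φ₁).symm y)) (φ₁ (1 : G)) := by
    rw [← mdifferentiableAt_iff_differentiableAt]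
    exact (hAd _).comp _ mdiff_symm_one
  rw [← h1, ad_eq_fderiv, ← fderiv_conj_local (chartMul EG G) (chartInv EG G) (φ₁ (1 : G))
    contDiffAt_chartMul contDiffAt_chartInv, ← (Ad_symm_eventuallyEq η).fderiv_eq,
    fderiv_clm_apply hd (differentiableAt_const _)]
  · simp
  · filter_upwards [target_mem (EG := EG) (G := G)] with y hy
    simp only [chartMul, symm_chart_one, mul_one]
    exact (φ₁ : PartialEquiv G EG).right_inv hy
  · filter_upwards [target_mem (EG := EG) (G := G)] with y hy
    simp only [chartMul, symm_chart_one, one_mul]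
    exact (φ₁ : PartialEquiv G EG).right_inv hy
  · have hinv : ∀ᶠ y in 𝓝 (φ₁ (1 : G)), ((φ₁ : PartialEquiv G EG).symm y)⁻¹ ∈
        (φ₁ : PartialEquiv G EG).source := by
      have : Tendsto (fun y => ((φ₁ : PartialEquiv G EG).symm y)⁻¹) (𝓝 (φ₁ (1 : G))) (𝓝 1) := by
        have h := (contMDiffAt_symm_one (EG := EG) (G := G)).inv.continuousAt
        rwa [ContinuousAt, symm_chart_one, inv_one] at h
      exact this source_mem
    filter_upwards [hinv] with y hy'
    simp only [chartMul, chartInv]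
    rw [(φ₁ : PartialEquiv G EG).left_inv hy', mul_inv_cancel]
  · simp only [chartInv, symm_chart_one, inv_one]

end AdDerivative

/-! ### The first variation of the logarithmic derivative -/

section LieVariation

variable {E : Type*} [NormedAddCommGroup E] [NormedSpace ℝ E]
  {H : Type*} [TopologicalSpace H] {I : ModelWithCorners ℝ E H}
  {X : Type*} [TopologicalSpace X] [ChartedSpace H X]
  {F F' : Type*} [NormedAddCommGroup F] [NormedSpace ℝ F] [NormedAddCommGroup F'] [NormedSpace ℝ F']
  {EG : Type*} [NormedAddCommGroup EG] [NormedSpace ℝ EG] [FiniteDimensional ℝ EG]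
  {G : Type*} [TopologicalSpace G] [ChartedSpace EG G] [Group G] [LieGroup 𝓘(ℝ, EG) ∞ G]

theorem der_clm_apply (T : F →L[ℝ] F') {f : X → F} {x : X}
    (hf : MDifferentiableAt I 𝓘(ℝ, F) f x) :
    der I 𝓘(ℝ, F') (fun y => T (f y)) x = T.comp (der I 𝓘(ℝ, F) f x) := by
  rw [der_comp (g := T) (J := 𝓘(ℝ, F')) T.differentiableAt.mdifferentiableAt hf, der_eq_fderiv,
    T.fderiv]

theorem der_add {f g : X → F} {x : X} (hf : MDifferentiableAt I 𝓘(ℝ, F) f x)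
    (hg : MDifferentiableAt I 𝓘(ℝ, F) g x) :
    der I 𝓘(ℝ, F) (fun y => f y + g y) x = der I 𝓘(ℝ, F) f x + der I 𝓘(ℝ, F) g x :=
  (hf.hasMFDerivAt.add hg.hasMFDerivAt).mfderiv

variable (EG G) in
/-- The adjoint representation of the Lie algebra, as a continuous bilinear map. -/
def adL : EG →L[ℝ] EG →L[ℝ] EG := der 𝓘(ℝ, EG) 𝓘(ℝ, EG →L[ℝ] EG) (fun g : G => Ad (EG := EG) G g) 1

theorem adL_apply (ξ : EG) : adL EG G ξ = ad G ξ := der_Ad_one ξ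

theorem ad_swap (ξ η : EG) : ad G ξ η = - ad G η ξ := by
  rw [ad_eq_fderiv, ad_eq_fderiv, neg_sub]

theorem mdiff_Ad (g : G) :
    MDifferentiableAt 𝓘(ℝ, EG) 𝓘(ℝ, EG →L[ℝ] EG) (fun g : G => Ad (EG := EG) G g) g :=
  contMDiff_Ad.mdifferentiableAt (by simp)

theorem der_Ad_comp {k : X → G} {x : X} (hk : MDifferentiableAt I 𝓘(ℝ, EG) k x) (u : E) :
    der I 𝓘(ℝ, EG →L[ℝ] EG) (fun y => Ad (EG := EG) G (k y)) x u =
      (ad G (rlog I EG k x u)).comp (Ad G (k x)) := by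
  let T : (EG →L[ℝ] EG) →L[ℝ] (EG →L[ℝ] EG) :=
    (ContinuousLinearMap.compL ℝ EG EG EG).flip (Ad G (k x))
  have e : (fun y => Ad (EG := EG) G (k y)) = fun y => T (Ad G (k y * (k x)⁻¹)) := by
    ext1 y
    change _ = (Ad G (k y * (k x)⁻¹)).comp (Ad G (k x) : EG →L[ℝ] EG)
    rw [← Ad_mul]; simp
  have hk' := MDiffAt.mul_const hk (k x)⁻¹
  have h1 : MDifferentiableAt I 𝓘(ℝ, EG →L[ℝ] EG)
      (fun y => Ad (EG := EG) G (k y * (k x)⁻¹)) x := (mdiff_Ad _).comp x hk'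
  rw [e, der_clm_apply T h1, der_comp_of_eq (g := fun g : G => Ad (EG := EG) G g)
    (mdiff_Ad 1) hk' (by simp)]
  simp only [ContinuousLinearMap.comp_apply, der_Ad_one]
  rfl

/-- `Ad g` is an automorphism of the Lie algebra: differentiate `Ad (g h g⁻¹) = Ad g ∘ Ad h ∘ Ad
g⁻¹` in `h` at the identity. -/
theorem Ad_ad (g : G) (ξ η : EG) : Ad G g (ad G ξ η) = ad G (Ad G g ξ) (Ad G g η) := by
  have h1 := der_Ad_comp (mdiff_conj (EG := EG) g 1) ξ
  rw [rlog_of_eq_one (by simp), ← Ad_eq] at h1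
  let T : (EG →L[ℝ] EG) →L[ℝ] (EG →L[ℝ] EG) :=
    ((ContinuousLinearMap.compL ℝ EG EG EG).flip (Ad G g⁻¹)).comp
      (ContinuousLinearMap.compL ℝ EG EG EG (Ad G g))
  have e : (fun h : G => Ad (EG := EG) G (g * h * g⁻¹)) = fun h => T (Ad G h) := by
    ext1 h
    change _ = ((Ad G g).comp (Ad G h : EG →L[ℝ] EG)).comp (Ad G g⁻¹ : EG →L[ℝ] EG)
    rw [← Ad_mul, ← Ad_mul]
  rw [e, der_clm_apply T (mdiff_Ad 1)] at h1
  have h2 := congrArg (fun A : EG →L[ℝ] EG => A (Ad G g η)) h1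
  have h3 : (T (ad G ξ)) (Ad G g η) = Ad G g (ad G ξ (Ad G g⁻¹ (Ad G g η))) := rfl
  simp only [ContinuousLinearMap.comp_apply, der_Ad_one, mul_one, mul_inv_cancel, Ad_one,
    ContinuousLinearMap.id_apply] at h2
  rw [h3, Ad_inv_Ad] at h2
  exact h2

variable (EG G) in
/-- A global smooth substitute for the exponential map: it is only required to have the right first
order behaviour at `0`. -/
theorem exists_localExp : ∃ c : EG → G, ContMDiff 𝓘(ℝ, EG) 𝓘(ℝ, EG) ∞ c ∧ c 0 = 1 ∧
    der 𝓘(ℝ, EG) 𝓘(ℝ, EG) c 0 = ContinuousLinearMap.id ℝ EG := by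
  set φ := extChartAt 𝓘(ℝ, EG) (1 : G) with hφ
  obtain ⟨r, hr, hrs⟩ := Metric.mem_nhds_iff.1 (target_mem (EG := EG) (G := G))
  -- The cutoff `f` keeps the argument of the inverse chart in the ball of radius `r`, and is `1`
  -- near the origin.
  let f : ContDiffBump (0 : EG) := ⟨r / 4, r / 2, by positivity, by linarith⟩
  have hball : ∀ y : EG, φ 1 + f y • y ∈ φ.target := by
    intro y
    apply hrs
    rw [Metric.mem_ball, dist_eq_norm, add_sub_cancel_left, norm_smul, Real.norm_of_nonneg f.nonneg]
    by_cases hy : ‖y‖ < r / 2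
    · calc f y * ‖y‖ ≤ 1 * ‖y‖ := by gcongr; exact f.le_one
        _ < r := by linarith
    · have : f y = 0 := f.zero_of_le_dist (by simpa using not_lt.1 hy)
      rw [this]; simpa using hr
  have hsm : ContDiff ℝ ∞ (fun y : EG => φ 1 + f y • y) :=
    contDiff_const.add (f.contDiff.smul contDiff_id)
  refine ⟨fun y => φ.symm (φ 1 + f y • y), ?_, ?_, ?_⟩
  · exact (contMDiffOn_extChartAt_symm (1 : G)).comp_contMDiff hsm.contMDiff hball
  · simp only [smul_zero, add_zero]; exact symm_chart_one
  · have e : (fun y : EG => φ 1 + f y • y) =ᶠ[𝓝 0] fun y => φ 1 + y := by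
      filter_upwards [f.eventuallyEq_one] with y hy
      rw [hy]; simp
    rw [der_comp_of_eq (g := φ.symm) (mdiff_symm_one (EG := EG) (G := G))
      (hsm.contMDiff.mdifferentiableAt (by simp)) (by simp [hφ]), der_extChartAt_symm_self,
      der_eq_fderiv, e.fderiv_eq, fderiv_const_add, ContinuousLinearMap.id_comp]
    exact fderiv_fun_id

variable [IsManifold I ∞ X] [I.Boundaryless]

theorem ContMDiffAt.mdiff_left {k : ℝ → X → G} {ε : ℝ} {x : X}
    (hk : ContMDiffAt (𝓘(ℝ, ℝ).prod I) 𝓘(ℝ, EG) ∞ (fun z : ℝ × X => k z.1 z.2) (ε, x)) :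
    MDifferentiableAt 𝓘(ℝ, ℝ) 𝓘(ℝ, EG) (fun ε => k ε x) ε :=
  (ContMDiffAt.comp ε (g := fun z : ℝ × X => k z.1 z.2) hk
    (contMDiffAt_id.prodMk contMDiffAt_const)).mdifferentiableAt (by simp)

theorem eventually_contMDiffAt_right {k : ℝ → X → G} {ε : ℝ} {x : X}
    (hk : ContMDiffAt (𝓘(ℝ, ℝ).prod I) 𝓘(ℝ, EG) 1 (fun z : ℝ × X => k z.1 z.2) (ε, x)) :
    ∀ᶠ y in 𝓝 x, MDifferentiableAt 𝓘(ℝ, ℝ) 𝓘(ℝ, EG) (fun ε => k ε y) ε := by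
  have : IsManifold I 1 X := IsManifold.of_le (n := ∞) (by simp)
  have : IsManifold 𝓘(ℝ, EG) 1 G := IsManifold.of_le (n := ∞) (by simp)
  have hT : Tendsto (fun y : X => (ε, y)) (𝓝 x) (𝓝 (ε, x)) :=
    (Continuous.prodMk_right ε).tendsto x
  have h1 : ∀ᶠ z in 𝓝 (ε, x), ContMDiffAt (𝓘(ℝ, ℝ).prod I) 𝓘(ℝ, EG) 1
      (fun z : ℝ × X => k z.1 z.2) z :=
    (contMDiffAt_iff_contMDiffAt_nhds (by simp)).1 hk
  filter_upwards [hT.eventually h1] with y hy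
  exact (ContMDiffAt.comp ε (g := fun z : ℝ × X => k z.1 z.2) hy
    (contMDiffAt_id.prodMk contMDiffAt_const)).mdifferentiableAt (by simp)

/-- The first variation of the logarithmic derivative at the constant map `1`, where it is the
interchange of the derivatives in the parameter and in the point. -/
theorem hasDerivAt_rlog_of_one {k : ℝ → X → G} {x : X}
    (hk : ContMDiffAt (𝓘(ℝ, ℝ).prod I) 𝓘(ℝ, EG) ∞ (fun z : ℝ × X => k z.1 z.2) (0, x))
    (h1 : ∀ᶠ y in 𝓝 x, k 0 y = 1) :
    HasDerivAt (fun ε => rlog I EG (k ε) x)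
      (der I 𝓘(ℝ, EG) (fun y => der 𝓘(ℝ, ℝ) 𝓘(ℝ, EG) (fun ε => k ε y) 0 1) x) 0 := by
  set φ := extChartAt 𝓘(ℝ, EG) (1 : G) with hφ
  set ψ := extChartAt I x with hψ
  have h1x : k 0 x = 1 := h1.self_of_nhds
  -- normalize at `x`, so that all maps send `x` to the identity
  let k' : ℝ × X → G := fun z => k z.1 z.2 * (k z.1 x)⁻¹
  have hkx : ContMDiffAt (𝓘(ℝ, ℝ).prod I) 𝓘(ℝ, EG) ∞ (fun z : ℝ × X => k z.1 x) (0, x) :=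
    ContMDiffAt.comp (0, x) (g := fun z : ℝ × X => k z.1 z.2) hk
      (contMDiffAt_fst.prodMk contMDiffAt_const)
  have hk' : ContMDiffAt (𝓘(ℝ, ℝ).prod I) 𝓘(ℝ, EG) ∞ k' (0, x) := hk.mul hkx.inv
  have hk'x : ∀ ε, k' (ε, x) = 1 := fun ε => by simp [k']
  -- in charts
  let κ : ℝ × E → EG := fun z => φ (k' (z.1, ψ.symm z.2))
  have hψs : ContMDiffAt 𝓘(ℝ, E) I ∞ ψ.symm (ψ x) :=
    contMDiffAt_extChartAt_symm (mem_extChartAt_target x)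
  have hψx : ψ.symm (ψ x) = x := ψ.left_inv (mem_extChartAt_source x)
  have hk's : ContMDiffAt 𝓘(ℝ, ℝ × E) 𝓘(ℝ, EG) ∞
      (fun z : ℝ × E => k' (z.1, ψ.symm z.2)) (0, ψ x) := by
    refine ContMDiffAt.comp_of_eq (g := k') hk' ?_ (by simp [hψx])
    exact contDiffAt_fst.contMDiffAt.prodMk
      (ContMDiffAt.comp (0, ψ x) (g := ψ.symm) hψs contDiffAt_snd.contMDiffAt)
  have hκ : ContDiffAt ℝ ∞ κ (0, ψ x) := by
    rw [← contMDiffAt_iff_contDiffAt]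
    refine ContMDiffAt.comp_of_eq (g := φ) contMDiffAt_extChartAt hk's ?_
    simp [hψx, hk'x]
  have hT : Tendsto (fun ε : ℝ => (ε, x)) (𝓝 0) (𝓝 (0, x)) :=
    (Continuous.prodMk_left x).tendsto 0
  have : IsManifold I 1 X := IsManifold.of_le (n := ∞) (by simp)
  have : IsManifold 𝓘(ℝ, EG) 1 G := IsManifold.of_le (n := ∞) (by simp)
  have hrlog : (fun ε => rlog I EG (k ε) x) =ᶠ[𝓝 0]
      fun ε => fderiv ℝ (fun y => κ (ε, y)) (ψ x) := by
    have hev : ∀ᶠ z in 𝓝 ((0 : ℝ), x), ContMDiffAt (𝓘(ℝ, ℝ).prod I) 𝓘(ℝ, EG) 1 k' z :=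
      (contMDiffAt_iff_contMDiffAt_nhds (by simp)).1 (hk'.of_le (by simp))
    filter_upwards [hT.eventually hev] with ε hε
    have hd : MDifferentiableAt I 𝓘(ℝ, EG) (fun y => k' (ε, y)) x :=
      (ContMDiffAt.comp x (g := k') hε
        (contMDiffAt_const.prodMk contMDiffAt_id)).mdifferentiableAt (by simp)
    have hψd : MDifferentiableAt 𝓘(ℝ, E) I ψ.symm (ψ x) := hψs.mdifferentiableAt (by simp)
    have hd' : MDifferentiableAt 𝓘(ℝ, E) 𝓘(ℝ, EG) (fun y => k' (ε, ψ.symm y)) (ψ x) :=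
      MDifferentiableAt.comp_of_eq (g := fun y => k' (ε, y)) (ψ x) hd hψd hψx
    rw [← der_eq_fderiv, der_comp_of_eq (g := φ) (mdiff_chart
      (mem_extChartAt_source (I := 𝓘(ℝ, EG)) (1 : G))) hd' (by simp [hψx, hk'x]),
      der_extChartAt_self, ContinuousLinearMap.id_comp,
      der_comp_of_eq (g := fun y => k' (ε, y)) hd hψd hψx, der_extChartAt_symm_self,
      ContinuousLinearMap.comp_id]
    rfl
  refine HasDerivAt.congr_of_eventuallyEq ?_ hrlog
  have hdiff : DifferentiableAt ℝ (fun ε => fderiv ℝ (fun y => κ (ε, y)) (ψ x)) 0 := by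
    have h2 : ContDiffAt ℝ ∞ (fun ε : ℝ => fderiv ℝ (fun y => κ (ε, y)) (ψ x)) 0 :=
      ContDiffAt.fderiv (f := fun ε y => κ (ε, y)) (n := ∞) hκ
        contDiffAt_const (by simp)
    exact h2.differentiableAt (by simp)
  convert hdiff.hasDerivAt using 1
  ext u
  have h3 : deriv (fun ε => fderiv ℝ (fun y => κ (ε, y)) (ψ x)) 0 u =
      fderiv ℝ (fun ε : ℝ => fderiv ℝ (fun y => κ (ε, y)) (ψ x) u) 0 1 := by
    rw [fderiv_clm_apply hdiff (differentiableAt_const _), ← fderiv_apply_one_eq_deriv]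
    simp
  rw [h3, fderiv_partial_comm hκ (1 : ℝ) u]
  -- the derivative in the parameter
  have hζ : (fun y => der 𝓘(ℝ, ℝ) 𝓘(ℝ, EG) (fun ε => k' (ε, y)) 0 (1 : ℝ)) =ᶠ[𝓝 x]
      fun y => der 𝓘(ℝ, ℝ) 𝓘(ℝ, EG) (fun ε => k ε y) 0 1 +
        der 𝓘(ℝ, ℝ) 𝓘(ℝ, EG) (fun ε => (k ε x)⁻¹) 0 1 := by
    have hi : MDifferentiableAt 𝓘(ℝ, ℝ) 𝓘(ℝ, EG) (fun ε => (k ε x)⁻¹) 0 :=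
      (ContMDiffAt.comp (0 : ℝ) (g := fun z : ℝ × X => k z.1 z.2) hk
        (contMDiffAt_id.prodMk contMDiffAt_const)).inv.mdifferentiableAt (by simp)
    filter_upwards [h1, eventually_contMDiffAt_right (hk.of_le (by simp))] with y hy hyd
    rw [← _root_.add_apply, ← der_mul_of_one hyd hi hy (by simp [h1x])]
  have hκζ : (fun z => fderiv ℝ (fun ε : ℝ => κ (ε, z)) 0 1) =ᶠ[𝓝 (ψ x)]
      fun z => der 𝓘(ℝ, ℝ) 𝓘(ℝ, EG) (fun ε => k' (ε, ψ.symm z)) 0 (1 : ℝ) := by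
    have hTs : Tendsto ψ.symm (𝓝 (ψ x)) (𝓝 x) := by
      have := hψs.continuousAt
      rwa [ContinuousAt, hψx] at this
    filter_upwards [hTs.eventually h1,
      hTs.eventually (eventually_contMDiffAt_right (k := fun ε y => k' (ε, y))
        (hk'.of_le (by simp)))] with z hz hzd
    rw [← der_eq_fderiv, der_comp_of_eq (g := φ) (mdiff_chart
      (mem_extChartAt_source (I := 𝓘(ℝ, EG)) (1 : G))) hzd (by simp [k', hz, h1x]),
      der_extChartAt_self, ContinuousLinearMap.id_comp]
  have hd4 : DifferentiableAt ℝ (fun z => fderiv ℝ (fun ε : ℝ => κ (ε, z)) 0 1) (ψ x) :=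
    (contDiffAt_partial_left hκ 1).differentiableAt (by simp)
  -- transport back to the manifold
  have hψd : MDifferentiableAt I 𝓘(ℝ, E) ψ x :=
    (contMDiffAt_extChartAt (n := ∞)).mdifferentiableAt (by simp)
  have h5 : (fun y => der 𝓘(ℝ, ℝ) 𝓘(ℝ, EG) (fun ε => k' (ε, y)) 0 (1 : ℝ)) =ᶠ[𝓝 x]
      fun y => fderiv ℝ (fun ε : ℝ => κ (ε, ψ y)) 0 1 := by
    filter_upwards [hψd.continuousAt.eventually hκζ, extChartAt_source_mem_nhds (I := I) x]
      with y hy hys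
    rw [hy, hψ, (extChartAt I x).left_inv hys]
  have h6 : der I 𝓘(ℝ, EG) (fun y => der 𝓘(ℝ, ℝ) 𝓘(ℝ, EG) (fun ε => k' (ε, y)) 0 (1 : ℝ)) x u =
      fderiv ℝ (fun z => fderiv ℝ (fun ε : ℝ => κ (ε, z)) 0 1) (ψ x) u := by
    rw [der_congr h5, der_comp (g := fun z => fderiv ℝ (fun ε : ℝ => κ (ε, z)) 0 1)
      hd4.mdifferentiableAt hψd, der_extChartAt_self, der_eq_fderiv, ContinuousLinearMap.comp_id]
  have hmd : MDifferentiableAt I 𝓘(ℝ, EG)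
      (fun y => der 𝓘(ℝ, ℝ) 𝓘(ℝ, EG) (fun ε => k' (ε, y)) 0 (1 : ℝ)) x :=
    MDifferentiableAt.congr_of_eventuallyEq
      (MDifferentiableAt.comp x (g := fun z => fderiv ℝ (fun ε : ℝ => κ (ε, z)) 0 1)
      hd4.mdifferentiableAt hψd) h5
  rw [← h6]
  set c₀ := der 𝓘(ℝ, ℝ) 𝓘(ℝ, EG) (fun ε => (k ε x)⁻¹) 0 1
  have h7 : (fun y => der 𝓘(ℝ, ℝ) 𝓘(ℝ, EG) (fun ε => k ε y) 0 (1 : ℝ)) =ᶠ[𝓝 x]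
      fun y => der 𝓘(ℝ, ℝ) 𝓘(ℝ, EG) (fun ε => k' (ε, y)) 0 (1 : ℝ) + (- c₀) := by
    filter_upwards [hζ] with y hy
    rw [hy]; simp
  rw [der_congr h7, der_add hmd mdifferentiableAt_const, der_const, add_zero]

/-- The first variation of the right logarithmic derivative: if `ζ = δh h⁻¹` then
`δ(dh h⁻¹) = dζ + [ζ, dh h⁻¹]`. -/
theorem hasDerivAt_rlog {h : ℝ → X → G} {x : X}
    (hh : ContMDiffAt (𝓘(ℝ, ℝ).prod I) 𝓘(ℝ, EG) ∞ (fun z : ℝ × X => h z.1 z.2) (0, x)) :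
    HasDerivAt (fun ε => rlog I EG (h ε) x)
      (der I 𝓘(ℝ, EG) (fun y => rlog 𝓘(ℝ, ℝ) EG (fun ε => h ε y) 0 1) x +
        (ad G (rlog 𝓘(ℝ, ℝ) EG (fun ε => h ε x) 0 1)).comp (rlog I EG (h 0) x)) 0 := by
  -- By `h_ε = k_ε h_0` and the cocycle identity, it suffices to vary `k_ε`, which starts at the
  -- constant map `1`; the factor `Ad k_ε` contributes the bracket.
  let k : ℝ → X → G := fun ε y => h ε y * (h 0 y)⁻¹
  have hh0 : ContMDiffAt I 𝓘(ℝ, EG) ∞ (h 0) x :=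
    ContMDiffAt.comp x (g := fun z : ℝ × X => h z.1 z.2) hh
      (contMDiffAt_const.prodMk contMDiffAt_id)
  have hk : ContMDiffAt (𝓘(ℝ, ℝ).prod I) 𝓘(ℝ, EG) ∞ (fun z : ℝ × X => k z.1 z.2) (0, x) :=
    hh.mul (ContMDiffAt.comp (0, x) (g := h 0) hh0 contMDiffAt_snd).inv
  have hT : Tendsto (fun ε : ℝ => (ε, x)) (𝓝 0) (𝓝 (0, x)) :=
    (Continuous.prodMk_left x).tendsto 0
  have : IsManifold I 1 X := IsManifold.of_le (n := ∞) (by simp)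
  have : IsManifold 𝓘(ℝ, EG) 1 G := IsManifold.of_le (n := ∞) (by simp)
  have e : (fun ε => rlog I EG (h ε) x) =ᶠ[𝓝 0]
      fun ε => rlog I EG (k ε) x + (Ad G (k ε x)).comp (rlog I EG (h 0) x) := by
    have hev : ∀ᶠ z in 𝓝 ((0 : ℝ), x), ContMDiffAt (𝓘(ℝ, ℝ).prod I) 𝓘(ℝ, EG) 1
        (fun z : ℝ × X => k z.1 z.2) z :=
      (contMDiffAt_iff_contMDiffAt_nhds (by simp)).1 (hk.of_le (by simp))
    filter_upwards [hT.eventually hev] with ε hε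
    have hd : MDifferentiableAt I 𝓘(ℝ, EG) (k ε) x :=
      (ContMDiffAt.comp x (g := fun z : ℝ × X => k z.1 z.2) hε
        (contMDiffAt_const.prodMk contMDiffAt_id)).mdifferentiableAt (by simp)
    rw [← rlog_mul hd (hh0.mdifferentiableAt (by simp))]
    congr 1; ext y; simp [k]
  refine HasDerivAt.congr_of_eventuallyEq ?_ e
  have h1 := hasDerivAt_rlog_of_one hk (Eventually.of_forall fun y => by simp [k])
  refine h1.add ?_
  have hkx : MDifferentiableAt 𝓘(ℝ, ℝ) 𝓘(ℝ, EG) (fun ε => k ε x) 0 := ContMDiffAt.mdiff_left hk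
  have h2 : HasDerivAt (fun ε => Ad (EG := EG) G (k ε x))
      (ad G (rlog 𝓘(ℝ, ℝ) EG (fun ε => h ε x) 0 1)) 0 := by
    have h3 : DifferentiableAt ℝ (fun ε => Ad (EG := EG) G (k ε x)) 0 := by
      rw [← mdifferentiableAt_iff_differentiableAt]
      exact (mdiff_Ad _).comp _ hkx
    have h5 : deriv (fun ε => Ad (EG := EG) G (k ε x)) 0 =
        ad G (rlog 𝓘(ℝ, ℝ) EG (fun ε => h ε x) 0 1) := by
      rw [← fderiv_apply_one_eq_deriv, ← der_eq_fderiv, der_Ad_comp hkx,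
        rlog_of_eq_one (by simp [k])]
      simp only [k, mul_inv_cancel, Ad_one, ContinuousLinearMap.comp_id]
      rfl
    rw [← h5]
    exact h3.hasDerivAt
  exact ((ContinuousLinearMap.compL ℝ E EG EG).flip
    (rlog I EG (h 0) x)).hasFDerivAt.comp_hasDerivAt (0 : ℝ) h2

end LieVariation

/-! ### Smooth one-forms -/

section Forms

variable {E : Type*} [NormedAddCommGroup E] [NormedSpace ℝ E]
  {H : Type*} [TopologicalSpace H] {I : ModelWithCorners ℝ E H}
  {X : Type*} [TopologicalSpace X] [ChartedSpace H X] [IsManifold I ∞ X]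
  {E' : Type*} [NormedAddCommGroup E'] [NormedSpace ℝ E']
  {H' : Type*} [TopologicalSpace H'] {I' : ModelWithCorners ℝ E' H'}
  {Y : Type*} [TopologicalSpace Y] [ChartedSpace H' Y] [IsManifold I' ∞ Y]
  {F F' : Type*} [NormedAddCommGroup F] [NormedSpace ℝ F] [NormedAddCommGroup F'] [NormedSpace ℝ F']

instance instTangentContMDiffVectorBundle :
    ContMDiffVectorBundle ∞ E (TangentSpace I : X → Type _) I :=
  TangentBundle.contMDiffVectorBundle (n := ∞) (h := by simpa using (inferInstance : IsManifold I ∞ X))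

variable (I) in
/-- Smoothness on `S` of a one-form with values in a vector space. -/
def SmoothFormOn (S : Set X) (A : X → E →L[ℝ] F) : Prop :=
  ContMDiffOn I.tangent 𝓘(ℝ, F) ∞ (fun v : TangentBundle I X => A v.1 v.2) {v | v.1 ∈ S}

theorem contMDiffAt_tangentMap_of_isOpen {f : X → Y} {S : Set X} (hS : IsOpen S)
    (hf : ContMDiffOn I I' ∞ f S) {v : TangentBundle I X} (hv : v.1 ∈ S) :
    ContMDiffAt I.tangent I'.tangent ∞
      (fun v : TangentBundle I X => (⟨f v.1, der I I' f v.1 v.2⟩ : TangentBundle I' Y)) v := by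
  have : IsManifold I 1 X := IsManifold.of_le (n := ∞) (by simp)
  have : IsManifold I' 1 Y := IsManifold.of_le (n := ∞) (by simp)
  have h := hf.contMDiffOn_tangentMapWithin (m := ∞) (by simp) hS.uniqueMDiffOn
  have ho : IsOpen (Bundle.TotalSpace.proj ⁻¹' S : Set (TangentBundle I X)) :=
    hS.preimage (FiberBundle.continuous_proj E (TangentSpace I))
  refine (h.contMDiffAt (ho.mem_nhds hv)).congr_of_eventuallyEq ?_
  filter_upwards [ho.mem_nhds hv] with w hw
  simp only [tangentMapWithin, der]
  rw [mfderivWithin_of_isOpen hS hw]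
  rfl

theorem contMDiff_bundle_proj :
    ContMDiff I.tangent I ∞ (fun v : TangentBundle I X => v.1) :=
  Bundle.contMDiff_proj (TangentSpace I)

theorem SmoothFormOn.pullback {f : X → Y} {S : Set X} {T : Set Y} {A : Y → E' →L[ℝ] F}
    (hA : SmoothFormOn I' T A) (hS : IsOpen S) (hT : IsOpen T) (hf : ContMDiffOn I I' ∞ f S)
    (hST : MapsTo f S T) : SmoothFormOn I S (fun x => (A (f x)).comp (der I I' f x)) := by
  intro v hv
  have hTo : IsOpen {w : TangentBundle I' Y | w.1 ∈ T} :=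
    hT.preimage (FiberBundle.continuous_proj E' (TangentSpace I'))
  have h1 : ContMDiffAt I'.tangent 𝓘(ℝ, F) ∞ (fun w : TangentBundle I' Y => A w.1 w.2)
      (⟨f v.1, der I I' f v.1 v.2⟩ : TangentBundle I' Y) :=
    hA.contMDiffAt (hTo.mem_nhds (hST hv))
  exact (ContMDiffAt.comp v h1 (contMDiffAt_tangentMap_of_isOpen hS hf hv)).contMDiffWithinAt

theorem contMDiffOn_der_apply {f : X → F} {S : Set X} (hS : IsOpen S)
    (hf : ContMDiffOn I 𝓘(ℝ, F) ∞ f S) : SmoothFormOn I S (fun x => der I 𝓘(ℝ, F) f x) := by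
  intro v hv
  exact (ContMDiffAt.comp v (contMDiff_snd_tangentBundle_modelSpace F 𝓘(ℝ, F)).contMDiffAt
    (contMDiffAt_tangentMap_of_isOpen hS hf hv)).contMDiffWithinAt

theorem SmoothFormOn.add {S : Set X} {A B : X → E →L[ℝ] F} (hA : SmoothFormOn I S A)
    (hB : SmoothFormOn I S B) : SmoothFormOn I S (fun x => A x + B x) :=
  ContMDiffOn.add hA hB

theorem SmoothFormOn.congr {S : Set X} {A B : X → E →L[ℝ] F} (hA : SmoothFormOn I S A)
    (h : ∀ x ∈ S, B x = A x) : SmoothFormOn I S B :=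
  ContMDiffOn.congr hA (fun v hv => by rw [h _ hv])

theorem SmoothFormOn.mono {S T : Set X} {A : X → E →L[ℝ] F} (hA : SmoothFormOn I T A)
    (h : S ⊆ T) : SmoothFormOn I S A :=
  ContMDiffOn.mono hA (fun _ hv => h hv)

theorem SmoothFormOn.clm_comp {S : Set X} {A : X → E →L[ℝ] F} {T : X → F →L[ℝ] F'}
    (hA : SmoothFormOn I S A) (hT : ContMDiffOn I 𝓘(ℝ, F →L[ℝ] F') ∞ T S) :
    SmoothFormOn I S (fun x => (T x).comp (A x)) := by
  have h : ContMDiffOn I.tangent 𝓘(ℝ, F →L[ℝ] F') ∞ (fun v : TangentBundle I X => T v.1)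
      {v | v.1 ∈ S} := hT.comp contMDiff_bundle_proj.contMDiffOn (fun _ hv => hv)
  exact h.clm_apply hA

theorem SmoothFormOn.smulRight {S : Set X} {A : X → E →L[ℝ] ℝ} {f : X → F}
    (hA : SmoothFormOn I S A) (hf : ContMDiffOn I 𝓘(ℝ, F) ∞ f S) :
    SmoothFormOn I S (fun x => (A x).smulRight (f x)) := by
  have h : ContMDiffOn I.tangent 𝓘(ℝ, F) ∞ (fun v : TangentBundle I X => f v.1)
      {v | v.1 ∈ S} := hf.comp contMDiff_bundle_proj.contMDiffOn (fun _ hv => hv)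
  exact ContMDiffOn.smul (f := fun v : TangentBundle I X => A v.1 v.2) hA h

variable [I.Boundaryless]

/-- If the point `f v (g v)` does not move with the parameter `v`, the derivative of `f v` at `g v`
takes values in a fixed tangent space, and its smoothness needs no charts on the target. -/
theorem contMDiffAt_der_model {EW : Type*} [NormedAddCommGroup EW] [NormedSpace ℝ EW]
    {HW : Type*} [TopologicalSpace HW] {J : ModelWithCorners ℝ EW HW}
    {W : Type*} [TopologicalSpace W] [ChartedSpace HW W] [IsManifold J 1 W]
    (f : W → F → Y) (g : W → F) (b : Y) {w : W}
    (hf : ContMDiffAt (J.prod 𝓘(ℝ, F)) I' ∞ (fun z : W × F => f z.1 z.2) (w, g w))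
    (hg : ContMDiffAt J 𝓘(ℝ, F) ∞ g w)
    (hb : ∀ᶠ v in 𝓝 w, f v (g v) = b) :
    ContMDiffAt J 𝓘(ℝ, F →L[ℝ] E') ∞ (fun v => der 𝓘(ℝ, F) I' (f v) (g v)) w := by
  have : IsManifold I' 1 Y := IsManifold.of_le (n := ∞) (by simp)
  have h : ContMDiffAt J 𝓘(ℝ, F →L[ℝ] E') ∞ (inTangentCoordinates 𝓘(ℝ, F) I' g
      (fun v => f v (g v)) (fun v => der 𝓘(ℝ, F) I' (f v) (g v)) w) w :=
    ContMDiffAt.mfderiv (m := ∞) (n := ∞) f g hf hg (by simp)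
  refine h.congr_of_eventuallyEq ?_
  filter_upwards [hb] with v hv
  have hw := hb.self_of_nhds
  rw [inTangentCoordinates_eq]
  · ext u
    simp only [ContinuousLinearMap.comp_apply]
    rw [hv, hw, (tangentBundleCore I' Y).coordChange_self _ _ (by simp)]
    exact congrArg (der 𝓘(ℝ, F) I' (f v) (g v)) (congrArg (fun T : F →L[ℝ] F => T u)
      (tangentBundleCore_coordChange_model_space (I := 𝓘(ℝ, F)) (g w) (g v) (g v))).symm
  · exact mem_univ _
  · rw [hv, hw]; exact mem_chart_source H' b

theorem contMDiffAt_clm_of_apply [FiniteDimensional ℝ E'] {f : X → E' →L[ℝ] F} {x : X}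
    (h : ∀ u, ContMDiffAt I 𝓘(ℝ, F) ∞ (fun y => f y u) x) :
    ContMDiffAt I 𝓘(ℝ, E' →L[ℝ] F) ∞ f x := by
  let b := Module.finBasis ℝ E'
  let T : Fin (Module.finrank ℝ E') → F →L[ℝ] (E' →L[ℝ] F) := fun i =>
    ContinuousLinearMap.smulRightL ℝ E' F (LinearMap.toContinuousLinearMap (b.coord i))
  have e : f = fun y => ∑ i, T i (f y (b i)) := by
    ext y u
    have hu : f y u = f y (∑ i, b.repr u i • b i) := by rw [b.sum_repr u]
    rw [hu, map_sum, sum_apply]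
    exact Finset.sum_congr rfl fun i _ => by simp [T]
  rw [e]
  refine ContMDiffAt.sum fun i _ => ?_
  exact ContMDiffAt.comp x (g := T i) (T i).contDiff.contMDiff.contMDiffAt (h (b i))

variable (I) in
/-- A one-form, written in the chart at `x₀`. -/
def coordForm (x₀ : X) (A : X → E →L[ℝ] F) (x : X) : E →L[ℝ] F :=
  (A x).comp (der 𝓘(ℝ, E) I (extChartAt I x₀).symm (extChartAt I x₀ x))

theorem coordForm_comp_der {x₀ x : X} (hx : x ∈ (extChartAt I x₀).source) (A : X → E →L[ℝ] F) :
    (coordForm I x₀ A x).comp (der I 𝓘(ℝ, E) (extChartAt I x₀) x) = A x := by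
  rw [coordForm, ContinuousLinearMap.comp_assoc, der_symm_comp_extChartAt hx,
    ContinuousLinearMap.comp_id]

/-- A smooth one-form is smooth in the chart at each point. -/
theorem SmoothFormOn.contMDiffAt_coordForm [FiniteDimensional ℝ E] {S : Set X} (hS : IsOpen S)
    {A : X → E →L[ℝ] F} (hA : SmoothFormOn I S A) {x₀ : X} (hx₀ : x₀ ∈ S) :
    ContMDiffAt I 𝓘(ℝ, E →L[ℝ] F) ∞ (coordForm I x₀ A) x₀ := by
  refine contMDiffAt_clm_of_apply fun u => ?_
  set φ := extChartAt I x₀ with hφ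
  have h1 : ContMDiff 𝓘(ℝ, E) 𝓘(ℝ, E).tangent ∞
      (fun z : E => (⟨z, u⟩ : TangentBundle 𝓘(ℝ, E) E)) :=
    contMDiff_vectorSpace_iff_contDiff (V := fun _ : E => u).2 contDiff_const
  have h2 : ContMDiffAt I 𝓘(ℝ, E).tangent ∞
      (fun x => (⟨φ x, u⟩ : TangentBundle 𝓘(ℝ, E) E)) x₀ :=
    ContMDiffAt.comp x₀ h1.contMDiffAt contMDiffAt_extChartAt
  have h3 := ContMDiffAt.comp x₀ (contMDiffAt_tangentMap_of_isOpen (isOpen_extChartAt_target x₀)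
    (contMDiffOn_extChartAt_symm (n := ∞) x₀) (v := ⟨φ x₀, u⟩) (mem_extChartAt_target x₀)) h2
  have hTo : IsOpen {w : TangentBundle I X | w.1 ∈ S} :=
    hS.preimage (FiberBundle.continuous_proj E (TangentSpace I))
  have h4 : ContMDiffAt I 𝓘(ℝ, F) ∞
      (fun x => A (φ.symm (φ x)) (der 𝓘(ℝ, E) I φ.symm (φ x) u)) x₀ :=
    ContMDiffAt.comp_of_eq (g := fun w : TangentBundle I X => A w.1 w.2)
      (hA.contMDiffAt (x := ⟨φ.symm (φ x₀), der 𝓘(ℝ, E) I φ.symm (φ x₀) u⟩)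
        (hTo.mem_nhds (by
          change φ.symm (φ x₀) ∈ S
          rwa [hφ, (extChartAt I x₀).left_inv (mem_extChartAt_source x₀)]))) h3 rfl
  refine h4.congr_of_eventuallyEq ?_
  filter_upwards [extChartAt_source_mem_nhds (I := I) x₀] with x hx
  rw [hφ, (extChartAt I x₀).left_inv hx]
  rfl

/-- Smoothness of a one-form can be checked at each point in the chart at that point. -/
theorem smoothFormOn_of_coordForm {S : Set X} {A : X → E →L[ℝ] F}
    (h : ∀ x₀ ∈ S, ContMDiffAt I 𝓘(ℝ, E →L[ℝ] F) ∞ (coordForm I x₀ A) x₀) :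
    SmoothFormOn I S A := by
  intro v hv
  refine ContMDiffAt.contMDiffWithinAt ?_
  have h1 : ContMDiffAt I.tangent 𝓘(ℝ, E →L[ℝ] F) ∞
      (fun w : TangentBundle I X => coordForm I v.1 A w.1) v :=
    ContMDiffAt.comp v (h v.1 hv) contMDiff_bundle_proj.contMDiffAt
  have hso := isOpen_extChartAt_source (I := I) v.1
  have h2 : ContMDiffAt I.tangent 𝓘(ℝ, E) ∞
      (fun w : TangentBundle I X => der I 𝓘(ℝ, E) (extChartAt I v.1) w.1 w.2) v :=
    (contMDiffOn_der_apply hso (contMDiffOn_extChartAt (n := ∞)|>.mono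
      (by rw [extChartAt_source]))).contMDiffAt
      ((hso.preimage (FiberBundle.continuous_proj E (TangentSpace I))).mem_nhds
        (mem_extChartAt_source v.1))
  refine (h1.clm_apply h2).congr_of_eventuallyEq ?_
  filter_upwards [(hso.preimage (FiberBundle.continuous_proj E (TangentSpace I))).mem_nhds
    (mem_extChartAt_source v.1)] with w hw
  exact (congrArg (fun T : E →L[ℝ] F => T w.2) (coordForm_comp_der hw A)).symm

end Forms

section RlogSmooth

variable {E : Type*} [NormedAddCommGroup E] [NormedSpace ℝ E]
  {H : Type*} [TopologicalSpace H] {I : ModelWithCorners ℝ E H} [I.Boundaryless]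
  {X : Type*} [TopologicalSpace X] [ChartedSpace H X] [IsManifold I ∞ X]
  {EG : Type*} [NormedAddCommGroup EG] [NormedSpace ℝ EG]
  {G : Type*} [TopologicalSpace G] [ChartedSpace EG G] [Group G] [LieGroup 𝓘(ℝ, EG) ∞ G]

theorem smoothFormOn_rlog {S : Set X} (hS : IsOpen S) {h : X → G}
    (hh : ContMDiffOn I 𝓘(ℝ, EG) ∞ h S) : SmoothFormOn I S (rlog I EG h) := by
  refine smoothFormOn_of_coordForm fun x₀ hx₀ => ?_
  have : IsManifold I 1 X := IsManifold.of_le (n := ∞) (by simp)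
  set φ := extChartAt I x₀ with hφ
  have hhx : ContMDiffAt I 𝓘(ℝ, EG) ∞ h x₀ := hh.contMDiffAt (hS.mem_nhds hx₀)
  have hφs : ContMDiffAt 𝓘(ℝ, E) I ∞ φ.symm (φ x₀) :=
    contMDiffAt_extChartAt_symm (mem_extChartAt_target x₀)
  have hφx : φ.symm (φ x₀) = x₀ := φ.left_inv (mem_extChartAt_source x₀)
  have h1 : ContMDiffAt (I.prod 𝓘(ℝ, E)) 𝓘(ℝ, EG) ∞
      (fun z : X × E => h (φ.symm z.2) * (h z.1)⁻¹) (x₀, φ x₀) := by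
    have ha : ContMDiffAt (I.prod 𝓘(ℝ, E)) I ∞ (fun z : X × E => φ.symm z.2) (x₀, φ x₀) :=
      ContMDiffAt.comp (x₀, φ x₀) (g := φ.symm) hφs contMDiffAt_snd
    exact (ContMDiffAt.comp_of_eq (g := h) hhx ha hφx).mul
      (ContMDiffAt.comp (x₀, φ x₀) (g := h) hhx contMDiffAt_fst).inv
  have hsrc := extChartAt_source_mem_nhds (I := I) x₀
  have h2 := contMDiffAt_der_model (I' := 𝓘(ℝ, EG)) (J := I)
    (fun (x : X) (z : E) => h (φ.symm z) * (h x)⁻¹) φ 1 h1 contMDiffAt_extChartAt (by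
      filter_upwards [hsrc] with x hx
      rw [hφ, (extChartAt I x₀).left_inv hx, mul_inv_cancel])
  refine h2.congr_of_eventuallyEq ?_
  filter_upwards [hsrc, hS.mem_nhds hx₀] with x hx hxS
  have hd : MDifferentiableAt I 𝓘(ℝ, EG) h x :=
    (hh.contMDiffAt (hS.mem_nhds hxS)).mdifferentiableAt (by simp)
  rw [coordForm, rlog, der_comp_of_eq (g := fun y => h y * (h x)⁻¹) (MDiffAt.mul_const hd _)
    ((contMDiffAt_extChartAt_symm (φ.map_source hx)).mdifferentiableAt (by simp))
    (φ.left_inv hx)]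

end RlogSmooth

/-! ### Integrals and fibre derivatives depending smoothly on parameters -/

section ParamDeriv

variable {EW : Type*} [NormedAddCommGroup EW] [NormedSpace ℝ EW]
  {HW : Type*} [TopologicalSpace HW] {J : ModelWithCorners ℝ EW HW}
  {W : Type*} [TopologicalSpace W] [ChartedSpace HW W]
  {F F' : Type*} [NormedAddCommGroup F] [NormedSpace ℝ F] [NormedAddCommGroup F'] [NormedSpace ℝ F']

theorem contMDiffAt_fderiv_param [IsManifold J ∞ W] (f : W → F → F') (g : W → F) {w : W}
    (hf : ContMDiffAt (J.prod 𝓘(ℝ, F)) 𝓘(ℝ, F') ∞ (fun z : W × F => f z.1 z.2) (w, g w))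
    (hg : ContMDiffAt J 𝓘(ℝ, F) ∞ g w) :
    ContMDiffAt J 𝓘(ℝ, F →L[ℝ] F') ∞ (fun v => fderiv ℝ (f v) (g v)) w := by
  have : IsManifold J 1 W := IsManifold.of_le (n := ∞) (by simp)
  have h : ContMDiffAt J 𝓘(ℝ, F →L[ℝ] F') ∞ (inTangentCoordinates 𝓘(ℝ, F) 𝓘(ℝ, F') g
      (fun v => f v (g v)) (fun v => der 𝓘(ℝ, F) 𝓘(ℝ, F') (f v) (g v)) w) w :=
    ContMDiffAt.mfderiv (m := ∞) (n := ∞) f g hf hg (by simp)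
  rw [inTangentCoordinates_model_space] at h
  refine h.congr_of_eventuallyEq (Eventually.of_forall fun v => ?_)
  exact mfderiv_eq_fderiv.symm

theorem contMDiffAt_deriv_param [IsManifold J ∞ W] (f : W → ℝ → F') (g : W → ℝ) {w : W}
    (hf : ContMDiffAt (J.prod 𝓘(ℝ, ℝ)) 𝓘(ℝ, F') ∞ (fun z : W × ℝ => f z.1 z.2) (w, g w))
    (hg : ContMDiffAt J 𝓘(ℝ, ℝ) ∞ g w) :
    ContMDiffAt J 𝓘(ℝ, F') ∞ (fun v => deriv (f v) (g v)) w :=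
  (contMDiffAt_fderiv_param f g hf hg).clm_apply contMDiffAt_const

/-- The partial derivative in the first variable of a smooth function is smooth. -/
theorem contMDiffOn_deriv_left [IsManifold J ∞ W] {T : Set ℝ} (hT : IsOpen T) {U : Set W}
    (hU : IsOpen U) {Φ : ℝ → W → F'}
    (hΦ : ContMDiffOn (𝓘(ℝ, ℝ).prod J) 𝓘(ℝ, F') ∞ (fun z : ℝ × W => Φ z.1 z.2) (T ×ˢ U)) :
    ContMDiffOn (𝓘(ℝ, ℝ).prod J) 𝓘(ℝ, F') ∞
      (fun z : ℝ × W => deriv (fun ε => Φ ε z.2) z.1) (T ×ˢ U) := by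
  rintro ⟨t, x⟩ hz
  refine ContMDiffAt.contMDiffWithinAt ?_
  refine contMDiffAt_deriv_param (fun (z : ℝ × W) ε => Φ ε z.2) (fun z => z.1) ?_ contMDiffAt_fst
  have h := hΦ.contMDiffAt ((hT.prod hU).mem_nhds hz)
  exact ContMDiffAt.comp (((t, x), t) : (ℝ × W) × ℝ) (g := fun z : ℝ × W => Φ z.1 z.2)
    (f := fun z : (ℝ × W) × ℝ => (z.2, z.1.2)) h
    (contMDiffAt_snd.prodMk (contMDiffAt_snd.comp _ contMDiffAt_fst))

/-- Differentiation under the integral over a compact set. -/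
theorem hasDerivAt_setIntegral [IsManifold J ∞ W] [MeasurableSpace W] [OpensMeasurableSpace W]
    [T2Space W] {μ : Measure W} [IsFiniteMeasureOnCompacts μ] {T : Set ℝ} (hT : IsOpen T)
    {U : Set W} (hU : IsOpen U) {Φ : ℝ → W → ℝ}
    (hΦ : ContMDiffOn (𝓘(ℝ, ℝ).prod J) 𝓘(ℝ, ℝ) ∞ (fun z : ℝ × W => Φ z.1 z.2) (T ×ˢ U))
    {K : Set W} (hK : IsCompact K) (hKU : K ⊆ U) {t : ℝ} (ht : t ∈ T) :
    HasDerivAt (fun ε => ∫ x in K, Φ ε x ∂μ) (∫ x in K, deriv (fun ε => Φ ε x) t ∂μ) t := by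
  obtain ⟨δ, hδ, hb⟩ := Metric.nhds_basis_closedBall.mem_iff.1 (hT.mem_nhds ht)
  have hcK : IsCompact (Metric.closedBall t δ ×ˢ K) := (isCompact_closedBall t δ).prod hK
  have hsub : Metric.closedBall t δ ×ˢ K ⊆ T ×ˢ U := prod_mono hb hKU
  have hdc := ((contMDiffOn_deriv_left hT hU hΦ).continuousOn).mono hsub
  obtain ⟨C, hC⟩ := hcK.exists_bound_of_continuousOn hdc
  have hslice : ∀ ε ∈ T, ContinuousOn (fun x => Φ ε x) K := fun ε hε =>
    hΦ.continuousOn.comp (f := fun x => (ε, x)) (by fun_prop) (fun x hx => ⟨hε, hKU hx⟩)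
  have hdslice : ContinuousOn (fun x => deriv (fun ε => Φ ε x) t) K :=
    (contMDiffOn_deriv_left hT hU hΦ).continuousOn.comp (f := fun x => (t, x)) (by fun_prop)
      (fun x hx => ⟨ht, hKU hx⟩)
  have hdiff : ∀ x ∈ K, ∀ ε ∈ T, DifferentiableAt ℝ (fun ε => Φ ε x) ε := by
    intro x hx ε hε
    have h := (hΦ.contMDiffAt ((hT.prod hU).mem_nhds (x := (ε, x)) ⟨hε, hKU hx⟩))
    have h2 : ContMDiffAt 𝓘(ℝ, ℝ) 𝓘(ℝ, ℝ) ∞ (fun ε => Φ ε x) ε :=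
      ContMDiffAt.comp ε (g := fun z : ℝ × W => Φ z.1 z.2) (f := fun ε => (ε, x)) h
        (contMDiffAt_id.prodMk contMDiffAt_const)
    exact h2.contDiffAt.differentiableAt (by simp)
  have hms := hK.measurableSet
  refine (hasDerivAt_integral_of_dominated_loc_of_deriv_le (s := Metric.ball t δ)
    (bound := fun _ => C) (F' := fun ε x => deriv (fun ε => Φ ε x) ε)
    (Metric.ball_mem_nhds t hδ) ?_ ?_ ?_ ?_ ?_ ?_).2
  · filter_upwards [hT.mem_nhds ht] with ε hε
    exact (hslice ε hε).aestronglyMeasurable_of_isCompact hK hms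
  · exact (hslice t ht).integrableOn_compact hK
  · exact hdslice.aestronglyMeasurable_of_isCompact hK hms
  · refine (ae_restrict_iff' hms).2 (Eventually.of_forall fun x hx ε hε => ?_)
    exact hC (ε, x) ⟨Metric.ball_subset_closedBall hε, hx⟩
  · exact (continuousOn_const (c := C)).integrableOn_compact hK
  · refine (ae_restrict_iff' hms).2 (Eventually.of_forall fun x hx ε hε => ?_)
    exact (hdiff x hx ε (hb (Metric.ball_subset_closedBall hε))).hasDerivAt

end ParamDeriv

section FibreSmooth

variable {E : Type*} [NormedAddCommGroup E] [NormedSpace ℝ E]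
  {H : Type*} [TopologicalSpace H] {I : ModelWithCorners ℝ E H}
  {X : Type*} [TopologicalSpace X] [ChartedSpace H X] [IsManifold I ∞ X]
  {F : Type*} [NormedAddCommGroup F] [NormedSpace ℝ F]
  {EW : Type*} [NormedAddCommGroup EW] [NormedSpace ℝ EW]
  {HW : Type*} [TopologicalSpace HW] {J : ModelWithCorners ℝ EW HW}
  {W : Type*} [TopologicalSpace W] [ChartedSpace HW W]

variable (I) in
/-- Smoothness of a function of a point `x` of `U` and of a linear map `T_xX → F`, expressed in the
chart at each point. -/
def FibreSmooth (U : Set X) (Λ : X → (E →L[ℝ] F) → ℝ) : Prop :=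
  ∀ x₀ ∈ U, ∀ ν : E →L[ℝ] F, ContMDiffAt (I.prod 𝓘(ℝ, E →L[ℝ] F)) 𝓘(ℝ, ℝ) ∞
    (fun z : X × (E →L[ℝ] F) => Λ z.1 (z.2.comp (der I 𝓘(ℝ, E) (extChartAt I x₀) z.1))) (x₀, ν)

variable [I.Boundaryless] {U : Set X} {Λ : X → (E →L[ℝ] F) → ℝ}

/-- A fibrewise smooth function is smooth along a family of linear maps which is smooth in charts.
-/
theorem FibreSmooth.contMDiffAt (hΛ : FibreSmooth I U Λ) {g : W → X} {A : W → E →L[ℝ] F} {q : W}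
    (hq : g q ∈ U) (hg : ContMDiffAt J I ∞ g q)
    (hA : ContMDiffAt J 𝓘(ℝ, E →L[ℝ] F) ∞ (fun r => (A r).comp
      (der 𝓘(ℝ, E) I (extChartAt I (g q)).symm (extChartAt I (g q) (g r)))) q) :
    ContMDiffAt J 𝓘(ℝ, ℝ) ∞ (fun r => Λ (g r) (A r)) q := by
  have h := ContMDiffAt.comp q (g := fun z : X × (E →L[ℝ] F) =>
    Λ z.1 (z.2.comp (der I 𝓘(ℝ, E) (extChartAt I (g q)) z.1))) (hΛ (g q) hq _) (hg.prodMk hA)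
  refine h.congr_of_eventuallyEq ?_
  filter_upwards [hg.continuousAt.preimage_mem_nhds (extChartAt_source_mem_nhds (I := I) (g q))]
    with r hr
  have := coordForm_comp_der (I := I) hr (fun _ => A r)
  rw [coordForm] at this
  simp only [Function.comp]
  rw [this]

theorem FibreSmooth.contDiff (hΛ : FibreSmooth I U Λ) {x : X} (hx : x ∈ U) :
    ContDiff ℝ ∞ (Λ x) := by
  rw [← contMDiff_iff_contDiff]
  intro ν
  refine hΛ.contMDiffAt (J := 𝓘(ℝ, E →L[ℝ] F)) (g := fun _ => x) (A := fun r => r) hx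
    contMDiffAt_const ?_
  exact ((ContinuousLinearMap.compL ℝ E E F).flip _).contDiff.contMDiff.contMDiffAt

variable [FiniteDimensional ℝ E]

/-- Smoothness along an affine line of smooth forms, jointly in the point and in the line parameter.
-/
theorem FibreSmooth.contMDiffOn_add_smul (hU : IsOpen U) (hΛ : FibreSmooth I U Λ)
    {A C : X → E →L[ℝ] F} (hA : SmoothFormOn I U A) (hC : SmoothFormOn I U C) :
    ContMDiffOn (𝓘(ℝ, ℝ).prod I) 𝓘(ℝ, ℝ) ∞
      (fun z : ℝ × X => Λ z.2 (A z.2 + z.1 • C z.2)) (univ ×ˢ U) := by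
  rintro ⟨ε, x⟩ ⟨-, hx⟩
  refine ContMDiffAt.contMDiffWithinAt ?_
  refine hΛ.contMDiffAt (g := fun z : ℝ × X => z.2) (A := fun z => A z.2 + z.1 • C z.2) hx
    contMDiffAt_snd ?_
  have hA' : ContMDiffAt (𝓘(ℝ, ℝ).prod I) 𝓘(ℝ, E →L[ℝ] F) ∞
      (fun z : ℝ × X => coordForm I x A z.2) (ε, x) :=
    ContMDiffAt.comp (ε, x) (g := coordForm I x A) (hA.contMDiffAt_coordForm hU hx) contMDiffAt_snd
  have hC' : ContMDiffAt (𝓘(ℝ, ℝ).prod I) 𝓘(ℝ, E →L[ℝ] F) ∞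
      (fun z : ℝ × X => coordForm I x C z.2) (ε, x) :=
    ContMDiffAt.comp (ε, x) (g := coordForm I x C) (hC.contMDiffAt_coordForm hU hx) contMDiffAt_snd
  refine (hA'.add (contMDiffAt_fst.smul hC')).congr_of_eventuallyEq (Eventually.of_forall fun z => ?_)
  simp only [coordForm]
  rw [ContinuousLinearMap.add_comp, ContinuousLinearMap.smul_comp]
  rfl

theorem FibreSmooth.hasDerivAt (hΛ : FibreSmooth I U Λ) {x : X} (hx : x ∈ U) {c : ℝ → E →L[ℝ] F}
    {ν' : E →L[ℝ] F} {t : ℝ} (hc : HasDerivAt c ν' t) :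
    HasDerivAt (fun ε => Λ x (c ε)) (fderiv ℝ (Λ x) (c t) ν') t :=
  ((hΛ.contDiff hx).differentiable (by simp) (c t)).hasFDerivAt.comp_hasDerivAt t hc

theorem FibreSmooth.hasDerivAt_add_smul (hΛ : FibreSmooth I U Λ) {x : X} (hx : x ∈ U)
    (ν α : E →L[ℝ] F) :
    HasDerivAt (fun ε : ℝ => Λ x (ν + ε • α)) (fderiv ℝ (Λ x) ν α) 0 := by
  have hc : HasDerivAt (fun ε : ℝ => ν + ε • α) α 0 := by
    simpa using ((hasDerivAt_id (0 : ℝ)).smul_const α).const_add ν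
  simpa using hΛ.hasDerivAt hx hc

/-- The fibre derivative of `Λ` along a smooth form, evaluated at another one, is smooth. -/
theorem FibreSmooth.contMDiffOn_fderiv (hU : IsOpen U) (hΛ : FibreSmooth I U Λ)
    {A C : X → E →L[ℝ] F} (hA : SmoothFormOn I U A) (hC : SmoothFormOn I U C) :
    ContMDiffOn I 𝓘(ℝ, ℝ) ∞ (fun x => fderiv ℝ (Λ x) (A x) (C x)) U := by
  have h := contMDiffOn_deriv_left isOpen_univ hU
    (Φ := fun ε x => Λ x (A x + ε • C x)) (hΛ.contMDiffOn_add_smul hU hA hC)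
  have h0 : ContMDiffOn I 𝓘(ℝ, ℝ) ∞ (fun x => deriv (fun ε : ℝ => Λ x (A x + ε • C x)) 0) U :=
    ContMDiffOn.comp h (f := fun x => ((0 : ℝ), x))
      (contMDiffOn_const.prodMk contMDiffOn_id) (fun x hx => ⟨mem_univ _, hx⟩)
  exact h0.congr fun x hx => (hΛ.hasDerivAt_add_smul hx (A x) (C x)).deriv.symm

end FibreSmooth

/-! ### Trivialized bundles -/

section Trivialized

variable
  {EX : Type*} [NormedAddCommGroup EX] [NormedSpace ℝ EX]
  {HX : Type*} [TopologicalSpace HX] {IX : ModelWithCorners ℝ EX HX}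
  {X : Type*} [TopologicalSpace X] [ChartedSpace HX X] [IsManifold IX ∞ X]
  {EP : Type*} [NormedAddCommGroup EP] [NormedSpace ℝ EP]
  {HP : Type*} [TopologicalSpace HP] {IP : ModelWithCorners ℝ EP HP}
  {P : Type*} [TopologicalSpace P] [ChartedSpace HP P] [IsManifold IP ∞ P]
  {EG : Type*} [NormedAddCommGroup EG] [NormedSpace ℝ EG]
  {G : Type*} [TopologicalSpace G] [ChartedSpace EG G] [Group G]
  {B : BundleMaps X P G} {U : Set X} {ξ : P → G} {e : X → P}

variable (EG IX IP B U ξ e) in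
/-- The smooth equivariant map `ξ` trivializes the bundle over the open set `U`, and `e` is the
section over `U` on which it takes the value `1`. -/
structure IsTrivialized : Prop where
  isOpen : IsOpen U
  smooth_proj : ContMDiff IP IX ∞ B.proj
  smooth_act : ContMDiff (IP.prod 𝓘(ℝ, EG)) IP ∞ (fun z : P × G => B.act z.1 z.2)
  act_one : ∀ p, B.act p 1 = p
  act_mul : ∀ p g h, B.act (B.act p g) h = B.act p (g * h)
  proj_act : ∀ p g, B.proj (B.act p g) = B.proj p
  smooth_triv : ContMDiffOn IP 𝓘(ℝ, EG) ∞ ξ (B.part U)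
  triv_act : ∀ p ∈ B.part U, ∀ g, ξ (B.act p g) = ξ p * g
  smooth_sec : ContMDiffOn IX IP ∞ e U
  proj_sec : ∀ x ∈ U, B.proj (e x) = x
  triv_sec : ∀ x ∈ U, ξ (e x) = 1
  act_sec : ∀ p ∈ B.part U, B.act (e (B.proj p)) (ξ p) = p

variable (EG IP B) in
/-- The infinitesimal generators at `p`, as a map between the model spaces. -/
def gen (p : P) : EG →L[ℝ] EP := der 𝓘(ℝ, EG) IP (B.act p) 1

variable [LieGroup 𝓘(ℝ, EG) ∞ G]

namespace IsTrivialized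

variable (hT : IsTrivialized IX IP EG B U ξ e)

include hT

theorem isOpen_part : IsOpen (B.part U) := hT.isOpen.preimage hT.smooth_proj.continuous

theorem sec_mem {x : X} (hx : x ∈ U) : e x ∈ B.part U := by
  change B.proj (e x) ∈ U
  rwa [hT.proj_sec x hx]

theorem act_mem {p : P} (hp : p ∈ B.part U) (g : G) : B.act p g ∈ B.part U := by
  change B.proj (B.act p g) ∈ U
  rwa [hT.proj_act]

theorem eq_of_proj_of_triv {p q : P} (hp : p ∈ B.part U) (hq : q ∈ B.part U)
    (h1 : B.proj p = B.proj q) (h2 : ξ p = ξ q) : p = q := by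
  rw [← hT.act_sec p hp, ← hT.act_sec q hq, h1, h2]

theorem mdiff_proj (p : P) : MDifferentiableAt IP IX B.proj p :=
  hT.smooth_proj.mdifferentiableAt (by simp)

theorem mdiff_triv {p : P} (hp : p ∈ B.part U) : MDifferentiableAt IP 𝓘(ℝ, EG) ξ p :=
  (hT.smooth_triv.contMDiffAt (hT.isOpen_part.mem_nhds hp)).mdifferentiableAt (by simp)

theorem mdiff_sec {x : X} (hx : x ∈ U) : MDifferentiableAt IX IP e x :=
  (hT.smooth_sec.contMDiffAt (hT.isOpen.mem_nhds hx)).mdifferentiableAt (by simp)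

theorem mdiff_act (z : P × G) :
    MDifferentiableAt (IP.prod 𝓘(ℝ, EG)) IP (fun z : P × G => B.act z.1 z.2) z :=
  hT.smooth_act.mdifferentiableAt (by simp)

theorem contMDiff_act_right (g : G) : ContMDiff IP IP ∞ (fun p => B.act p g) :=
  hT.smooth_act.comp (f := fun p => (p, g)) (contMDiff_id.prodMk contMDiff_const)

theorem contMDiff_act_left (p : P) : ContMDiff 𝓘(ℝ, EG) IP ∞ (B.act p) :=
  hT.smooth_act.comp (f := fun g => (p, g)) (contMDiff_const.prodMk contMDiff_id)

theorem der_proj_gen (p : P) : (der IP IX B.proj p).comp (gen IP EG B p) = 0 := by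
  rw [gen, ← der_comp_of_eq (hT.mdiff_proj p)
    ((hT.contMDiff_act_left p).mdifferentiableAt (by simp)) (hT.act_one p)]
  simp only [hT.proj_act]
  exact der_const _ _

/-- The generator of `η` at `p` has logarithmic derivative `Ad (ξ p) η`. -/
theorem rlog_gen {p : P} (hp : p ∈ B.part U) :
    (rlog IP EG ξ p).comp (gen IP EG B p) = Ad G (ξ p) := by
  have hd : MDifferentiableAt IP 𝓘(ℝ, EG) ξ (B.act p 1) := by
    rw [hT.act_one]; exact hT.mdiff_triv hp
  have h := rlog_comp (I := 𝓘(ℝ, EG)) hd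
    ((hT.contMDiff_act_left p).mdifferentiableAt (x := 1) (by simp))
  rw [hT.act_one] at h
  rw [gen, ← h]
  simp only [hT.triv_act p hp]
  rw [rlog_mul (h := fun _ => ξ p) (k := fun y => y) mdifferentiableAt_const
    mdifferentiableAt_id, rlog_const, zero_add,
    rlog_of_eq_one (k := fun y : G => y) (x := 1) rfl, der_id, ContinuousLinearMap.comp_id]

theorem der_proj_act (p : P) (g : G) :
    (der IP IX B.proj (B.act p g)).comp (der IP IP (fun q => B.act q g) p) = der IP IX B.proj p := by
  rw [← der_comp (hT.mdiff_proj _) ((hT.contMDiff_act_right g).mdifferentiableAt (by simp))]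
  simp only [hT.proj_act]

theorem rlog_act {p : P} (hp : p ∈ B.part U) (g : G) :
    (rlog IP EG ξ (B.act p g)).comp (der IP IP (fun q => B.act q g) p) = rlog IP EG ξ p := by
  rw [← rlog_comp (f := fun q => B.act q g) (hT.mdiff_triv (hT.act_mem hp g))
    ((hT.contMDiff_act_right g).mdifferentiableAt (by simp)),
    ← rlog_mul_const (hT.mdiff_triv hp) g]
  refine rlog_congr ?_
  filter_upwards [hT.isOpen_part.mem_nhds hp] with q hq
  exact hT.triv_act q hq g

/-- A tangent vector is determined by its projection to the base and its image under the
logarithmic derivative of the trivialization. -/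
theorem ext_vector {p : P} (hp : p ∈ B.part U) {v : EP} (h1 : der IP IX B.proj p v = 0)
    (h2 : rlog IP EG ξ p v = 0) : v = 0 := by
  -- `F` is a left inverse of `f` near `p`, so the derivative of `f` is injective.
  let F : X × G → P := fun z => B.act (e z.1) (z.2 * ξ p)
  let f : P → X × G := fun q => (B.proj q, ξ q * (ξ p)⁻¹)
  have hx : B.proj p ∈ U := hp
  have hf : MDifferentiableAt IP (IX.prod 𝓘(ℝ, EG)) f p :=
    (hT.mdiff_proj p).prodMk (MDiffAt.mul_const (hT.mdiff_triv hp) _)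
  have hF : MDifferentiableAt (IX.prod 𝓘(ℝ, EG)) IP F (f p) := by
    have ha : MDifferentiableAt (IX.prod 𝓘(ℝ, EG)) IP (fun z : X × G => e z.1) (f p) :=
      MDifferentiableAt.comp (f p) (g := e) (hT.mdiff_sec hx) mdifferentiableAt_fst
    exact MDifferentiableAt.comp (f p) (g := fun z : P × G => B.act z.1 z.2) (hT.mdiff_act _)
      (ha.prodMk (MDiffAt.mul_const mdifferentiableAt_snd _))
  have h := der_comp hF hf
  have e1 : der IP IP (fun q => F (f q)) p = ContinuousLinearMap.id ℝ EP := by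
    rw [← der_id (I := IP) p]
    refine der_congr ?_
    filter_upwards [hT.isOpen_part.mem_nhds hp] with q hq
    simp only [F, f, inv_mul_cancel_right]
    exact hT.act_sec q hq
  have e2 : der IP (IX.prod 𝓘(ℝ, EG)) f p =
      (der IP IX B.proj p).prod (rlog IP EG ξ p) :=
    der_prodMk (hT.mdiff_proj p) (MDiffAt.mul_const (hT.mdiff_triv hp) _)
  have h3 := congrArg (fun T : EP →L[ℝ] EP => T v) h
  simp only [e1, e2, ContinuousLinearMap.comp_apply, ContinuousLinearMap.prod_apply, h1, h2] at h3
  rw [Prod.mk_zero_zero, map_zero] at h3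
  exact h3

theorem ext_map {p : P} (hp : p ∈ B.part U) {W : Type*} [NormedAddCommGroup W] [NormedSpace ℝ W]
    {S T : W →L[ℝ] EP} (h1 : (der IP IX B.proj p).comp S = (der IP IX B.proj p).comp T)
    (h2 : (rlog IP EG ξ p).comp S = (rlog IP EG ξ p).comp T) : S = T := by
  ext w
  rw [← sub_eq_zero]
  refine hT.ext_vector hp ?_ ?_
  · rw [map_sub, sub_eq_zero]
    exact congrArg (fun R : W →L[ℝ] EX => R w) h1
  · rw [map_sub, sub_eq_zero]
    exact congrArg (fun R : W →L[ℝ] EG => R w) h2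

theorem der_proj_sec {x : X} (hx : x ∈ U) :
    (der IP IX B.proj (e x)).comp (der IX IP e x) = ContinuousLinearMap.id ℝ EX := by
  rw [← der_comp (hT.mdiff_proj _) (hT.mdiff_sec hx), ← der_id (I := IX) x]
  refine der_congr ?_
  filter_upwards [hT.isOpen.mem_nhds hx] with y hy
  exact hT.proj_sec y hy

theorem rlog_sec {x : X} (hx : x ∈ U) :
    (rlog IP EG ξ (e x)).comp (der IX IP e x) = 0 := by
  rw [← rlog_comp (hT.mdiff_triv (hT.sec_mem hx)) (hT.mdiff_sec hx), ← rlog_const (I := IX) (EG := EG) (1 : G) x]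
  refine rlog_congr ?_
  filter_upwards [hT.isOpen.mem_nhds hx] with y hy
  exact hT.triv_sec y hy

/-- A lift of `T_xX` to `T_pP` with prescribed logarithmic derivative exists. -/
theorem exists_lift {p : P} (hp : p ∈ B.part U) (ν : EX →L[ℝ] EG) :
    ∃ γ : EX →L[ℝ] EP, (der IP IX B.proj p).comp γ = ContinuousLinearMap.id ℝ EX ∧
      (rlog IP EG ξ p).comp γ = ν := by
  have hx : B.proj p ∈ U := hp
  let Φ := der IP IP (fun q => B.act q (ξ p)) (e (B.proj p))
  have h1 := hT.der_proj_act (e (B.proj p)) (ξ p)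
  have h2 := hT.rlog_act (hT.sec_mem hx) (ξ p)
  rw [hT.act_sec p hp] at h1 h2
  refine ⟨Φ.comp (der IX IP e (B.proj p) + (gen IP EG B (e (B.proj p))).comp ν), ?_, ?_⟩
  · rw [← ContinuousLinearMap.comp_assoc, h1, ContinuousLinearMap.comp_add, hT.der_proj_sec hx,
      ← ContinuousLinearMap.comp_assoc, hT.der_proj_gen, ContinuousLinearMap.zero_comp, add_zero]
  · rw [← ContinuousLinearMap.comp_assoc, h2, ContinuousLinearMap.comp_add, hT.rlog_sec hx,
      ← ContinuousLinearMap.comp_assoc, hT.rlog_gen (hT.sec_mem hx), hT.triv_sec _ hx, Ad_one,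
      zero_add, ContinuousLinearMap.id_comp]

omit [LieGroup 𝓘(ℝ, EG) ∞ G] in
theorem descend_eq {F : Type*} [Zero F] {f : P → F} {x : X} {c : F} (hx : x ∈ U)
    (h : ∀ p, B.proj p = x → f p = c) : B.descend f x = c := by
  have hex : ∃ p, B.proj p = x := ⟨e x, hT.proj_sec x hx⟩
  rw [BundleMaps.descend, dif_pos hex]
  exact h _ hex.choose_spec

omit [LieGroup 𝓘(ℝ, EG) ∞ G] in
/-- The element of the group which carries `q` to `p` is `(ξ q)⁻¹ ξ p`. -/
theorem transl_eq {p q : P} (hp : p ∈ B.part U) (hq : q ∈ B.part U) (h : B.proj p = B.proj q) :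
    B.act q (B.transl q p) = p ∧ ξ p = ξ q * B.transl q p := by
  have hex : ∃ g, B.act q g = p := by
    refine ⟨(ξ q)⁻¹ * ξ p, ?_⟩
    have := hT.act_sec q hq
    rw [← this, hT.act_mul, this, mul_inv_cancel_left, ← h, hT.act_sec p hp]
  have h1 : B.act q (B.transl q p) = p := by
    rw [BundleMaps.transl, dif_pos hex]; exact hex.choose_spec
  refine ⟨h1, ?_⟩
  conv_lhs => rw [← h1]
  exact hT.triv_act q hq _

end IsTrivialized

/-! ### Jets in a trivialization -/

omit [LieGroup 𝓘(ℝ, EG) ∞ G] in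
theorem redEval_reduce (L : Jet IX IP B → ℝ) (hL : Invariant IX IP B L) (p : P)
    (γ : TangentSpace IX (B.proj p) →L[ℝ] TangentSpace IP p) :
    redEval (reduce IX IP B L hL) p γ = jetEval L p γ := by
  unfold redEval jetEval
  split_ifs <;> rfl

omit [LieGroup 𝓘(ℝ, EG) ∞ G] in
theorem jetEval_of_proj {L : Jet IX IP B → ℝ} {p : P} {γ : EX →L[ℝ] EP}
    (h : (der IP IX B.proj p).comp γ = ContinuousLinearMap.id ℝ EX) :
    jetEval L p γ = L ⟨p, γ, h⟩ := dif_pos h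

variable (EG IX IP B e) in
/-- A Lagrangian on jets, in the trivialization with unit section `e`, as a function of the base
point and of the logarithmic derivative `ν` of the fibre coordinate: its value at the jet at `e x`
which differs from the jet of `e` by the generator of `ν`. -/
def trivLag (L : Jet IX IP B → ℝ) (x : X) (ν : EX →L[ℝ] EG) : ℝ :=
  let γ : EX →L[ℝ] EP := der IX IP e x + (gen IP EG B (e x)).comp ν
  jetEval L (e x) γ

namespace IsTrivialized

variable (hT : IsTrivialized IX IP EG B U ξ e)

include hT

/-- By invariance, the Lagrangian depends on a jet only through its base point and its logarithmic
derivative. -/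
theorem jetEval_eq {L : Jet IX IP B → ℝ} (hL : Invariant IX IP B L) {p : P} (hp : p ∈ B.part U)
    {γ : EX →L[ℝ] EP} (hγ : (der IP IX B.proj p).comp γ = ContinuousLinearMap.id ℝ EX)
    {ν : EX →L[ℝ] EG} (hν : (rlog IP EG ξ p).comp γ = ν) :
    jetEval L p γ = trivLag IX IP EG B e L (B.proj p) ν := by
  have hx : B.proj p ∈ U := hp
  set x := B.proj p with hxd
  let γ' : EX →L[ℝ] EP := der IX IP e x + (gen IP EG B (e x)).comp ν
  have h1 : (der IP IX B.proj (e x)).comp γ' = ContinuousLinearMap.id ℝ EX := by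
    rw [ContinuousLinearMap.comp_add, hT.der_proj_sec hx, ← ContinuousLinearMap.comp_assoc,
      hT.der_proj_gen, ContinuousLinearMap.zero_comp, add_zero]
  have h2 : (rlog IP EG ξ (e x)).comp γ' = ν := by
    rw [ContinuousLinearMap.comp_add, hT.rlog_sec hx, ← ContinuousLinearMap.comp_assoc,
      hT.rlog_gen (hT.sec_mem hx), hT.triv_sec _ hx, Ad_one, zero_add, ContinuousLinearMap.id_comp]
  refine (jetEval_of_proj hγ).trans (Eq.trans ?_ (jetEval_of_proj (γ := γ') h1).symm)
  refine (hL _ _ ⟨ξ p, (hT.act_sec p hp).symm, fun u => ?_⟩).symm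
  -- The translate by `ξ p` of the jet at `e x` has the same projection and the same logarithmic
  -- derivative as `γ`.
  have key : γ = (der IP IP (fun q => B.act q (ξ p)) (e x)).comp γ' := by
    have h3 := hT.der_proj_act (e x) (ξ p)
    have h4 := hT.rlog_act (hT.sec_mem hx) (ξ p)
    rw [hxd, hT.act_sec p hp] at h3 h4
    refine hT.ext_map hp ?_ ?_
    · rw [← ContinuousLinearMap.comp_assoc, h3, hγ]; exact h1.symm
    · rw [← ContinuousLinearMap.comp_assoc, h4, hν]; exact h2.symm
  exact congrArg (fun T : EX →L[ℝ] EP => T u) key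

theorem der_proj_section {S : X → P} {x : X}
    (hS : MDifferentiableAt IX IP S x) (hp : ∀ᶠ y in 𝓝 x, B.proj (S y) = y) :
    (der IP IX B.proj (S x)).comp (der IX IP S x) = ContinuousLinearMap.id ℝ EX := by
  rw [← der_comp (hT.mdiff_proj _) hS, ← der_id (I := IX) x]
  exact der_congr hp

/-- The Lagrangian along a section `S` is a function of the logarithmic derivative of `ξ ∘ S`. -/
theorem jetEval_section {L : Jet IX IP B → ℝ} (hL : Invariant IX IP B L) {S : X → P} {x : X}
    (hx : x ∈ U) (hS : MDifferentiableAt IX IP S x) (hp : ∀ᶠ y in 𝓝 x, B.proj (S y) = y) :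
    jetEval L (S x) (jetExt IX IP S x) =
      trivLag IX IP EG B e L x (rlog IX EG (fun y => ξ (S y)) x) := by
  have hpx := hp.self_of_nhds
  have hSx : S x ∈ B.part U := by change B.proj (S x) ∈ U; rwa [hpx]
  have h := hT.jetEval_eq hL hSx (hT.der_proj_section hS hp)
    (rlog_comp (hT.mdiff_triv hSx) hS).symm
  rw [hpx] at h
  exact h

end IsTrivialized

end Trivialized

/-! ### Smooth families of jets -/

section JetFamilies

variable
  {EX : Type*} [NormedAddCommGroup EX] [NormedSpace ℝ EX]
  {HX : Type*} [TopologicalSpace HX] {IX : ModelWithCorners ℝ EX HX}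
  {X : Type*} [TopologicalSpace X] [ChartedSpace HX X] [IsManifold IX ∞ X]
  {EP : Type*} [NormedAddCommGroup EP] [NormedSpace ℝ EP]
  {HP : Type*} [TopologicalSpace HP] {IP : ModelWithCorners ℝ EP HP}
  {P : Type*} [TopologicalSpace P] [ChartedSpace HP P] [IsManifold IP ∞ P]
  {EG : Type*} [NormedAddCommGroup EG] [NormedSpace ℝ EG]
  {G : Type*} [TopologicalSpace G] [ChartedSpace EG G] [Group G]
  {B : BundleMaps X P G} {U : Set X} {ξ : P → G} {e : X → P}
  {EN : Type*} [NormedAddCommGroup EN] [NormedSpace ℝ EN]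
  {HN : Type*} [TopologicalSpace HN] {IN : ModelWithCorners ℝ EN HN}
  {N : Type*} [TopologicalSpace N] [ChartedSpace HN N] [IsManifold IN ∞ N]

variable (IX IP) in
/-- A linear map `T_xX → T_pP` in the coordinates of the charts at `x₀` and `p₀`. -/
def jetCoord (x₀ x : X) (p₀ p : P) (γ : EX →L[ℝ] EP) : EX →L[ℝ] EP :=
  ContinuousLinearMap.inCoordinates EX (TangentSpace IX) EP (TangentSpace IP) x₀ x p₀ p γ

/-- The jet at `p` given by a linear map between the model spaces. -/
def mkJet (p : P) (γ : EX →L[ℝ] EP)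
    (h : (der IP IX B.proj p).comp γ = ContinuousLinearMap.id ℝ EX) : Jet IX IP B := ⟨p, γ, h⟩

theorem eventually_mdiff_slice {S : N → X → P} {q : N × X}
    (hS : ContMDiffAt (IN.prod IX) IP ∞ (fun z : N × X => S z.1 z.2) q) :
    ∀ᶠ z in 𝓝 q, MDifferentiableAt IX IP (S z.1) z.2 := by
  have : IsManifold IX 1 X := IsManifold.of_le (n := ∞) (by simp)
  have : IsManifold IP 1 P := IsManifold.of_le (n := ∞) (by simp)
  have : IsManifold IN 1 N := IsManifold.of_le (n := ∞) (by simp)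
  have h1 : ContMDiffAt (IN.prod IX) IP 1 (fun z : N × X => S z.1 z.2) q := hS.of_le (by simp)
  filter_upwards [contMDiffAt_iff_contMDiffAt_nhds (n := 1) (by simp)|>.1 h1] with z hz
  exact (ContMDiffAt.comp z.2 (g := fun z : N × X => S z.1 z.2) (f := fun x => (z.1, x)) hz
    (contMDiffAt_const.prodMk contMDiffAt_id)).mdifferentiableAt (by simp)

/-- A Lagrangian which is smooth on jets is smooth along smooth families of jets of sections
parametrized by a manifold. -/
theorem contMDiffAt_jetEval [FiniteDimensional ℝ EN] [IN.Boundaryless] {L : Jet IX IP B → ℝ}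
    (hL : SmoothOnJets IX IP B L) (hproj : ContMDiff IP IX ∞ B.proj)
    {S : N → X → P} {g : N → X} {q : N}
    (hS : ContMDiffAt (IN.prod IX) IP ∞ (fun z : N × X => S z.1 z.2) (q, g q))
    (hg : ContMDiffAt IN IX ∞ g q) (hsec : ∀ᶠ z in 𝓝 (q, g q), B.proj (S z.1 z.2) = z.2) :
    ContMDiffAt IN 𝓘(ℝ, ℝ) ∞
      (fun r => jetEval L (S r (g r)) (jetExt IX IP (S r) (g r))) q := by
  have : IsManifold IX 1 X := IsManifold.of_le (n := ∞) (by simp)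
  have : IsManifold IP 1 P := IsManifold.of_le (n := ∞) (by simp)
  have : IsManifold IN 1 N := IsManifold.of_le (n := ∞) (by simp)
  have hgr : Tendsto (fun r => (r, g r)) (𝓝 q) (𝓝 (q, g q)) :=
    (continuousAt_id.prodMk hg.continuousAt)
  -- the maps `T S_r` at `g r` are jets for `r` near `q`
  have hjet : ∀ᶠ r in 𝓝 q, (der IP IX B.proj (S r (g r))).comp (der IX IP (S r) (g r)) =
      ContinuousLinearMap.id ℝ EX ∧ B.proj (S r (g r)) = g r := by
    filter_upwards [hgr.eventually hsec.eventually_nhds, hgr.eventually (eventually_mdiff_slice hS)]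
      with r h1 h2
    refine ⟨?_, h1.self_of_nhds⟩
    rw [← der_comp (hproj.mdifferentiableAt (by simp)) h2, ← der_id (I := IX) (g r)]
    exact der_congr ((Continuous.prodMk_right r).continuousAt.eventually h1)
  -- `SmoothOnJets` speaks of families of jets over Euclidean spaces, so the parameter is read in
  -- the chart `φ` at `q`.
  let T := toEuclidean (E := EN)
  set φ := extChartAt IN q with hφ
  let ψ : EuclideanSpace ℝ (Fin (Module.finrank ℝ EN)) → N := fun y => φ.symm (T.symm y)
  set z := T (φ q) with hz
  have hψz : ψ z = q := by
    simp only [ψ, hz, ContinuousLinearEquiv.symm_apply_apply]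
    exact φ.left_inv (mem_extChartAt_source q)
  have hψ : ContMDiffAt (𝓡 (Module.finrank ℝ EN)) IN ∞ ψ z := by
    refine ContMDiffAt.comp z (g := φ.symm) (f := T.symm) ?_
      T.symm.contDiff.contMDiff.contMDiffAt
    rw [hz, ContinuousLinearEquiv.symm_apply_apply]
    exact contMDiffAt_extChartAt_symm (mem_extChartAt_target q)
  classical
  -- Away from `q` the tangent map need not be a jet; there the family takes the filler value `c₀`.
  let c₀ : Jet IX IP B := mkJet _ _ hjet.self_of_nhds.1
  let c : EuclideanSpace ℝ (Fin (Module.finrank ℝ EN)) → Jet IX IP B := fun y =>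
    if h : (der IP IX B.proj (S (ψ y) (g (ψ y)))).comp (der IX IP (S (ψ y)) (g (ψ y))) =
        ContinuousLinearMap.id ℝ EX
    then mkJet _ _ h else c₀
  have hψc : Tendsto ψ (𝓝 z) (𝓝 q) := by
    have := hψ.continuousAt.tendsto; rwa [hψz] at this
  have hc : ∀ᶠ y in 𝓝 z, (c y).pt = S (ψ y) (g (ψ y)) ∧
      ((c y).lin : EX →L[ℝ] EP) = der IX IP (S (ψ y)) (g (ψ y)) ∧
      B.proj (c y).pt = g (ψ y) ∧
      L (c y) = jetEval L (S (ψ y) (g (ψ y))) (jetExt IX IP (S (ψ y)) (g (ψ y))) := by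
    filter_upwards [hψc.eventually hjet] with y hy
    have hcy : c y = mkJet _ _ hy.1 := dif_pos hy.1
    rw [hcy]
    exact ⟨rfl, rfl, hy.2, (jetEval_of_proj hy.1).symm⟩
  have hgψ : ContMDiffAt (𝓡 (Module.finrank ℝ EN)) IX ∞ (fun y => g (ψ y)) z :=
    ContMDiffAt.comp_of_eq (g := g) hg hψ hψz
  have hSψ : ContMDiffAt ((𝓡 (Module.finrank ℝ EN)).prod IX) IP ∞
      (fun w : EuclideanSpace ℝ (Fin (Module.finrank ℝ EN)) × X => S (ψ w.1) w.2)
      (z, g (ψ z)) := by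
    refine ContMDiffAt.comp_of_eq (g := fun z : N × X => S z.1 z.2) hS
      ((ContMDiffAt.comp (z, g (ψ z)) (g := ψ) hψ contMDiffAt_fst).prodMk contMDiffAt_snd) ?_
    simp only [hψz, Function.comp]
  have hmain := ContMDiffAt.mfderiv (m := ∞) (n := ∞) (fun y => S (ψ y)) (fun y => g (ψ y))
    hSψ hgψ (by simp)
  have key : ContMDiffAt (𝓡 (Module.finrank ℝ EN)) 𝓘(ℝ, ℝ) ∞ (fun y => L (c y)) z := by
    refine hL _ c z ?_ ?_
    · have h1 : ContMDiffAt (𝓡 (Module.finrank ℝ EN)) IP ∞ (fun y => S (ψ y) (g (ψ y))) z :=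
        ContMDiffAt.comp z (g := fun w : EuclideanSpace ℝ (Fin (Module.finrank ℝ EN)) × X =>
          S (ψ w.1) w.2) hSψ (contMDiffAt_id.prodMk hgψ)
      refine h1.congr_of_eventuallyEq ?_
      filter_upwards [hc] with y hy using hy.1
    · refine hmain.congr_of_eventuallyEq ?_
      have hz0 := hc.self_of_nhds
      filter_upwards [hc] with y hy
      change jetCoord IX IP (B.proj (c z).pt) (B.proj (c y).pt) (c z).pt (c y).pt (c y).lin =
        jetCoord IX IP (g (ψ z)) (g (ψ y)) (S (ψ z) (g (ψ z))) (S (ψ y) (g (ψ y)))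
          (der IX IP (S (ψ y)) (g (ψ y)))
      rw [hz0.2.2.1, hz0.1]
      have e1 := hy.2.2.1
      have e2 := hy.1
      have e3 := hy.2.1
      generalize B.proj (c y).pt = a1 at e1 ⊢
      generalize ((c y).lin : EX →L[ℝ] EP) = a3 at e3 ⊢
      generalize (c y).pt = a2 at e2 ⊢
      rw [e1, e2, e3]
  have hcomp : ContMDiffAt IN 𝓘(ℝ, ℝ) ∞ (fun r => L (c (T (φ r)))) q :=
    ContMDiffAt.comp q (g := fun y => L (c y)) (f := fun r => T (φ r)) key
      (ContMDiffAt.comp q (g := T) T.contDiff.contMDiff.contMDiffAt contMDiffAt_extChartAt)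
  refine hcomp.congr_of_eventuallyEq ?_
  have hTφ : Tendsto (fun r => T (φ r)) (𝓝 q) (𝓝 z) :=
    (T.continuous.continuousAt.comp (continuousAt_extChartAt q)).tendsto
  filter_upwards [hTφ.eventually hc, extChartAt_source_mem_nhds (I := IN) q] with r hr hrs
  have hψr : ψ (T (φ r)) = r := by
    simp only [ψ, ContinuousLinearEquiv.symm_apply_apply]
    exact φ.left_inv hrs
  rw [hr.2.2.2, hψr]

variable [LieGroup 𝓘(ℝ, EG) ∞ G]

/-- In a trivialization, a smooth invariant Lagrangian is a smooth function of the base point and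
of the logarithmic derivative. -/
theorem IsTrivialized.fibreSmooth_trivLag [FiniteDimensional ℝ EX] [FiniteDimensional ℝ EG]
    [IX.Boundaryless] (hT : IsTrivialized IX IP EG B U ξ e) {L : Jet IX IP B → ℝ}
    (hL : SmoothOnJets IX IP B L) (hinv : Invariant IX IP B L) :
    FibreSmooth IX U (trivLag IX IP EG B e L) := by
  intro x₀ hx₀ ν₀
  obtain ⟨c, hc, hc1, hcd⟩ := exists_localExp (EG := EG) (G := G)
  set φ := extChartAt IX x₀ with hφ
  -- the section through `e x` whose logarithmic derivative at `x` is `ν ∘ Tφ`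
  let k : X × (EX →L[ℝ] EG) → X → G := fun r y => c (r.2 (φ y - φ r.1))
  let S : X × (EX →L[ℝ] EG) → X → P := fun r y => B.act (e y) (k r y)
  have hφs : ContMDiffAt IX 𝓘(ℝ, EX) ∞ φ x₀ := contMDiffAt_extChartAt
  have hk : ContMDiffAt ((IX.prod 𝓘(ℝ, EX →L[ℝ] EG)).prod IX) 𝓘(ℝ, EG) ∞
      (fun w : (X × (EX →L[ℝ] EG)) × X => k w.1 w.2) ((x₀, ν₀), x₀) := by
    have h1 : ContMDiffAt ((IX.prod 𝓘(ℝ, EX →L[ℝ] EG)).prod IX) 𝓘(ℝ, EX) ∞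
        (fun w : (X × (EX →L[ℝ] EG)) × X => φ w.2) ((x₀, ν₀), x₀) :=
      ContMDiffAt.comp ((x₀, ν₀), x₀) (g := φ) hφs contMDiffAt_snd
    have h2 : ContMDiffAt ((IX.prod 𝓘(ℝ, EX →L[ℝ] EG)).prod IX) 𝓘(ℝ, EX) ∞
        (fun w : (X × (EX →L[ℝ] EG)) × X => φ w.1.1) ((x₀, ν₀), x₀) :=
      ContMDiffAt.comp ((x₀, ν₀), x₀) (g := φ) hφs (contMDiffAt_fst.comp _ contMDiffAt_fst)
    have h3 : ContMDiffAt ((IX.prod 𝓘(ℝ, EX →L[ℝ] EG)).prod IX) 𝓘(ℝ, EX →L[ℝ] EG) ∞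
        (fun w : (X × (EX →L[ℝ] EG)) × X => w.1.2) ((x₀, ν₀), x₀) :=
      contMDiffAt_snd.comp _ contMDiffAt_fst
    exact ContMDiffAt.comp ((x₀, ν₀), x₀) (g := c) hc.contMDiffAt (h3.clm_apply (h1.sub h2))
  have hS : ContMDiffAt ((IX.prod 𝓘(ℝ, EX →L[ℝ] EG)).prod IX) IP ∞
      (fun w : (X × (EX →L[ℝ] EG)) × X => S w.1 w.2) ((x₀, ν₀), x₀) := by
    have h1 : ContMDiffAt ((IX.prod 𝓘(ℝ, EX →L[ℝ] EG)).prod IX) IP ∞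
        (fun w : (X × (EX →L[ℝ] EG)) × X => e w.2) ((x₀, ν₀), x₀) :=
      ContMDiffAt.comp ((x₀, ν₀), x₀) (g := e)
        (hT.smooth_sec.contMDiffAt (hT.isOpen.mem_nhds hx₀)) contMDiffAt_snd
    exact ContMDiffAt.comp ((x₀, ν₀), x₀) (g := fun z : P × G => B.act z.1 z.2)
      hT.smooth_act.contMDiffAt (h1.prodMk hk)
  have hU : ∀ᶠ w in 𝓝 (((x₀, ν₀), x₀) : (X × (EX →L[ℝ] EG)) × X), w.2 ∈ U :=
    continuousAt_snd.eventually (hT.isOpen.mem_nhds hx₀)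
  have hsec : ∀ᶠ w in 𝓝 (((x₀, ν₀), x₀) : (X × (EX →L[ℝ] EG)) × X),
      B.proj (S w.1 w.2) = w.2 := by
    filter_upwards [hU] with w hw
    rw [hT.proj_act, hT.proj_sec _ hw]
  have main := contMDiffAt_jetEval (IN := IX.prod 𝓘(ℝ, EX →L[ℝ] EG)) (g := fun r => r.1)
    (q := ((x₀, ν₀) : X × (EX →L[ℝ] EG))) hL hT.smooth_proj hS contMDiffAt_fst hsec
  refine main.congr_of_eventuallyEq ?_
  have hfst : Tendsto (fun r : X × (EX →L[ℝ] EG) => r.1) (𝓝 (x₀, ν₀)) (𝓝 x₀) := continuousAt_fst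
  have hdiag : Tendsto (fun r : X × (EX →L[ℝ] EG) => (r, r.1)) (𝓝 (x₀, ν₀))
      (𝓝 ((x₀, ν₀), x₀)) := continuousAt_id.prodMk continuousAt_fst
  filter_upwards [hfst.eventually (hT.isOpen.mem_nhds hx₀),
    hfst.eventually (extChartAt_source_mem_nhds (I := IX) x₀),
    hdiag.eventually (eventually_mdiff_slice hS)] with r hrU hrs hrd
  have hp : ∀ᶠ y in 𝓝 r.1, B.proj (S r y) = y := by
    filter_upwards [hT.isOpen.mem_nhds hrU] with y hy
    rw [hT.proj_act, hT.proj_sec _ hy]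
  refine Eq.trans ?_ (hT.jetEval_section hinv hrU hrd hp).symm
  congr 1
  have e1 : rlog IX EG (fun y => ξ (S r y)) r.1 = rlog IX EG (k r) r.1 := by
    refine rlog_congr ?_
    filter_upwards [hT.isOpen.mem_nhds hrU] with y hy
    rw [hT.triv_act _ (hT.sec_mem hy), hT.triv_sec y hy, one_mul]
  have hφd : MDifferentiableAt IX 𝓘(ℝ, EX) φ r.1 :=
    (contMDiffAt_extChartAt' (n := ∞) (by rwa [← extChartAt_source IX])).mdifferentiableAt
      (by simp)
  have hk0 : (r.2 (φ r.1 - φ r.1)) = 0 := by simp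
  rw [e1, rlog_of_eq_one (by simp only [k, hk0, hc1])]
  let A : EX → EG := fun y => r.2 (y - φ r.1)
  have hAd : DifferentiableAt ℝ A (φ r.1) := by fun_prop
  have hA0 : A (φ r.1) = 0 := hk0
  have h1 : der 𝓘(ℝ, EX) 𝓘(ℝ, EG) (fun y => c (A y)) (φ r.1) = r.2 := by
    rw [der_comp_of_eq (g := c) (hc.mdifferentiableAt (by simp)) hAd.mdifferentiableAt hA0, hcd,
      ContinuousLinearMap.id_comp, der_eq_fderiv]
    have : HasFDerivAt A r.2 (φ r.1) := by
      have := r.2.hasFDerivAt.comp (φ r.1) ((hasFDerivAt_id (φ r.1)).sub_const (φ r.1))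
      rwa [ContinuousLinearMap.comp_id] at this
    exact this.fderiv
  have h2 := der_comp (g := fun y => c (A y)) (f := φ) (x := r.1)
    (MDifferentiableAt.comp (φ r.1) (g := c) (hc.mdifferentiableAt (by simp))
      hAd.mdifferentiableAt) hφd
  rw [h1] at h2
  exact h2.symm

end JetFamilies

/-! ### Sections of the adjoint bundle, connections and reduced jets in a trivialization -/

section TrivializedObjects

variable
  {EX : Type*} [NormedAddCommGroup EX] [NormedSpace ℝ EX]
  {HX : Type*} [TopologicalSpace HX] {IX : ModelWithCorners ℝ EX HX}
  {X : Type*} [TopologicalSpace X] [ChartedSpace HX X] [IsManifold IX ∞ X]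
  {EP : Type*} [NormedAddCommGroup EP] [NormedSpace ℝ EP]
  {HP : Type*} [TopologicalSpace HP] {IP : ModelWithCorners ℝ EP HP}
  {P : Type*} [TopologicalSpace P] [ChartedSpace HP P] [IsManifold IP ∞ P]
  {EG : Type*} [NormedAddCommGroup EG] [NormedSpace ℝ EG]
  {G : Type*} [TopologicalSpace G] [ChartedSpace EG G] [Group G]
  {B : BundleMaps X P G} {U : Set X} {ξ : P → G} {e : X → P}
  [LieGroup 𝓘(ℝ, EG) ∞ G]

variable (IP B) in
/-- The jet `γ + ε ζ_P` at `p`. -/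
def shiftJet (p : P) (γ : EX →L[ℝ] EP) (ε : ℝ) (ζ : EX →L[ℝ] EG) : EX →L[ℝ] EP :=
  γ + ε • (gen IP EG B p).comp ζ

/-- The flat connection is the left logarithmic derivative of the trivialization. -/
theorem flatConnection_eq {p : P} (h : MDifferentiableAt IP 𝓘(ℝ, EG) ξ p) :
    flatConnection (EG := EG) IP ξ p = (Ad G (ξ p)⁻¹).comp (rlog IP EG ξ p) := by
  have h1 : (Ad G (ξ p)⁻¹).comp (rlog IP EG ξ p) =
      der IP 𝓘(ℝ, EG) (fun y => (ξ p)⁻¹ * (ξ y * (ξ p)⁻¹) * (ξ p)⁻¹⁻¹) p := by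
    rw [Ad_eq, rlog, ← der_comp_of_eq (mdiff_conj _ 1) (MDiffAt.mul_const h _) (by simp)]
  have h2 : der IP 𝓘(ℝ, EG) (fun y => (ξ p)⁻¹ * ξ y) p =
      (der 𝓘(ℝ, EG) 𝓘(ℝ, EG) (fun g : G => (ξ p)⁻¹ * g) (ξ p)).comp (der IP 𝓘(ℝ, EG) ξ p) :=
    der_comp (MDiffAt.const_mul _ mdifferentiableAt_id) h
  rw [h1]
  refine h2.symm.trans ?_
  congr 1
  ext y
  group

theorem rlog_inv {k : P → G} {p : P} (h : MDifferentiableAt IP 𝓘(ℝ, EG) k p) :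
    rlog IP EG (fun q => (k q)⁻¹) p = - (Ad G (k p)⁻¹).comp (rlog IP EG k p) := by
  have hi : MDifferentiableAt IP 𝓘(ℝ, EG) (fun q => (k q)⁻¹) p :=
    MDifferentiableAt.comp p (g := fun g : G => g⁻¹)
      ((contMDiff_inv 𝓘(ℝ, EG) ∞).mdifferentiableAt (by simp)) h
  have h1 := rlog_mul hi h
  simp only [inv_mul_cancel] at h1
  rw [rlog_const] at h1
  exact eq_neg_of_add_eq_zero_left h1.symm

theorem der_clm_apply_apply {F F' : Type*} [NormedAddCommGroup F] [NormedSpace ℝ F]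
    [NormedAddCommGroup F'] [NormedSpace ℝ F'] {T : P → F →L[ℝ] F'} {f : P → F} {p : P}
    (hA : MDifferentiableAt IP 𝓘(ℝ, F →L[ℝ] F') T p) (hf : MDifferentiableAt IP 𝓘(ℝ, F) f p)
    (v : EP) : der IP 𝓘(ℝ, F') (fun q => T q (f q)) p v =
      T p (der IP 𝓘(ℝ, F) f p v) + der IP 𝓘(ℝ, F →L[ℝ] F') T p v (f p) := by
  have h1 := (isBoundedBilinearMap_apply (𝕜 := ℝ) (E := F) (F := F')).hasFDerivAt (T p, f p)
  have h0 : HasMFDerivAt IP 𝓘(ℝ, (F →L[ℝ] F') × F) (fun q => (T q, f q)) p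
      ((der IP 𝓘(ℝ, F →L[ℝ] F') T p).prod (der IP 𝓘(ℝ, F) f p)) :=
    ⟨hA.hasMFDerivAt.1.prodMk hf.hasMFDerivAt.1, hA.hasMFDerivAt.2.prodMk hf.hasMFDerivAt.2⟩
  have h2 := (HasMFDerivAt.comp p h1.hasMFDerivAt h0).mfderiv
  exact congrArg (fun T : EP →L[ℝ] F' => T v) h2

theorem contMDiffOn_Ad_comp {k : P → G} {S : Set P} (h : ContMDiffOn IP 𝓘(ℝ, EG) ∞ k S) :
    ContMDiffOn IP 𝓘(ℝ, EG →L[ℝ] EG) ∞ (fun p => Ad (EG := EG) G (k p)) S :=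
  contMDiff_Ad.comp_contMDiffOn (f := k) h

namespace IsTrivialized

variable (hT : IsTrivialized IX IP EG B U ξ e)

include hT

/-- The section of the adjoint bundle given in the trivialization by a Lie algebra valued function
on the base. -/
theorem isAdSection {η : X → EG} (hη : ContMDiffOn IX 𝓘(ℝ, EG) ∞ η U) :
    IsAdSection IP B U (fun p => Ad G (ξ p)⁻¹ (η (B.proj p))) where
  smooth := by
    have h1 := contMDiffOn_Ad_comp hT.smooth_triv.inv
    exact h1.clm_apply (hη.comp hT.smooth_proj.contMDiffOn (fun p hp => hp))
  equivariant := by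
    intro p hp g
    rw [hT.triv_act p hp, hT.proj_act, mul_inv_rev, Ad_mul_apply]

theorem adSection_eq {f : P → EG} (hf : IsAdSection IP B U f) {p : P} (hp : p ∈ B.part U) :
    f p = Ad G (ξ p)⁻¹ (f (e (B.proj p))) := by
  rw [← hf.equivariant _ (hT.sec_mem hp), hT.act_sec p hp]

theorem contMDiffOn_adSection {f : P → EG} (hf : IsAdSection IP B U f) :
    ContMDiffOn IX 𝓘(ℝ, EG) ∞ (fun x => f (e x)) U :=
  hf.smooth.comp hT.smooth_sec (fun _ hx => hT.sec_mem hx)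

theorem adSection_vanish {η : X → EG} {K : Set X} (h : ∀ x ∈ U \ K, η x = 0) :
    ∀ p ∈ B.part (U \ K), Ad G (ξ p)⁻¹ (η (B.proj p)) = 0 := by
  intro p hp
  rw [h _ hp, map_zero]

theorem vanish_adSection {f : P → EG} {K : Set X} (h : ∀ p ∈ B.part (U \ K), f p = 0) :
    ∀ x ∈ U \ K, f (e x) = 0 := by
  intro x hx
  refine h _ ?_
  change B.proj (e x) ∈ U \ K
  rwa [hT.proj_sec x hx.1]

/-- A connection form which vanishes on the lifts with logarithmic derivative `ν` has these lifts as
its horizontal lifts. -/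
theorem horLift_spec {A : P → EP →L[ℝ] EG} {p : P} (hp : p ∈ B.part U) {ν : EX →L[ℝ] EG}
    (hA : A p = (Ad G (ξ p)⁻¹).comp (rlog IP EG ξ p - ν.comp (der IP IX B.proj p))) :
    (der IP IX B.proj p).comp (horLift IX IP B A p) = ContinuousLinearMap.id ℝ EX ∧
      (rlog IP EG ξ p).comp (horLift IX IP B A p) = ν := by
  have key : ∀ γ : EX →L[ℝ] EP, (der IP IX B.proj p).comp γ = ContinuousLinearMap.id ℝ EX →
      ((A p).comp γ = 0 ↔ (rlog IP EG ξ p).comp γ = ν) := by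
    intro γ hγ
    have h1 : (A p).comp γ = (Ad G (ξ p)⁻¹).comp ((rlog IP EG ξ p).comp γ - ν) := by
      rw [hA, ContinuousLinearMap.comp_assoc, ContinuousLinearMap.sub_comp,
        ContinuousLinearMap.comp_assoc ν, hγ, ContinuousLinearMap.comp_id]
    rw [h1]
    constructor
    · intro h
      rw [← sub_eq_zero]
      ext u
      have := congrArg (fun T : EX →L[ℝ] EG => Ad G (ξ p) (T u)) h
      simpa only [ContinuousLinearMap.comp_apply, Ad_Ad_inv, _root_.zero_apply, map_zero] using this
    · intro h
      rw [h, sub_self, ContinuousLinearMap.comp_zero]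
  have hex : ∃ γ : EX →L[ℝ] EP, (der IP IX B.proj p).comp γ = ContinuousLinearMap.id ℝ EX ∧
      (A p).comp γ = 0 := by
    obtain ⟨γ, h1, h2⟩ := hT.exists_lift hp ν
    exact ⟨γ, h1, (key γ h1).2 h2⟩
  have hh : horLift IX IP B A p = hex.choose := dif_pos hex
  rw [hh]
  exact ⟨hex.choose_spec.1, (key _ hex.choose_spec.1).1 hex.choose_spec.2⟩

/-- A vertical vector is the generator of its logarithmic derivative, up to `Ad`. -/
theorem generator_eq {p : P} (hp : p ∈ B.part U) {v : EP} (hv : der IP IX B.proj p v = 0) :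
    generator (EG := EG) IP B p v = Ad G (ξ p)⁻¹ (rlog IP EG ξ p v) := by
  have hrg : ∀ α : EG, rlog IP EG ξ p (gen IP EG B p α) = Ad G (ξ p) α := fun α =>
    congrArg (fun T : EG →L[ℝ] EG => T α) (hT.rlog_gen hp)
  have hex : ∃ α : EG, infGen IP B p α = v := by
    refine ⟨Ad G (ξ p)⁻¹ (rlog IP EG ξ p v), ?_⟩
    change gen IP EG B p (Ad G (ξ p)⁻¹ (rlog IP EG ξ p v)) = v
    rw [← sub_eq_zero]
    refine hT.ext_vector hp ?_ ?_
    · rw [map_sub, hv, sub_zero]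
      exact congrArg (fun T : EG →L[ℝ] EX => T _) (hT.der_proj_gen p)
    · rw [map_sub, hrg, Ad_Ad_inv, sub_self]
  have hh : generator (EG := EG) IP B p v = hex.choose := dif_pos hex
  have h1 := hrg hex.choose
  have h2 : gen IP EG B p hex.choose = v := hex.choose_spec
  rw [h2] at h1
  rw [hh, h1, Ad_inv_Ad]

/-- The derivative of the section `p ↦ Ad (ξ p)⁻¹ η` of the adjoint bundle. -/
theorem der_adSection {η : X → EG} {p : P} (hp : p ∈ B.part U)
    (hη : MDifferentiableAt IX 𝓘(ℝ, EG) η (B.proj p)) [FiniteDimensional ℝ EG] :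
    der IP 𝓘(ℝ, EG) (fun q => Ad G (ξ q)⁻¹ (η (B.proj q))) p =
      (Ad G (ξ p)⁻¹).comp ((der IX 𝓘(ℝ, EG) η (B.proj p)).comp (der IP IX B.proj p) +
        (ad G (η (B.proj p))).comp (rlog IP EG ξ p)) := by
  have hd := hT.mdiff_triv hp
  have hi : MDifferentiableAt IP 𝓘(ℝ, EG) (fun q => (ξ q)⁻¹) p :=
    MDifferentiableAt.comp p (g := fun g : G => g⁻¹)
      ((contMDiff_inv 𝓘(ℝ, EG) ∞).mdifferentiableAt (by simp)) hd
  have hA : MDifferentiableAt IP 𝓘(ℝ, EG →L[ℝ] EG) (fun q => Ad (EG := EG) G (ξ q)⁻¹) p :=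
    MDifferentiableAt.comp p (g := fun g : G => Ad (EG := EG) G g) (mdiff_Ad _) hi
  have hηπ : MDifferentiableAt IP 𝓘(ℝ, EG) (fun q => η (B.proj q)) p :=
    MDifferentiableAt.comp p (g := η) hη (hT.mdiff_proj p)
  ext v
  have h1 : der IP 𝓘(ℝ, EG) (fun q => Ad G (ξ q)⁻¹ (η (B.proj q))) p v =
      Ad G (ξ p)⁻¹ (der IP 𝓘(ℝ, EG) (fun q => η (B.proj q)) p v) +
      der IP 𝓘(ℝ, EG →L[ℝ] EG) (fun q => Ad (EG := EG) G (ξ q)⁻¹) p v (η (B.proj p)) :=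
    der_clm_apply_apply hA hηπ v
  rw [h1, der_Ad_comp hi, rlog_inv hd, der_comp hη (hT.mdiff_proj p)]
  simp only [ContinuousLinearMap.comp_apply, _root_.add_apply, map_add, _root_.neg_apply]
  rw [Ad_ad, ad_swap, map_neg, neg_neg]

/-- The covariant differential of a section of the adjoint bundle in a trivialization. For the flat
connection `ν = 0` and it is the plain derivative of `η`. -/
theorem covDiff_eq {A : P → EP →L[ℝ] EG} {f : P → EG} {η : X → EG} {p : P} (hp : p ∈ B.part U)
    [FiniteDimensional ℝ EG] {ν : EX →L[ℝ] EG}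
    (hA : A p = (Ad G (ξ p)⁻¹).comp (rlog IP EG ξ p - ν.comp (der IP IX B.proj p)))
    (hη : MDifferentiableAt IX 𝓘(ℝ, EG) η (B.proj p))
    (hf : ∀ q ∈ B.part U, f q = Ad G (ξ q)⁻¹ (η (B.proj q))) :
    covDiff IP G A f p = (Ad G (ξ p)⁻¹).comp
      ((der IX 𝓘(ℝ, EG) η (B.proj p) + (ad G (η (B.proj p))).comp ν).comp
        (der IP IX B.proj p)) := by
  have h1 : der IP 𝓘(ℝ, EG) f p = der IP 𝓘(ℝ, EG) (fun q => Ad G (ξ q)⁻¹ (η (B.proj q))) p :=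
    der_congr (by filter_upwards [hT.isOpen_part.mem_nhds hp] with q hq using hf q hq)
  have h2 : covDiff IP G A f p = der IP 𝓘(ℝ, EG) f p - (ad G (f p)).comp (A p) := rfl
  rw [h2, h1, hT.der_adSection hp hη, hA, hf p hp]
  ext v
  simp only [ContinuousLinearMap.comp_apply, _root_.add_apply, map_add, _root_.sub_apply, map_sub]
  rw [← Ad_ad, ← Ad_ad]
  abel

/-- The covariant derivative of a section of the adjoint bundle, as a form on the base. -/
theorem covDeriv_eq {A : P → EP →L[ℝ] EG} {f : P → EG} {η : X → EG} {p : P} (hp : p ∈ B.part U)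
    [FiniteDimensional ℝ EG] {ν : EX →L[ℝ] EG}
    (hA : A p = (Ad G (ξ p)⁻¹).comp (rlog IP EG ξ p - ν.comp (der IP IX B.proj p)))
    (hη : MDifferentiableAt IX 𝓘(ℝ, EG) η (B.proj p))
    (hf : ∀ q ∈ B.part U, f q = Ad G (ξ q)⁻¹ (η (B.proj q))) :
    covDeriv IX IP B A f p = (Ad G (ξ p)⁻¹).comp
      (der IX 𝓘(ℝ, EG) η (B.proj p) + (ad G (η (B.proj p))).comp ν) := by
  have h1 := hT.covDiff_eq hp hA hη hf
  have h2 : covDeriv IX IP B A f p = (covDiff IP G A f p).comp (horLift IX IP B A p) := rfl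
  rw [h2]
  have h3 : ∀ (C : EP →L[ℝ] EG) (γ : EX →L[ℝ] EP) (D : EX →L[ℝ] EG),
      C = (Ad G (ξ p)⁻¹).comp (D.comp (der IP IX B.proj p)) →
      (der IP IX B.proj p).comp γ = ContinuousLinearMap.id ℝ EX →
      C.comp γ = (Ad G (ξ p)⁻¹).comp D := by
    rintro C γ D rfl hγ
    rw [ContinuousLinearMap.comp_assoc, ContinuousLinearMap.comp_assoc, hγ,
      ContinuousLinearMap.comp_id]
  exact h3 _ _ _ h1 (hT.horLift_spec hp hA).1

/-- The reduced jet extension at `p` is the translate through `p` of the jet of the section, so it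
has the same logarithmic derivative. -/
theorem redJetExt_spec {s : X → P} {p : P} (hp : p ∈ B.part U)
    (hs : MDifferentiableAt IX IP s (B.proj p)) (hsec : ∀ x ∈ U, B.proj (s x) = x) :
    (der IP IX B.proj p).comp (redJetExt IX IP B s p) = ContinuousLinearMap.id ℝ EX ∧
      (rlog IP EG ξ p).comp (redJetExt IX IP B s p) =
        rlog IX EG (fun y => ξ (s y)) (B.proj p) := by
  have hx : B.proj p ∈ U := hp
  have hsm : s (B.proj p) ∈ B.part U := by
    change B.proj (s (B.proj p)) ∈ U; rwa [hsec _ hx]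
  have htr := hT.transl_eq hp hsm (hsec _ hx).symm
  set g := B.transl (s (B.proj p)) p with hg
  have h1 := hT.der_proj_act (s (B.proj p)) g
  have h2 := hT.rlog_act hsm g
  rw [htr.1] at h1 h2
  have hr : redJetExt IX IP B s p =
      (der IP IP (fun q => B.act q g) (s (B.proj p))).comp (der IX IP s (B.proj p)) := rfl
  rw [hr]
  constructor
  · refine Eq.trans (ContinuousLinearMap.comp_assoc _ _ _).symm ?_
    rw [h1]
    exact hT.der_proj_section hs (by
      filter_upwards [hT.isOpen.mem_nhds hx] with y hy using hsec y hy)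
  · refine Eq.trans (ContinuousLinearMap.comp_assoc _ _ _).symm ?_
    rw [h2]
    exact (rlog_comp (hT.mdiff_triv hsm) hs).symm

/-- For the flat connection, the reduced jet of a section is its logarithmic derivative up to `Ad`.
-/
theorem redJetForm_eq {A : P → EP →L[ℝ] EG} {s : X → P} {p : P} (hp : p ∈ B.part U)
    (hA : ∀ q ∈ B.part U, A q = (Ad G (ξ q)⁻¹).comp (rlog IP EG ξ q))
    (hs : MDifferentiableAt IX IP s (B.proj p)) (hsec : ∀ x ∈ U, B.proj (s x) = x) :
    redJetForm IX IP B A s p =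
      (Ad G (ξ p)⁻¹).comp (rlog IX EG (fun y => ξ (s y)) (B.proj p)) := by
  have hx : B.proj p ∈ U := hp
  have hsm : s (B.proj p) ∈ B.part U := by
    change B.proj (s (B.proj p)) ∈ U; rwa [hsec _ hx]
  have htr := hT.transl_eq hp hsm (hsec _ hx).symm
  have hr : redJetForm IX IP B A s p = (Ad G (B.transl (s (B.proj p)) p)⁻¹).comp
      ((A (s (B.proj p))).comp (der IX IP s (B.proj p))) := rfl
  rw [hr, hA _ hsm, rlog_comp (hT.mdiff_triv hsm) hs, htr.2, mul_inv_rev, Ad_mul,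
    ContinuousLinearMap.comp_assoc, ContinuousLinearMap.comp_assoc]

/-- The value of the reduced Lagrangian at `[j¹s] + ζ`. -/
theorem redEval_redJetExt_add {L : Jet IX IP B → ℝ} (hL : Invariant IX IP B L) {s : X → P} {p : P}
    (hp : p ∈ B.part U) (hs : MDifferentiableAt IX IP s (B.proj p))
    (hsec : ∀ x ∈ U, B.proj (s x) = x) (ε : ℝ) (ζ : EX →L[ℝ] EG) :
    redEval (reduce IX IP B L hL) p (shiftJet (EX := EX) (EP := EP) IP B p (redJetExt IX IP B s p) ε ζ) =
      trivLag IX IP EG B e L (B.proj p)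
        (rlog IX EG (fun y => ξ (s y)) (B.proj p) + ε • (Ad G (ξ p)).comp ζ) := by
  refine (redEval_reduce _ _ _ _).trans ?_
  obtain ⟨h1, h2⟩ := hT.redJetExt_spec hp hs hsec
  have key : ∀ (γ : EX →L[ℝ] EP) (ζ : EX →L[ℝ] EG) (ν : EX →L[ℝ] EG),
      (der IP IX B.proj p).comp γ = ContinuousLinearMap.id ℝ EX →
      (rlog IP EG ξ p).comp γ = ν →
      (der IP IX B.proj p).comp (γ + ε • (gen IP EG B p).comp ζ) = ContinuousLinearMap.id ℝ EX ∧
      (rlog IP EG ξ p).comp (γ + ε • (gen IP EG B p).comp ζ) = ν + ε • (Ad G (ξ p)).comp ζ := by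
    intro γ ζ ν hγ hν
    constructor
    · rw [ContinuousLinearMap.comp_add, ContinuousLinearMap.comp_smul,
        ← ContinuousLinearMap.comp_assoc, hT.der_proj_gen, ContinuousLinearMap.zero_comp, smul_zero,
        add_zero, hγ]
    · rw [ContinuousLinearMap.comp_add, ContinuousLinearMap.comp_smul,
        ← ContinuousLinearMap.comp_assoc, hT.rlog_gen hp, hν]
  exact hT.jetEval_eq hL hp (key _ ζ _ h1 h2).1 (key _ ζ _ h1 h2).2

/-- The fibre derivative of the reduced Lagrangian is the derivative of `trivLag` in the logarithmic
derivative. -/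
theorem fibreDeriv_eq [FiniteDimensional ℝ EX] [IX.Boundaryless] {L : Jet IX IP B → ℝ}
    (hL : Invariant IX IP B L) (hΛ : FibreSmooth IX U (trivLag IX IP EG B e L))
    {s : X → P} {p : P}
    (hp : p ∈ B.part U) (hs : MDifferentiableAt IX IP s (B.proj p))
    (hsec : ∀ x ∈ U, B.proj (s x) = x) (ζ : EX →L[ℝ] EG) :
    fibreDeriv IX IP B (reduce IX IP B L hL) s p ζ =
      fderiv ℝ (trivLag IX IP EG B e L (B.proj p)) (rlog IX EG (fun y => ξ (s y)) (B.proj p))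
        ((Ad G (ξ p)).comp ζ) := by
  have h : fibreDeriv IX IP B (reduce IX IP B L hL) s p ζ =
    deriv (fun ε : ℝ => redEval (reduce IX IP B L hL) p
      (shiftJet (EX := EX) (EP := EP) IP B p (redJetExt IX IP B s p) ε ζ)) 0 := rfl
  rw [h]
  refine (congrArg (fun f : ℝ → ℝ => deriv f 0) (funext fun ε =>
    hT.redEval_redJetExt_add hL hp hs hsec ε ζ)).trans ?_
  exact (hΛ.hasDerivAt_add_smul hp _ _).deriv

end IsTrivialized

end TrivializedObjects

/-! ### The field equations and the unreduced covariant principles -/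

section Variations

variable
  {EX : Type*} [NormedAddCommGroup EX] [NormedSpace ℝ EX]
  {HX : Type*} [TopologicalSpace HX] {IX : ModelWithCorners ℝ EX HX}
  {X : Type*} [TopologicalSpace X] [ChartedSpace HX X] [IsManifold IX ∞ X]
  {EG : Type*} [NormedAddCommGroup EG] [NormedSpace ℝ EG] [FiniteDimensional ℝ EG]
  {G : Type*} [TopologicalSpace G] [ChartedSpace EG G] [Group G] [LieGroup 𝓘(ℝ, EG) ∞ G]

variable (EG) in
/-- The velocity `dh_ε/dε h_ε⁻¹` at `ε = 0` of a family of maps into the group. -/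
def variationField (h : ℝ → X → G) (x : X) : EG := rlog 𝓘(ℝ, ℝ) EG (fun ε => h ε x) 0 (1 : ℝ)

theorem contMDiffOn_variationField {U : Set X} (hU : IsOpen U) {h : ℝ → X → G}
    (hh : ContMDiffOn (𝓘(ℝ, ℝ).prod IX) 𝓘(ℝ, EG) ∞ (fun z : ℝ × X => h z.1 z.2) (univ ×ˢ U)) :
    ContMDiffOn IX 𝓘(ℝ, EG) ∞ (variationField EG h) U := by
  intro x hx
  refine ContMDiffAt.contMDiffWithinAt ?_
  have : IsManifold IX 1 X := IsManifold.of_le (n := ∞) (by simp)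
  have hat : ContMDiffAt (𝓘(ℝ, ℝ).prod IX) 𝓘(ℝ, EG) ∞ (fun z : ℝ × X => h z.1 z.2) (0, x) :=
    hh.contMDiffAt ((isOpen_univ.prod hU).mem_nhds ⟨mem_univ _, hx⟩)
  have h1 : ContMDiffAt (IX.prod 𝓘(ℝ, ℝ)) 𝓘(ℝ, EG) ∞
      (fun z : X × ℝ => h z.2 z.1 * (h 0 z.1)⁻¹) (x, 0) := by
    have ha : ContMDiffAt (IX.prod 𝓘(ℝ, ℝ)) 𝓘(ℝ, EG) ∞ (fun z : X × ℝ => h z.2 z.1) (x, 0) :=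
      ContMDiffAt.comp (x, 0) (g := fun z : ℝ × X => h z.1 z.2) (f := fun z : X × ℝ => (z.2, z.1))
        hat (contMDiffAt_snd.prodMk contMDiffAt_fst)
    have hb : ContMDiffAt (IX.prod 𝓘(ℝ, ℝ)) 𝓘(ℝ, EG) ∞ (fun z : X × ℝ => h 0 z.1) (x, 0) :=
      ContMDiffAt.comp (x, 0) (g := fun z : ℝ × X => h z.1 z.2) (f := fun z : X × ℝ => (0, z.1))
        hat (contMDiffAt_const.prodMk contMDiffAt_fst)
    exact ha.mul hb.inv
  have h2 := contMDiffAt_der_model (I' := 𝓘(ℝ, EG)) (J := IX)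
    (fun (x : X) (ε : ℝ) => h ε x * (h 0 x)⁻¹) (fun _ => 0) 1 h1 contMDiffAt_const
    (Eventually.of_forall fun y => mul_inv_cancel _)
  exact h2.clm_apply contMDiffAt_const

/-- Every Lie algebra valued function is the velocity of a variation of a given map. -/
theorem exists_variation {U : Set X} {h : X → G} (hh : ContMDiffOn IX 𝓘(ℝ, EG) ∞ h U)
    {η : X → EG} (hη : ContMDiffOn IX 𝓘(ℝ, EG) ∞ η U) :
    ∃ k : ℝ → X → G,
      ContMDiffOn (𝓘(ℝ, ℝ).prod IX) 𝓘(ℝ, EG) ∞ (fun z : ℝ × X => k z.1 z.2) (univ ×ˢ U) ∧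
      (∀ x, k 0 x = h x) ∧ (∀ x, η x = 0 → ∀ ε, k ε x = h x) ∧
      ∀ x, variationField EG k x = η x := by
  obtain ⟨c, hc, hc1, hcd⟩ := exists_localExp (EG := EG) (G := G)
  refine ⟨fun ε x => c (ε • η x) * h x, ?_, ?_, ?_, ?_⟩
  · have h1 : ContMDiffOn (𝓘(ℝ, ℝ).prod IX) 𝓘(ℝ, EG) ∞ (fun z : ℝ × X => z.1 • η z.2)
        (univ ×ˢ U) :=
      contMDiffOn_fst.smul (hη.comp contMDiffOn_snd fun _ hz => hz.2)
    exact (hc.comp_contMDiffOn (f := fun z : ℝ × X => z.1 • η z.2) h1).mul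
      (hh.comp contMDiffOn_snd fun _ hz => hz.2)
  · intro x
    simp only [zero_smul, hc1, one_mul]
  · intro x hx ε
    simp only [hx, smul_zero, hc1, one_mul]
  · intro x
    have hs : MDifferentiableAt 𝓘(ℝ, ℝ) 𝓘(ℝ, EG) (fun ε : ℝ => ε • η x) 0 :=
      (differentiableAt_id.smul_const (η x)).mdifferentiableAt
    have hcs : MDifferentiableAt 𝓘(ℝ, ℝ) 𝓘(ℝ, EG) (fun ε : ℝ => c (ε • η x)) 0 :=
      MDifferentiableAt.comp (0 : ℝ) (g := c) (hc.mdifferentiableAt (by simp)) hs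
    rw [variationField, rlog_mul_const hcs, rlog_of_eq_one (by simp only [zero_smul, hc1]),
      der_comp_of_eq (g := c) (hc.mdifferentiableAt (by simp)) hs (zero_smul _ _), hcd,
      ContinuousLinearMap.id_comp, der_eq_fderiv, fderiv_apply_one_eq_deriv]
    have := ((hasDerivAt_id (0 : ℝ)).smul_const (η x)).deriv
    rw [one_smul] at this
    exact this

variable (IX G) in
/-- The first variation of `Λ(x, ν)` for `δν = dη + [η, ν]`. -/
def firstVar (Λ : X → (EX →L[ℝ] EG) → ℝ) (ν : X → EX →L[ℝ] EG) (η : X → EG) (x : X) : ℝ :=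
  fderiv ℝ (Λ x) (ν x) (der IX 𝓘(ℝ, EG) η x + (ad G (η x)).comp (ν x))

/-- The vector field `w · η`, where `w` is the fibre derivative of `Λ` along `ν`. -/
def momentumField [FiniteDimensional ℝ EX] (Λ : X → (EX →L[ℝ] EG) → ℝ) (ν : X → EX →L[ℝ] EG)
    (η : X → EG) (x : X) : EX :=
  vecOf (fun β : EX →L[ℝ] ℝ => fderiv ℝ (Λ x) (ν x) (β.smulRight (η x)))

variable (IX G) in
/-- The stationarity of `∫ Λ(x, ν) dμ` for compactly supported variations `δν = dη + [η, ν]`. -/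
def WeakEquation [MeasurableSpace X] (μ : Measure X) (U : Set X) (Λ : X → (EX →L[ℝ] EG) → ℝ)
    (ν : X → EX →L[ℝ] EG) : Prop :=
  ∀ K : Set X, IsCompact K → K ⊆ U → ∀ η : X → EG, ContMDiffOn IX 𝓘(ℝ, EG) ∞ η U →
    (∀ x ∈ U \ K, η x = 0) → ∫ x in K, firstVar IX G Λ ν η x ∂μ = 0

variable (IX G) in
/-- The field equation `div (w · η) = w · (dη + [η, ν])` for all `η`, where `w` is the fibre
derivative of `Λ` along `ν` and `ρ` holds the chart densities which enter the divergence. -/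
def StrongEquation [FiniteDimensional ℝ EX] (ρ : X → EX → ℝ) (U : Set X)
    (Λ : X → (EX →L[ℝ] EG) → ℝ) (ν : X → EX →L[ℝ] EG) : Prop :=
  ∀ η : X → EG, ContMDiffOn IX 𝓘(ℝ, EG) ∞ η U → ∀ x ∈ U,
    divergence IX ρ (momentumField Λ ν η) x = firstVar IX G Λ ν η x

omit [IsManifold IX ∞ X] in
theorem divergence_congr {ρ : X → EX → ℝ} {W W' : X → EX} {x : X}
    [IX.Boundaryless] (h : W =ᶠ[𝓝 x] W') :
    divergence IX ρ W x = divergence IX ρ W' x := by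
  refine congrArg (fun T : EX →L[ℝ] EX => (ρ x (extChartAt IX x x))⁻¹ *
    LinearMap.trace ℝ EX T.toLinearMap) (Filter.EventuallyEq.fderiv_eq ?_)
  have hc : ContinuousAt (extChartAt IX x).symm (extChartAt IX x x) :=
    continuousAt_extChartAt_symm (I := IX) x
  have h' : ∀ᶠ y in 𝓝 (extChartAt IX x x), W ((extChartAt IX x).symm y) =
      W' ((extChartAt IX x).symm y) := by
    refine hc.eventually (p := fun z => W z = W' z) ?_
    rw [(extChartAt IX x).left_inv (mem_extChartAt_source x)]
    exact h
  filter_upwards [h'] with y hy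
  rw [hy]

theorem smoothFormOn_firstVar_direction [IX.Boundaryless] [FiniteDimensional ℝ EX] {U : Set X}
    (hU : IsOpen U) {ν : X → EX →L[ℝ] EG} (hν : SmoothFormOn IX U ν) {η : X → EG}
    (hη : ContMDiffOn IX 𝓘(ℝ, EG) ∞ η U) :
    SmoothFormOn IX U (fun x => der IX 𝓘(ℝ, EG) η x + (ad G (η x)).comp (ν x)) := by
  refine (contMDiffOn_der_apply hU hη).add (hν.clm_comp ?_)
  have h : ContMDiffOn IX 𝓘(ℝ, EG →L[ℝ] EG) ∞ (fun x => adL EG G (η x)) U :=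
    (adL EG G).contDiff.contMDiff.comp_contMDiffOn hη
  exact h.congr fun x _ => (adL_apply _).symm

theorem contMDiffOn_firstVar [IX.Boundaryless] [FiniteDimensional ℝ EX] {U : Set X}
    (hU : IsOpen U) {Λ : X → (EX →L[ℝ] EG) → ℝ} (hΛ : FibreSmooth IX U Λ)
    {ν : X → EX →L[ℝ] EG} (hν : SmoothFormOn IX U ν) {η : X → EG}
    (hη : ContMDiffOn IX 𝓘(ℝ, EG) ∞ η U) :
    ContMDiffOn IX 𝓘(ℝ, ℝ) ∞ (firstVar IX G Λ ν η) U :=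
  hΛ.contMDiffOn_fderiv hU hν (smoothFormOn_firstVar_direction hU hν hη)

end Variations

section CovariantPrinciples

variable
  {EX : Type*} [NormedAddCommGroup EX] [NormedSpace ℝ EX] [FiniteDimensional ℝ EX]
  {HX : Type*} [TopologicalSpace HX] {IX : ModelWithCorners ℝ EX HX} [IX.Boundaryless]
  {X : Type*} [TopologicalSpace X] [ChartedSpace HX X] [IsManifold IX ∞ X]
  {EP : Type*} [NormedAddCommGroup EP] [NormedSpace ℝ EP]
  {HP : Type*} [TopologicalSpace HP] {IP : ModelWithCorners ℝ EP HP}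
  {P : Type*} [TopologicalSpace P] [ChartedSpace HP P] [IsManifold IP ∞ P]
  {EG : Type*} [NormedAddCommGroup EG] [NormedSpace ℝ EG] [FiniteDimensional ℝ EG]
  {G : Type*} [TopologicalSpace G] [ChartedSpace EG G] [Group G] [LieGroup 𝓘(ℝ, EG) ∞ G]
  {B : BundleMaps X P G} {U : Set X} {ξ : P → G} {e : X → P}
  {L : Jet IX IP B → ℝ} {s : X → P}

namespace IsTrivialized

variable (hT : IsTrivialized IX IP EG B U ξ e)

include hT

/-- A smooth family of maps into the group, as a family of sections. -/
theorem exists_sectionVariation (hs : IsLocalSection IX IP B U s) {k : ℝ → X → G}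
    (hk : ContMDiffOn (𝓘(ℝ, ℝ).prod IX) 𝓘(ℝ, EG) ∞ (fun z : ℝ × X => k z.1 z.2) (univ ×ˢ U))
    (hk0 : ∀ x, k 0 x = ξ (s x)) :
    IsSectionVariation IX IP B U s (fun ε x => B.act (e x) (k ε x)) where
  smooth := hT.smooth_act.comp_contMDiffOn
    ((hT.smooth_sec.comp contMDiffOn_snd fun _ hz => hz.2).prodMk hk)
  proj_eq := fun ε x hx => by rw [hT.proj_act, hT.proj_sec x hx]
  zero := fun x hx => by
    have hsx : s x ∈ B.part U := by change B.proj (s x) ∈ U; rwa [hs.proj_eq x hx]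
    have := hT.act_sec (s x) hsx
    rw [hs.proj_eq x hx] at this
    rw [hk0, this]

theorem section_mem {S : ℝ → X → P} (hS : IsSectionVariation IX IP B U s S) (ε : ℝ) {x : X}
    (hx : x ∈ U) : S ε x ∈ B.part U := by
  change B.proj (S ε x) ∈ U
  rwa [hS.proj_eq ε x hx]

theorem contMDiffOn_triv_variation {S : ℝ → X → P} (hS : IsSectionVariation IX IP B U s S) :
    ContMDiffOn (𝓘(ℝ, ℝ).prod IX) 𝓘(ℝ, EG) ∞ (fun z : ℝ × X => ξ (S z.1 z.2)) (univ ×ˢ U) :=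
  hT.smooth_triv.comp hS.smooth fun z hz => hT.section_mem hS z.1 hz.2

theorem mdiff_variation {S : ℝ → X → P} (hS : IsSectionVariation IX IP B U s S) (ε : ℝ) {x : X}
    (hx : x ∈ U) : MDifferentiableAt IX IP (S ε) x := by
  have h := hS.smooth.contMDiffAt ((isOpen_univ.prod hT.isOpen).mem_nhds
    (x := (ε, x)) ⟨mem_univ _, hx⟩)
  exact (ContMDiffAt.comp x (g := fun z : ℝ × X => S z.1 z.2) (f := fun x => (ε, x)) h
    (contMDiffAt_const.prodMk contMDiffAt_id)).mdifferentiableAt (by simp)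

theorem mdiff_variation_left {S : ℝ → X → P} (hS : IsSectionVariation IX IP B U s S) (ε : ℝ)
    {x : X} (hx : x ∈ U) : MDifferentiableAt 𝓘(ℝ, ℝ) IP (fun ε => S ε x) ε := by
  have h := hS.smooth.contMDiffAt ((isOpen_univ.prod hT.isOpen).mem_nhds
    (x := (ε, x)) ⟨mem_univ _, hx⟩)
  exact (ContMDiffAt.comp ε (g := fun z : ℝ × X => S z.1 z.2) (f := fun ε => (ε, x)) h
    (contMDiffAt_id.prodMk contMDiffAt_const)).mdifferentiableAt (by simp)

theorem contMDiffOn_jetEval_variation (hL : SmoothOnJets IX IP B L) {S : ℝ → X → P}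
    (hS : IsSectionVariation IX IP B U s S) :
    ContMDiffOn (𝓘(ℝ, ℝ).prod IX) 𝓘(ℝ, ℝ) ∞
      (fun z : ℝ × X => jetEval L (S z.1 z.2) (jetExt IX IP (S z.1) z.2)) (univ ×ˢ U) := by
  rintro ⟨ε, x⟩ ⟨-, hx⟩
  refine ContMDiffAt.contMDiffWithinAt ?_
  refine contMDiffAt_jetEval (IN := 𝓘(ℝ, ℝ).prod IX) (S := fun (z : ℝ × X) => S z.1)
    (g := fun z => z.2) (q := (ε, x)) hL hT.smooth_proj ?_ contMDiffAt_snd ?_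
  · have h := hS.smooth.contMDiffAt ((isOpen_univ.prod hT.isOpen).mem_nhds
      (x := (ε, x)) ⟨mem_univ _, hx⟩)
    exact ContMDiffAt.comp (((ε, x), x) : (ℝ × X) × X) (g := fun z : ℝ × X => S z.1 z.2)
      (f := fun w : (ℝ × X) × X => (w.1.1, w.2)) h
      ((contMDiffAt_fst.comp _ contMDiffAt_fst).prodMk contMDiffAt_snd)
  · have : ∀ᶠ w in 𝓝 (((ε, x), x) : (ℝ × X) × X), w.2 ∈ U :=
      continuousAt_snd.eventually (hT.isOpen.mem_nhds hx)
    filter_upwards [this] with w hw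
    exact hS.proj_eq _ _ hw

/-- The first variation of the Lagrangian along a variation of a section. -/
theorem hasDerivAt_jetEval_variation (hinv : Invariant IX IP B L)
    (hΛ : FibreSmooth IX U (trivLag IX IP EG B e L)) {S : ℝ → X → P}
    (hS : IsSectionVariation IX IP B U s S) {x : X} (hx : x ∈ U) :
    HasDerivAt (fun ε => jetEval L (S ε x) (jetExt IX IP (S ε) x))
      (firstVar IX G (trivLag IX IP EG B e L) (rlog IX EG (fun y => ξ (s y)))
        (variationField EG (fun ε y => ξ (S ε y))) x) 0 := by
  have h1 : ∀ ε, jetEval L (S ε x) (jetExt IX IP (S ε) x) =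
      trivLag IX IP EG B e L x (rlog IX EG (fun y => ξ (S ε y)) x) := fun ε =>
    hT.jetEval_section hinv hx (hT.mdiff_variation hS ε hx)
      (by filter_upwards [hT.isOpen.mem_nhds hx] with y hy using hS.proj_eq ε y hy)
  have h2 := hasDerivAt_rlog (h := fun ε y => ξ (S ε y)) ((hT.contMDiffOn_triv_variation hS).contMDiffAt
    ((isOpen_univ.prod hT.isOpen).mem_nhds (x := (0, x)) ⟨mem_univ _, hx⟩))
  have h3 := hΛ.hasDerivAt hx h2
  have h4 : rlog IX EG (fun y => ξ (S 0 y)) x = rlog IX EG (fun y => ξ (s y)) x :=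
    rlog_congr (by filter_upwards [hT.isOpen.mem_nhds hx] with y hy using by rw [hS.zero y hy])
  rw [h4] at h3
  exact h3.congr_of_eventuallyEq (Eventually.of_forall h1)

theorem smoothFormOn_rlog_section (hs : IsLocalSection IX IP B U s) :
    SmoothFormOn IX U (rlog IX EG (fun y => ξ (s y))) :=
  smoothFormOn_rlog hT.isOpen (hT.smooth_triv.comp hs.smooth fun x hx => by
    change B.proj (s x) ∈ U; rwa [hs.proj_eq x hx])

theorem contMDiffOn_triv_section (hs : IsLocalSection IX IP B U s) :
    ContMDiffOn IX 𝓘(ℝ, EG) ∞ (fun y => ξ (s y)) U :=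
  hT.smooth_triv.comp hs.smooth fun x hx => by
    change B.proj (s x) ∈ U; rwa [hs.proj_eq x hx]

theorem mdiff_section (hs : IsLocalSection IX IP B U s) {x : X} (hx : x ∈ U) :
    MDifferentiableAt IX IP s x :=
  (hs.smooth.contMDiffAt (hT.isOpen.mem_nhds hx)).mdifferentiableAt (by simp)

/-- Hamilton’s covariant principle is the weak field equation, since the variations of `s` realize
all velocities `η`. -/
theorem covariantHamilton_iff [MeasurableSpace X] [OpensMeasurableSpace X] [T2Space X]
    {μ : Measure X} [IsFiniteMeasureOnCompacts μ]
    (hL : SmoothOnJets IX IP B L) (hinv : Invariant IX IP B L)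
    (hs : IsLocalSection IX IP B U s) :
    CovariantHamilton IX IP B μ L U s ↔
      WeakEquation IX G μ U (trivLag IX IP EG B e L) (rlog IX EG (fun y => ξ (s y))) := by
  have hΛ := hT.fibreSmooth_trivLag hL hinv
  -- The derivative of the action along any variation of the section.
  have key : ∀ K : Set X, IsCompact K → K ⊆ U → ∀ S : ℝ → X → P,
      IsSectionVariation IX IP B U s S →
      HasDerivAt (fun ε => ∫ x in K, jetEval L (S ε x) (jetExt IX IP (S ε) x) ∂μ)
        (∫ x in K, firstVar IX G (trivLag IX IP EG B e L) (rlog IX EG (fun y => ξ (s y)))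
          (variationField EG (fun ε y => ξ (S ε y))) x ∂μ) 0 := by
    intro K hK hKU S hS
    have h := hasDerivAt_setIntegral (μ := μ) isOpen_univ hT.isOpen
      (Φ := fun ε x => jetEval L (S ε x) (jetExt IX IP (S ε) x))
      (hT.contMDiffOn_jetEval_variation hL hS) hK hKU (mem_univ (0 : ℝ))
    rwa [setIntegral_congr_fun hK.measurableSet (fun x hx =>
      (hT.hasDerivAt_jetEval_variation hinv hΛ hS (hKU hx)).deriv)] at h
  constructor
  · intro H K hK hKU η hη hη0
    -- Every `η` is the velocity of a variation of `ξ ∘ s`, which acts on the unit section.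
    obtain ⟨k, hk, hk0, hkη, hkv⟩ := exists_variation (hT.contMDiffOn_triv_section hs) hη
    have hS := hT.exists_sectionVariation hs hk hk0
    have h1 := key K hK hKU _ hS
    have h2 := H K hK hKU _ hS (fun ε x hx => by
      rw [hkη x (hη0 x hx), ← hk0]; exact hS.zero x hx.1)
    have h3 := h1.unique h2
    rw [← h3]
    refine setIntegral_congr_fun hK.measurableSet fun x hx => ?_
    have e1 : ∀ y ∈ U, variationField EG (fun ε y => ξ (B.act (e y) (k ε y))) y = η y := by
      intro y hy
      rw [← hkv y]
      unfold variationField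
      simp only [hT.triv_act _ (hT.sec_mem hy), hT.triv_sec y hy, one_mul]
    simp only [firstVar]
    rw [e1 x (hKU hx), der_congr (f := variationField EG (fun ε y => ξ (B.act (e y) (k ε y))))
      (g := η) (by filter_upwards [hT.isOpen.mem_nhds (hKU hx)] with y hy using e1 y hy)]
  · intro H K hK hKU S hS hS0
    have h1 := key K hK hKU S hS
    rwa [H K hK hKU _ (contMDiffOn_variationField hT.isOpen (hT.contMDiffOn_triv_variation hS)) ?_]
      at h1
    intro x hx
    rw [variationField]
    simp only [hS0 _ x hx]
    rw [rlog_const, _root_.zero_apply]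

/-- The covariant Euler–Lagrange equations are the strong field equation. -/
theorem covariantEulerLagrange_iff {ρ : X → EX → ℝ}
    (hL : SmoothOnJets IX IP B L) (hinv : Invariant IX IP B L)
    (hs : IsLocalSection IX IP B U s) :
    CovariantEulerLagrange IX IP B ρ L U s ↔
      StrongEquation IX G ρ U (trivLag IX IP EG B e L) (rlog IX EG (fun y => ξ (s y))) := by
  have hΛ := hT.fibreSmooth_trivLag hL hinv
  -- The momentum field of a variation `δs` is `w · η`, because the jets `j + ε β ⊗ δs` have
  -- logarithmic derivatives `ν + ε β ⊗ η`.
  have key : ∀ S : ℝ → X → P, IsSectionVariation IX IP B U s S → ∀ x ∈ U,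
      divergence IX ρ (fun y => vecOf (EX := EX) (fun β : EX →L[ℝ] ℝ =>
        let j : EX →L[ℝ] EP := jetExt IX IP s y
        let δs : EP := mfderiv 𝓘(ℝ, ℝ) IP (fun ε => S ε y) 0 (1 : ℝ)
        deriv (fun ε : ℝ => jetEval L (s y) (j + ε • β.smulRight δs)) 0)) x =
      divergence IX ρ (momentumField (trivLag IX IP EG B e L) (rlog IX EG (fun y => ξ (s y)))
        (variationField EG (fun ε y => ξ (S ε y)))) x := by
    intro S hS x hx
    refine divergence_congr ?_
    filter_upwards [hT.isOpen.mem_nhds hx] with y hy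
    rw [momentumField]
    congr 1
    funext β
    have hsy : s y ∈ B.part U := by change B.proj (s y) ∈ U; rwa [hs.proj_eq y hy]
    set δs : EP := der 𝓘(ℝ, ℝ) IP (fun ε => S ε y) 0 (1 : ℝ) with hδ
    have hd := hT.mdiff_variation_left hS 0 hy
    have h1 : der IP IX B.proj (s y) δs = 0 := by
      have h := der_comp_of_eq (g := B.proj) (hT.mdiff_proj (s y)) hd (hS.zero y hy)
      simp only [hS.proj_eq _ y hy] at h
      rw [der_const] at h
      exact (congrArg (fun T : ℝ →L[ℝ] EX => T 1) h).symm
    have h2 : rlog IP EG ξ (s y) δs = variationField EG (fun ε y => ξ (S ε y)) y := by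
      have h := rlog_comp (k := ξ) (f := fun ε => S ε y) (x := (0 : ℝ))
        (hT.mdiff_triv (hT.section_mem hS 0 hy)) hd
      rw [variationField, h, hS.zero y hy]
      rfl
    have hsec : (der IP IX B.proj (s y)).comp (der IX IP s y) = ContinuousLinearMap.id ℝ EX :=
      hT.der_proj_section (hT.mdiff_section hs hy)
        (by filter_upwards [hT.isOpen.mem_nhds hy] with z hz using hs.proj_eq z hz)
    have h3 : ∀ ε : ℝ, jetEval L (s y)
        (show EX →L[ℝ] EP from der IX IP s y + ε • β.smulRight δs) =
        trivLag IX IP EG B e L y (rlog IX EG (fun y => ξ (s y)) y +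
          ε • β.smulRight (variationField EG (fun ε y => ξ (S ε y)) y)) := by
      intro ε
      have h := hT.jetEval_eq hinv hsy (γ := der IX IP s y + ε • β.smulRight δs)
        (ν := rlog IX EG (fun y => ξ (s y)) y +
          ε • β.smulRight (variationField EG (fun ε y => ξ (S ε y)) y)) ?_ ?_
      · rw [hs.proj_eq y hy] at h
        exact h
      · rw [ContinuousLinearMap.comp_add, hsec]
        ext u
        simp [h1]
      · rw [ContinuousLinearMap.comp_add, rlog_comp (k := ξ) (hT.mdiff_triv hsy)
          (hT.mdiff_section hs hy), ← h2]
        ext u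
        simp
    refine (congrArg (fun f : ℝ → ℝ => deriv f 0) (funext h3)).trans ?_
    exact (hΛ.hasDerivAt_add_smul hy _ _).deriv
  constructor
  · intro H η hη x hx
    obtain ⟨k, hk, hk0, hkη, hkv⟩ := exists_variation (hT.contMDiffOn_triv_section hs) hη
    have hS := hT.exists_sectionVariation hs hk hk0
    have h1 := hT.hasDerivAt_jetEval_variation hinv hΛ hS hx
    have h2 := H _ hS x hx
    rw [key _ hS x hx] at h2
    have h3 := h1.unique h2
    have e1 : ∀ y ∈ U, variationField EG (fun ε y => ξ (B.act (e y) (k ε y))) y = η y := by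
      intro y hy
      rw [← hkv y]
      unfold variationField
      simp only [hT.triv_act _ (hT.sec_mem hy), hT.triv_sec y hy, one_mul]
    have e2 : variationField EG (fun ε y => ξ (B.act (e y) (k ε y))) =ᶠ[𝓝 x] η := by
      filter_upwards [hT.isOpen.mem_nhds hx] with y hy using e1 y hy
    rw [firstVar, e1 x hx, der_congr e2] at h3
    rw [firstVar, h3]
    refine divergence_congr ?_
    filter_upwards [e2] with y hy
    rw [momentumField, momentumField, hy]
  · intro H S hS x hx
    have h1 := hT.hasDerivAt_jetEval_variation hinv hΛ hS hx
    rw [← H _ (contMDiffOn_variationField hT.isOpen (hT.contMDiffOn_triv_variation hS)) x hx,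
      ← key S hS x hx] at h1
    exact h1

end IsTrivialized

end CovariantPrinciples

/-! ### The reduced covariant principles -/

section CovariantReduced

variable
  {EX : Type*} [NormedAddCommGroup EX] [NormedSpace ℝ EX] [FiniteDimensional ℝ EX]
  {HX : Type*} [TopologicalSpace HX] {IX : ModelWithCorners ℝ EX HX} [IX.Boundaryless]
  {X : Type*} [TopologicalSpace X] [ChartedSpace HX X] [IsManifold IX ∞ X]
  {EP : Type*} [NormedAddCommGroup EP] [NormedSpace ℝ EP]
  {HP : Type*} [TopologicalSpace HP] {IP : ModelWithCorners ℝ EP HP}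
  {P : Type*} [TopologicalSpace P] [ChartedSpace HP P] [IsManifold IP ∞ P]
  {EG : Type*} [NormedAddCommGroup EG] [NormedSpace ℝ EG] [FiniteDimensional ℝ EG]
  {G : Type*} [TopologicalSpace G] [ChartedSpace EG G] [Group G] [LieGroup 𝓘(ℝ, EG) ∞ G]
  {B : BundleMaps X P G} {U : Set X} {ξ : P → G} {e : X → P}
  {L : Jet IX IP B → ℝ} {s : X → P}

omit [FiniteDimensional ℝ EG] in
theorem FibreSmooth.hasDerivAt_integral [MeasurableSpace X] [OpensMeasurableSpace X] [T2Space X]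
    {μ : Measure X} [IsFiniteMeasureOnCompacts μ] (hU : IsOpen U) {Λ : X → (EX →L[ℝ] EG) → ℝ}
    (hΛ : FibreSmooth IX U Λ) {A C : X → EX →L[ℝ] EG} (hA : SmoothFormOn IX U A)
    (hC : SmoothFormOn IX U C) {K : Set X} (hK : IsCompact K) (hKU : K ⊆ U) :
    HasDerivAt (fun ε : ℝ => ∫ x in K, Λ x (A x + ε • C x) ∂μ)
      (∫ x in K, fderiv ℝ (Λ x) (A x) (C x) ∂μ) 0 := by
  have h := hasDerivAt_setIntegral (μ := μ) isOpen_univ hU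
    (Φ := fun ε x => Λ x (A x + ε • C x))
    (hΛ.contMDiffOn_add_smul hU hA hC) hK hKU (mem_univ (0 : ℝ))
  rwa [setIntegral_congr_fun hK.measurableSet (fun x hx =>
    (hΛ.hasDerivAt_add_smul (hKU hx) (A x) (C x)).deriv)] at h

namespace IsTrivialized

variable (hT : IsTrivialized IX IP EG B U ξ e)

include hT

theorem Ad_comp_Ad_inv_comp {W : Type*} [NormedAddCommGroup W] [NormedSpace ℝ W] (g : G)
    (T : W →L[ℝ] EG) : (Ad G g).comp ((Ad G g⁻¹).comp T) = T := by
  ext u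
  exact Ad_Ad_inv g (T u)

/-- The reduced variation `∇η - [σ, η]` in the trivialization. -/
theorem Ad_comp_reduced_variation {A : P → EP →L[ℝ] EG}
    (hA : ∀ q ∈ B.part U, A q = (Ad G (ξ q)⁻¹).comp (rlog IP EG ξ q))
    (hs : IsLocalSection IX IP B U s) {f : P → EG} {η : X → EG}
    (hη : ContMDiffOn IX 𝓘(ℝ, EG) ∞ η U)
    (hf : ∀ q ∈ B.part U, f q = Ad G (ξ q)⁻¹ (η (B.proj q))) {p : P} (hp : p ∈ B.part U) :
    (Ad G (ξ p)).comp (covDeriv IX IP B A f p) = der IX 𝓘(ℝ, EG) η (B.proj p) ∧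
    (Ad G (ξ p)).comp ((ad G (f p)).comp (redJetForm IX IP B A s p)) =
      (ad G (η (B.proj p))).comp (rlog IX EG (fun y => ξ (s y)) (B.proj p)) := by
  have hx : B.proj p ∈ U := hp
  constructor
  · have h := hT.covDeriv_eq hp (A := A) (ν := 0) (by
      rw [hA p hp, ContinuousLinearMap.zero_comp, sub_zero])
      ((hη.contMDiffAt (hT.isOpen.mem_nhds hx)).mdifferentiableAt (by simp)) hf
    rw [ContinuousLinearMap.comp_zero, add_zero] at h
    exact (congrArg (fun T : EX →L[ℝ] EG => (Ad G (ξ p)).comp T) h).trans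
      (hT.Ad_comp_Ad_inv_comp _ _)
  · have h := hT.redJetForm_eq hp hA (hT.mdiff_section hs hx) hs.proj_eq
    refine (congrArg (fun T : EX →L[ℝ] EG => (Ad G (ξ p)).comp ((ad G (f p)).comp T)) h).trans ?_
    ext u
    simp only [ContinuousLinearMap.comp_apply]
    rw [Ad_ad, Ad_Ad_inv, hf p hp, Ad_Ad_inv]

/-- The reduced covariant principle is the weak field equation: in the trivialization the variation
`∇η - [σ, η]` becomes `dη + [η, ν]`. -/
theorem covariantReducedPrinciple_iff [MeasurableSpace X] [OpensMeasurableSpace X] [T2Space X]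
    {μ : Measure X} [IsFiniteMeasureOnCompacts μ] {A : P → EP →L[ℝ] EG}
    (hA : ∀ q ∈ B.part U, A q = (Ad G (ξ q)⁻¹).comp (rlog IP EG ξ q))
    (hL : SmoothOnJets IX IP B L) (hinv : Invariant IX IP B L)
    (hs : IsLocalSection IX IP B U s) :
    CovariantReducedPrinciple IX IP B μ (reduce IX IP B L hinv) U A s ↔
      WeakEquation IX G μ U (trivLag IX IP EG B e L) (rlog IX EG (fun y => ξ (s y))) := by
  have hΛ := hT.fibreSmooth_trivLag hL hinv
  set ν := rlog IX EG (fun y => ξ (s y)) with hν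
  have hνs : SmoothFormOn IX U ν := hT.smoothFormOn_rlog_section hs
  have key : ∀ K : Set X, IsCompact K → K ⊆ U → ∀ (f : P → EG) (η : X → EG),
      ContMDiffOn IX 𝓘(ℝ, EG) ∞ η U →
      (∀ q ∈ B.part U, f q = Ad G (ξ q)⁻¹ (η (B.proj q))) →
      HasDerivAt (fun ε : ℝ => ∫ x in K, B.descend (fun p => redEval (reduce IX IP B L hinv) p
      (redJetExt IX IP B s p + ε • (infGen IP B p).comp
        (covDeriv IX IP B A f p + (ad G (f p)).comp (redJetForm IX IP B A s p)))) x ∂μ)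
        (∫ x in K, firstVar IX G (trivLag IX IP EG B e L) ν η x ∂μ) 0 := by
    intro K hK hKU f η hη hf
    have hC := smoothFormOn_firstVar_direction (G := G) hT.isOpen hνs hη
    have h := hΛ.hasDerivAt_integral hT.isOpen (μ := μ) hνs hC hK hKU
    refine h.congr_of_eventuallyEq (Eventually.of_forall fun ε => ?_)
    refine setIntegral_congr_fun hK.measurableSet fun x hx => ?_
    refine hT.descend_eq (hKU hx) fun p hpx => ?_
    have hp : p ∈ B.part U := by change B.proj p ∈ U; rw [hpx]; exact hKU hx
    have h1 := hT.redEval_redJetExt_add hinv hp (hT.mdiff_section hs hp) hs.proj_eq ε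
      ((covDeriv IX IP B A f p : EX →L[ℝ] EG) + (ad G (f p)).comp (redJetForm IX IP B A s p))
    refine h1.trans ?_
    obtain ⟨h2, h3⟩ := hT.Ad_comp_reduced_variation hA hs hη hf hp
    rw [hpx] at h2 h3
    rw [hpx]
    refine congrArg (fun T : EX →L[ℝ] EG => trivLag IX IP EG B e L x (ν x + ε • T)) ?_
    refine (ContinuousLinearMap.comp_add _ _ _).trans ?_
    exact congrArg₂ (fun S T : EX →L[ℝ] EG => S + T) h2 h3
  constructor
  · intro H K hK hKU η hη hη0
    exact ((key K hK hKU _ η hη fun q hq => rfl).unique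
      (H K hK hKU _ (hT.isAdSection hη) (hT.adSection_vanish hη0)))
  · intro H K hK hKU f hf hf0
    have h := key K hK hKU f _ (hT.contMDiffOn_adSection hf) fun q hq => hT.adSection_eq hf hq
    rwa [H K hK hKU _ (hT.contMDiffOn_adSection hf) (hT.vanish_adSection hf0)] at h

/-- The covariant Euler–Poincaré equations are the strong field equation. -/
theorem covariantEulerPoincare_iff {ρ : X → EX → ℝ} {A : P → EP →L[ℝ] EG}
    (hA : ∀ q ∈ B.part U, A q = (Ad G (ξ q)⁻¹).comp (rlog IP EG ξ q))
    (hL : SmoothOnJets IX IP B L) (hinv : Invariant IX IP B L)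
    (hs : IsLocalSection IX IP B U s) :
    CovariantEulerPoincare IX IP B ρ (reduce IX IP B L hinv) U A s ↔
      StrongEquation IX G ρ U (trivLag IX IP EG B e L) (rlog IX EG (fun y => ξ (s y))) := by
  have hΛ := hT.fibreSmooth_trivLag hL hinv
  set ν := rlog IX EG (fun y => ξ (s y)) with hν
  have hfd : ∀ p ∈ B.part U, ∀ ζ : EX →L[ℝ] EG,
      fibreDeriv IX IP B (reduce IX IP B L hinv) s p ζ =
        fderiv ℝ (trivLag IX IP EG B e L (B.proj p)) (ν (B.proj p)) ((Ad G (ξ p)).comp ζ) :=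
    fun p hp ζ => hT.fibreDeriv_eq hinv hΛ hp (hT.mdiff_section hs hp) hs.proj_eq ζ
  have key : ∀ (f : P → EG) (η : X → EG), ContMDiffOn IX 𝓘(ℝ, EG) ∞ η U →
      (∀ q ∈ B.part U, f q = Ad G (ξ q)⁻¹ (η (B.proj q))) → ∀ p ∈ B.part U,
      (divergence IX ρ (fun x => B.descend (fun q => vecOf (EX := EX) (fun β : EX →L[ℝ] ℝ =>
          fibreDeriv IX IP B (reduce IX IP B L hinv) s q (β.smulRight (f q) : EX →L[ℝ] EG))) x)
        (B.proj p) =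
        divergence IX ρ (momentumField (trivLag IX IP EG B e L) ν η) (B.proj p)) ∧
      (- fibreDeriv IX IP B (reduce IX IP B L hinv) s p
          (- (ad G (f p)).comp (redJetForm IX IP B A s p)) +
        fibreDeriv IX IP B (reduce IX IP B L hinv) s p (covDeriv IX IP B A f p) =
        firstVar IX G (trivLag IX IP EG B e L) ν η (B.proj p)) := by
    intro f η hη hf p hp
    constructor
    · refine divergence_congr ?_
      filter_upwards [hT.isOpen.mem_nhds (show B.proj p ∈ U from hp)] with x hx
      refine hT.descend_eq hx fun q hqx => ?_
      have hq : q ∈ B.part U := by change B.proj q ∈ U; rwa [hqx]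
      refine congrArg vecOf (funext fun β => ?_)
      rw [hfd q hq, hqx]
      congr 1
      ext u
      simp only [ContinuousLinearMap.comp_apply, ContinuousLinearMap.smulRight_apply, map_smul]
      rw [hf q hq, Ad_Ad_inv, hqx]
    · obtain ⟨h2, h3⟩ := hT.Ad_comp_reduced_variation hA hs hη hf hp
      have e1 := hfd p hp (covDeriv IX IP B A f p)
      have e2 := hfd p hp (- (ad G (f p)).comp (redJetForm IX IP B A s p))
      refine (congrArg₂ (fun a b : ℝ => -a + b) e2 e1).trans ?_
      have h4 : (Ad G (ξ p)).comp (- (ad G (f p)).comp (redJetForm IX IP B A s p)) =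
          - (ad G (η (B.proj p))).comp (ν (B.proj p)) :=
        (ContinuousLinearMap.comp_neg _ _).trans
          (congrArg (fun T : EX →L[ℝ] EG => -T) h3)
      refine (congrArg₂ (fun S T : EX →L[ℝ] EG =>
        - fderiv ℝ (trivLag IX IP EG B e L (B.proj p)) (ν (B.proj p)) S +
          fderiv ℝ (trivLag IX IP EG B e L (B.proj p)) (ν (B.proj p)) T) h4 h2).trans ?_
      simp only [firstVar]
      rw [map_neg, neg_neg, map_add, add_comm]
  constructor
  · intro H η hη x hx
    have h := H _ (hT.isAdSection hη) (e x) (hT.sec_mem hx)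
    have hk := key (fun p => Ad G (ξ p)⁻¹ (η (B.proj p))) η hη (fun q hq => rfl) (e x)
      (hT.sec_mem hx)
    have := (hk.1.symm.trans h).trans hk.2
    rwa [hT.proj_sec x hx] at this
  · intro H f hf p hp
    have hk := key f _ (hT.contMDiffOn_adSection hf) (fun q hq => hT.adSection_eq hf hq) p hp
    exact (hk.1.trans (H _ (hT.contMDiffOn_adSection hf) _ hp)).trans hk.2.symm

end IsTrivialized

end CovariantReduced

/-! ### The bundle over space-time -/

section JoinForm

variable {E F : Type*} [NormedAddCommGroup E] [NormedSpace ℝ E] [NormedAddCommGroup F]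
  [NormedSpace ℝ F]

/-- The linear map `(v, u) ↦ v α + ν(u)`. -/
def joinForm (α : F) (ν : E →L[ℝ] F) : ℝ × E →L[ℝ] F :=
  (ContinuousLinearMap.fst ℝ ℝ E).smulRight α + ν.comp (ContinuousLinearMap.snd ℝ ℝ E)

@[simp] theorem joinForm_apply (α : F) (ν : E →L[ℝ] F) (w : ℝ × E) :
    joinForm α ν w = w.1 • α + ν w.2 := rfl

theorem joinForm_add_smul (α α' : F) (ν ν' : E →L[ℝ] F) (ε : ℝ) :
    joinForm (α + ε • α') (ν + ε • ν') = joinForm α ν + ε • joinForm α' ν' := by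
  ext <;> simp

theorem joinForm_decomp (A : ℝ × E →L[ℝ] F) :
    joinForm (A (1, 0)) (A.comp (ContinuousLinearMap.inr ℝ ℝ E)) = A := by
  refine ContinuousLinearMap.ext fun w => ?_
  rw [joinForm_apply, ← map_smul, ContinuousLinearMap.comp_apply, ContinuousLinearMap.inr_apply,
    ← map_add]
  simp

end JoinForm

theorem locInv_spec {P : Type*} {S : Set P} {φ : P → P} (hφ : SurjOn φ S S) {q : P}
    (hq : q ∈ S) : locInv S φ q ∈ S ∧ φ (locInv S φ q) = q := by
  have hex : ∃ p, p ∈ S ∧ φ p = q := hφ hq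
  rw [locInv, dif_pos hex]
  exact hex.choose_spec

section TimesLine

variable
  {EX : Type*} [NormedAddCommGroup EX] [NormedSpace ℝ EX]
  {HX : Type*} [TopologicalSpace HX] {IX : ModelWithCorners ℝ EX HX}
  {X : Type*} [TopologicalSpace X] [ChartedSpace HX X] [IsManifold IX ∞ X]
  {EP : Type*} [NormedAddCommGroup EP] [NormedSpace ℝ EP]
  {HP : Type*} [TopologicalSpace HP] {IP : ModelWithCorners ℝ EP HP}
  {P : Type*} [TopologicalSpace P] [ChartedSpace HP P] [IsManifold IP ∞ P]
  {EG : Type*} [NormedAddCommGroup EG] [NormedSpace ℝ EG]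
  {G : Type*} [TopologicalSpace G] [ChartedSpace EG G] [Group G] [LieGroup 𝓘(ℝ, EG) ∞ G]
  {B : BundleMaps X P G} {V : Set X} {ξ : P → G} {e : X → P} {J : Set ℝ}

theorem der_prod_eq_joinForm {F : Type*} [NormedAddCommGroup F] [NormedSpace ℝ F]
    {f : ℝ × X → F} {x : ℝ × X} (hf : MDifferentiableAt (𝓘(ℝ, ℝ).prod IX) 𝓘(ℝ, F) f x) :
    der (𝓘(ℝ, ℝ).prod IX) 𝓘(ℝ, F) f x =
      joinForm (deriv (fun t => f (t, x.2)) x.1) (der IX 𝓘(ℝ, F) (fun y => f (x.1, y)) x.2) := by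
  refine ContinuousLinearMap.ext fun v => ?_
  rw [der_prod_apply hf, der_eq_fderiv, joinForm_apply]
  congr 1
  rw [← fderiv_apply_one_eq_deriv, ← map_smul, smul_eq_mul, mul_one]

/-- The logarithmic derivative on space-time, split into its time and space components. -/
theorem rlog_prod_eq_joinForm {f : ℝ × X → G} {x : ℝ × X}
    (hf : MDifferentiableAt (𝓘(ℝ, ℝ).prod IX) 𝓘(ℝ, EG) f x) :
    rlog (𝓘(ℝ, ℝ).prod IX) EG f x =
      joinForm (rlog 𝓘(ℝ, ℝ) EG (fun t => f (t, x.2)) x.1 1)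
        (rlog IX EG (fun y => f (x.1, y)) x.2) := by
  refine ContinuousLinearMap.ext fun v => ?_
  rw [rlog, der_prod_apply (MDiffAt.mul_const hf _), joinForm_apply]
  congr 1
  rw [← map_smul, smul_eq_mul, mul_one]
  rfl

namespace IsTrivialized

variable (hT : IsTrivialized IX IP EG B V ξ e)

include hT

/-- A trivialization of `P` over `V` induces one of `ℝ × P` over `J × V`. -/
theorem timesLine (hJ : IsOpen J) :
    IsTrivialized (𝓘(ℝ, ℝ).prod IX) (𝓘(ℝ, ℝ).prod IP) EG B.timesLine (J ×ˢ V)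
      (fun q => ξ q.2) (fun x => (x.1, e x.2)) where
  isOpen := hJ.prod hT.isOpen
  smooth_proj := contMDiff_fst.prodMk (hT.smooth_proj.comp contMDiff_snd)
  smooth_act := (contMDiff_fst.comp contMDiff_fst).prodMk
    (hT.smooth_act.comp (f := fun z : (ℝ × P) × G => (z.1.2, z.2))
      ((contMDiff_snd.comp contMDiff_fst).prodMk contMDiff_snd))
  act_one := fun q => Prod.ext rfl (hT.act_one q.2)
  act_mul := fun q g h => Prod.ext rfl (hT.act_mul q.2 g h)
  proj_act := fun q g => Prod.ext rfl (hT.proj_act q.2 g)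
  smooth_triv := hT.smooth_triv.comp contMDiffOn_snd fun _ hq => hq.2
  triv_act := fun q hq g => hT.triv_act q.2 hq.2 g
  smooth_sec := contMDiffOn_fst.prodMk (hT.smooth_sec.comp contMDiffOn_snd fun _ hx => hx.2)
  proj_sec := fun x hx => Prod.ext rfl (hT.proj_sec x.2 hx.2)
  triv_sec := fun x hx => hT.triv_sec x.2 hx.2
  act_sec := fun q hq => Prod.ext rfl (hT.act_sec q.2 hq.2)

theorem rlog_snd {q : ℝ × P} (hq : q.2 ∈ B.part V) :
    rlog (𝓘(ℝ, ℝ).prod IP) EG (fun q : ℝ × P => ξ q.2) q =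
      (rlog IP EG ξ q.2).comp (ContinuousLinearMap.snd ℝ ℝ EP) := by
  rw [rlog_comp (I := 𝓘(ℝ, ℝ).prod IP) (f := fun q : ℝ × P => q.2) (hT.mdiff_triv hq)
    mdifferentiableAt_snd, der_snd]

theorem der_timesLine_proj (q : ℝ × P) :
    der (𝓘(ℝ, ℝ).prod IP) (𝓘(ℝ, ℝ).prod IX) B.timesLine.proj q =
      (ContinuousLinearMap.fst ℝ ℝ EP).prod
        ((der IP IX B.proj q.2).comp (ContinuousLinearMap.snd ℝ ℝ EP)) := by
  have h1 : MDifferentiableAt (𝓘(ℝ, ℝ).prod IP) IX (fun q : ℝ × P => B.proj q.2) q :=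
    MDifferentiableAt.comp q (g := B.proj) (hT.mdiff_proj q.2) mdifferentiableAt_snd
  have h := der_prodMk (I := 𝓘(ℝ, ℝ).prod IP) (I' := 𝓘(ℝ, ℝ)) (f := fun q : ℝ × P => q.1)
    mdifferentiableAt_fst h1
  rw [der_fst, der_comp (g := B.proj) (f := fun q : ℝ × P => q.2) (hT.mdiff_proj q.2)
    mdifferentiableAt_snd, der_snd] at h
  exact h

variable {L : Jet (𝓘(ℝ, ℝ).prod IX) (𝓘(ℝ, ℝ).prod IP) B.timesLine → ℝ}

/-- The Lagrangian at the jet with components `a` and `γ`. -/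
theorem jetEval_splitJet (hJ : IsOpen J)
    (hinv : Invariant (𝓘(ℝ, ℝ).prod IX) (𝓘(ℝ, ℝ).prod IP) B.timesLine L) {t : ℝ} (ht : t ∈ J)
    {p : P} (hp : p ∈ B.part V) {a : EP} (ha : der IP IX B.proj p a = 0) {γ : EX →L[ℝ] EP}
    (hγ : (der IP IX B.proj p).comp γ = ContinuousLinearMap.id ℝ EX)
    {α : EG} (hα : rlog IP EG ξ p a = α) {ν : EX →L[ℝ] EG} (hν : (rlog IP EG ξ p).comp γ = ν) :
    jetEval L (t, p) (splitJet IX IP B p a γ) =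
      trivLag (𝓘(ℝ, ℝ).prod IX) (𝓘(ℝ, ℝ).prod IP) EG B.timesLine (fun x => (x.1, e x.2)) L
        (t, B.proj p) (joinForm α ν) := by
  refine (hT.timesLine hJ).jetEval_eq hinv (p := (t, p)) ⟨ht, hp⟩
    (γ := splitJet IX IP B p a γ) ?_ ?_
  · rw [hT.der_timesLine_proj]
    refine ContinuousLinearMap.ext fun w => ?_
    refine Prod.ext rfl ?_
    change der IP IX B.proj p (w.1 • a + γ w.2) = w.2
    rw [map_add, map_smul, ha, smul_zero, zero_add]
    exact congrArg (fun T : EX →L[ℝ] EX => T w.2) hγ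
  · rw [hT.rlog_snd (q := (t, p)) hp]
    refine ContinuousLinearMap.ext fun w => ?_
    change rlog IP EG ξ p (w.1 • a + γ w.2) = _
    rw [map_add, map_smul, hα, joinForm_apply, ← hν]
    rfl

theorem timesLineConnection_eq {A : P → EP →L[ℝ] EG}
    (hA : ∀ p ∈ B.part V, A p = (Ad G (ξ p)⁻¹).comp (rlog IP EG ξ p)) :
    ∀ q ∈ B.timesLine.part (J ×ˢ V), timesLineConnection IP A q =
      (Ad G (ξ q.2)⁻¹).comp (rlog (𝓘(ℝ, ℝ).prod IP) EG (fun q : ℝ × P => ξ q.2) q) := by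
  intro q hq
  rw [hT.rlog_snd hq.2, ← ContinuousLinearMap.comp_assoc, ← hA q.2 hq.2]
  rfl

/-! ### Gauge transformations in a trivialization -/

omit [LieGroup 𝓘(ℝ, EG) ∞ G] in
theorem gauge_mem {φ : P → P} (hφ : IsGauge IP B V φ) {p : P} (hp : p ∈ B.part V) :
    φ p ∈ B.part V := hφ.bijOn.mapsTo hp

omit [LieGroup 𝓘(ℝ, EG) ∞ G] in
/-- In the trivialization a gauge transformation is left multiplication by its values on the unit
section. -/
theorem triv_gauge {φ : P → P} (hφ : IsGauge IP B V φ) {p : P} (hp : p ∈ B.part V) :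
    ξ (φ p) = ξ (φ (e (B.proj p))) * ξ p := by
  have hx : B.proj p ∈ V := hp
  have h0 := hT.proj_sec _ hx
  have hep : e (B.proj p) ∈ B.part V := by
    change B.proj (e (B.proj p)) ∈ V; rwa [h0]
  conv_lhs => rw [← hT.act_sec p hp]
  rw [hφ.equivariant _ hep, hT.triv_act _ (hφ.bijOn.mapsTo hep)]

/-- The push-forward of the flat connection by a gauge transformation. -/
theorem pushForm_eq {Γ : P → EP →L[ℝ] EG}
    (hΓ : ∀ p ∈ B.part V, Γ p = (Ad G (ξ p)⁻¹).comp (rlog IP EG ξ p))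
    {φ : P → P} (hφ : IsGauge IP B V φ) {q : P} (hq : q ∈ B.part V) :
    pushForm IP B V φ Γ q = (Ad G (ξ q)⁻¹).comp (rlog IP EG ξ q -
      (rlog IX EG (fun x => ξ (φ (e x))) (B.proj q)).comp (der IP IX B.proj q)) := by
  have hx : B.proj q ∈ V := hq
  set ψ := locInv (B.part V) φ with hψ
  have hψq := locInv_spec hφ.bijOn.surjOn hq
  have hpr : B.proj (ψ q) = B.proj q := by
    rw [← hφ.proj_eq _ hψq.1, hψq.2]
  have hψd : MDifferentiableAt IP IP ψ q :=
    (hφ.smooth_inv.contMDiffAt (hT.isOpen_part.mem_nhds hq)).mdifferentiableAt (by simp)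
  have hkd : MDifferentiableAt IX 𝓘(ℝ, EG) (fun x => ξ (φ (e x))) (B.proj q) := by
    have h1 : ContMDiffOn IX 𝓘(ℝ, EG) ∞ (fun x => ξ (φ (e x))) V :=
      hT.smooth_triv.comp (hφ.smooth.comp hT.smooth_sec fun x hx => hT.sec_mem hx)
        fun x hx => hφ.bijOn.mapsTo (hT.sec_mem hx)
    exact (h1.contMDiffAt (hT.isOpen.mem_nhds hx)).mdifferentiableAt (by simp)
  have hξψ : MDifferentiableAt IP 𝓘(ℝ, EG) (fun r => ξ (ψ r)) q :=
    MDifferentiableAt.comp q (g := ξ) (hT.mdiff_triv hψq.1) hψd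
  have hkπ : MDifferentiableAt IP 𝓘(ℝ, EG) (fun r => ξ (φ (e (B.proj r)))) q :=
    MDifferentiableAt.comp q (g := fun x => ξ (φ (e x))) hkd (hT.mdiff_proj q)
  -- With `k = ξ ∘ φ ∘ e` the trivialization factors as `ξ = (k ∘ proj) (ξ ∘ φ⁻¹)`.
  have hfac : ∀ r ∈ B.part V, ξ r = ξ (φ (e (B.proj r))) * ξ (ψ r) := by
    intro r hr
    have h := locInv_spec hφ.bijOn.surjOn hr
    have h2 := hT.triv_gauge hφ h.1
    rw [h.2, ← hφ.proj_eq _ h.1, h.2] at h2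
    exact h2
  have h1 : rlog IP EG ξ q = (rlog IX EG (fun x => ξ (φ (e x))) (B.proj q)).comp
      (der IP IX B.proj q) + (Ad G (ξ (φ (e (B.proj q))))).comp
        ((rlog IP EG ξ (ψ q)).comp (der IP IP ψ q)) := by
    rw [← rlog_comp (k := fun x => ξ (φ (e x))) hkd (hT.mdiff_proj q),
      ← rlog_comp (k := ξ) (hT.mdiff_triv hψq.1) hψd, ← rlog_mul hkπ hξψ]
    exact rlog_congr (by filter_upwards [hT.isOpen_part.mem_nhds hq] with r hr using hfac r hr)
  have h2 : pushForm IP B V φ Γ q = (Γ (ψ q)).comp (der IP IP ψ q) := rfl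
  rw [h2, hΓ _ hψq.1, h1, hfac q hq, add_sub_cancel_left, mul_inv_rev, Ad_mul,
    ContinuousLinearMap.comp_assoc, ContinuousLinearMap.comp_assoc]
  congr 1
  ext v
  simp only [ContinuousLinearMap.comp_apply]
  rw [Ad_inv_Ad]

omit [LieGroup 𝓘(ℝ, EG) ∞ G] in
theorem mdiff_curve (hJ : IsOpen J) {φ : ℝ → P → P}
    (hφ : ContMDiffOn (𝓘(ℝ, ℝ).prod IP) IP ∞ (fun z : ℝ × P => φ z.1 z.2) (J ×ˢ B.part V))
    {t : ℝ} (ht : t ∈ J) {p : P} (hp : p ∈ B.part V) :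
    MDifferentiableAt 𝓘(ℝ, ℝ) IP (fun τ => φ τ p) t := by
  have hop : IsOpen (B.part V) := hT.isOpen.preimage hT.smooth_proj.continuous
  have h := hφ.contMDiffAt ((hJ.prod hop).mem_nhds (x := (t, p)) ⟨ht, hp⟩)
  exact (ContMDiffAt.comp t (g := fun z : ℝ × P => φ z.1 z.2) (f := fun τ => (τ, p)) h
    (contMDiffAt_id.prodMk contMDiffAt_const)).mdifferentiableAt (by simp)

/-- The velocity of a curve of gauge transformations in the trivialization. -/
theorem velocity_spec (hJ : IsOpen J) {φ : ℝ → P → P}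
    (hφ : ContMDiffOn (𝓘(ℝ, ℝ).prod IP) IP ∞ (fun z : ℝ × P => φ z.1 z.2) (J ×ˢ B.part V))
    (hg : ∀ t ∈ J, IsGauge IP B V (φ t)) {t : ℝ} (ht : t ∈ J) {p : P} (hp : p ∈ B.part V) :
    der IP IX B.proj (φ t p) (velocity IP φ t p) = 0 ∧
      rlog IP EG ξ (φ t p) (velocity IP φ t p) =
        rlog 𝓘(ℝ, ℝ) EG (fun τ => ξ (φ τ (e (B.proj p)))) t 1 := by
  have hx : B.proj p ∈ V := hp
  have hd := hT.mdiff_curve hJ hφ ht hp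
  have hd' := hT.mdiff_curve hJ hφ ht (hT.sec_mem hx)
  have hv : velocity IP φ t p = der 𝓘(ℝ, ℝ) IP (fun τ => φ τ p) t 1 := rfl
  constructor
  · have h := der_comp (g := B.proj) (f := fun τ => φ τ p) (x := t) (hT.mdiff_proj _) hd
    have h2 : der 𝓘(ℝ, ℝ) IX (fun τ => B.proj (φ τ p)) t = 0 := by
      rw [← der_const (I := 𝓘(ℝ, ℝ)) (I' := IX) (B.proj p) t]
      exact der_congr (by filter_upwards [hJ.mem_nhds ht] with τ hτ using (hg τ hτ).proj_eq p hp)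
    rw [h2] at h
    exact (congrArg (fun T : ℝ →L[ℝ] EX => T 1) h).symm
  · have h := rlog_comp (k := ξ) (f := fun τ => φ τ p) (x := t)
      (hT.mdiff_triv (hT.gauge_mem (hg t ht) hp)) hd
    have h2 : rlog 𝓘(ℝ, ℝ) EG (fun τ => ξ (φ τ p)) t =
        rlog 𝓘(ℝ, ℝ) EG (fun τ => ξ (φ τ (e (B.proj p)))) t := by
      have hk : MDifferentiableAt 𝓘(ℝ, ℝ) 𝓘(ℝ, EG) (fun τ => ξ (φ τ (e (B.proj p)))) t :=
        MDifferentiableAt.comp t (g := ξ)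
          (hT.mdiff_triv (hT.gauge_mem (hg t ht) (hT.sec_mem hx))) hd'
      rw [← rlog_mul_const hk (ξ p)]
      exact rlog_congr (by
        filter_upwards [hJ.mem_nhds ht] with τ hτ using hT.triv_gauge (hg τ hτ) hp)
    rw [← h2, h]
    rfl

/-- Maps into the group act as gauge transformations. -/
theorem isGauge {k : X → G} (hk : ContMDiffOn IX 𝓘(ℝ, EG) ∞ k V) :
    IsGauge IP B V (fun p => B.act (e (B.proj p)) (k (B.proj p) * ξ p)) := by
  have hsm : ∀ k : X → G, ContMDiffOn IX 𝓘(ℝ, EG) ∞ k V →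
      ContMDiffOn IP IP ∞ (fun p => B.act (e (B.proj p)) (k (B.proj p) * ξ p)) (B.part V) := by
    intro k hk
    have h1 : ContMDiffOn IP 𝓘(ℝ, EG) ∞ (fun p => k (B.proj p)) (B.part V) :=
      hk.comp hT.smooth_proj.contMDiffOn fun p hp => hp
    have h2 : ContMDiffOn IP IP ∞ (fun p => e (B.proj p)) (B.part V) :=
      hT.smooth_sec.comp hT.smooth_proj.contMDiffOn fun p hp => hp
    exact hT.smooth_act.comp_contMDiffOn (h2.prodMk (h1.mul hT.smooth_triv))
  have hpr : ∀ (k : X → G), ∀ p ∈ B.part V,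
      B.proj (B.act (e (B.proj p)) (k (B.proj p) * ξ p)) = B.proj p := fun k p hp => by
    rw [hT.proj_act, hT.proj_sec _ hp]
  have htr : ∀ (k : X → G), ∀ p ∈ B.part V,
      ξ (B.act (e (B.proj p)) (k (B.proj p) * ξ p)) = k (B.proj p) * ξ p := fun k p hp => by
    rw [hT.triv_act _ (hT.sec_mem hp), hT.triv_sec _ hp, one_mul]
  have hmem : ∀ (k : X → G), ∀ p ∈ B.part V,
      B.act (e (B.proj p)) (k (B.proj p) * ξ p) ∈ B.part V := fun k p hp =>
    hT.act_mem (hT.sec_mem hp) _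
  have hinj : InjOn (fun p => B.act (e (B.proj p)) (k (B.proj p) * ξ p)) (B.part V) := by
    intro p hp q hq h
    have h1 := congrArg B.proj h
    have h2 := congrArg ξ h
    simp only at h1 h2
    rw [hpr k p hp, hpr k q hq] at h1
    rw [htr k p hp, htr k q hq, h1] at h2
    exact hT.eq_of_proj_of_triv hp hq h1 (mul_left_cancel h2)
  have hright : ∀ q ∈ B.part V, B.act (e (B.proj q)) ((k (B.proj q))⁻¹ * ξ q) ∈ B.part V ∧
      (fun p => B.act (e (B.proj p)) (k (B.proj p) * ξ p))
        (B.act (e (B.proj q)) ((k (B.proj q))⁻¹ * ξ q)) = q := by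
    intro q hq
    refine ⟨hmem (fun x => (k x)⁻¹) q hq, ?_⟩
    have h1 := htr (fun x => (k x)⁻¹) q hq
    have h2 := hpr (fun x => (k x)⁻¹) q hq
    simp only at h1 h2 ⊢
    rw [h2, h1, mul_inv_cancel_left, hT.act_sec q hq]
  have hbij : BijOn (fun p => B.act (e (B.proj p)) (k (B.proj p) * ξ p)) (B.part V) (B.part V) :=
    ⟨fun p hp => hmem k p hp, hinj, fun q hq => ⟨_, hright q hq⟩⟩
  refine ⟨hsm k hk, hpr k, ?_, hbij, ?_⟩
  · intro p hp g
    rw [hT.proj_act, hT.triv_act p hp, ← mul_assoc, hT.act_mul]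
  · refine (hsm (fun x => (k x)⁻¹) hk.inv).congr fun q hq => ?_
    have hex : ∃ p, p ∈ B.part V ∧ (fun p => B.act (e (B.proj p)) (k (B.proj p) * ξ p)) p = q :=
      ⟨_, hright q hq⟩
    rw [locInv, dif_pos hex]
    exact hinj hex.choose_spec.1 (hright q hq).1 (hex.choose_spec.2.trans (hright q hq).2.symm)

end IsTrivialized

end TimesLine

/-! ### Iterated integrals, the endpoint and evolution equations -/

section SliceIntegrals

variable
  {EX : Type*} [NormedAddCommGroup EX] [NormedSpace ℝ EX]
  {HX : Type*} [TopologicalSpace HX] {IX : ModelWithCorners ℝ EX HX}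
  {X : Type*} [TopologicalSpace X] [ChartedSpace HX X] [IsManifold IX ∞ X]
  [MeasurableSpace X] [OpensMeasurableSpace X] [T2Space X]
  {μ : Measure X} [IsFiniteMeasureOnCompacts μ] [SFinite μ]

omit [IsManifold IX ∞ X] in
theorem intervalIntegral_setIntegral_eq {f : ℝ × X → ℝ} {t₁ t₂ : ℝ} (h : t₁ ≤ t₂) {K : Set X}
    (hK : IsCompact K) (hf : ContinuousOn f (Icc t₁ t₂ ×ˢ K)) :
    ∫ t in t₁..t₂, ∫ m in K, f (t, m) ∂μ =
      ∫ x in Icc t₁ t₂ ×ˢ K, f x ∂((volume : Measure ℝ).prod μ) := by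
  rw [intervalIntegral.integral_of_le h, ← integral_Icc_eq_integral_Ioc, setIntegral_prod]
  exact hf.integrableOn_compact (isCompact_Icc.prod hK)

/-- Differentiation under the iterated integral. -/
theorem hasDerivAt_intervalIntegral {T : Set ℝ} (hT : IsOpen T) {J : Set ℝ} (hJ : IsOpen J)
    {V : Set X} (hV : IsOpen V) {Φ : ℝ → ℝ × X → ℝ}
    (hΦ : ContMDiffOn (𝓘(ℝ, ℝ).prod (𝓘(ℝ, ℝ).prod IX)) 𝓘(ℝ, ℝ) ∞
      (fun z : ℝ × ℝ × X => Φ z.1 z.2) (T ×ˢ (J ×ˢ V)))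
    {t₁ t₂ : ℝ} (h : t₁ ≤ t₂) (hJt : Icc t₁ t₂ ⊆ J) {K : Set X} (hK : IsCompact K) (hKV : K ⊆ V)
    {ε : ℝ} (hε : ε ∈ T) :
    HasDerivAt (fun ε => ∫ t in t₁..t₂, ∫ m in K, Φ ε (t, m) ∂μ)
      (∫ t in t₁..t₂, ∫ m in K, deriv (fun ε => Φ ε (t, m)) ε ∂μ) ε := by
  have hsub : Icc t₁ t₂ ×ˢ K ⊆ J ×ˢ V := prod_mono hJt hKV
  have hcont : ∀ ε ∈ T, ContinuousOn (Φ ε) (Icc t₁ t₂ ×ˢ K) := fun ε hε =>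
    hΦ.continuousOn.comp (f := fun x => (ε, x)) (by fun_prop) (fun x hx => ⟨hε, hsub hx⟩)
  have hdcont : ContinuousOn (fun x => deriv (fun ε => Φ ε x) ε) (Icc t₁ t₂ ×ˢ K) :=
    (contMDiffOn_deriv_left hT (hJ.prod hV) hΦ).continuousOn.comp (f := fun x => (ε, x))
      (by fun_prop) (fun x hx => ⟨hε, hsub hx⟩)
  have h1 := hasDerivAt_setIntegral (μ := (volume : Measure ℝ).prod μ) hT (hJ.prod hV) hΦ
    (isCompact_Icc.prod hK) hsub hε
  rw [← intervalIntegral_setIntegral_eq h hK hdcont] at h1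
  refine h1.congr_of_eventuallyEq ?_
  filter_upwards [hT.mem_nhds hε] with ε' hε'
  exact intervalIntegral_setIntegral_eq h hK (hcont ε' hε')

end SliceIntegrals

section Equations

variable
  {EX : Type*} [NormedAddCommGroup EX] [NormedSpace ℝ EX]
  {HX : Type*} [TopologicalSpace HX] (IX : ModelWithCorners ℝ EX HX)
  {X : Type*} [TopologicalSpace X] [ChartedSpace HX X] [MeasurableSpace X]
  {EG : Type*} [NormedAddCommGroup EG] [NormedSpace ℝ EG] [FiniteDimensional ℝ EG]
  (G : Type*) [TopologicalSpace G] [ChartedSpace EG G] [Group G] [LieGroup 𝓘(ℝ, EG) ∞ G]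

/-- Stationarity of the action for variations which vanish at the endpoints of a time interval and
outside a compact set of space. -/
def EndpointEquation (μ : Measure X) (J : Set ℝ) (V : Set X)
    (Λ : ℝ × X → (ℝ × EX →L[ℝ] EG) → ℝ) (ν : ℝ × X → ℝ × EX →L[ℝ] EG) : Prop :=
  ∀ t₁ t₂ : ℝ, t₁ < t₂ → Icc t₁ t₂ ⊆ J → ∀ K : Set X, IsCompact K → K ⊆ V → ∀ η : ℝ × X → EG,
    ContMDiffOn (𝓘(ℝ, ℝ).prod IX) 𝓘(ℝ, EG) ∞ η (J ×ˢ V) →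
    (∀ t ∈ J, ∀ m ∈ V \ K, η (t, m) = 0) → (∀ m ∈ V, η (t₁, m) = 0 ∧ η (t₂, m) = 0) →
    ∫ t in t₁..t₂, ∫ m in K, firstVar (𝓘(ℝ, ℝ).prod IX) G Λ ν η (t, m) ∂μ = 0

/-- The evolution equation of the momentum `η ↦ ∫ w(dt ⊗ η) dμ`, where `w` is the fibre derivative
of `Λ` along `ν`. -/
def EvolutionEquation (μ : Measure X) (J : Set ℝ) (V : Set X)
    (Λ : ℝ × X → (ℝ × EX →L[ℝ] EG) → ℝ) (ν : ℝ × X → ℝ × EX →L[ℝ] EG) : Prop :=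
  ∀ K : Set X, IsCompact K → K ⊆ V → ∀ η : ℝ × X → EG,
    ContMDiffOn (𝓘(ℝ, ℝ).prod IX) 𝓘(ℝ, EG) ∞ η (J ×ˢ V) →
    (∀ t ∈ J, ∀ m ∈ V \ K, η (t, m) = 0) → ∀ t ∈ J,
    HasDerivAt (fun τ => ∫ m in K, fderiv ℝ (Λ (τ, m)) (ν (τ, m)) (joinForm (η (τ, m)) 0) ∂μ)
      (∫ m in K, firstVar (𝓘(ℝ, ℝ).prod IX) G Λ ν η (t, m) ∂μ) t

end Equations

section Families

variable
  {EX : Type*} [NormedAddCommGroup EX] [NormedSpace ℝ EX] [FiniteDimensional ℝ EX]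
  {HX : Type*} [TopologicalSpace HX] {IX : ModelWithCorners ℝ EX HX} [IX.Boundaryless]
  {X : Type*} [TopologicalSpace X] [ChartedSpace HX X] [IsManifold IX ∞ X]
  {EP : Type*} [NormedAddCommGroup EP] [NormedSpace ℝ EP]
  {HP : Type*} [TopologicalSpace HP] {IP : ModelWithCorners ℝ EP HP}
  {P : Type*} [TopologicalSpace P] [ChartedSpace HP P] [IsManifold IP ∞ P]
  {EG : Type*} [NormedAddCommGroup EG] [NormedSpace ℝ EG] [FiniteDimensional ℝ EG]
  {G : Type*} [TopologicalSpace G] [ChartedSpace EG G] [Group G] [LieGroup 𝓘(ℝ, EG) ∞ G]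
  {B : BundleMaps X P G} {U : Set X} {ξ : P → G} {e : X → P}
  {L : Jet IX IP B → ℝ}

namespace IsTrivialized

variable (hT : IsTrivialized IX IP EG B U ξ e)

include hT

theorem contMDiffOn_trivLag_rlog (hL : SmoothOnJets IX IP B L) (hinv : Invariant IX IP B L)
    {k : ℝ → X → G}
    (hk : ContMDiffOn (𝓘(ℝ, ℝ).prod IX) 𝓘(ℝ, EG) ∞ (fun z : ℝ × X => k z.1 z.2) (univ ×ˢ U)) :
    ContMDiffOn (𝓘(ℝ, ℝ).prod IX) 𝓘(ℝ, ℝ) ∞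
      (fun z : ℝ × X => trivLag IX IP EG B e L z.2 (rlog IX EG (k z.1) z.2)) (univ ×ˢ U) := by
  have hS : IsSectionVariation IX IP B U (fun x => B.act (e x) (k 0 x))
      (fun ε x => B.act (e x) (k ε x)) :=
    ⟨hT.smooth_act.comp_contMDiffOn
      ((hT.smooth_sec.comp contMDiffOn_snd fun _ hz => hz.2).prodMk hk),
      fun ε x hx => by rw [hT.proj_act, hT.proj_sec x hx], fun x _ => rfl⟩
  refine (hT.contMDiffOn_jetEval_variation hL hS).congr ?_
  rintro ⟨ε, x⟩ ⟨-, hx⟩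
  refine Eq.trans ?_ (hT.jetEval_section (S := fun x => B.act (e x) (k ε x)) hinv hx
    (hT.mdiff_variation hS ε hx)
    (by filter_upwards [hT.isOpen.mem_nhds hx] with y hy using hS.proj_eq ε y hy)).symm
  refine congrArg (trivLag IX IP EG B e L x) (rlog_congr ?_)
  filter_upwards [hT.isOpen.mem_nhds hx] with y hy
  rw [hT.triv_act _ (hT.sec_mem hy), hT.triv_sec y hy, one_mul]

end IsTrivialized

/-- The derivative of `Λ` along a variation of a map into the group is the first variation in the
direction of its velocity. -/
theorem hasDerivAt_rlog_variation {Λ : X → (EX →L[ℝ] EG) → ℝ} (hU : IsOpen U)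
    (hΛ : FibreSmooth IX U Λ) {k : ℝ → X → G} {h : X → G}
    (hk : ContMDiffOn (𝓘(ℝ, ℝ).prod IX) 𝓘(ℝ, EG) ∞ (fun z : ℝ × X => k z.1 z.2) (univ ×ˢ U))
    (hk0 : ∀ x ∈ U, k 0 x = h x) {x : X} (hx : x ∈ U) :
    HasDerivAt (fun ε => Λ x (rlog IX EG (k ε) x))
      (firstVar IX G Λ (rlog IX EG h) (variationField EG k) x) 0 := by
  have h2 := hasDerivAt_rlog (h := k)
    (hk.contMDiffAt ((isOpen_univ.prod hU).mem_nhds (x := (0, x)) ⟨mem_univ _, hx⟩))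
  have h3 := hΛ.hasDerivAt hx h2
  have h4 : rlog IX EG (k 0) x = rlog IX EG h x :=
    rlog_congr (by filter_upwards [hU.mem_nhds hx] with y hy using hk0 y hy)
  rw [h4] at h3
  exact h3

end Families

section Dynamic

variable
  {EX : Type*} [NormedAddCommGroup EX] [NormedSpace ℝ EX]
  {HX : Type*} [TopologicalSpace HX] {IX : ModelWithCorners ℝ EX HX}
  {X : Type*} [TopologicalSpace X] [ChartedSpace HX X] [IsManifold IX ∞ X]
  {EP : Type*} [NormedAddCommGroup EP] [NormedSpace ℝ EP]
  {HP : Type*} [TopologicalSpace HP] {IP : ModelWithCorners ℝ EP HP}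
  {P : Type*} [TopologicalSpace P] [ChartedSpace HP P] [IsManifold IP ∞ P]
  {EG : Type*} [NormedAddCommGroup EG] [NormedSpace ℝ EG] [FiniteDimensional ℝ EG]
  {G : Type*} [TopologicalSpace G] [ChartedSpace EG G] [Group G] [LieGroup 𝓘(ℝ, EG) ∞ G]
  {B : BundleMaps X P G} {V : Set X} {ξ : P → G} {e : X → P} {J : Set ℝ}

omit [LieGroup 𝓘(ℝ, EG) ∞ G] [FiniteDimensional ℝ EG] [IsManifold IX ∞ X] [IsManifold IP ∞ P] in
theorem IsGauge.congr {φ ψ : P → P} (h : IsGauge IP B V φ) (hact : ∀ p g, B.proj (B.act p g) = B.proj p)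
    (he : ∀ p ∈ B.part V, ψ p = φ p) : IsGauge IP B V ψ := by
  have hbij : BijOn ψ (B.part V) (B.part V) := h.bijOn.congr fun p hp => (he p hp).symm
  refine ⟨h.smooth.congr he, fun p hp => by rw [he p hp, h.proj_eq p hp], fun p hp g => ?_, hbij, ?_⟩
  · have : B.act p g ∈ B.part V := by change B.proj (B.act p g) ∈ V; rwa [hact]
    rw [he p hp, he _ this, h.equivariant p hp g]
  · refine h.smooth_inv.congr fun q hq => ?_
    have h1 := locInv_spec h.bijOn.surjOn hq
    have h2 := locInv_spec hbij.surjOn hq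
    refine h.bijOn.injOn h2.1 h1.1 ?_
    rw [← he _ h2.1, h2.2, h1.2]

end Dynamic

/-! ### The instantaneous Lagrangian in a trivialization -/

section DynamicPrinciples

variable
  {EX : Type*} [NormedAddCommGroup EX] [NormedSpace ℝ EX]
  {HX : Type*} [TopologicalSpace HX] {IX : ModelWithCorners ℝ EX HX}
  {X : Type*} [TopologicalSpace X] [ChartedSpace HX X] [IsManifold IX ∞ X]
  {EP : Type*} [NormedAddCommGroup EP] [NormedSpace ℝ EP]
  {HP : Type*} [TopologicalSpace HP] {IP : ModelWithCorners ℝ EP HP}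
  {P : Type*} [TopologicalSpace P] [ChartedSpace HP P] [IsManifold IP ∞ P]
  {EG : Type*} [NormedAddCommGroup EG] [NormedSpace ℝ EG]
  {G : Type*} [TopologicalSpace G] [ChartedSpace EG G] [Group G] [LieGroup 𝓘(ℝ, EG) ∞ G]
  {B : BundleMaps X P G} {V : Set X} {ξ : P → G} {e : X → P} {J : Set ℝ}

variable (IX IP EG B e) in
/-- The Lagrangian on jets of `ℝ × P`, in the trivialization. -/
def lineLag (L : Jet (𝓘(ℝ, ℝ).prod IX) (𝓘(ℝ, ℝ).prod IP) B.timesLine → ℝ) :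
    ℝ × X → (ℝ × EX →L[ℝ] EG) → ℝ :=
  trivLag (𝓘(ℝ, ℝ).prod IX) (𝓘(ℝ, ℝ).prod IP) EG B.timesLine (fun x => (x.1, e x.2)) L

variable (IX EG ξ) in
/-- The logarithmic derivative of a section of `ℝ × P`, in the trivialization. -/
def lineLog (s : ℝ × X → ℝ × P) : ℝ × X → ℝ × EX →L[ℝ] EG :=
  rlog (𝓘(ℝ, ℝ).prod IX) EG (fun x => ξ (s x).2)

variable {L : Jet (𝓘(ℝ, ℝ).prod IX) (𝓘(ℝ, ℝ).prod IP) B.timesLine → ℝ} {s : ℝ × X → ℝ × P}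

theorem firstVar_congr [FiniteDimensional ℝ EG] {Λ : X → (EX →L[ℝ] EG) → ℝ}
    {ν : X → EX →L[ℝ] EG} {η η' : X → EG} {x : X} (h : η =ᶠ[𝓝 x] η') :
    firstVar IX G Λ ν η x = firstVar IX G Λ ν η' x := by
  rw [firstVar, firstVar, h.eq_of_nhds, der_congr h]

/-- The first variation of an action integral over a time interval. -/
theorem hasDerivAt_intervalIntegral_rlog [FiniteDimensional ℝ EX] [IX.Boundaryless]
    [FiniteDimensional ℝ EG] [MeasurableSpace X] [OpensMeasurableSpace X] [T2Space X]
    {μ : Measure X} [IsFiniteMeasureOnCompacts μ] [SFinite μ] (hJ : IsOpen J) (hV : IsOpen V)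
    {Λ : ℝ × X → (ℝ × EX →L[ℝ] EG) → ℝ} (hΛ : FibreSmooth (𝓘(ℝ, ℝ).prod IX) (J ×ˢ V) Λ)
    {k : ℝ → ℝ × X → G} {h : ℝ × X → G}
    (hk : ContMDiffOn (𝓘(ℝ, ℝ).prod (𝓘(ℝ, ℝ).prod IX)) 𝓘(ℝ, EG) ∞
      (fun z : ℝ × ℝ × X => k z.1 z.2) (univ ×ˢ (J ×ˢ V)))
    (hΛk : ContMDiffOn (𝓘(ℝ, ℝ).prod (𝓘(ℝ, ℝ).prod IX)) 𝓘(ℝ, ℝ) ∞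
      (fun z : ℝ × ℝ × X => Λ z.2 (rlog (𝓘(ℝ, ℝ).prod IX) EG (k z.1) z.2)) (univ ×ˢ (J ×ˢ V)))
    (hk0 : ∀ x ∈ J ×ˢ V, k 0 x = h x) {t₁ t₂ : ℝ} (h12 : t₁ < t₂) (hIJ : Icc t₁ t₂ ⊆ J)
    {K : Set X} (hK : IsCompact K) (hKV : K ⊆ V) :
    HasDerivAt (fun ε => ∫ t in t₁..t₂, ∫ m in K,
        Λ (t, m) (rlog (𝓘(ℝ, ℝ).prod IX) EG (k ε) (t, m)) ∂μ)
      (∫ t in t₁..t₂, ∫ m in K, firstVar (𝓘(ℝ, ℝ).prod IX) G Λ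
        (rlog (𝓘(ℝ, ℝ).prod IX) EG h) (variationField EG k) (t, m) ∂μ) 0 := by
  have h1 := hasDerivAt_intervalIntegral (μ := μ) isOpen_univ hJ hV
    (Φ := fun ε x => Λ x (rlog (𝓘(ℝ, ℝ).prod IX) EG (k ε) x)) hΛk h12.le hIJ hK hKV
    (mem_univ (0 : ℝ))
  have e1 : ∀ t ∈ uIcc t₁ t₂, ∫ m in K, deriv (fun ε => Λ (t, m)
      (rlog (𝓘(ℝ, ℝ).prod IX) EG (k ε) (t, m))) 0 ∂μ =
      ∫ m in K, firstVar (𝓘(ℝ, ℝ).prod IX) G Λ (rlog (𝓘(ℝ, ℝ).prod IX) EG h)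
        (variationField EG k) (t, m) ∂μ := by
    intro t ht
    rw [uIcc_of_le h12.le] at ht
    refine setIntegral_congr_fun hK.measurableSet fun m hm => ?_
    exact (hasDerivAt_rlog_variation (hJ.prod hV) hΛ hk hk0 (x := (t, m))
      ⟨hIJ ht, hKV hm⟩).deriv
  rwa [intervalIntegral.integral_congr e1] at h1

namespace IsTrivialized

variable (hT : IsTrivialized IX IP EG B V ξ e)

include hT

theorem flatConnection_eq {p : P} (hp : p ∈ B.part V) :
    flatConnection (EG := EG) IP ξ p = (Ad G (ξ p)⁻¹).comp (rlog IP EG ξ p) :=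
  GaugeField.flatConnection_eq (hT.mdiff_triv hp)

/-- The instantaneous Lagrangian at a gauge transformation `φ` and a vertical velocity `a` only
depends on the logarithmic derivatives of `ξ ∘ φ ∘ e` and of `a`. -/
theorem instLagrangian_eq [MeasurableSpace X] [OpensMeasurableSpace X] [T2Space X]
    {μ : Measure X} (hJ : IsOpen J)
    (hinv : Invariant (𝓘(ℝ, ℝ).prod IX) (𝓘(ℝ, ℝ).prod IP) B.timesLine L) {t : ℝ} (ht : t ∈ J)
    {K : Set X} (hK : IsCompact K) (hKV : K ⊆ V) {φ : P → P} (hφ : IsGauge IP B V φ)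
    {a : P → EP} {α : X → EG} (ha : ∀ p ∈ B.part V, der IP IX B.proj (φ p) (a p) = 0 ∧
      rlog IP EG ξ (φ p) (a p) = α (B.proj p)) :
    instLagrangian IX IP B μ L V K t φ a (flatConnection (EG := EG) IP ξ) =
      ∫ m in K, lineLag IX IP EG B e L (t, m)
        (joinForm (α m) (rlog IX EG (fun x => ξ (φ (e x))) m)) ∂μ := by
  refine setIntegral_congr_fun hK.measurableSet fun m hm => ?_
  refine hT.descend_eq (hKV hm) fun p hpm => ?_
  have hp : p ∈ B.part V := by change B.proj p ∈ V; rw [hpm]; exact hKV hm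
  have hφp : φ p ∈ B.part V := hT.gauge_mem hφ hp
  have hpr : B.proj (φ p) = m := by rw [hφ.proj_eq p hp, hpm]
  have hA := hT.pushForm_eq (fun q hq => hT.flatConnection_eq hq) hφ hφp
  have hh := hT.horLift_spec hφp hA
  have h := hT.jetEval_splitJet hJ hinv ht hφp (ha p hp).1 hh.1 (ha p hp).2 hh.2
  rw [hpr, hpm] at h
  exact h

theorem contMDiffOn_triv_curve {φ : ℝ → P → P}
    (hφ : ContMDiffOn (𝓘(ℝ, ℝ).prod IP) IP ∞ (fun z : ℝ × P => φ z.1 z.2) (J ×ˢ B.part V))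
    (hg : ∀ t ∈ J, IsGauge IP B V (φ t)) :
    ContMDiffOn (𝓘(ℝ, ℝ).prod IX) 𝓘(ℝ, EG) ∞ (fun x : ℝ × X => ξ (φ x.1 (e x.2))) (J ×ˢ V) := by
  have h1 : ContMDiffOn (𝓘(ℝ, ℝ).prod IX) IP ∞ (fun x : ℝ × X => φ x.1 (e x.2)) (J ×ˢ V) :=
    hφ.comp (f := fun x : ℝ × X => (x.1, e x.2))
      (contMDiffOn_fst.prodMk (hT.smooth_sec.comp contMDiffOn_snd fun x hx => hx.2))
      fun _ hx => ⟨hx.1, hT.sec_mem hx.2⟩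
  exact hT.smooth_triv.comp h1 fun x hx => hT.gauge_mem (hg x.1 hx.1) (hT.sec_mem hx.2)

/-- Along a curve of gauge transformations the instantaneous Lagrangian is the integral of `lineLag`
at the space-time logarithmic derivative of `(t, m) ↦ ξ (φ_t (e m))`. -/
theorem instLagrangian_curve [MeasurableSpace X] [OpensMeasurableSpace X] [T2Space X]
    {μ : Measure X} (hJ : IsOpen J)
    (hinv : Invariant (𝓘(ℝ, ℝ).prod IX) (𝓘(ℝ, ℝ).prod IP) B.timesLine L) {t : ℝ} (ht : t ∈ J)
    {K : Set X} (hK : IsCompact K) (hKV : K ⊆ V) {φ : ℝ → P → P}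
    (hφ : ContMDiffOn (𝓘(ℝ, ℝ).prod IP) IP ∞ (fun z : ℝ × P => φ z.1 z.2) (J ×ˢ B.part V))
    (hg : ∀ t ∈ J, IsGauge IP B V (φ t)) :
    instLagrangian IX IP B μ L V K t (φ t) (velocity IP φ t) (flatConnection (EG := EG) IP ξ) =
      ∫ m in K, lineLag IX IP EG B e L (t, m)
        (rlog (𝓘(ℝ, ℝ).prod IX) EG (fun x : ℝ × X => ξ (φ x.1 (e x.2))) (t, m)) ∂μ := by
  refine (hT.instLagrangian_eq hJ hinv ht hK hKV (hg t ht)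
    (α := fun m => rlog 𝓘(ℝ, ℝ) EG (fun τ => ξ (φ τ (e m))) t 1)
    fun p hp => hT.velocity_spec hJ hφ hg ht hp).trans ?_
  refine setIntegral_congr_fun hK.measurableSet fun m hm => ?_
  have hd := ((hT.contMDiffOn_triv_curve hφ hg).contMDiffAt ((hJ.prod hT.isOpen).mem_nhds
    (x := (t, m)) ⟨ht, hKV hm⟩)).mdifferentiableAt (by simp)
  exact congrArg (lineLag IX IP EG B e L (t, m)) (rlog_prod_eq_joinForm hd).symm

/-! ### The curve of gauge transformations of a section -/

theorem section_snd (hs : IsLocalSection (𝓘(ℝ, ℝ).prod IX) (𝓘(ℝ, ℝ).prod IP) B.timesLine (J ×ˢ V) s)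
    {t : ℝ} (ht : t ∈ J) {m : X} (hm : m ∈ V) :
    B.proj (s (t, m)).2 = m ∧ (s (t, m)).2 ∈ B.part V ∧
      B.act (e m) (ξ (s (t, m)).2) = (s (t, m)).2 := by
  have h1 : B.proj (s (t, m)).2 = m := congrArg Prod.snd (hs.proj_eq (t, m) ⟨ht, hm⟩)
  have h2 : (s (t, m)).2 ∈ B.part V := by change B.proj (s (t, m)).2 ∈ V; rwa [h1]
  have h3 := hT.act_sec _ h2
  rw [h1] at h3
  exact ⟨h1, h2, h3⟩

theorem contMDiffOn_section_triv
    (hs : IsLocalSection (𝓘(ℝ, ℝ).prod IX) (𝓘(ℝ, ℝ).prod IP) B.timesLine (J ×ˢ V) s) :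
    ContMDiffOn (𝓘(ℝ, ℝ).prod IX) 𝓘(ℝ, EG) ∞ (fun x => ξ (s x).2) (J ×ˢ V) :=
  hT.smooth_triv.comp (contMDiff_snd.comp_contMDiffOn hs.smooth)
    fun _ hx => (hT.section_snd hs hx.1 hx.2).2.1

/-- The curve of gauge transformations of a section is left multiplication by the fibre coordinate
of the section. -/
theorem gaugeCurve_eq
    (hs : IsLocalSection (𝓘(ℝ, ℝ).prod IX) (𝓘(ℝ, ℝ).prod IP) B.timesLine (J ×ˢ V) s)
    {t : ℝ} (ht : t ∈ J) {p : P} (hp : p ∈ B.part V) :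
    gaugeCurve B ξ s t p = B.act (e (B.proj p)) (ξ (s (t, B.proj p)).2 * ξ p) := by
  rw [← hT.act_mul, (hT.section_snd hs ht hp).2.2]
  rfl

theorem isGauge_gaugeCurve
    (hs : IsLocalSection (𝓘(ℝ, ℝ).prod IX) (𝓘(ℝ, ℝ).prod IP) B.timesLine (J ×ˢ V) s)
    {t : ℝ} (ht : t ∈ J) : IsGauge IP B V (gaugeCurve B ξ s t) := by
  have hk : ContMDiffOn IX 𝓘(ℝ, EG) ∞ (fun m => ξ (s (t, m)).2) V :=
    (hT.contMDiffOn_section_triv hs).comp (f := fun m => (t, m))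
      (contMDiffOn_const.prodMk contMDiffOn_id) fun m hm => ⟨ht, hm⟩
  exact (hT.isGauge hk).congr hT.proj_act fun p hp => hT.gaugeCurve_eq hs ht hp

theorem contMDiffOn_act_curve {k : ℝ × X → G}
    (hk : ContMDiffOn (𝓘(ℝ, ℝ).prod IX) 𝓘(ℝ, EG) ∞ k (J ×ˢ V)) :
    ContMDiffOn (𝓘(ℝ, ℝ).prod IP) IP ∞
      (fun z : ℝ × P => B.act (e (B.proj z.2)) (k (z.1, B.proj z.2) * ξ z.2))
      (J ×ˢ B.part V) := by
  have hπ : ContMDiffOn (𝓘(ℝ, ℝ).prod IP) IX ∞ (fun z : ℝ × P => B.proj z.2) (J ×ˢ B.part V) :=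
    hT.smooth_proj.comp_contMDiffOn contMDiffOn_snd
  have h1 := hT.smooth_sec.comp hπ fun z hz => hz.2
  have h2 := hk.comp (f := fun z : ℝ × P => (z.1, B.proj z.2)) (contMDiffOn_fst.prodMk hπ)
    fun z hz => ⟨hz.1, hz.2⟩
  have h3 : ContMDiffOn (𝓘(ℝ, ℝ).prod IP) 𝓘(ℝ, EG) ∞ (fun z : ℝ × P => ξ z.2) (J ×ˢ B.part V) :=
    hT.smooth_triv.comp contMDiffOn_snd fun z hz => hz.2
  exact hT.smooth_act.comp_contMDiffOn (h1.prodMk (h2.mul h3))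

theorem contMDiffOn_gaugeCurve
    (hs : IsLocalSection (𝓘(ℝ, ℝ).prod IX) (𝓘(ℝ, ℝ).prod IP) B.timesLine (J ×ˢ V) s) :
    ContMDiffOn (𝓘(ℝ, ℝ).prod IP) IP ∞ (fun z : ℝ × P => gaugeCurve B ξ s z.1 z.2)
      (J ×ˢ B.part V) :=
  (hT.contMDiffOn_act_curve (hT.contMDiffOn_section_triv hs)).congr
    fun _ hz => hT.gaugeCurve_eq hs hz.1 hz.2

theorem triv_gaugeCurve
    (hs : IsLocalSection (𝓘(ℝ, ℝ).prod IX) (𝓘(ℝ, ℝ).prod IP) B.timesLine (J ×ˢ V) s)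
    {t : ℝ} (ht : t ∈ J) {m : X} (hm : m ∈ V) :
    ξ (gaugeCurve B ξ s t (e m)) = ξ (s (t, m)).2 := by
  rw [hT.gaugeCurve_eq hs ht (hT.sec_mem hm), hT.proj_sec m hm, hT.triv_act _ (hT.sec_mem hm),
    hT.triv_sec m hm, one_mul, mul_one]

/-! ### Variations of the curve of gauge transformations -/

theorem contMDiffOn_triv_gaugeVariation {K : Set X} {φ : ℝ → P → P} {F : ℝ → ℝ → P → P}
    (hF : IsGaugeVariation IP B J V K φ F) :
    ContMDiffOn (𝓘(ℝ, ℝ).prod (𝓘(ℝ, ℝ).prod IX)) 𝓘(ℝ, EG) ∞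
      (fun z : ℝ × ℝ × X => ξ (F z.1 z.2.1 (e z.2.2))) (univ ×ˢ (J ×ˢ V)) := by
  have h0 : ContMDiffOn (𝓘(ℝ, ℝ).prod (𝓘(ℝ, ℝ).prod IX)) IP ∞ (fun z : ℝ × ℝ × X => e z.2.2)
      (univ ×ˢ (J ×ˢ V)) :=
    hT.smooth_sec.comp (contMDiff_snd.comp contMDiff_snd).contMDiffOn fun z hz => hz.2.2
  have h1 := hF.smooth.comp (f := fun z : ℝ × ℝ × X => (z.1, z.2.1, e z.2.2))
    (contMDiffOn_fst.prodMk ((contMDiff_fst.comp contMDiff_snd).contMDiffOn.prodMk h0))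
    fun z hz => ⟨mem_univ _, hz.2.1, hT.sec_mem hz.2.2⟩
  exact hT.smooth_triv.comp h1 fun z hz =>
    hT.gauge_mem (hF.gauge z.1 z.2.1 hz.2.1) (hT.sec_mem hz.2.2)

omit hT [LieGroup 𝓘(ℝ, EG) ∞ G] in
theorem gaugeVariation_slice {K : Set X} {φ : ℝ → P → P} {F : ℝ → ℝ → P → P}
    (hF : IsGaugeVariation IP B J V K φ F) (ε : ℝ) :
    ContMDiffOn (𝓘(ℝ, ℝ).prod IP) IP ∞ (fun z : ℝ × P => F ε z.1 z.2) (J ×ˢ B.part V) :=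
  hF.smooth.comp (f := fun z : ℝ × P => (ε, z.1, z.2))
    (contMDiffOn_const.prodMk (contMDiffOn_fst.prodMk contMDiffOn_snd))
    fun _ hz => ⟨mem_univ _, hz.1, hz.2⟩

/-- Every variation of the fibre coordinate of the section is a variation of the curve of gauge
transformations. -/
theorem isGaugeVariation
    (hs : IsLocalSection (𝓘(ℝ, ℝ).prod IX) (𝓘(ℝ, ℝ).prod IP) B.timesLine (J ×ˢ V) s)
    {K : Set X} {k : ℝ → ℝ × X → G}
    (hk : ContMDiffOn (𝓘(ℝ, ℝ).prod (𝓘(ℝ, ℝ).prod IX)) 𝓘(ℝ, EG) ∞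
      (fun z : ℝ × ℝ × X => k z.1 z.2) (univ ×ˢ (J ×ˢ V)))
    (hk0 : ∀ x, k 0 x = ξ (s x).2)
    (hkK : ∀ ε, ∀ t ∈ J, ∀ m ∈ V \ K, k ε (t, m) = ξ (s (t, m)).2) :
    IsGaugeVariation IP B J V K (gaugeCurve B ξ s)
      (fun ε t p => B.act (e (B.proj p)) (k ε (t, B.proj p) * ξ p)) where
  smooth := by
    have hπ : ContMDiffOn (𝓘(ℝ, ℝ).prod (𝓘(ℝ, ℝ).prod IP)) IX ∞
        (fun z : ℝ × ℝ × P => B.proj z.2.2) (univ ×ˢ (J ×ˢ B.part V)) :=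
      (hT.smooth_proj.comp (contMDiff_snd.comp contMDiff_snd)).contMDiffOn
    have h1 := hT.smooth_sec.comp hπ fun z hz => hz.2.2
    have h2 := hk.comp (f := fun z : ℝ × ℝ × P => (z.1, z.2.1, B.proj z.2.2))
      (contMDiffOn_fst.prodMk ((contMDiff_fst.comp contMDiff_snd).contMDiffOn.prodMk hπ))
      fun z hz => ⟨hz.1, hz.2.1, hz.2.2⟩
    have h3 : ContMDiffOn (𝓘(ℝ, ℝ).prod (𝓘(ℝ, ℝ).prod IP)) 𝓘(ℝ, EG) ∞
        (fun z : ℝ × ℝ × P => ξ z.2.2) (univ ×ˢ (J ×ˢ B.part V)) :=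
      hT.smooth_triv.comp (contMDiff_snd.comp contMDiff_snd).contMDiffOn fun z hz => hz.2.2
    exact hT.smooth_act.comp_contMDiffOn (h1.prodMk (h2.mul h3))
  gauge := fun ε t ht => hT.isGauge (k := fun m => k ε (t, m))
    (hk.comp (f := fun m => (ε, t, m))
      (contMDiffOn_const.prodMk (contMDiffOn_const.prodMk contMDiffOn_id))
      fun m hm => ⟨mem_univ _, ht, hm⟩)
  zero := fun t ht p hp => by rw [hT.gaugeCurve_eq hs ht hp, hk0]
  support := fun ε t ht p hp => by
    rw [hT.gaugeCurve_eq hs ht hp.1, hkK ε t ht _ hp]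

theorem triv_act_curve {k : X → G} {m : X} (hm : m ∈ V) :
    ξ (B.act (e (B.proj (e m))) (k (B.proj (e m)) * ξ (e m))) = k m := by
  rw [hT.proj_sec m hm, hT.triv_act _ (hT.sec_mem hm), hT.triv_sec m hm, one_mul, mul_one]

variable [FiniteDimensional ℝ EX] [IX.Boundaryless] [FiniteDimensional ℝ EG]

theorem fibreSmooth_lineLag (hJ : IsOpen J)
    (hL : SmoothOnJets (𝓘(ℝ, ℝ).prod IX) (𝓘(ℝ, ℝ).prod IP) B.timesLine L)
    (hinv : Invariant (𝓘(ℝ, ℝ).prod IX) (𝓘(ℝ, ℝ).prod IP) B.timesLine L) :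
    FibreSmooth (𝓘(ℝ, ℝ).prod IX) (J ×ˢ V) (lineLag IX IP EG B e L) :=
  (hT.timesLine hJ).fibreSmooth_trivLag hL hinv

theorem smoothFormOn_lineLog (hJ : IsOpen J)
    (hs : IsLocalSection (𝓘(ℝ, ℝ).prod IX) (𝓘(ℝ, ℝ).prod IP) B.timesLine (J ×ˢ V) s) :
    SmoothFormOn (𝓘(ℝ, ℝ).prod IX) (J ×ˢ V) (lineLog IX EG ξ s) :=
  smoothFormOn_rlog (hJ.prod hT.isOpen) (hT.contMDiffOn_section_triv hs)

theorem contMDiffOn_lineLag_variation (hJ : IsOpen J)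
    (hL : SmoothOnJets (𝓘(ℝ, ℝ).prod IX) (𝓘(ℝ, ℝ).prod IP) B.timesLine L)
    (hinv : Invariant (𝓘(ℝ, ℝ).prod IX) (𝓘(ℝ, ℝ).prod IP) B.timesLine L)
    {k : ℝ → ℝ × X → G}
    (hk : ContMDiffOn (𝓘(ℝ, ℝ).prod (𝓘(ℝ, ℝ).prod IX)) 𝓘(ℝ, EG) ∞
      (fun z : ℝ × ℝ × X => k z.1 z.2) (univ ×ˢ (J ×ˢ V))) :
    ContMDiffOn (𝓘(ℝ, ℝ).prod (𝓘(ℝ, ℝ).prod IX)) 𝓘(ℝ, ℝ) ∞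
      (fun z : ℝ × ℝ × X => lineLag IX IP EG B e L z.2 (rlog (𝓘(ℝ, ℝ).prod IX) EG (k z.1) z.2))
      (univ ×ˢ (J ×ˢ V)) :=
  (hT.timesLine hJ).contMDiffOn_trivLag_rlog hL hinv hk

variable [MeasurableSpace X] [OpensMeasurableSpace X] [T2Space X]
  {μ : Measure X} [IsFiniteMeasureOnCompacts μ] [SFinite μ]

/-- Hamilton’s principle for the curve of gauge transformations is stationarity of the space-time
action for variations which vanish at the endpoints. -/
theorem dynamicHamilton_iff (hJ : IsOpen J)
    (hL : SmoothOnJets (𝓘(ℝ, ℝ).prod IX) (𝓘(ℝ, ℝ).prod IP) B.timesLine L)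
    (hinv : Invariant (𝓘(ℝ, ℝ).prod IX) (𝓘(ℝ, ℝ).prod IP) B.timesLine L)
    (hs : IsLocalSection (𝓘(ℝ, ℝ).prod IX) (𝓘(ℝ, ℝ).prod IP) B.timesLine (J ×ˢ V) s) :
    DynamicHamilton IX IP B μ L J V (flatConnection (EG := EG) IP ξ) (gaugeCurve B ξ s) ↔
      EndpointEquation IX G μ J V (lineLag IX IP EG B e L) (lineLog IX EG ξ s) := by
  have hΛ := hT.fibreSmooth_lineLag hJ hL hinv
  -- The derivative of the action along any variation of the curve.
  have key : ∀ t₁ t₂ : ℝ, t₁ < t₂ → Icc t₁ t₂ ⊆ J → ∀ K : Set X, IsCompact K → K ⊆ V →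
      ∀ F : ℝ → ℝ → P → P, IsGaugeVariation IP B J V K (gaugeCurve B ξ s) F →
      HasDerivAt (fun ε => ∫ t in t₁..t₂, instLagrangian IX IP B μ L V K t (F ε t)
          (velocity IP (F ε) t) (flatConnection (EG := EG) IP ξ))
        (∫ t in t₁..t₂, ∫ m in K, firstVar (𝓘(ℝ, ℝ).prod IX) G (lineLag IX IP EG B e L)
          (lineLog IX EG ξ s) (variationField EG fun ε x => ξ (F ε x.1 (e x.2))) (t, m) ∂μ) 0 := by
    intro t₁ t₂ h12 hIJ K hK hKV F hF
    have hk := hT.contMDiffOn_triv_gaugeVariation hF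
    have h := hasDerivAt_intervalIntegral_rlog (μ := μ) hJ hT.isOpen hΛ
      (Λ := lineLag IX IP EG B e L) (k := fun ε x => ξ (F ε x.1 (e x.2)))
      (h := fun x => ξ (s x).2) hk
      (hT.contMDiffOn_lineLag_variation (k := fun ε x => ξ (F ε x.1 (e x.2))) hJ hL hinv hk)
      (fun x hx => by
        rw [hF.zero x.1 hx.1 _ (hT.sec_mem hx.2), hT.triv_gaugeCurve hs hx.1 hx.2])
      h12 hIJ hK hKV
    refine h.congr_of_eventuallyEq (Eventually.of_forall fun ε => ?_)
    refine intervalIntegral.integral_congr fun t ht => ?_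
    rw [uIcc_of_le h12.le] at ht
    exact hT.instLagrangian_curve hJ hinv (hIJ ht) hK hKV (gaugeVariation_slice hF ε)
      (hF.gauge ε)
  constructor
  · intro H t₁ t₂ h12 hIJ K hK hKV η hη hηK hηe
    -- Every `η` is the velocity of a variation of the curve.
    obtain ⟨k, hk, hk0, hkη, hkv⟩ := exists_variation (hT.contMDiffOn_section_triv hs) hη
    have hF := hT.isGaugeVariation hs (K := K) hk hk0 fun ε t ht m hm => hkη _ (hηK t ht m hm) ε
    have h1 := key t₁ t₂ h12 hIJ K hK hKV _ hF
    have h2 := H t₁ t₂ h12 hIJ K hK hKV _ hF fun ε p hp => by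
      rw [hT.gaugeCurve_eq hs (hIJ (left_mem_Icc.2 h12.le)) hp,
        hT.gaugeCurve_eq hs (hIJ (right_mem_Icc.2 h12.le)) hp,
        hkη _ (hηe _ hp).1, hkη _ (hηe _ hp).2]
      exact ⟨rfl, rfl⟩
    rw [← h1.unique h2]
    refine intervalIntegral.integral_congr fun t ht => ?_
    rw [uIcc_of_le h12.le] at ht
    refine setIntegral_congr_fun hK.measurableSet fun m hm => ?_
    have e1 : ∀ x ∈ J ×ˢ V, variationField EG (fun ε (x : ℝ × X) =>
        ξ (B.act (e (B.proj (e x.2))) (k ε (x.1, B.proj (e x.2)) * ξ (e x.2)))) x = η x := by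
      intro x hx
      rw [← hkv x]
      exact congrArg (fun c : ℝ → G => rlog 𝓘(ℝ, ℝ) EG c 0 (1 : ℝ))
        (funext fun ε => hT.triv_act_curve (k := fun m => k ε (x.1, m)) hx.2)
    have hx : (t, m) ∈ J ×ˢ V := ⟨hIJ ht, hKV hm⟩
    exact (firstVar_congr (by
      filter_upwards [(hJ.prod hT.isOpen).mem_nhds hx] with y hy using e1 y hy)).symm
  · intro H t₁ t₂ h12 hIJ K hK hKV F hF hFe
    have h1 := key t₁ t₂ h12 hIJ K hK hKV F hF
    rwa [H t₁ t₂ h12 hIJ K hK hKV _ (contMDiffOn_variationField (hJ.prod hT.isOpen)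
      (hT.contMDiffOn_triv_gaugeVariation hF)) ?_ ?_] at h1
    · intro t ht m hm
      have hp : e m ∈ B.part (V \ K) := by
        change B.proj (e m) ∈ V \ K
        rwa [hT.proj_sec m hm.1]
      rw [variationField]
      simp only [hF.support _ t ht _ hp]
      rw [rlog_const, _root_.zero_apply]
    · intro m hm
      constructor
      · rw [variationField]
        simp only [(hFe _ _ (hT.sec_mem hm)).1]
        rw [rlog_const, _root_.zero_apply]
      · rw [variationField]
        simp only [(hFe _ _ (hT.sec_mem hm)).2]
        rw [rlog_const, _root_.zero_apply]

end IsTrivialized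

end DynamicPrinciples

/-! ### The dynamic Euler–Lagrange equations -/

section DynamicEquations

variable
  {EX : Type*} [NormedAddCommGroup EX] [NormedSpace ℝ EX] [FiniteDimensional ℝ EX]
  {HX : Type*} [TopologicalSpace HX] {IX : ModelWithCorners ℝ EX HX} [IX.Boundaryless]
  {X : Type*} [TopologicalSpace X] [ChartedSpace HX X] [IsManifold IX ∞ X]
  {EP : Type*} [NormedAddCommGroup EP] [NormedSpace ℝ EP]
  {HP : Type*} [TopologicalSpace HP] {IP : ModelWithCorners ℝ EP HP}
  {P : Type*} [TopologicalSpace P] [ChartedSpace HP P] [IsManifold IP ∞ P]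
  {EG : Type*} [NormedAddCommGroup EG] [NormedSpace ℝ EG] [FiniteDimensional ℝ EG]
  {G : Type*} [TopologicalSpace G] [ChartedSpace EG G] [Group G] [LieGroup 𝓘(ℝ, EG) ∞ G]
  {B : BundleMaps X P G} {V : Set X} {ξ : P → G} {e : X → P} {J : Set ℝ}
  {L : Jet (𝓘(ℝ, ℝ).prod IX) (𝓘(ℝ, ℝ).prod IP) B.timesLine → ℝ} {s : ℝ × X → ℝ × P}

theorem SmoothFormOn.joinForm_left {η : ℝ × X → EG} {S : Set (ℝ × X)} (hS : IsOpen S)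
    (hη : ContMDiffOn (𝓘(ℝ, ℝ).prod IX) 𝓘(ℝ, EG) ∞ η S) :
    SmoothFormOn (𝓘(ℝ, ℝ).prod IX) S (fun x => joinForm (E := EX) (η x) 0) := by
  have h1 : SmoothFormOn (𝓘(ℝ, ℝ).prod IX) S
      (fun x => der (𝓘(ℝ, ℝ).prod IX) 𝓘(ℝ, ℝ) (fun z : ℝ × X => z.1) x) :=
    contMDiffOn_der_apply hS contMDiffOn_fst
  refine (h1.smulRight hη).congr fun x _ => ?_
  rw [der_fst, joinForm, ContinuousLinearMap.zero_comp, add_zero]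

section Slices

variable [MeasurableSpace X] [OpensMeasurableSpace X] [T2Space X]
  {μ : Measure X} [IsFiniteMeasureOnCompacts μ]

theorem hasDerivAt_sliceIntegral (hV : IsOpen V) {Φ : ℝ → ℝ × X → ℝ}
    (hΦ : ContMDiffOn (𝓘(ℝ, ℝ).prod (𝓘(ℝ, ℝ).prod IX)) 𝓘(ℝ, ℝ) ∞
      (fun z : ℝ × ℝ × X => Φ z.1 z.2) (univ ×ˢ (J ×ˢ V)))
    {t : ℝ} (ht : t ∈ J) {K : Set X} (hK : IsCompact K) (hKV : K ⊆ V) {φ : X → ℝ}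
    (hφ : ∀ m ∈ V, HasDerivAt (fun ε => Φ ε (t, m)) (φ m) 0) :
    HasDerivAt (fun ε => ∫ m in K, Φ ε (t, m) ∂μ) (∫ m in K, φ m ∂μ) 0 := by
  have h := hasDerivAt_setIntegral (μ := μ) isOpen_univ hV (Φ := fun ε m => Φ ε (t, m))
    (hΦ.comp (f := fun z : ℝ × X => (z.1, t, z.2))
      (contMDiffOn_fst.prodMk (contMDiffOn_const.prodMk contMDiffOn_snd))
      fun z hz => ⟨hz.1, ht, hz.2⟩) hK hKV (mem_univ (0 : ℝ))
  rwa [setIntegral_congr_fun hK.measurableSet fun m hm => (hφ m (hKV hm)).deriv] at h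

/-- The derivative of a slice integral of a Lagrangian in the direction of a form. -/
theorem FibreSmooth.hasDerivAt_sliceIntegral (hJ : IsOpen J) (hV : IsOpen V)
    {Λ : ℝ × X → (ℝ × EX →L[ℝ] EG) → ℝ} (hΛ : FibreSmooth (𝓘(ℝ, ℝ).prod IX) (J ×ˢ V) Λ)
    {A C : ℝ × X → ℝ × EX →L[ℝ] EG} (hA : SmoothFormOn (𝓘(ℝ, ℝ).prod IX) (J ×ˢ V) A)
    (hC : SmoothFormOn (𝓘(ℝ, ℝ).prod IX) (J ×ˢ V) C)
    {t : ℝ} (ht : t ∈ J) {K : Set X} (hK : IsCompact K) (hKV : K ⊆ V) :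
    HasDerivAt (fun ε : ℝ => ∫ m in K, Λ (t, m) (A (t, m) + ε • C (t, m)) ∂μ)
      (∫ m in K, fderiv ℝ (Λ (t, m)) (A (t, m)) (C (t, m)) ∂μ) 0 :=
  GaugeField.hasDerivAt_sliceIntegral hV (Φ := fun ε x => Λ x (A x + ε • C x))
    (hΛ.contMDiffOn_add_smul (hJ.prod hV) hA hC) ht hK hKV
    fun m hm => hΛ.hasDerivAt_add_smul (x := (t, m)) ⟨ht, hm⟩ _ _

theorem hasDerivAt_sliceIntegral_rlog (hJ : IsOpen J) (hV : IsOpen V)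
    {Λ : ℝ × X → (ℝ × EX →L[ℝ] EG) → ℝ} (hΛ : FibreSmooth (𝓘(ℝ, ℝ).prod IX) (J ×ˢ V) Λ)
    {k : ℝ → ℝ × X → G} {h : ℝ × X → G}
    (hk : ContMDiffOn (𝓘(ℝ, ℝ).prod (𝓘(ℝ, ℝ).prod IX)) 𝓘(ℝ, EG) ∞
      (fun z : ℝ × ℝ × X => k z.1 z.2) (univ ×ˢ (J ×ˢ V)))
    (hΛk : ContMDiffOn (𝓘(ℝ, ℝ).prod (𝓘(ℝ, ℝ).prod IX)) 𝓘(ℝ, ℝ) ∞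
      (fun z : ℝ × ℝ × X => Λ z.2 (rlog (𝓘(ℝ, ℝ).prod IX) EG (k z.1) z.2)) (univ ×ˢ (J ×ˢ V)))
    (hk0 : ∀ x ∈ J ×ˢ V, k 0 x = h x) {t : ℝ} (ht : t ∈ J)
    {K : Set X} (hK : IsCompact K) (hKV : K ⊆ V) :
    HasDerivAt (fun ε => ∫ m in K, Λ (t, m) (rlog (𝓘(ℝ, ℝ).prod IX) EG (k ε) (t, m)) ∂μ)
      (∫ m in K, firstVar (𝓘(ℝ, ℝ).prod IX) G Λ
        (rlog (𝓘(ℝ, ℝ).prod IX) EG h) (variationField EG k) (t, m) ∂μ) 0 :=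
  hasDerivAt_sliceIntegral hV (Φ := fun ε x => Λ x (rlog (𝓘(ℝ, ℝ).prod IX) EG (k ε) x)) hΛk
    ht hK hKV fun m hm => hasDerivAt_rlog_variation (hJ.prod hV) hΛ hk hk0 (x := (t, m)) ⟨ht, hm⟩

theorem FibreSmooth.hasDerivAt_intervalIntegral [SFinite μ] (hJ : IsOpen J) (hV : IsOpen V)
    {Λ : ℝ × X → (ℝ × EX →L[ℝ] EG) → ℝ} (hΛ : FibreSmooth (𝓘(ℝ, ℝ).prod IX) (J ×ˢ V) Λ)
    {A C : ℝ × X → ℝ × EX →L[ℝ] EG} (hA : SmoothFormOn (𝓘(ℝ, ℝ).prod IX) (J ×ˢ V) A)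
    (hC : SmoothFormOn (𝓘(ℝ, ℝ).prod IX) (J ×ˢ V) C) {t₁ t₂ : ℝ} (h12 : t₁ < t₂)
    (hIJ : Icc t₁ t₂ ⊆ J) {K : Set X} (hK : IsCompact K) (hKV : K ⊆ V) :
    HasDerivAt (fun ε : ℝ => ∫ t in t₁..t₂, ∫ m in K, Λ (t, m) (A (t, m) + ε • C (t, m)) ∂μ)
      (∫ t in t₁..t₂, ∫ m in K, fderiv ℝ (Λ (t, m)) (A (t, m)) (C (t, m)) ∂μ) 0 := by
  have h1 := GaugeField.hasDerivAt_intervalIntegral (μ := μ) isOpen_univ hJ hV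
    (Φ := fun ε x => Λ x (A x + ε • C x)) (hΛ.contMDiffOn_add_smul (hJ.prod hV) hA hC)
    h12.le hIJ hK hKV (mem_univ (0 : ℝ))
  have e1 : ∀ t ∈ uIcc t₁ t₂,
      ∫ m in K, deriv (fun ε : ℝ => Λ (t, m) (A (t, m) + ε • C (t, m))) 0 ∂μ =
      ∫ m in K, fderiv ℝ (Λ (t, m)) (A (t, m)) (C (t, m)) ∂μ := by
    intro t ht
    rw [uIcc_of_le h12.le] at ht
    refine setIntegral_congr_fun hK.measurableSet fun m hm => ?_
    exact (hΛ.hasDerivAt_add_smul (x := (t, m)) ⟨hIJ ht, hKV hm⟩ _ _).deriv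
  rwa [intervalIntegral.integral_congr e1] at h1

end Slices

namespace IsTrivialized

variable (hT : IsTrivialized IX IP EG B V ξ e)

include hT

/-- The components of the space-time logarithmic derivative are those of the curve in time and of
each gauge transformation in space. -/
theorem lineLog_eq_joinForm (hJ : IsOpen J)
    (hs : IsLocalSection (𝓘(ℝ, ℝ).prod IX) (𝓘(ℝ, ℝ).prod IP) B.timesLine (J ×ˢ V) s)
    {t : ℝ} (ht : t ∈ J) {m : X} (hm : m ∈ V) :
    lineLog IX EG ξ s (t, m) =
      joinForm (rlog 𝓘(ℝ, ℝ) EG (fun τ => ξ (gaugeCurve B ξ s τ (e m))) t 1)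
        (rlog IX EG (fun y => ξ (gaugeCurve B ξ s t (e y))) m) := by
  have h1 := rlog_prod_eq_joinForm (x := (t, m)) (((hT.contMDiffOn_section_triv hs).contMDiffAt
    ((hJ.prod hT.isOpen).mem_nhds (x := (t, m)) ⟨ht, hm⟩)).mdifferentiableAt (by simp))
  have h2 : rlog 𝓘(ℝ, ℝ) EG (fun τ => ξ (gaugeCurve B ξ s τ (e m))) t =
      rlog 𝓘(ℝ, ℝ) EG (fun τ => ξ (s (τ, m)).2) t := rlog_congr (by
    filter_upwards [hJ.mem_nhds ht] with τ hτ using hT.triv_gaugeCurve hs hτ hm)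
  have h3 : rlog IX EG (fun y => ξ (gaugeCurve B ξ s t (e y))) m =
      rlog IX EG (fun y => ξ (s (t, y)).2) m := rlog_congr (by
    filter_upwards [hT.isOpen.mem_nhds hm] with y hy using hT.triv_gaugeCurve hs ht hy)
  rw [h2, h3]
  exact h1

/-- The variation `δφ_t` is vertical, and its logarithmic derivative is the velocity `η` of the
variation of the fibre coordinate. -/
theorem gaugeVariation_velocity_spec {K : Set X} {F : ℝ → ℝ → P → P}
    (hs : IsLocalSection (𝓘(ℝ, ℝ).prod IX) (𝓘(ℝ, ℝ).prod IP) B.timesLine (J ×ˢ V) s)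
    (hF : IsGaugeVariation IP B J V K (gaugeCurve B ξ s) F) {t : ℝ} (ht : t ∈ J) {p : P}
    (hp : p ∈ B.part V) :
    der IP IX B.proj (gaugeCurve B ξ s t p) (der 𝓘(ℝ, ℝ) IP (fun ε => F ε t p) 0 (1 : ℝ)) = 0 ∧
      rlog IP EG ξ (gaugeCurve B ξ s t p) (der 𝓘(ℝ, ℝ) IP (fun ε => F ε t p) 0 (1 : ℝ)) =
        variationField EG (fun ε x => ξ (F ε x.1 (e x.2))) (t, B.proj p) := by
  have h := hT.velocity_spec (J := univ) isOpen_univ (φ := fun ε p => F ε t p)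
    (hF.smooth.comp (f := fun z : ℝ × P => (z.1, t, z.2))
      (contMDiffOn_fst.prodMk (contMDiffOn_const.prodMk contMDiffOn_snd))
      fun z hz => ⟨hz.1, ht, hz.2⟩) (fun ε _ => hF.gauge ε t ht) (mem_univ (0 : ℝ)) hp
  rw [hF.zero t ht p hp] at h
  exact h

section Measure

variable [MeasurableSpace X] [OpensMeasurableSpace X] [T2Space X]
  {μ : Measure X} [IsFiniteMeasureOnCompacts μ] [SFinite μ]

/-- Varying the velocity alone varies the time component of the space-time logarithmic derivative.
-/
theorem instLagrangian_fibre_eq (hJ : IsOpen J)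
    (hinv : Invariant (𝓘(ℝ, ℝ).prod IX) (𝓘(ℝ, ℝ).prod IP) B.timesLine L)
    (hs : IsLocalSection (𝓘(ℝ, ℝ).prod IX) (𝓘(ℝ, ℝ).prod IP) B.timesLine (J ×ˢ V) s)
    {K : Set X} (hK : IsCompact K) (hKV : K ⊆ V) {F : ℝ → ℝ → P → P}
    (hF : IsGaugeVariation IP B J V K (gaugeCurve B ξ s) F) {t : ℝ} (ht : t ∈ J) (ε : ℝ) :
    instLagrangian IX IP B μ L V K t (gaugeCurve B ξ s t)
        (fun p =>
          let v : EP := velocity IP (gaugeCurve B ξ s) t p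
          let δφ : EP := mfderiv 𝓘(ℝ, ℝ) IP (fun ε' => F ε' t p) 0 (1 : ℝ)
          v + ε • δφ) (flatConnection (EG := EG) IP ξ) =
      ∫ m in K, lineLag IX IP EG B e L (t, m) (lineLog IX EG ξ s (t, m) +
        ε • joinForm (variationField EG (fun ε x => ξ (F ε x.1 (e x.2))) (t, m)) 0) ∂μ := by
  have hg : ∀ t ∈ J, IsGauge IP B V (gaugeCurve B ξ s t) := fun t ht => hT.isGauge_gaugeCurve hs ht
  have key : ∀ p ∈ B.part V, ∀ v w : EP, ∀ a b : EG,
      (der IP IX B.proj (gaugeCurve B ξ s t p) v = 0 ∧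
        rlog IP EG ξ (gaugeCurve B ξ s t p) v = a) →
      (der IP IX B.proj (gaugeCurve B ξ s t p) w = 0 ∧
        rlog IP EG ξ (gaugeCurve B ξ s t p) w = b) →
      der IP IX B.proj (gaugeCurve B ξ s t p) (v + ε • w) = 0 ∧
        rlog IP EG ξ (gaugeCurve B ξ s t p) (v + ε • w) = a + ε • b := by
    intro p _ v w a b hv hw
    rw [map_add, map_add, map_smul, map_smul, hv.1, hv.2, hw.1, hw.2, smul_zero, add_zero]
    exact ⟨rfl, rfl⟩
  refine (hT.instLagrangian_eq hJ hinv ht hK hKV (hg t ht)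
    (α := fun m => rlog 𝓘(ℝ, ℝ) EG (fun τ => ξ (gaugeCurve B ξ s τ (e m))) t 1 +
      ε • variationField EG (fun ε x => ξ (F ε x.1 (e x.2))) (t, m))
    fun p hp => key p hp _ _ _ _
      (hT.velocity_spec hJ (hT.contMDiffOn_gaugeCurve hs) hg ht hp)
      (hT.gaugeVariation_velocity_spec hs hF ht hp)).trans ?_
  refine setIntegral_congr_fun hK.measurableSet fun m hm => ?_
  refine congrArg (lineLag IX IP EG B e L (t, m)) ?_
  rw [hT.lineLog_eq_joinForm hJ hs ht (hKV hm), ← joinForm_add_smul, smul_zero, add_zero]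

/-- The Euler–Lagrange equations of the curve of gauge transformations are the evolution equation of
the momentum. -/
theorem dynamicEulerLagrange_iff (hJ : IsOpen J)
    (hL : SmoothOnJets (𝓘(ℝ, ℝ).prod IX) (𝓘(ℝ, ℝ).prod IP) B.timesLine L)
    (hinv : Invariant (𝓘(ℝ, ℝ).prod IX) (𝓘(ℝ, ℝ).prod IP) B.timesLine L)
    (hs : IsLocalSection (𝓘(ℝ, ℝ).prod IX) (𝓘(ℝ, ℝ).prod IP) B.timesLine (J ×ˢ V) s) :
    DynamicEulerLagrange IX IP B μ L J V (flatConnection (EG := EG) IP ξ) (gaugeCurve B ξ s) ↔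
      EvolutionEquation IX G μ J V (lineLag IX IP EG B e L) (lineLog IX EG ξ s) := by
  have hΛ := hT.fibreSmooth_lineLag hJ hL hinv
  have hν := hT.smoothFormOn_lineLog hJ hs
  -- The momentum: the derivative of the Lagrangian in the velocity.
  have key1 : ∀ K : Set X, IsCompact K → K ⊆ V → ∀ F : ℝ → ℝ → P → P,
      IsGaugeVariation IP B J V K (gaugeCurve B ξ s) F → ∀ t ∈ J,
      deriv (fun ε : ℝ => instLagrangian IX IP B μ L V K t (gaugeCurve B ξ s t)
        (fun p =>
          let v : EP := velocity IP (gaugeCurve B ξ s) t p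
          let δφ : EP := mfderiv 𝓘(ℝ, ℝ) IP (fun ε' => F ε' t p) 0 (1 : ℝ)
          v + ε • δφ) (flatConnection (EG := EG) IP ξ)) 0 =
      ∫ m in K, fderiv ℝ (lineLag IX IP EG B e L (t, m)) (lineLog IX EG ξ s (t, m))
        (joinForm (variationField EG (fun ε x => ξ (F ε x.1 (e x.2))) (t, m)) 0) ∂μ := by
    intro K hK hKV F hF t ht
    have hη := contMDiffOn_variationField (h := fun ε x => ξ (F ε x.1 (e x.2))) (hJ.prod hT.isOpen)
      (hT.contMDiffOn_triv_gaugeVariation hF)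
    refine (congrArg (fun f : ℝ → ℝ => deriv f 0) (funext fun ε =>
      hT.instLagrangian_fibre_eq hJ hinv hs hK hKV hF ht ε)).trans ?_
    exact (hΛ.hasDerivAt_sliceIntegral hJ hT.isOpen hν
      (SmoothFormOn.joinForm_left (hJ.prod hT.isOpen) hη) ht hK hKV).deriv
  -- The derivative of the Lagrangian along the variation.
  have key2 : ∀ K : Set X, IsCompact K → K ⊆ V → ∀ F : ℝ → ℝ → P → P,
      IsGaugeVariation IP B J V K (gaugeCurve B ξ s) F → ∀ t ∈ J,
      deriv (fun ε : ℝ => instLagrangian IX IP B μ L V K t (F ε t) (velocity IP (F ε) t)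
        (flatConnection (EG := EG) IP ξ)) 0 =
      ∫ m in K, firstVar (𝓘(ℝ, ℝ).prod IX) G (lineLag IX IP EG B e L) (lineLog IX EG ξ s)
        (variationField EG fun ε x => ξ (F ε x.1 (e x.2))) (t, m) ∂μ := by
    intro K hK hKV F hF t ht
    have hk := hT.contMDiffOn_triv_gaugeVariation hF
    have h := hasDerivAt_sliceIntegral_rlog (μ := μ) hJ hT.isOpen hΛ
      (Λ := lineLag IX IP EG B e L) (k := fun ε x => ξ (F ε x.1 (e x.2)))
      (h := fun x => ξ (s x).2) hk
      (hT.contMDiffOn_lineLag_variation (k := fun ε x => ξ (F ε x.1 (e x.2))) hJ hL hinv hk)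
      (fun x hx => by
        rw [hF.zero x.1 hx.1 _ (hT.sec_mem hx.2), hT.triv_gaugeCurve hs hx.1 hx.2]) ht hK hKV
    refine (congrArg (fun f : ℝ → ℝ => deriv f 0) (funext fun ε =>
      hT.instLagrangian_curve hJ hinv ht hK hKV (gaugeVariation_slice hF ε)
      (hF.gauge ε))).trans h.deriv
  constructor
  · intro H K hK hKV η hη hηK t ht
    obtain ⟨k, hk, hk0, hkη, hkv⟩ := exists_variation (hT.contMDiffOn_section_triv hs) hη
    have hF := hT.isGaugeVariation hs (K := K) hk hk0 fun ε t ht m hm => hkη _ (hηK t ht m hm) ε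
    have h := H K hK hKV _ hF t ht
    rw [key2 K hK hKV _ hF t ht] at h
    have e1 : ∀ x ∈ J ×ˢ V, variationField EG (fun ε (x : ℝ × X) =>
        ξ (B.act (e (B.proj (e x.2))) (k ε (x.1, B.proj (e x.2)) * ξ (e x.2)))) x = η x := by
      intro x hx
      rw [← hkv x]
      exact congrArg (fun c : ℝ → G => rlog 𝓘(ℝ, ℝ) EG c 0 (1 : ℝ))
        (funext fun ε => hT.triv_act_curve (k := fun m => k ε (x.1, m)) hx.2)
    have e2 : ∫ m in K, firstVar (𝓘(ℝ, ℝ).prod IX) G (lineLag IX IP EG B e L)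
        (lineLog IX EG ξ s) (variationField EG (fun ε (x : ℝ × X) =>
        ξ (B.act (e (B.proj (e x.2))) (k ε (x.1, B.proj (e x.2)) * ξ (e x.2))))) (t, m) ∂μ =
        ∫ m in K, firstVar (𝓘(ℝ, ℝ).prod IX) G (lineLag IX IP EG B e L)
        (lineLog IX EG ξ s) η (t, m) ∂μ :=
      setIntegral_congr_fun hK.measurableSet fun m hm => firstVar_congr (by
        filter_upwards [(hJ.prod hT.isOpen).mem_nhds (x := (t, m)) ⟨ht, hKV hm⟩] with y hy
          using e1 y hy)
    rw [← e2]
    refine h.congr_of_eventuallyEq ?_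
    filter_upwards [hJ.mem_nhds ht] with τ hτ
    refine Eq.trans ?_ (key1 K hK hKV _ hF τ hτ).symm
    refine setIntegral_congr_fun hK.measurableSet fun m hm => ?_
    exact congrArg (fun v => fderiv ℝ (lineLag IX IP EG B e L (τ, m)) (lineLog IX EG ξ s (τ, m))
      (joinForm v 0)) (e1 (τ, m) ⟨hτ, hKV hm⟩).symm
  · intro H K hK hKV F hF t ht
    have h := H K hK hKV _ (contMDiffOn_variationField (h := fun ε x => ξ (F ε x.1 (e x.2))) (hJ.prod hT.isOpen)
      (hT.contMDiffOn_triv_gaugeVariation hF)) (fun t ht m hm => by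
        have hp : e m ∈ B.part (V \ K) := by
          change B.proj (e m) ∈ V \ K
          rwa [hT.proj_sec m hm.1]
        rw [variationField]
        simp only [hF.support _ t ht _ hp]
        rw [rlog_const, _root_.zero_apply]) t ht
    rw [key2 K hK hKV _ hF t ht]
    refine h.congr_of_eventuallyEq ?_
    filter_upwards [hJ.mem_nhds ht] with τ hτ
    exact key1 K hK hKV _ hF τ hτ

/-! ### The reduced principle -/

omit [IsFiniteMeasureOnCompacts μ] [SFinite μ] in
/-- The reduced Lagrangian is the integral of `lineLag` at the form `κ` whose time component
represents the velocity and whose space component represents the connection. -/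
theorem redLagrangian_eq (hJ : IsOpen J)
    (hinv : Invariant (𝓘(ℝ, ℝ).prod IX) (𝓘(ℝ, ℝ).prod IP) B.timesLine L) {t : ℝ} (ht : t ∈ J)
    {K : Set X} (hK : IsCompact K) (hKV : K ⊆ V) {f : P → EG} {A : P → EP →L[ℝ] EG}
    {κ : X → ℝ × EX →L[ℝ] EG}
    (hf : ∀ p ∈ B.part V, f p = Ad G (ξ p)⁻¹ (κ (B.proj p) (1, 0)))
    (hA : ∀ p ∈ B.part V, A p = (Ad G (ξ p)⁻¹).comp (rlog IP EG ξ p -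
      ((κ (B.proj p)).comp (ContinuousLinearMap.inr ℝ ℝ EX)).comp (der IP IX B.proj p))) :
    redLagrangian IX IP B μ (reduce (𝓘(ℝ, ℝ).prod IX) (𝓘(ℝ, ℝ).prod IP) B.timesLine L hinv) K t
        f A =
      ∫ m in K, lineLag IX IP EG B e L (t, m) (κ m) ∂μ := by
  refine setIntegral_congr_fun hK.measurableSet fun m hm => ?_
  refine hT.descend_eq (hKV hm) fun p hpm => ?_
  have hp : p ∈ B.part V := by change B.proj p ∈ V; rw [hpm]; exact hKV hm
  refine (redEval_reduce _ _ _ _).trans ?_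
  have hh := hT.horLift_spec hp (hA p hp)
  have h1 : der IP IX B.proj p (gen IP EG B p (f p)) = 0 :=
    congrArg (fun T : EG →L[ℝ] EX => T (f p)) (hT.der_proj_gen p)
  have h2 : rlog IP EG ξ p (gen IP EG B p (f p)) = κ (B.proj p) (1, 0) := by
    refine (congrArg (fun T : EG →L[ℝ] EG => T (f p)) (hT.rlog_gen hp)).trans ?_
    rw [hf p hp, Ad_Ad_inv]
  have h := hT.jetEval_splitJet hJ hinv ht hp h1 hh.1 h2 hh.2
  rw [joinForm_decomp, hpm] at h
  exact h

omit [IsFiniteMeasureOnCompacts μ] [SFinite μ] [MeasurableSpace X] [OpensMeasurableSpace X]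
  [T2Space X] in
/-- The pushed forward connection is represented by the space component of the space-time
logarithmic derivative. -/
theorem pushForm_gaugeCurve (hJ : IsOpen J)
    (hs : IsLocalSection (𝓘(ℝ, ℝ).prod IX) (𝓘(ℝ, ℝ).prod IP) B.timesLine (J ×ˢ V) s)
    {t : ℝ} (ht : t ∈ J) {p : P} (hp : p ∈ B.part V) :
    pushForm IP B V (gaugeCurve B ξ s t) (flatConnection (EG := EG) IP ξ) p =
      (Ad G (ξ p)⁻¹).comp (rlog IP EG ξ p -
        ((lineLog IX EG ξ s (t, B.proj p)).comp (ContinuousLinearMap.inr ℝ ℝ EX)).comp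
          (der IP IX B.proj p)) := by
  rw [hT.pushForm_eq (fun q hq => hT.flatConnection_eq hq) (hT.isGauge_gaugeCurve hs ht) hp,
    hT.lineLog_eq_joinForm hJ hs ht hp]
  congr 3
  ext u
  simp

omit [IsFiniteMeasureOnCompacts μ] [SFinite μ] [MeasurableSpace X] [OpensMeasurableSpace X]
  [T2Space X] in
/-- The velocity `U_t` is represented by the time component of the space-time logarithmic
derivative. -/
theorem bodyVelocity_gaugeCurve (hJ : IsOpen J)
    (hs : IsLocalSection (𝓘(ℝ, ℝ).prod IX) (𝓘(ℝ, ℝ).prod IP) B.timesLine (J ×ˢ V) s)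
    {t : ℝ} (ht : t ∈ J) {p : P} (hp : p ∈ B.part V) :
    bodyVelocity IP B V (gaugeCurve B ξ s) t p =
      Ad G (ξ p)⁻¹ (lineLog IX EG ξ s (t, B.proj p) (1, 0)) := by
  have hg : ∀ t ∈ J, IsGauge IP B V (gaugeCurve B ξ s t) := fun t ht => hT.isGauge_gaugeCurve hs ht
  obtain ⟨hq, hqp⟩ := locInv_spec (hg t ht).bijOn.surjOn hp
  have hpr := (hg t ht).proj_eq _ hq
  rw [hqp] at hpr
  have h := hT.velocity_spec hJ (hT.contMDiffOn_gaugeCurve hs) hg ht hq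
  rw [hqp] at h
  refine (hT.generator_eq hp h.1).trans ?_
  refine congrArg (Ad G (ξ p)⁻¹) (h.2.trans ?_)
  rw [hT.lineLog_eq_joinForm hJ hs ht hp, ← hpr]
  simp

/-- In the trivialization the variations `∂ζ/∂t - [U, ζ]` of the velocity and `-dζ - [Γ, ζ]` of the
connection are the time and space components of `dη + [η, ν]`. -/
theorem redLagrangian_variation_eq (hJ : IsOpen J)
    (hinv : Invariant (𝓘(ℝ, ℝ).prod IX) (𝓘(ℝ, ℝ).prod IP) B.timesLine L)
    (hs : IsLocalSection (𝓘(ℝ, ℝ).prod IX) (𝓘(ℝ, ℝ).prod IP) B.timesLine (J ×ˢ V) s)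
    {K : Set X} (hK : IsCompact K) (hKV : K ⊆ V) {η : ℝ × X → EG}
    (hη : ContMDiffOn (𝓘(ℝ, ℝ).prod IX) 𝓘(ℝ, EG) ∞ η (J ×ˢ V)) {ζ : ℝ → P → EG}
    (hζ : ∀ t ∈ J, ∀ p ∈ B.part V, ζ t p = Ad G (ξ p)⁻¹ (η (t, B.proj p)))
    {t : ℝ} (ht : t ∈ J) (ε : ℝ) :
    redLagrangian IX IP B μ (reduce (𝓘(ℝ, ℝ).prod IX) (𝓘(ℝ, ℝ).prod IP) B.timesLine L hinv) K t
      (fun p => bodyVelocity IP B V (gaugeCurve B ξ s) t p + ε • (deriv (fun τ => ζ τ p) t -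
        ad G (bodyVelocity IP B V (gaugeCurve B ξ s) t p) (ζ t p)))
      (fun p => pushForm IP B V (gaugeCurve B ξ s t) (flatConnection (EG := EG) IP ξ) p -
        ε • covDiff IP G (pushForm IP B V (gaugeCurve B ξ s t)
          (flatConnection (EG := EG) IP ξ)) (ζ t) p) =
      ∫ m in K, lineLag IX IP EG B e L (t, m) (lineLog IX EG ξ s (t, m) +
        ε • (der (𝓘(ℝ, ℝ).prod IX) 𝓘(ℝ, EG) η (t, m) +
          (ad G (η (t, m))).comp (lineLog IX EG ξ s (t, m)))) ∂μ := by
  have hηd : ∀ m ∈ V, MDifferentiableAt (𝓘(ℝ, ℝ).prod IX) 𝓘(ℝ, EG) η (t, m) := fun m hm =>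
    (hη.contMDiffAt ((hJ.prod hT.isOpen).mem_nhds (x := (t, m)) ⟨ht, hm⟩)).mdifferentiableAt
      (by simp)
  have hηs : ∀ m ∈ V, MDifferentiableAt IX 𝓘(ℝ, EG) (fun y => η (t, y)) m := fun m hm =>
    MDifferentiableAt.comp m (g := η) (f := fun y => (t, y)) (hηd m hm)
      (mdifferentiableAt_const.prodMk mdifferentiableAt_id)
  have hηt : ∀ m ∈ V, HasDerivAt (fun τ => η (τ, m)) (deriv (fun τ => η (τ, m)) t) t :=
    fun m hm => (mdifferentiableAt_iff_differentiableAt.1 (MDifferentiableAt.comp t (g := η)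
      (f := fun τ => (τ, m)) (hηd m hm)
      (mdifferentiableAt_id.prodMk mdifferentiableAt_const))).hasDerivAt
  refine hT.redLagrangian_eq hJ hinv ht hK hKV
    (κ := fun m => lineLog IX EG ξ s (t, m) + ε • (der (𝓘(ℝ, ℝ).prod IX) 𝓘(ℝ, EG) η (t, m) +
          (ad G (η (t, m))).comp (lineLog IX EG ξ s (t, m)))) ?_ ?_
  · intro p hp
    have h1 : deriv (fun τ => ζ τ p) t =
        Ad G (ξ p)⁻¹ (deriv (fun τ => η (τ, B.proj p)) t) := by
      refine HasDerivAt.deriv ?_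
      refine ((Ad G (ξ p)⁻¹ : EG →L[ℝ] EG).hasFDerivAt.comp_hasDerivAt t
        (hηt _ hp)).congr_of_eventuallyEq ?_
      filter_upwards [hJ.mem_nhds ht] with τ hτ using hζ τ hτ p hp
    rw [h1, hζ t ht p hp, hT.bodyVelocity_gaugeCurve hJ hs ht hp, ← Ad_ad,
      der_prod_eq_joinForm (hηd _ hp)]
    simp only [_root_.add_apply, _root_.smul_apply, ContinuousLinearMap.comp_apply,
      joinForm_apply, one_smul, map_zero, add_zero, map_add, map_smul]
    rw [ad_swap (G := G) (lineLog IX EG ξ s (t, B.proj p) (1, 0)), map_neg, sub_neg_eq_add]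
  · intro p hp
    have h1 := hT.covDiff_eq hp (f := ζ t) (hT.pushForm_gaugeCurve hJ hs ht hp) (hηs _ hp)
      (fun q hq => hζ t ht q hq)
    have h2 := hT.pushForm_gaugeCurve hJ hs ht hp
    refine (congrArg₂ (fun S T : EP →L[ℝ] EG => S - ε • T) h2 h1).trans ?_
    rw [der_prod_eq_joinForm (hηd _ hp)]
    refine ContinuousLinearMap.ext fun v => ?_
    simp only [_root_.add_apply, _root_.smul_apply, ContinuousLinearMap.comp_apply,
      joinForm_apply, map_add, map_smul, _root_.sub_apply, map_sub,
      ContinuousLinearMap.inr_apply, zero_smul, zero_add]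
    abel

/-- The reduced dynamic principle is stationarity of the space-time action for variations which
vanish at the endpoints. -/
theorem affineReducedPrinciple_iff (hJ : IsOpen J)
    (hL : SmoothOnJets (𝓘(ℝ, ℝ).prod IX) (𝓘(ℝ, ℝ).prod IP) B.timesLine L)
    (hinv : Invariant (𝓘(ℝ, ℝ).prod IX) (𝓘(ℝ, ℝ).prod IP) B.timesLine L)
    (hs : IsLocalSection (𝓘(ℝ, ℝ).prod IX) (𝓘(ℝ, ℝ).prod IP) B.timesLine (J ×ˢ V) s) :
    AffineReducedPrinciple IX IP B μ
        (reduce (𝓘(ℝ, ℝ).prod IX) (𝓘(ℝ, ℝ).prod IP) B.timesLine L hinv) J V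
        (bodyVelocity IP B V (gaugeCurve B ξ s))
        (fun t => pushForm IP B V (gaugeCurve B ξ s t) (flatConnection (EG := EG) IP ξ)) ↔
      EndpointEquation IX G μ J V (lineLag IX IP EG B e L) (lineLog IX EG ξ s) := by
  have hΛ := hT.fibreSmooth_lineLag hJ hL hinv
  have hν := hT.smoothFormOn_lineLog hJ hs
  have key : ∀ t₁ t₂ : ℝ, t₁ < t₂ → Icc t₁ t₂ ⊆ J → ∀ K : Set X, IsCompact K → K ⊆ V →
      ∀ η : ℝ × X → EG, ContMDiffOn (𝓘(ℝ, ℝ).prod IX) 𝓘(ℝ, EG) ∞ η (J ×ˢ V) →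
      ∀ ζ : ℝ → P → EG, (∀ t ∈ J, ∀ p ∈ B.part V, ζ t p = Ad G (ξ p)⁻¹ (η (t, B.proj p))) →
      HasDerivAt (fun ε : ℝ => ∫ t in t₁..t₂, redLagrangian IX IP B μ
        (reduce (𝓘(ℝ, ℝ).prod IX) (𝓘(ℝ, ℝ).prod IP) B.timesLine L hinv) K t
        (fun p => bodyVelocity IP B V (gaugeCurve B ξ s) t p + ε • (deriv (fun τ => ζ τ p) t -
          ad G (bodyVelocity IP B V (gaugeCurve B ξ s) t p) (ζ t p)))
        (fun p => pushForm IP B V (gaugeCurve B ξ s t) (flatConnection (EG := EG) IP ξ) p -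
          ε • covDiff IP G (pushForm IP B V (gaugeCurve B ξ s t)
            (flatConnection (EG := EG) IP ξ)) (ζ t) p))
        (∫ t in t₁..t₂, ∫ m in K, firstVar (𝓘(ℝ, ℝ).prod IX) G (lineLag IX IP EG B e L)
          (lineLog IX EG ξ s) η (t, m) ∂μ) 0 := by
    intro t₁ t₂ h12 hIJ K hK hKV η hη ζ hζ
    have hC := smoothFormOn_firstVar_direction (G := G) (hJ.prod hT.isOpen) hν hη
    have h := hΛ.hasDerivAt_intervalIntegral (μ := μ) hJ hT.isOpen hν hC h12 hIJ hK hKV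
    refine h.congr_of_eventuallyEq (Eventually.of_forall fun ε => ?_)
    refine intervalIntegral.integral_congr fun t ht => ?_
    rw [uIcc_of_le h12.le] at ht
    exact hT.redLagrangian_variation_eq hJ hinv hs hK hKV hη hζ (hIJ ht) ε
  constructor
  · intro H t₁ t₂ h12 hIJ K hK hKV η hη hηK hηe
    have hsec : ContMDiffOn (𝓘(ℝ, ℝ).prod IP) 𝓘(ℝ, EG) ∞
        (fun z : ℝ × P => Ad G (ξ z.2)⁻¹ (η (z.1, B.proj z.2))) (J ×ˢ B.part V) := by
      have h1 := contMDiffOn_Ad_comp (hT.smooth_triv.inv.comp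
        (contMDiffOn_snd (I := 𝓘(ℝ, ℝ)) (M := ℝ) (s := J ×ˢ B.part V)) fun z hz => hz.2)
      refine h1.clm_apply (hη.comp (f := fun z : ℝ × P => (z.1, B.proj z.2))
        (contMDiffOn_fst.prodMk (hT.smooth_proj.comp_contMDiffOn contMDiffOn_snd))
        fun z hz => ⟨hz.1, hz.2⟩)
    refine (key t₁ t₂ h12 hIJ K hK hKV η hη (fun t p => Ad G (ξ p)⁻¹ (η (t, B.proj p)))
      fun t _ p _ => rfl).unique (H t₁ t₂ h12 hIJ K hK hKV _ hsec ?_ ?_ ?_)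
    · intro t ht
      exact hT.isAdSection (η := fun m => η (t, m)) (hη.comp (f := fun m => (t, m))
        (contMDiffOn_const.prodMk contMDiffOn_id) fun m hm => ⟨ht, hm⟩)
    · intro t ht p hp
      rw [hηK t ht _ hp, map_zero]
    · intro p hp
      rw [(hηe _ hp).1, (hηe _ hp).2, map_zero]
      exact ⟨rfl, rfl⟩
  · intro H t₁ t₂ h12 hIJ K hK hKV ζ hζs hζa hζK hζe
    have hη : ContMDiffOn (𝓘(ℝ, ℝ).prod IX) 𝓘(ℝ, EG) ∞ (fun x : ℝ × X => ζ x.1 (e x.2))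
        (J ×ˢ V) :=
      hζs.comp (f := fun x : ℝ × X => (x.1, e x.2))
        (contMDiffOn_fst.prodMk (hT.smooth_sec.comp contMDiffOn_snd fun _ hx => hx.2))
        fun _ hx => ⟨hx.1, hT.sec_mem hx.2⟩
    have h := key t₁ t₂ h12 hIJ K hK hKV _ hη ζ fun t ht p hp => hT.adSection_eq (hζa t ht) hp
    rwa [H t₁ t₂ h12 hIJ K hK hKV _ hη
      (fun t ht => hT.vanish_adSection (f := ζ t) (hζK t ht))
      (fun m hm => hζe _ (hT.sec_mem hm))] at h

end Measure

end IsTrivialized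

end DynamicEquations

/-! ### The divergence theorem -/

section Trace

variable {E : Type*} [NormedAddCommGroup E] [NormedSpace ℝ E] [FiniteDimensional ℝ E]

theorem trace_eq_sum_finBasis (A : E →L[ℝ] E) : LinearMap.trace ℝ E A.toLinearMap =
    ∑ i, (Module.finBasis ℝ E).repr (A (Module.finBasis ℝ E i)) i := by
  rw [LinearMap.trace_eq_matrix_trace ℝ (Module.finBasis ℝ E), Matrix.trace]
  refine Finset.sum_congr rfl fun i _ => ?_
  rw [Matrix.diag_apply, LinearMap.toMatrix_apply]
  rfl

theorem trace_smulRight (T : E →L[ℝ] ℝ) (v : E) :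
    LinearMap.trace ℝ E (T.smulRight v).toLinearMap = T v := by
  rw [trace_eq_sum_finBasis]
  conv_rhs => rw [← (Module.finBasis ℝ E).sum_repr v, map_sum]
  refine Finset.sum_congr rfl fun i _ => ?_
  simp [mul_comm]

/-- `vecOf` inverts the identification of a finite dimensional space with its bidual. -/
theorem apply_vecOf (F : (E →L[ℝ] ℝ) →L[ℝ] ℝ) (β : E →L[ℝ] ℝ) :
    β (vecOf (fun γ => F γ)) = F β := by
  have h : β = ∑ i, β (Module.finBasis ℝ E i) •
      LinearMap.toContinuousLinearMap ((Module.finBasis ℝ E).coord i) := by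
    ext v
    conv_lhs => rw [← (Module.finBasis ℝ E).sum_repr v, map_sum]
    simp [mul_comm]
  conv_rhs => rw [h]
  rw [vecOf, map_sum, map_sum]
  simp [mul_comm]

/-- The integral of the divergence of a compactly supported vector field vanishes. -/
theorem integral_trace_fderiv_eq_zero [MeasurableSpace E] [BorelSpace E] {lam : Measure E}
    [lam.IsAddHaarMeasure] {Z : E → E} (hZ : ContDiff ℝ 1 Z) (hc : HasCompactSupport Z) :
    ∫ y, LinearMap.trace ℝ E (fderiv ℝ Z y).toLinearMap ∂lam = 0 := by
  have hD := hZ.continuous_fderiv (by simp)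
  have key : ∀ i, Integrable (fun y => (Module.finBasis ℝ E).repr
      (fderiv ℝ Z y (Module.finBasis ℝ E i)) i) lam ∧
      ∫ y, (Module.finBasis ℝ E).repr (fderiv ℝ Z y (Module.finBasis ℝ E i)) i ∂lam = 0 := by
    intro i
    let ℓ : E →L[ℝ] ℝ := LinearMap.toContinuousLinearMap ((Module.finBasis ℝ E).coord i)
    have e : ∀ y, (Module.finBasis ℝ E).repr (fderiv ℝ Z y (Module.finBasis ℝ E i)) i =
        fderiv ℝ (fun y => ℓ (Z y)) y (Module.finBasis ℝ E i) := by
      intro y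
      have h1 := (ℓ.hasFDerivAt.comp y (hZ.differentiable (by simp) y).hasFDerivAt).fderiv
      rw [show fderiv ℝ (fun y => ℓ (Z y)) y = _ from h1]
      rfl
    have hℓ : HasCompactSupport (fun y => ℓ (Z y)) := hc.comp_left (map_zero ℓ)
    have hcd : ContDiff ℝ 1 (fun y => ℓ (Z y)) := ℓ.contDiff.comp hZ
    have hi : Integrable (fun y => fderiv ℝ (fun y => ℓ (Z y)) y (Module.finBasis ℝ E i)) lam :=
      ((hcd.continuous_fderiv (by simp)).clm_apply continuous_const).integrable_of_hasCompactSupport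
        (hℓ.fderiv_apply (𝕜 := ℝ) _)
    simp only [e]
    refine ⟨hi, ?_⟩
    have h := integral_mul_fderiv_eq_neg_fderiv_mul_of_integrable (μ := lam) (f := fun _ : E => (1 : ℝ))
      (g := fun y => ℓ (Z y)) (v := Module.finBasis ℝ E i) (by simp)
      (by simpa using hi) (by simpa using hcd.continuous.integrable_of_hasCompactSupport hℓ)
      (fun x _ => differentiableAt_const _) (fun x _ => hcd.differentiable (by simp) x)
    simpa using h
  simp only [trace_eq_sum_finBasis]
  rw [integral_finsetSum _ fun i _ => (key i).1]
  exact Finset.sum_eq_zero fun i _ => (key i).2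

end Trace

section Divergence

variable {EX : Type*} [NormedAddCommGroup EX] [NormedSpace ℝ EX] [FiniteDimensional ℝ EX]
  {HX : Type*} [TopologicalSpace HX] {IX : ModelWithCorners ℝ EX HX} [IX.Boundaryless]
  {X : Type*} [TopologicalSpace X] [ChartedSpace HX X] [IsManifold IX ∞ X]

variable (IX) in
/-- The functions `ρ x₀` are smooth densities of the measure `μ` in the charts, with respect to the
measure `lam` on the model space. -/
structure HasChartDensity [MeasurableSpace EX] [MeasurableSpace X] (lam : Measure EX)
    (μ : Measure X) (ρ : X → EX → ℝ) : Prop where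
  smooth : ∀ x₀, ContDiffOn ℝ ∞ (ρ x₀) (extChartAt IX x₀).target
  ne_zero : ∀ x₀, ∀ y ∈ (extChartAt IX x₀).target, ρ x₀ y ≠ 0
  integral_eq : ∀ x₀ (f : X → ℝ), Continuous f → HasCompactSupport f →
    tsupport f ⊆ (extChartAt IX x₀).source →
    ∫ x, f x ∂μ = ∫ y in (extChartAt IX x₀).target,
      |ρ x₀ y| * f ((extChartAt IX x₀).symm y) ∂lam

variable (IX) in
/-- Smoothness of a vector field over an open set: it maps smooth functions to smooth functions. -/
def IsSmoothField (U : Set X) (W : X → EX) : Prop :=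
  ∀ O : Set X, IsOpen O → O ⊆ U → ∀ f : X → ℝ, ContMDiffOn IX 𝓘(ℝ, ℝ) ∞ f O →
    ContMDiffOn IX 𝓘(ℝ, ℝ) ∞ (fun x => der IX 𝓘(ℝ, ℝ) f x (W x)) O

theorem IsSmoothField.mono {U U' : Set X} {W : X → EX} (h : IsSmoothField IX U W) (hU : U' ⊆ U) :
    IsSmoothField IX U' W := fun O hO hOU => h O hO (hOU.trans hU)

variable (IX) in
/-- The vector field `W` in the chart at `x₀`. -/
def chartField (x₀ : X) (W : X → EX) (y : EX) : EX :=
  der IX 𝓘(ℝ, EX) (extChartAt IX x₀) ((extChartAt IX x₀).symm y) (W ((extChartAt IX x₀).symm y))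

variable (IX) in
/-- The divergence of `W` computed in the chart at `x₀`. -/
def chartDiv (ρ : X → EX → ℝ) (W : X → EX) (x₀ x : X) : ℝ :=
  (ρ x₀ (extChartAt IX x₀ x))⁻¹ * LinearMap.trace ℝ EX
    (fderiv ℝ (fun y => ρ x₀ y • chartField IX x₀ W y) (extChartAt IX x₀ x)).toLinearMap

omit [IX.Boundaryless] [IsManifold IX ∞ X] in
omit [FiniteDimensional ℝ EX] [IX.Boundaryless] [IsManifold IX ∞ X] in
theorem der_clm_comp {F F' : Type*} [NormedAddCommGroup F] [NormedSpace ℝ F]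
    [NormedAddCommGroup F'] [NormedSpace ℝ F'] (ℓ : F →L[ℝ] F') {f : X → F} {x : X}
    (hf : MDifferentiableAt IX 𝓘(ℝ, F) f x) :
    der IX 𝓘(ℝ, F') (fun y => ℓ (f y)) x = ℓ.comp (der IX 𝓘(ℝ, F) f x) := by
  rw [der_comp (g := fun v : F => ℓ v)
    (ℓ.differentiableAt.mdifferentiableAt : MDifferentiableAt 𝓘(ℝ, F) 𝓘(ℝ, F') ℓ (f x)) hf,
    der_eq_fderiv]
  congr 1
  exact ℓ.fderiv

theorem isOpen_chart_preimage (x₀ : X) {U : Set X} (hU : IsOpen U) :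
    IsOpen ((extChartAt IX x₀).target ∩ (extChartAt IX x₀).symm ⁻¹' U) :=
  (continuousOn_extChartAt_symm x₀).isOpen_inter_preimage (isOpen_extChartAt_target x₀) hU

theorem IsSmoothField.contDiffOn_chartField {U : Set X} (hU : IsOpen U) {W : X → EX}
    (hW : IsSmoothField IX U W) (x₀ : X) :
    ContDiffOn ℝ ∞ (chartField IX x₀ W)
      ((extChartAt IX x₀).target ∩ (extChartAt IX x₀).symm ⁻¹' U) := by
  set φ := extChartAt IX x₀ with hφ
  have hO : IsOpen (φ.source ∩ U) := (isOpen_extChartAt_source x₀).inter hU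
  have hφs : ContMDiffOn IX 𝓘(ℝ, EX) ∞ φ φ.source :=
    contMDiffOn_extChartAt.mono (by rw [hφ, extChartAt_source])
  have key : ∀ ℓ : EX →L[ℝ] ℝ, ContDiffOn ℝ ∞ (fun y => ℓ (chartField IX x₀ W y))
      (φ.target ∩ φ.symm ⁻¹' U) := by
    intro ℓ
    have h1 := hW _ hO inter_subset_right (fun x => ℓ (φ x))
      (ℓ.contDiff.contMDiff.comp_contMDiffOn (hφs.mono inter_subset_left))
    have h2 := h1.comp ((contMDiffOn_extChartAt_symm x₀).mono inter_subset_left)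
      (fun y (hy : y ∈ φ.target ∩ φ.symm ⁻¹' U) => ⟨φ.map_target hy.1, hy.2⟩)
    rw [contMDiffOn_iff_contDiffOn] at h2
    refine h2.congr fun y hy => ?_
    have hd : MDifferentiableAt IX 𝓘(ℝ, EX) φ (φ.symm y) :=
      (hφs.contMDiffAt ((isOpen_extChartAt_source x₀).mem_nhds (φ.map_target hy.1))).mdifferentiableAt
        (by simp)
    exact (congrArg (fun T : EX →L[ℝ] ℝ => T (W (φ.symm y))) (der_clm_comp ℓ hd)).symm
  have e : chartField IX x₀ W = fun y => ∑ i, (LinearMap.toContinuousLinearMap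
      ((Module.finBasis ℝ EX).coord i)) (chartField IX x₀ W y) • Module.finBasis ℝ EX i := by
    funext y
    exact ((Module.finBasis ℝ EX).sum_repr _).symm
  rw [e]
  exact ContDiffOn.sum fun i _ => (key _).smul contDiffOn_const

theorem continuousOn_chartDiv {U : Set X} (hU : IsOpen U) {W : X → EX}
    (hW : IsSmoothField IX U W) {ρ : X → EX → ℝ} {x₀ : X}
    (hρ : ContDiffOn ℝ ∞ (ρ x₀) (extChartAt IX x₀).target)
    (hρ0 : ∀ y ∈ (extChartAt IX x₀).target, ρ x₀ y ≠ 0) :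
    ContinuousOn (chartDiv IX ρ W x₀) ((extChartAt IX x₀).source ∩ U) := by
  set φ := extChartAt IX x₀ with hφ
  have hT := isOpen_chart_preimage (IX := IX) x₀ hU
  have hm : MapsTo φ (φ.source ∩ U) (φ.target ∩ φ.symm ⁻¹' U) := fun x hx =>
    ⟨φ.map_source hx.1, by change φ.symm (φ x) ∈ U; rw [φ.left_inv hx.1]; exact hx.2⟩
  have h1 : ContinuousOn (fun y => (ρ x₀ y)⁻¹ * LinearMap.trace ℝ EX
      (fderiv ℝ (fun y => ρ x₀ y • chartField IX x₀ W y) y).toLinearMap)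
      (φ.target ∩ φ.symm ⁻¹' U) := by
    refine ((hρ.continuousOn.inv₀ hρ0).mono inter_subset_left).mul ?_
    have h2 : ContDiffOn ℝ ∞ (fun y => ρ x₀ y • chartField IX x₀ W y) (φ.target ∩ φ.symm ⁻¹' U) :=
      (hρ.mono inter_subset_left).smul (hW.contDiffOn_chartField hU x₀)
    have h3 := h2.continuousOn_fderiv_of_isOpen hT (by simp)
    have h4 : Continuous fun A : EX →L[ℝ] EX => LinearMap.trace ℝ EX A.toLinearMap :=
      ((LinearMap.trace ℝ EX).comp
        (ContinuousLinearMap.coeLM ℝ : (EX →L[ℝ] EX) →ₗ[ℝ] _)).continuous_of_finiteDimensional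
    exact h4.comp_continuousOn h3
  exact h1.comp ((continuousOn_extChartAt x₀).mono inter_subset_left) hm

theorem tsupport_mul_add_der_subset {W : X → EX} {f c : X → ℝ} :
    tsupport (fun x => f x * c x + der IX 𝓘(ℝ, ℝ) f x (W x)) ⊆ tsupport f := by
  refine closure_minimal (fun x hx => ?_) (isClosed_tsupport f)
  by_contra hxf
  refine hx ?_
  have h0 : f =ᶠ[𝓝 x] fun _ => 0 := notMem_tsupport_iff_eventuallyEq.1 hxf
  change f x * c x + der IX 𝓘(ℝ, ℝ) f x (W x) = 0
  rw [h0.eq_of_nhds, der_congr h0, der_const, zero_mul, _root_.zero_apply, add_zero]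

/-- The divergence theorem for a function supported in the domain of a chart. -/
theorem integral_chartDiv_eq_zero [MeasurableSpace EX] [BorelSpace EX] {lam : Measure EX}
    [lam.IsAddHaarMeasure] [MeasurableSpace X] {μ : Measure X} {ρ : X → EX → ℝ}
    [T2Space X]
    (hμ : HasChartDensity IX lam μ ρ) {U : Set X} (hU : IsOpen U) {W : X → EX}
    (hW : IsSmoothField IX U W) (x₀ : X) {f : X → ℝ} (hf : ContMDiff IX 𝓘(ℝ, ℝ) ∞ f)
    (hc : HasCompactSupport f) (hs : tsupport f ⊆ (extChartAt IX x₀).source ∩ U) :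
    ∫ x, (f x * chartDiv IX ρ W x₀ x + der IX 𝓘(ℝ, ℝ) f x (W x)) ∂μ = 0 := by
  set φ := extChartAt IX x₀ with hφ
  set g : X → ℝ := fun x => f x * chartDiv IX ρ W x₀ x + der IX 𝓘(ℝ, ℝ) f x (W x) with hg
  have hO : IsOpen (φ.source ∩ U) := (isOpen_extChartAt_source x₀).inter hU
  have hgs : tsupport g ⊆ tsupport f := tsupport_mul_add_der_subset
  have hgc : Continuous g := by
    refine ContinuousOn.continuous_of_tsupport_subset ?_ hO (hgs.trans hs)
    exact (hf.continuous.continuousOn.mul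
      (continuousOn_chartDiv hU hW (hμ.smooth x₀) (hμ.ne_zero x₀))).add
      (hW _ hO inter_subset_right f hf.contMDiffOn).continuousOn
  rw [hμ.integral_eq x₀ g hgc (hc.of_isClosed_subset (isClosed_tsupport g) hgs)
    ((hgs.trans hs).trans inter_subset_left)]
  -- The field `f |ρ| W` in the chart, extended by zero.
  set Z : EX → EX := φ.target.indicator
    (fun y => (f (φ.symm y) * |ρ x₀ y|) • chartField IX x₀ W y) with hZ
  set K := φ '' tsupport f with hK
  have hKc : IsCompact K := hc.isCompact.image_of_continuousOn
    ((continuousOn_extChartAt x₀).mono (hs.trans inter_subset_left))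
  have hKT : K ⊆ φ.target ∩ φ.symm ⁻¹' U := by
    rintro _ ⟨x, hx, rfl⟩
    refine ⟨φ.map_source (hs hx).1, ?_⟩
    change φ.symm (φ x) ∈ U
    rw [φ.left_inv (hs hx).1]
    exact (hs hx).2
  have hsymm : ∀ y ∈ φ.target, y ∉ K → φ.symm y ∉ tsupport f := fun y hy hyK h =>
    hyK ⟨φ.symm y, h, φ.right_inv hy⟩
  have hZ0 : ∀ y ∉ K, Z y = 0 := by
    intro y hy
    by_cases hyT : y ∈ φ.target
    · rw [hZ, indicator_of_mem hyT, image_eq_zero_of_notMem_tsupport (hsymm y hyT hy), zero_mul,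
        zero_smul]
    · exact indicator_of_notMem hyT _
  have hZn : ∀ y ∉ K, Z =ᶠ[𝓝 y] fun _ => 0 := fun y hy => by
    filter_upwards [hKc.isClosed.isOpen_compl.mem_nhds hy] with z hz using hZ0 z hz
  -- The sign of the density is locally constant.
  have hloc : ∀ y ∈ K, ∃ ε : ℝ, |ρ x₀ y| = ε * ρ x₀ y ∧
      Z =ᶠ[𝓝 y] fun z => (ε * f (φ.symm z)) • (ρ x₀ z • chartField IX x₀ W z) := by
    intro y hy
    have hyT := (hKT hy).1
    have hcont : ContinuousAt (ρ x₀) y :=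
      (hμ.smooth x₀).continuousOn.continuousAt ((isOpen_extChartAt_target x₀).mem_nhds hyT)
    have hε : ∃ ε : ℝ, ∀ᶠ z in 𝓝 y, |ρ x₀ z| = ε * ρ x₀ z := by
      rcases lt_or_gt_of_ne (hμ.ne_zero x₀ y hyT) with h | h
      · refine ⟨-1, ?_⟩
        filter_upwards [hcont.eventually (gt_mem_nhds h)] with z hz
        rw [abs_of_neg hz, neg_one_mul]
      · refine ⟨1, ?_⟩
        filter_upwards [hcont.eventually (lt_mem_nhds h)] with z hz
        rw [abs_of_pos hz, one_mul]
    obtain ⟨ε, hε⟩ := hε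
    refine ⟨ε, hε.self_of_nhds, ?_⟩
    filter_upwards [hε, (isOpen_extChartAt_target x₀).mem_nhds hyT] with z hz hzT
    rw [hZ, indicator_of_mem hzT, hz, smul_smul]
    congr 1
    ring
  have hρW : ∀ y ∈ K, ContDiffAt ℝ ∞ (fun z => ρ x₀ z • chartField IX x₀ W z) y := fun y hy =>
    (((hμ.smooth x₀).mono inter_subset_left).smul (hW.contDiffOn_chartField hU x₀)).contDiffAt
      ((isOpen_chart_preimage x₀ hU).mem_nhds (hKT hy))
  have hfs : ∀ y ∈ K, ContDiffAt ℝ ∞ (fun z => f (φ.symm z)) y := fun y hy =>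
    (ContMDiffAt.comp y (g := f) hf.contMDiffAt
      (contMDiffAt_extChartAt_symm (hKT hy).1)).contDiffAt
  have hZs : ContDiff ℝ 1 Z := by
    refine contDiff_iff_contDiffAt.2 fun y => ?_
    by_cases hy : y ∈ K
    · obtain ⟨ε, -, hε⟩ := hloc y hy
      refine ContDiffAt.congr_of_eventuallyEq ?_ hε
      exact ((contDiffAt_const.mul (hfs y hy)).smul (hρW y hy)).of_le (by simp)
    · exact contDiffAt_const.congr_of_eventuallyEq (hZn y hy)
  have hZc : HasCompactSupport Z := HasCompactSupport.intro hKc hZ0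
  have hZd : ∀ y ∉ K, LinearMap.trace ℝ EX (fderiv ℝ Z y).toLinearMap = 0 := by
    intro y hy
    rw [(hZn y hy).fderiv_eq, fderiv_fun_const]
    simp
  rw [← integral_trace_fderiv_eq_zero hZs hZc (lam := lam),
    ← setIntegral_eq_integral_of_forall_compl_eq_zero (s := φ.target)
      (fun y hy => hZd y fun hyK => hy (hKT hyK).1)]
  refine setIntegral_congr_fun (isOpen_extChartAt_target x₀).measurableSet fun y hyT => ?_
  by_cases hy : y ∈ K
  · obtain ⟨ε, hε1, hε⟩ := hloc y hy
    -- The product rule for the trace of the derivative of `ε f · ρ W`.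
    have hd1 : HasFDerivAt (fun z => ε * f (φ.symm z))
        (ε • fderiv ℝ (fun z => f (φ.symm z)) y) y :=
      ((hfs y hy).differentiableAt (by simp)).hasFDerivAt.const_mul ε
    have hd2 := ((hρW y hy).differentiableAt (by simp)).hasFDerivAt
    have hmd : MDifferentiableAt IX 𝓘(ℝ, ℝ) f (φ.symm y) := hf.mdifferentiableAt (by simp)
    have h3 : fderiv ℝ (fun z => f (φ.symm z)) y (chartField IX x₀ W y) =
        der IX 𝓘(ℝ, ℝ) f (φ.symm y) (W (φ.symm y)) := by
      rw [← der_eq_fderiv, der_comp (g := f) hmd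
        ((contMDiffAt_extChartAt_symm hyT).mdifferentiableAt (by simp))]
      have h4 := der_symm_comp_extChartAt (I := IX) (φ.map_target hyT)
      rw [φ.right_inv hyT] at h4
      exact congrArg (der IX 𝓘(ℝ, ℝ) f (φ.symm y))
        (congrArg (fun T : EX →L[ℝ] EX => T (W (φ.symm y))) h4)
    have h5 : fderiv ℝ (fun z => (ε * f (φ.symm z)) • ρ x₀ z • chartField IX x₀ W z) y = _ :=
      (hd1.smul hd2).fderiv
    rw [hε.fderiv_eq, h5]
    change _ = LinearMap.trace ℝ EX ((ε * f (φ.symm y)) •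
        (fderiv ℝ (fun z => ρ x₀ z • chartField IX x₀ W z) y).toLinearMap +
      ((ε • fderiv ℝ (fun z => f (φ.symm z)) y).smulRight
        (ρ x₀ y • chartField IX x₀ W y)).toLinearMap)
    rw [map_add, map_smul, trace_smulRight, hg]
    simp only [chartDiv, smul_eq_mul, _root_.smul_apply, map_smul]
    rw [h3, φ.right_inv hyT, hε1]
    field_simp [hμ.ne_zero x₀ y hyT]
    simp only [hφ]
    ring
  · rw [hZd y hy, image_eq_zero_of_notMem_tsupport fun h => hsymm y hyT hy (hgs h), mul_zero]

end Divergence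

/-! ### Chart independence of the divergence, partitions of unity -/

theorem hasMFDerivAt_finset_sum {E : Type*} [NormedAddCommGroup E] [NormedSpace ℝ E]
    {H : Type*} [TopologicalSpace H] {I : ModelWithCorners ℝ E H}
    {X : Type*} [TopologicalSpace X] [ChartedSpace H X] {ι : Type*} (t : Finset ι)
    {f : ι → X → ℝ} {x : X} {f' : ι → (E →L[ℝ] ℝ)}
    (hf : ∀ i ∈ t, HasMFDerivAt I 𝓘(ℝ, ℝ) (f i) x (f' i)) :
    HasMFDerivAt I 𝓘(ℝ, ℝ) (∑ i ∈ t, f i) x (∑ i ∈ t, f' i : E →L[ℝ] ℝ) := by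
  classical
  induction t using Finset.induction_on with
  | empty =>
    rw [Finset.sum_empty, Finset.sum_empty]
    exact hasMFDerivAt_const (0 : ℝ) x
  | insert i t hi IH =>
    rw [Finset.sum_insert hi, Finset.sum_insert hi]
    exact (hf i (Finset.mem_insert_self i t)).add
      (IH fun j hj => hf j (Finset.mem_insert_of_mem hj))

section WeakDivergence

variable {EX : Type*} [NormedAddCommGroup EX] [NormedSpace ℝ EX] [FiniteDimensional ℝ EX]
  [MeasurableSpace EX] [BorelSpace EX] {lam : Measure EX} [lam.IsAddHaarMeasure]
  {HX : Type*} [TopologicalSpace HX] {IX : ModelWithCorners ℝ EX HX} [IX.Boundaryless]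
  {X : Type*} [TopologicalSpace X] [ChartedSpace HX X] [IsManifold IX ∞ X]
  [T2Space X] [SigmaCompactSpace X] [MeasurableSpace X] [BorelSpace X]
  {μ : Measure X} [IsFiniteMeasureOnCompacts μ] {ρ : X → EX → ℝ}

theorem integrable_mul_add_der {U : Set X} (hU : IsOpen U) {W : X → EX}
    (hW : IsSmoothField IX U W) {c : X → ℝ} (hc : ContinuousOn c U) {f : X → ℝ}
    (hf : ContMDiff IX 𝓘(ℝ, ℝ) ∞ f) (hfc : HasCompactSupport f) (hs : tsupport f ⊆ U) :
    Integrable (fun x => f x * c x + der IX 𝓘(ℝ, ℝ) f x (W x)) μ := by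
  have hsub := tsupport_mul_add_der_subset (IX := IX) (W := W) (f := f) (c := c)
  refine Continuous.integrable_of_hasCompactSupport ?_
    (hfc.of_isClosed_subset (isClosed_tsupport _) hsub)
  refine ContinuousOn.continuous_of_tsupport_subset ?_ hU (hsub.trans hs)
  exact (hf.continuous.continuousOn.mul hc).add
    (hW _ hU Subset.rfl f hf.contMDiffOn).continuousOn

variable [μ.IsOpenPosMeasure]

/-- A continuous function which is the divergence of a vector field in the weak sense is its
divergence computed in any chart. -/
theorem chartDiv_eq_of_weak (hμ : HasChartDensity IX lam μ ρ) {U : Set X} (hU : IsOpen U)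
    {W : X → EX} (hW : IsSmoothField IX U W) {c : X → ℝ} (hc : ContinuousOn c U) (x₀ : X)
    (h : ∀ f : X → ℝ, ContMDiff IX 𝓘(ℝ, ℝ) ∞ f → HasCompactSupport f →
      tsupport f ⊆ (extChartAt IX x₀).source ∩ U →
      ∫ x, (f x * c x + der IX 𝓘(ℝ, ℝ) f x (W x)) ∂μ = 0) :
    ∀ x ∈ (extChartAt IX x₀).source ∩ U, chartDiv IX ρ W x₀ x = c x := by
  have := IX.locallyCompactSpace
  have := ChartedSpace.locallyCompactSpace HX X
  have := IX.secondCountableTopology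
  have := ChartedSpace.secondCountable_of_sigmaCompact HX X
  have hO : IsOpen ((extChartAt IX x₀).source ∩ U) := (isOpen_extChartAt_source x₀).inter hU
  have hD : ContinuousOn (chartDiv IX ρ W x₀) ((extChartAt IX x₀).source ∩ U) :=
    continuousOn_chartDiv hU hW (hμ.smooth x₀) (hμ.ne_zero x₀)
  have hc' := hc.mono (inter_subset_right (s := (extChartAt IX x₀).source))
  have h0 := hO.ae_eq_zero_of_integral_contMDiff_smul_eq_zero IX (μ := μ)
    (f := fun x => chartDiv IX ρ W x₀ x - c x)
    ((hD.sub hc').locallyIntegrableOn hO.measurableSet) fun f hf hfc hfs => by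
      have h1 := integral_chartDiv_eq_zero hμ hU hW x₀ hf hfc hfs
      have h2 := h f hf hfc hfs
      have h3 := integral_sub
        (integrable_mul_add_der (μ := μ) hO (hW.mono inter_subset_right) hD hf hfc hfs)
        (integrable_mul_add_der (μ := μ) hO (hW.mono inter_subset_right) hc' hf hfc hfs)
      rw [h1, h2, sub_zero] at h3
      rw [← h3]
      refine integral_congr_ae (Eventually.of_forall fun x => ?_)
      simp only [smul_eq_mul]
      ring
  have h1 : (chartDiv IX ρ W x₀) =ᵐ[μ.restrict ((extChartAt IX x₀).source ∩ U)] c := by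
    rw [Filter.EventuallyEq, ae_restrict_iff' hO.measurableSet]
    filter_upwards [h0] with x hx hxO using sub_eq_zero.1 (hx hxO)
  exact Measure.eqOn_open_of_ae_eq h1 hO hD hc'

/-- The divergence is independent of the chart. -/
theorem divergence_eq_chartDiv_of_mem (hμ : HasChartDensity IX lam μ ρ) {U : Set X}
    (hU : IsOpen U) {W : X → EX} (hW : IsSmoothField IX U W) (x₀ : X) {x : X}
    (hx : x ∈ (extChartAt IX x₀).source ∩ U) :
    divergence IX ρ W x = chartDiv IX ρ W x₀ x := by
  have hO : IsOpen ((extChartAt IX x₀).source ∩ U) := (isOpen_extChartAt_source x₀).inter hU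
  -- The divergence computed in the chart at `x₀` is a weak divergence, and hence also the
  -- divergence computed in the chart at `x`.
  exact chartDiv_eq_of_weak hμ hO (hW.mono inter_subset_right)
    (continuousOn_chartDiv hU hW (hμ.smooth x₀) (hμ.ne_zero x₀)) x
    (fun f hf hfc hfs => integral_chartDiv_eq_zero hμ hU hW x₀ hf hfc (hfs.trans inter_subset_right))
    x ⟨mem_extChartAt_source x, hx⟩

/-- A continuous function which is the divergence of a smooth field in the weak sense is its
divergence. -/
theorem divergence_eq_of_weak (hμ : HasChartDensity IX lam μ ρ) {U : Set X} (hU : IsOpen U)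
    {W : X → EX} (hW : IsSmoothField IX U W) {c : X → ℝ} (hc : ContinuousOn c U)
    (h : ∀ f : X → ℝ, ContMDiff IX 𝓘(ℝ, ℝ) ∞ f → HasCompactSupport f → tsupport f ⊆ U →
      ∫ x, (f x * c x + der IX 𝓘(ℝ, ℝ) f x (W x)) ∂μ = 0) :
    ∀ x ∈ U, divergence IX ρ W x = c x := fun x hx =>
  chartDiv_eq_of_weak hμ hU hW hc x
    (fun f hf hfc hfs => h f hf hfc (hfs.trans inter_subset_right)) x ⟨mem_extChartAt_source x, hx⟩

/-- The divergence theorem. -/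
theorem integral_divergence_eq_zero (hμ : HasChartDensity IX lam μ ρ) {U : Set X}
    (hU : IsOpen U) {W : X → EX} (hW : IsSmoothField IX U W) {c : X → ℝ} (hc : ContinuousOn c U)
    (h : ∀ x ∈ U, divergence IX ρ W x = c x) {f : X → ℝ} (hf : ContMDiff IX 𝓘(ℝ, ℝ) ∞ f)
    (hfc : HasCompactSupport f) (hfs : tsupport f ⊆ U) :
    ∫ x, (f x * c x + der IX 𝓘(ℝ, ℝ) f x (W x)) ∂μ = 0 := by
  obtain ⟨t, ht⟩ := hfc.isCompact.elim_finite_subcover (fun x => (extChartAt IX x).source)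
    (fun x => isOpen_extChartAt_source x) (fun x _ => mem_iUnion.2 ⟨x, mem_extChartAt_source x⟩)
  -- A partition of unity reduces to functions supported in the domain of one chart.
  obtain ⟨θ, hθ⟩ := SmoothPartitionOfUnity.exists_isSubordinate IX (isClosed_tsupport f)
    (fun i : t => (extChartAt IX (i : X)).source) (fun i => isOpen_extChartAt_source _)
    (fun x hx => by
      obtain ⟨i, hi, hxi⟩ := mem_iUnion₂.1 (ht hx)
      exact mem_iUnion.2 ⟨⟨i, hi⟩, hxi⟩)
  have hsum : ∀ x ∈ tsupport f, ∑ i, θ i x = 1 := fun x hx => by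
    rw [← θ.sum_eq_one hx, finsum_eq_sum_of_fintype]
  have hθf : ∀ i, ContMDiff IX 𝓘(ℝ, ℝ) ∞ fun x => θ i x * f x := fun i =>
    (θ i).contMDiff.mul hf
  have hts : ∀ i, tsupport (fun x => θ i x * f x) ⊆ (extChartAt IX (i : X)).source ∩ U := fun i =>
    subset_inter ((tsupport_mul_subset_left (f := θ i)).trans (hθ i))
      ((tsupport_mul_subset_right (f := θ i)).trans hfs)
  have hcs : ∀ i, HasCompactSupport fun x => θ i x * f x := fun i => hfc.mul_left
  have h0 : ∀ i, ∫ x, (θ i x * f x * c x + der IX 𝓘(ℝ, ℝ) (fun x => θ i x * f x) x (W x)) ∂μ =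
      0 := by
    intro i
    rw [← integral_chartDiv_eq_zero hμ hU hW i (hθf i) (hcs i) (hts i)]
    refine integral_congr_ae (Eventually.of_forall fun x => ?_)
    by_cases hx : x ∈ tsupport fun x => θ i x * f x
    · simp only
      rw [← divergence_eq_chartDiv_of_mem hμ hU hW i (hts i hx), h x (hts i hx).2]
    · simp only
      rw [image_eq_zero_of_notMem_tsupport hx, zero_mul, zero_mul]
  have hi : ∀ i, Integrable
      (fun x => θ i x * f x * c x + der IX 𝓘(ℝ, ℝ) (fun x => θ i x * f x) x (W x)) μ := fun i =>
    integrable_mul_add_der hU hW hc (hθf i) (hcs i) ((hts i).trans inter_subset_right)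
  have hf' : f = fun x => ∑ i, θ i x * f x := by
    funext x
    by_cases hx : x ∈ tsupport f
    · rw [← Finset.sum_mul, hsum x hx, one_mul]
    · simp [image_eq_zero_of_notMem_tsupport hx]
  have hder : ∀ x, der IX 𝓘(ℝ, ℝ) f x = ∑ i, der IX 𝓘(ℝ, ℝ) (fun x => θ i x * f x) x := by
    intro x
    have h0' : ∀ i ∈ (Finset.univ : Finset t), HasMFDerivAt IX 𝓘(ℝ, ℝ) (fun x => θ i x * f x) x
        (mfderiv IX 𝓘(ℝ, ℝ) (fun x => θ i x * f x) x) := fun i _ =>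
      ((hθf i).mdifferentiableAt (x := x) (by simp)).hasMFDerivAt
    have h1 := hasMFDerivAt_finset_sum (Finset.univ : Finset t)
      (f' := fun i => (der IX 𝓘(ℝ, ℝ) (fun x => θ i x * f x) x : EX →L[ℝ] ℝ)) h0'
    have h2 : (∑ i : t, fun x => θ i x * f x) = f := by
      conv_rhs => rw [hf']
      funext x
      simp
    rw [h2] at h1
    exact h1.mfderiv
  calc ∫ x, (f x * c x + der IX 𝓘(ℝ, ℝ) f x (W x)) ∂μ
      = ∫ x, ∑ i, (θ i x * f x * c x + der IX 𝓘(ℝ, ℝ) (fun x => θ i x * f x) x (W x)) ∂μ := by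
        refine integral_congr_ae (Eventually.of_forall fun x => ?_)
        simp only
        rw [Finset.sum_add_distrib, ← Finset.sum_mul, ← congrFun hf' x, hder, sum_apply]
    _ = 0 := by
        rw [integral_finsetSum _ fun i _ => hi i]
        exact Finset.sum_eq_zero fun i _ => h0 i

end WeakDivergence

/-! ### Weak and strong forms of the field equation -/

section FirstVariation

variable
  {EX : Type*} [NormedAddCommGroup EX] [NormedSpace ℝ EX] [FiniteDimensional ℝ EX]
  {HX : Type*} [TopologicalSpace HX] {IX : ModelWithCorners ℝ EX HX} [IX.Boundaryless]
  {X : Type*} [TopologicalSpace X] [ChartedSpace HX X] [IsManifold IX ∞ X]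
  {EG : Type*} [NormedAddCommGroup EG] [NormedSpace ℝ EG] [FiniteDimensional ℝ EG]
  {G : Type*} [TopologicalSpace G] [ChartedSpace EG G] [Group G] [LieGroup 𝓘(ℝ, EG) ∞ G]
  {Λ : X → (EX →L[ℝ] EG) → ℝ} {ν : X → EX →L[ℝ] EG} {U : Set X}

theorem apply_momentumField (η : X → EG) (x : X) (β : EX →L[ℝ] ℝ) :
    β (momentumField Λ ν η x) = fderiv ℝ (Λ x) (ν x) (β.smulRight (η x)) :=
  apply_vecOf ((fderiv ℝ (Λ x) (ν x)).comp
    ((ContinuousLinearMap.smulRightL ℝ EX EG).flip (η x))) β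

theorem momentumField_eq_zero {η : X → EG} {x : X} (h : η x = 0) :
    momentumField Λ ν η x = 0 := by
  have e : ∀ β : EX →L[ℝ] ℝ, β.smulRight (η x) = 0 := fun β => by
    ext u
    simp [h]
  simp [momentumField, vecOf, e]

theorem isSmoothField_momentumField (hΛ : FibreSmooth IX U Λ)
    (hν : SmoothFormOn IX U ν) {η : X → EG} (hη : ContMDiffOn IX 𝓘(ℝ, EG) ∞ η U) :
    IsSmoothField IX U (momentumField Λ ν η) := by
  intro O hO hOU f hf
  have h := FibreSmooth.contMDiffOn_fderiv hO (fun x hx => hΛ x (hOU hx)) (hν.mono hOU)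
    ((contMDiffOn_der_apply hO hf).smulRight (hη.mono hOU))
  exact h.congr fun x _ => apply_momentumField η x _

theorem der_smul {f : X → ℝ} {η : X → EG} {x : X} (hf : MDifferentiableAt IX 𝓘(ℝ, ℝ) f x)
    (hη : MDifferentiableAt IX 𝓘(ℝ, EG) η x) :
    der IX 𝓘(ℝ, EG) (fun y => f y • η y) x =
      f x • der IX 𝓘(ℝ, EG) η x + (der IX 𝓘(ℝ, ℝ) f x).smulRight (η x) := by
  have h0 : HasMFDerivAt IX 𝓘(ℝ, ℝ × EG) (fun q => (f q, η q)) x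
      ((der IX 𝓘(ℝ, ℝ) f x).prod (der IX 𝓘(ℝ, EG) η x)) :=
    ⟨hf.hasMFDerivAt.1.prodMk hη.hasMFDerivAt.1, hf.hasMFDerivAt.2.prodMk hη.hasMFDerivAt.2⟩
  have h1 : HasFDerivAt (fun z : ℝ × EG => z.1 • z.2) _ (f x, η x) :=
    (hasFDerivAt_fst (𝕜 := ℝ) (E := ℝ) (F := EG) (p := (f x, η x))).smul
      (hasFDerivAt_snd (𝕜 := ℝ) (E := ℝ) (F := EG) (p := (f x, η x)))
  have h2 := (HasMFDerivAt.comp x h1.hasMFDerivAt h0).mfderiv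
  refine Eq.trans h2 ?_
  ext u
  rfl

/-- The Leibniz rule which produces the momentum field. -/
theorem firstVar_smul {f : X → ℝ} {η : X → EG} {x : X} (hf : MDifferentiableAt IX 𝓘(ℝ, ℝ) f x)
    (hη : MDifferentiableAt IX 𝓘(ℝ, EG) η x) :
    firstVar IX G Λ ν (fun y => f y • η y) x =
      f x * firstVar IX G Λ ν η x + der IX 𝓘(ℝ, ℝ) f x (momentumField Λ ν η x) := by
  rw [apply_momentumField, firstVar, firstVar, der_smul hf hη, ← smul_eq_mul, ← map_smul, ← map_add,
    ← adL_apply, ← adL_apply, map_smul, ContinuousLinearMap.smul_comp, smul_add]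
  congr 1
  abel

theorem firstVar_eq_zero {η : X → EG} {x : X} (h : η =ᶠ[𝓝 x] fun _ => 0) :
    firstVar IX G Λ ν η x = 0 := by
  rw [firstVar_congr h, firstVar, der_const, ← adL_apply, map_zero, ContinuousLinearMap.zero_comp,
    add_zero, map_zero]

section Weak

variable [MeasurableSpace EX] [BorelSpace EX] {lam : Measure EX} [lam.IsAddHaarMeasure]
  [T2Space X] [SigmaCompactSpace X] [MeasurableSpace X] [BorelSpace X]
  {μ : Measure X} [IsFiniteMeasureOnCompacts μ] [μ.IsOpenPosMeasure] {ρ : X → EX → ℝ}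

/-- The fundamental lemma of the calculus of variations for the field equation. -/
theorem weakEquation_iff_strongEquation (hμ : HasChartDensity IX lam μ ρ) (hU : IsOpen U)
    (hΛ : FibreSmooth IX U Λ) (hν : SmoothFormOn IX U ν) :
    WeakEquation IX G μ U Λ ν ↔ StrongEquation IX G ρ U Λ ν := by
  have hd : ∀ {η : X → EG}, ContMDiffOn IX 𝓘(ℝ, EG) ∞ η U → ∀ x ∈ U,
      MDifferentiableAt IX 𝓘(ℝ, EG) η x := fun hη x hx =>
    (hη.contMDiffAt (hU.mem_nhds hx)).mdifferentiableAt (by simp)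
  constructor
  -- The weak equation for `f η` says that `firstVar η` is the weak divergence of the momentum
  -- field.
  · intro H η hη
    refine divergence_eq_of_weak hμ hU (isSmoothField_momentumField hΛ hν hη)
      (contMDiffOn_firstVar hU hΛ hν hη).continuousOn fun f hf hfc hfs => ?_
    rw [← H (tsupport f) hfc.isCompact hfs (fun x => f x • η x) (hf.contMDiffOn.smul hη)
        fun x hx => by rw [image_eq_zero_of_notMem_tsupport hx.2, zero_smul],
      ← setIntegral_eq_integral_of_forall_compl_eq_zero (s := tsupport f)
        fun x hx => image_eq_zero_of_notMem_tsupport fun h => hx (tsupport_mul_add_der_subset h)]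
    exact setIntegral_congr_fun (isClosed_tsupport f).measurableSet fun x hx =>
      (firstVar_smul (hf.mdifferentiableAt (by simp)) (hd hη x (hfs hx))).symm
  · intro H K hK hKU η hη hηK
    have := IX.locallyCompactSpace
    have := ChartedSpace.locallyCompactSpace HX X
    obtain ⟨K', hK', hKK', hK'U⟩ := exists_compact_between hK hU hKU
    -- A cutoff which is `1` near `K`, so that the divergence theorem applies to `f` and the
    -- momentum field of `η`.
    obtain ⟨f, hf1, hf0, -⟩ := exists_contMDiffMap_one_nhds_of_subset_interior (n := (⊤ : ℕ∞)) IX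
      hK.isClosed hKK'
    have hfs : tsupport f ⊆ K' :=
      closure_minimal (fun x hx => by by_contra h; exact hx (hf0 x h)) hK'.isClosed
    have hfc : HasCompactSupport f := hK'.of_isClosed_subset (isClosed_tsupport _) hfs
    rw [← integral_divergence_eq_zero hμ hU (isSmoothField_momentumField hΛ hν hη)
      (contMDiffOn_firstVar (G := G) hU hΛ hν hη).continuousOn (H η hη) f.contMDiff hfc
      (hfs.trans hK'U)]
    refine Eq.trans ?_ (setIntegral_eq_integral_of_forall_compl_eq_zero (s := K) fun x hx => ?_)
    · refine setIntegral_congr_fun hK.measurableSet fun x hx => ?_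
      have h1 : (f : X → ℝ) =ᶠ[𝓝 x] fun _ => (1 : ℝ) := hf1.filter_mono (nhds_le_nhdsSet hx)
      rw [der_congr h1, der_const _ x, h1.eq_of_nhds, one_mul, _root_.zero_apply, add_zero]
    · by_cases hxU : x ∈ U
      · have h0 : η =ᶠ[𝓝 x] fun _ => 0 := by
          filter_upwards [(hU.sdiff hK.isClosed).mem_nhds ⟨hxU, hx⟩] with y hy using hηK y hy
        rw [firstVar_eq_zero h0, momentumField_eq_zero h0.eq_of_nhds, mul_zero, map_zero, add_zero]
      · have h0 : (f : X → ℝ) =ᶠ[𝓝 x] fun _ => 0 :=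
          notMem_tsupport_iff_eventuallyEq.1 fun h => hxU (hK'U (hfs h))
        rw [der_congr h0, der_const, h0.eq_of_nhds, zero_mul, _root_.zero_apply, add_zero]

end Weak

end FirstVariation

section Evolution

variable
  {EX : Type*} [NormedAddCommGroup EX] [NormedSpace ℝ EX] [FiniteDimensional ℝ EX]
  {HX : Type*} [TopologicalSpace HX] {IX : ModelWithCorners ℝ EX HX} [IX.Boundaryless]
  {X : Type*} [TopologicalSpace X] [ChartedSpace HX X] [IsManifold IX ∞ X]
  {EG : Type*} [NormedAddCommGroup EG] [NormedSpace ℝ EG] [FiniteDimensional ℝ EG]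
  {G : Type*} [TopologicalSpace G] [ChartedSpace EG G] [Group G] [LieGroup 𝓘(ℝ, EG) ∞ G]
  {Λ : ℝ × X → (ℝ × EX →L[ℝ] EG) → ℝ} {ν : ℝ × X → ℝ × EX →L[ℝ] EG} {J : Set ℝ} {V : Set X}
  [T2Space X] [SecondCountableTopology X] [MeasurableSpace X] [BorelSpace X]
  {μ : Measure X} [IsFiniteMeasureOnCompacts μ] [SFinite μ]

omit [SecondCountableTopology X] [SFinite μ] [FiniteDimensional ℝ EX] [IX.Boundaryless] in
/-- The integrals of a smooth function over slices are continuously differentiable in time. -/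
theorem contDiffOn_sliceIntegral (hJ : IsOpen J) (hV : IsOpen V) {φ : ℝ × X → ℝ}
    (hφ : ContMDiffOn (𝓘(ℝ, ℝ).prod IX) 𝓘(ℝ, ℝ) ∞ φ (J ×ˢ V)) {K : Set X} (hK : IsCompact K)
    (hKV : K ⊆ V) : ∃ g' : ℝ → ℝ, ContinuousOn g' J ∧
      ∀ t ∈ J, HasDerivAt (fun τ => ∫ m in K, φ (τ, m) ∂μ) (g' t) t := by
  refine ⟨fun t => ∫ m in K, deriv (fun τ => φ (τ, m)) t ∂μ, ?_, fun t ht =>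
    hasDerivAt_setIntegral hJ hV (Φ := fun τ m => φ (τ, m)) hφ hK hKV ht⟩
  intro t ht
  exact (hasDerivAt_setIntegral hJ hV (Φ := fun t m => deriv (fun τ => φ (τ, m)) t)
    (contMDiffOn_deriv_left hJ hV (Φ := fun τ m => φ (τ, m)) hφ) hK hKV
    ht).continuousAt.continuousWithinAt

omit [SecondCountableTopology X] [SFinite μ] [FiniteDimensional ℝ EX] [IX.Boundaryless] in
theorem continuousOn_sliceIntegral (hJ : IsOpen J) (hV : IsOpen V) {φ : ℝ × X → ℝ}
    (hφ : ContMDiffOn (𝓘(ℝ, ℝ).prod IX) 𝓘(ℝ, ℝ) ∞ φ (J ×ˢ V)) {K : Set X} (hK : IsCompact K)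
    (hKV : K ⊆ V) : ContinuousOn (fun τ => ∫ m in K, φ (τ, m) ∂μ) J := by
  obtain ⟨g', -, h⟩ := contDiffOn_sliceIntegral (μ := μ) hJ hV hφ hK hKV
  exact fun t ht => (h t ht).continuousAt.continuousWithinAt

/-- Integrate the evolution equation over the time interval: the momentum vanishes at the endpoints
with `η`. -/
theorem EvolutionEquation.endpointEquation (hJ : IsOpen J) (hV : IsOpen V)
    (hΛ : FibreSmooth (𝓘(ℝ, ℝ).prod IX) (J ×ˢ V) Λ)
    (hν : SmoothFormOn (𝓘(ℝ, ℝ).prod IX) (J ×ˢ V) ν)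
    (H : EvolutionEquation IX G μ J V Λ ν) : EndpointEquation IX G μ J V Λ ν := by
  intro t₁ t₂ h12 hIJ K hK hKV η hη hηK hηe
  have hc := continuousOn_sliceIntegral (μ := μ) hJ hV
    (contMDiffOn_firstVar (G := G) (hJ.prod hV) hΛ hν hη) hK hKV
  have h := intervalIntegral.integral_eq_sub_of_hasDerivAt (a := t₁) (b := t₂)
    (fun t ht => H K hK hKV η hη hηK t (hIJ (by rwa [uIcc_of_le h12.le] at ht)))
    ((hc.mono (by rwa [uIcc_of_le h12.le])).intervalIntegrable)
  have e : ∀ t, (∀ m ∈ V, η (t, m) = 0) →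
      ∫ m in K, fderiv ℝ (Λ (t, m)) (ν (t, m)) (joinForm (η (t, m)) 0) ∂μ = 0 := by
    intro t ht
    refine (setIntegral_congr_fun (g := fun _ => (0 : ℝ)) hK.measurableSet
      fun m hm => ?_).trans (by simp)
    simp only
    rw [ht m (hKV hm)]
    have : joinForm (0 : EG) (0 : EX →L[ℝ] EG) = 0 := by ext <;> simp
    rw [this, map_zero]
  rw [h, e t₁ fun m hm => (hηe m hm).1, e t₂ fun m hm => (hηe m hm).2, sub_zero]

/-- Two continuous functions on an open set of the line with equal weak integrals agree. -/
theorem eqOn_of_integral_smul_eq {g h : ℝ → ℝ} (hJ : IsOpen J) (hg : ContinuousOn g J)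
    (hh : ContinuousOn h J)
    (H : ∀ f : ℝ → ℝ, ContDiff ℝ ∞ f → HasCompactSupport f → tsupport f ⊆ J →
      ∫ t, f t * (h t - g t) = 0) : EqOn h g J := by
  have h0 := hJ.ae_eq_zero_of_integral_contDiff_smul_eq_zero (μ := (volume : Measure ℝ))
    (f := fun t => h t - g t) ((hh.sub hg).locallyIntegrableOn hJ.measurableSet)
    fun f hf hfc hfs => by simpa using H f hf hfc hfs
  refine Measure.eqOn_open_of_ae_eq (μ := (volume : Measure ℝ)) ?_ hJ hh hg
  rw [Filter.EventuallyEq, ae_restrict_iff' hJ.measurableSet]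
  filter_upwards [h0] with t ht htJ using sub_eq_zero.1 (ht htJ)

omit [SecondCountableTopology X] [IsFiniteMeasureOnCompacts μ] [SFinite μ] [BorelSpace X]
  [MeasurableSpace X] [T2Space X] in
/-- The first variation in the direction `f(t) η`. -/
theorem firstVar_smul_fst {f : ℝ → ℝ} (hf : ContDiff ℝ ∞ f) {η : ℝ × X → EG} {x : ℝ × X}
    (hη : MDifferentiableAt (𝓘(ℝ, ℝ).prod IX) 𝓘(ℝ, EG) η x) :
    firstVar (𝓘(ℝ, ℝ).prod IX) G Λ ν (fun y => f y.1 • η y) x =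
      f x.1 * firstVar (𝓘(ℝ, ℝ).prod IX) G Λ ν η x +
        deriv f x.1 * fderiv ℝ (Λ x) (ν x) (joinForm (η x) 0) := by
  have hd : DifferentiableAt ℝ f x.1 := hf.differentiable (by simp) _
  have h1 : der (𝓘(ℝ, ℝ).prod IX) 𝓘(ℝ, ℝ) (fun y : ℝ × X => f y.1) x =
      deriv f x.1 • ContinuousLinearMap.fst ℝ ℝ EX := by
    rw [der_comp (g := f) (f := fun y : ℝ × X => y.1) hd.mdifferentiableAt mdifferentiableAt_fst,
      der_fst, der_eq_fderiv]
    ext <;> simp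
  rw [firstVar_smul (f := fun y : ℝ × X => f y.1)
    (MDifferentiableAt.comp x (g := f) hd.mdifferentiableAt mdifferentiableAt_fst) hη,
    apply_momentumField, h1, ← smul_eq_mul (deriv f x.1), ← map_smul]
  congr 2
  ext <;> simp

/-- The weak equation for `f(t) η` is the evolution equation integrated against `f`, after an
integration by parts in time. -/
theorem WeakEquation.evolutionEquation (hJ : IsOpen J) (hV : IsOpen V)
    (hΛ : FibreSmooth (𝓘(ℝ, ℝ).prod IX) (J ×ˢ V) Λ)
    (hν : SmoothFormOn (𝓘(ℝ, ℝ).prod IX) (J ×ˢ V) ν)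
    (H : WeakEquation (𝓘(ℝ, ℝ).prod IX) G ((volume : Measure ℝ).prod μ) (J ×ˢ V) Λ ν) :
    EvolutionEquation IX G μ J V Λ ν := by
  intro K hK hKV η hη hηK
  set φ : ℝ × X → ℝ := fun x => fderiv ℝ (Λ x) (ν x) (joinForm (η x) 0) with hφd
  set ψ : ℝ × X → ℝ := firstVar (𝓘(ℝ, ℝ).prod IX) G Λ ν η with hψd
  have hO := hJ.prod hV
  have hφ : ContMDiffOn (𝓘(ℝ, ℝ).prod IX) 𝓘(ℝ, ℝ) ∞ φ (J ×ˢ V) :=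
    hΛ.contMDiffOn_fderiv hO hν (SmoothFormOn.joinForm_left hO hη)
  have hψ : ContMDiffOn (𝓘(ℝ, ℝ).prod IX) 𝓘(ℝ, ℝ) ∞ ψ (J ×ˢ V) :=
    contMDiffOn_firstVar hO hΛ hν hη
  set g : ℝ → ℝ := fun τ => ∫ m in K, φ (τ, m) ∂μ with hgd
  set h : ℝ → ℝ := fun τ => ∫ m in K, ψ (τ, m) ∂μ with hhd
  have hh : ContinuousOn h J := continuousOn_sliceIntegral hJ hV hψ hK hKV
  obtain ⟨g', hg'c, hg'⟩ := contDiffOn_sliceIntegral (μ := μ) hJ hV hφ hK hKV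
  have hg : ContinuousOn g J := fun t ht => (hg' t ht).continuousAt.continuousWithinAt
  have key : EqOn h g' J := by
    refine eqOn_of_integral_smul_eq hJ hg'c hh fun f hf hfc hfs => ?_
    have hcont : ∀ {u v : ℝ → ℝ}, Continuous u → tsupport u ⊆ tsupport f → ContinuousOn v J →
        Integrable (fun t => u t * v t) := by
      intro u v hu hus hv
      refine Continuous.integrable_of_hasCompactSupport ?_ (HasCompactSupport.mul_right
        (hfc.of_isClosed_subset (isClosed_tsupport u) hus))
      exact ContinuousOn.continuous_of_tsupport_subset (hu.continuousOn.mul hv) hJ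
        ((tsupport_mul_subset_left.trans hus).trans hfs)
    have hf' : Continuous (deriv f) := hf.continuous_deriv (by simp)
    have hf's : tsupport (deriv f) ⊆ tsupport f := tsupport_deriv_subset
    have i1 := hcont hf.continuous Subset.rfl hh
    have i2 := hcont hf' hf's hg
    have i3 := hcont hf.continuous Subset.rfl hg'c
    have i4 := hcont hf.continuous Subset.rfl hg
    -- Integration by parts in time.
    have p1 : ∫ t, (deriv f t * g t + f t * g' t) = 0 := by
      refine integral_eq_zero_of_hasDerivAt_of_integrable (f := fun t => f t * g t) (fun t => ?_)
        (i2.add i3) i4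
      by_cases ht : t ∈ tsupport f
      · exact (hf.differentiable (by simp) t).hasDerivAt.mul (hg' t (hfs ht))
      · have h0 : f =ᶠ[𝓝 t] fun _ => 0 := notMem_tsupport_iff_eventuallyEq.1 ht
        have h1 : (fun t => f t * g t) =ᶠ[𝓝 t] fun _ => 0 := by
          filter_upwards [h0] with τ hτ
          rw [hτ, zero_mul]
        rw [h0.deriv_eq, deriv_const, h0.eq_of_nhds, zero_mul, zero_mul, add_zero]
        exact (hasDerivAt_const t (0 : ℝ)).congr_of_eventuallyEq h1
    -- The weak equation in the direction `f(t) η`.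
    have p2 : ∫ t, (f t * h t + deriv f t * g t) = 0 := by
      have hsub : tsupport f ×ˢ K ⊆ J ×ˢ V := prod_mono hfs hKV
      have h1 := H (tsupport f ×ˢ K) (hfc.isCompact.prod hK) hsub
        (fun y => f y.1 • η y)
        ((hf.contMDiff.comp_contMDiffOn contMDiffOn_fst).smul hη) (fun x hx => by
          by_cases hx1 : x.1 ∈ tsupport f
          · rw [hηK x.1 hx.1.1 x.2 ⟨hx.1.2, fun hx2 => hx.2 ⟨hx1, hx2⟩⟩, smul_zero]
          · rw [image_eq_zero_of_notMem_tsupport hx1, zero_smul])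
      have h2 : ∀ x ∈ tsupport f ×ˢ K, firstVar (𝓘(ℝ, ℝ).prod IX) G Λ ν
          (fun y => f y.1 • η y) x = f x.1 * ψ x + deriv f x.1 * φ x := fun x hx =>
        firstVar_smul_fst hf ((hη.contMDiffAt (hO.mem_nhds (hsub hx))).mdifferentiableAt (by simp))
      have hcψ : ContinuousOn (fun x : ℝ × X => f x.1 * ψ x) (tsupport f ×ˢ K) :=
        (hf.continuous.comp continuous_fst).continuousOn.mul (hψ.continuousOn.mono hsub)
      have hcφ : ContinuousOn (fun x : ℝ × X => deriv f x.1 * φ x) (tsupport f ×ˢ K) :=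
        (hf'.comp continuous_fst).continuousOn.mul (hφ.continuousOn.mono hsub)
      rw [setIntegral_congr_fun (isClosed_tsupport f |>.measurableSet.prod hK.measurableSet) h2,
        setIntegral_prod (fun x : ℝ × X => f x.1 * ψ x + deriv f x.1 * φ x)
          ((hcψ.add hcφ).integrableOn_compact (hfc.isCompact.prod hK))] at h1
      rw [← setIntegral_eq_integral_of_forall_compl_eq_zero (s := tsupport f) fun t ht => by
        rw [image_eq_zero_of_notMem_tsupport ht,
          image_eq_zero_of_notMem_tsupport fun h => ht (hf's h), zero_mul, zero_mul, add_zero],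
        ← h1]
      refine setIntegral_congr_fun (isClosed_tsupport f).measurableSet fun t ht => ?_
      have hsl : ∀ {c : ℝ × X → ℝ}, ContinuousOn c (J ×ˢ V) →
          IntegrableOn (fun m => c (t, m)) K μ := fun hc =>
        (hc.comp (f := fun m => (t, m)) (by fun_prop)
          fun m hm => ⟨hfs ht, hKV hm⟩).integrableOn_compact hK
      simp only [hhd, hgd]
      rw [integral_add ((hsl hψ.continuousOn).const_mul _) ((hsl hφ.continuousOn).const_mul _),
        integral_const_mul, integral_const_mul]
    have p3 := integral_sub (i1.add i2) (i2.add i3)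
    have p4 : ∫ t, (f t * h t + deriv f t * g t - (deriv f t * g t + f t * g' t)) = 0 :=
      p3.trans (by
        rw [show ∫ t, ((fun t => f t * h t) + fun t => deriv f t * g t) t = _ from p2,
          show ∫ t, ((fun t => deriv f t * g t) + fun t => f t * g' t) t = _ from p1, sub_zero])
    rw [← p4]
    refine integral_congr_ae (Eventually.of_forall fun t => ?_)
    simp only
    ring
  intro t ht
  have := hg' t ht
  rw [← key ht] at this
  exact this

/-- The strong equation is local in time, and functions supported in a small open time interval give
variations which vanish at its endpoints. -/
theorem EndpointEquation.strongEquation [MeasurableSpace EX] [BorelSpace EX]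
    {lam : Measure (ℝ × EX)} [lam.IsAddHaarMeasure] [μ.IsOpenPosMeasure]
    {ρ : ℝ × X → ℝ × EX → ℝ}
    (hμ : HasChartDensity (𝓘(ℝ, ℝ).prod IX) lam ((volume : Measure ℝ).prod μ) ρ)
    (hJ : IsOpen J) (hV : IsOpen V)
    (hΛ : FibreSmooth (𝓘(ℝ, ℝ).prod IX) (J ×ˢ V) Λ)
    (hν : SmoothFormOn (𝓘(ℝ, ℝ).prod IX) (J ×ˢ V) ν)
    (H : EndpointEquation IX G μ J V Λ ν) :
    StrongEquation (𝓘(ℝ, ℝ).prod IX) G ρ (J ×ˢ V) Λ ν := by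
  have := IX.locallyCompactSpace
  have := ChartedSpace.locallyCompactSpace HX X
  intro η hη x hx
  have hO := hJ.prod hV
  obtain ⟨δ, hδ, hb⟩ := Metric.nhds_basis_closedBall.mem_iff.1 (hJ.mem_nhds hx.1)
  rw [Real.closedBall_eq_Icc] at hb
  set t₁ := x.1 - δ with ht₁
  set t₂ := x.1 + δ with ht₂
  have h12 : t₁ < t₂ := by linarith
  have hsub : Ioo t₁ t₂ ×ˢ V ⊆ J ×ˢ V := prod_mono (Ioo_subset_Icc_self.trans hb) Subset.rfl
  refine divergence_eq_of_weak hμ (isOpen_Ioo.prod hV)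
    ((isSmoothField_momentumField hΛ hν hη).mono hsub)
    ((contMDiffOn_firstVar hO hΛ hν hη).continuousOn.mono hsub) (fun f hf hfc hfs => ?_) x
    ⟨⟨by linarith, by linarith⟩, hx.2⟩
  -- The projection to space of the support of the test function.
  set K := Prod.snd '' tsupport f with hKd
  have hK : IsCompact K := hfc.isCompact.image continuous_snd
  have hKV : K ⊆ V := by
    rintro _ ⟨y, hy, rfl⟩
    exact (hfs hy).2
  have hfη : ContMDiffOn (𝓘(ℝ, ℝ).prod IX) 𝓘(ℝ, EG) ∞ (fun y => f y • η y) (J ×ˢ V) :=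
    hf.contMDiffOn.smul hη
  have h1 := H t₁ t₂ h12 hb K hK hKV (fun y => f y • η y) hfη
    (fun t _ m hm => by
      rw [image_eq_zero_of_notMem_tsupport fun h => hm.2 ⟨_, h, rfl⟩, zero_smul])
    (fun m _ => by
      rw [image_eq_zero_of_notMem_tsupport fun h => lt_irrefl _ (hfs h).1.1,
        image_eq_zero_of_notMem_tsupport fun h => lt_irrefl _ (hfs h).1.2, zero_smul, zero_smul]
      exact ⟨rfl, rfl⟩)
  have hcK : Icc t₁ t₂ ×ˢ K ⊆ J ×ˢ V := prod_mono hb hKV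
  rw [intervalIntegral_setIntegral_eq h12.le hK
    ((contMDiffOn_firstVar hO hΛ hν hfη).continuousOn.mono hcK)] at h1
  refine Eq.trans (setIntegral_eq_integral_of_forall_compl_eq_zero (s := Icc t₁ t₂ ×ˢ K)
    fun y hy => ?_).symm (Eq.trans ?_ h1)
  · have h2 := image_eq_zero_of_notMem_tsupport (x := y) (f := fun y =>
      f y * firstVar (𝓘(ℝ, ℝ).prod IX) G Λ ν η y +
        der (𝓘(ℝ, ℝ).prod IX) 𝓘(ℝ, ℝ) f y (momentumField Λ ν η y)) fun h => hy ?_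
    · exact h2
    · have h' := tsupport_mul_add_der_subset h
      exact ⟨Ioo_subset_Icc_self (hfs h').1, mem_image_of_mem _ h'⟩
  · exact setIntegral_congr_fun (measurableSet_Icc.prod hK.measurableSet) fun y hy =>
      (firstVar_smul (hf.mdifferentiableAt (by simp))
        ((hη.contMDiffAt (hO.mem_nhds (hcK hy))).mdifferentiableAt (by simp))).symm

end Evolution

/-! ### The evolution equation on a time slice -/

section Slice

variable
  {EX : Type*} [NormedAddCommGroup EX] [NormedSpace ℝ EX] [FiniteDimensional ℝ EX]
  {HX : Type*} [TopologicalSpace HX] {IX : ModelWithCorners ℝ EX HX} [IX.Boundaryless]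
  {X : Type*} [TopologicalSpace X] [ChartedSpace HX X] [IsManifold IX ∞ X]
  {EG : Type*} [NormedAddCommGroup EG] [NormedSpace ℝ EG] [FiniteDimensional ℝ EG]
  {G : Type*} [TopologicalSpace G] [ChartedSpace EG G] [Group G] [LieGroup 𝓘(ℝ, EG) ∞ G]
  {Λ : ℝ × X → (ℝ × EX →L[ℝ] EG) → ℝ} {ν : ℝ × X → ℝ × EX →L[ℝ] EG} {J : Set ℝ} {V : Set X}

/-- The momentum `v ↦ w(dt ⊗ v)`, where `w` is the fibre derivative of `Λ` along `ν`. -/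
def momentum (Λ : ℝ × X → (ℝ × EX →L[ℝ] EG) → ℝ) (ν : ℝ × X → ℝ × EX →L[ℝ] EG) (x : ℝ × X) :
    EG →L[ℝ] ℝ :=
  (fderiv ℝ (Λ x) (ν x)).comp
    (ContinuousLinearMap.smulRightL ℝ (ℝ × EX) EG (ContinuousLinearMap.fst ℝ ℝ EX))

theorem momentum_apply (x : ℝ × X) (v : EG) :
    momentum Λ ν x v = fderiv ℝ (Λ x) (ν x) (joinForm v 0) := by
  rw [joinForm, ContinuousLinearMap.zero_comp, add_zero]
  rfl

variable (IX G) in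
/-- The spatial covariant derivative `dθ + [θ, ν]` of a function `θ` on space at time `t`. -/
def spatialDeriv (ν : ℝ × X → ℝ × EX →L[ℝ] EG) (t : ℝ) (θ : X → EG) (m : X) : EX →L[ℝ] EG :=
  der IX 𝓘(ℝ, EG) θ m +
    (ad G (θ m)).comp ((ν (t, m)).comp (ContinuousLinearMap.inr ℝ ℝ EX))

/-- The first variation, split into its time and space components. -/
theorem firstVar_eq_slice {η : ℝ × X → EG} {t : ℝ} {m : X}
    (hη : MDifferentiableAt (𝓘(ℝ, ℝ).prod IX) 𝓘(ℝ, EG) η (t, m)) :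
    firstVar (𝓘(ℝ, ℝ).prod IX) G Λ ν η (t, m) =
      momentum Λ ν (t, m) (deriv (fun τ => η (τ, m)) t + ad G (η (t, m)) (ν (t, m) (1, 0))) +
      fderiv ℝ (Λ (t, m)) (ν (t, m))
        (joinForm 0 (spatialDeriv IX G ν t (fun y => η (t, y)) m)) := by
  rw [momentum_apply, ← map_add, firstVar, der_prod_eq_joinForm hη]
  congr 1
  conv_lhs => rw [← joinForm_decomp (ν (t, m))]
  refine ContinuousLinearMap.ext fun u => ?_
  simp only [spatialDeriv, _root_.add_apply, ContinuousLinearMap.comp_apply, joinForm_apply, map_add,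
    map_smul, smul_add, smul_zero, _root_.zero_apply, add_zero, zero_add]
  abel

theorem contMDiffOn_momentum (hJ : IsOpen J) (hV : IsOpen V)
    (hΛ : FibreSmooth (𝓘(ℝ, ℝ).prod IX) (J ×ˢ V) Λ)
    (hν : SmoothFormOn (𝓘(ℝ, ℝ).prod IX) (J ×ˢ V) ν) :
    ContMDiffOn (𝓘(ℝ, ℝ).prod IX) 𝓘(ℝ, EG →L[ℝ] ℝ) ∞ (momentum Λ ν) (J ×ˢ V) := by
  have hO := hJ.prod hV
  intro x hx
  refine ContMDiffAt.contMDiffWithinAt (contMDiffAt_clm_of_apply fun v => ?_)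
  refine ((hΛ.contMDiffOn_fderiv hO hν (SmoothFormOn.joinForm_left (η := fun _ => v) hO
    contMDiffOn_const)).congr fun x _ => momentum_apply x v).contMDiffAt (hO.mem_nhds hx)

theorem SmoothFormOn.joinForm_right {a : X → EX →L[ℝ] EG} (hJ : IsOpen J) (hV : IsOpen V)
    (ha : SmoothFormOn IX V a) :
    SmoothFormOn (𝓘(ℝ, ℝ).prod IX) (J ×ˢ V) (fun x => joinForm (0 : EG) (a x.2)) := by
  refine (ha.pullback (f := fun x : ℝ × X => x.2) (I := 𝓘(ℝ, ℝ).prod IX) (hJ.prod hV) hV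
    contMDiffOn_snd fun x hx => hx.2).congr fun x _ => ?_
  rw [der_snd]
  refine ContinuousLinearMap.ext fun u => ?_
  simp

theorem smoothFormOn_spatialDeriv (hJ : IsOpen J) (hV : IsOpen V)
    (hν : SmoothFormOn (𝓘(ℝ, ℝ).prod IX) (J ×ˢ V) ν) {t : ℝ} (ht : t ∈ J) {θ : X → EG}
    (hθ : ContMDiffOn IX 𝓘(ℝ, EG) ∞ θ V) :
    SmoothFormOn IX V (spatialDeriv IX G ν t θ) := by
  refine (contMDiffOn_der_apply hV hθ).add (SmoothFormOn.clm_comp ?_ ?_)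
  · refine (hν.pullback (f := fun m : X => (t, m)) hV (hJ.prod hV)
      (contMDiffOn_const.prodMk contMDiffOn_id) fun m hm => ⟨ht, hm⟩).congr fun m _ => ?_
    have h : der IX (𝓘(ℝ, ℝ).prod IX) (fun m : X => (t, m)) m =
        (der IX 𝓘(ℝ, ℝ) (fun _ : X => t) m).prod (der IX IX (fun m : X => m) m) :=
      der_prodMk mdifferentiableAt_const mdifferentiableAt_id
    rw [h, der_const, der_id]
    rfl
  · exact ((adL EG G).contMDiff.comp_contMDiffOn hθ).congr fun x _ => (adL_apply _).symm

theorem contMDiffOn_slice_fderiv (hJ : IsOpen J) (hV : IsOpen V)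
    (hΛ : FibreSmooth (𝓘(ℝ, ℝ).prod IX) (J ×ˢ V) Λ)
    (hν : SmoothFormOn (𝓘(ℝ, ℝ).prod IX) (J ×ˢ V) ν) {t : ℝ} (ht : t ∈ J)
    {a : X → EX →L[ℝ] EG} (ha : SmoothFormOn IX V a) :
    ContMDiffOn IX 𝓘(ℝ, ℝ) ∞
      (fun m => fderiv ℝ (Λ (t, m)) (ν (t, m)) (joinForm (0 : EG) (a m))) V :=
  (hΛ.contMDiffOn_fderiv (hJ.prod hV) hν (ha.joinForm_right hJ hV)).comp (f := fun m => (t, m))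
    (contMDiffOn_const.prodMk contMDiffOn_id) fun _ hm => ⟨ht, hm⟩

/-- The time component of a smooth form on space-time is smooth. -/
theorem SmoothFormOn.contMDiffOn_apply_time {F : Type*} [NormedAddCommGroup F] [NormedSpace ℝ F]
    {S : Set (ℝ × X)} {A : ℝ × X → ℝ × EX →L[ℝ] F}
    (hA : SmoothFormOn (𝓘(ℝ, ℝ).prod IX) S A) :
    ContMDiffOn (𝓘(ℝ, ℝ).prod IX) 𝓘(ℝ, F) ∞ (fun x => A x (1, 0)) S := by
  have h1 : ContMDiff 𝓘(ℝ, ℝ) 𝓘(ℝ, ℝ).tangent ∞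
      (fun t : ℝ => (⟨t, (1 : ℝ)⟩ : TangentBundle 𝓘(ℝ, ℝ) ℝ)) :=
    contMDiff_vectorSpace_iff_contDiff (V := fun _ : ℝ => (1 : ℝ)).2 contDiff_const
  have h2 : ContMDiff IX IX.tangent ∞ (fun m : X => (⟨m, 0⟩ : TangentBundle IX X)) :=
    Bundle.contMDiff_zeroSection ℝ (TangentSpace IX : X → Type _)
  have : IsManifold IX (∞ + 1) X := by simpa using (inferInstance : IsManifold IX ∞ X)
  have h3 : ContMDiff (𝓘(ℝ, ℝ).prod IX) (𝓘(ℝ, ℝ).prod IX).tangent ∞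
      (fun x : ℝ × X => (⟨x, (1, 0)⟩ : TangentBundle (𝓘(ℝ, ℝ).prod IX) (ℝ × X))) :=
    contMDiff_equivTangentBundleProd_symm.comp
      ((h1.comp contMDiff_fst).prodMk (h2.comp contMDiff_snd))
  exact ContMDiffOn.comp hA h3.contMDiffOn fun x hx => hx

theorem contMDiffOn_slice {F : Type*} [NormedAddCommGroup F] [NormedSpace ℝ F] {f : ℝ × X → F}
    (hf : ContMDiffOn (𝓘(ℝ, ℝ).prod IX) 𝓘(ℝ, F) ∞ f (J ×ˢ V)) {t : ℝ} (ht : t ∈ J) :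
    ContMDiffOn IX 𝓘(ℝ, F) ∞ (fun m => f (t, m)) V :=
  hf.comp (f := fun m => (t, m)) (contMDiffOn_const.prodMk contMDiffOn_id) fun _ hm => ⟨ht, hm⟩

theorem hasDerivAt_of_contMDiffOn {F : Type*} [NormedAddCommGroup F] [NormedSpace ℝ F]
    {f : ℝ × X → F} (hJ : IsOpen J) (hV : IsOpen V)
    (hf : ContMDiffOn (𝓘(ℝ, ℝ).prod IX) 𝓘(ℝ, F) ∞ f (J ×ˢ V)) {t : ℝ} (ht : t ∈ J) {m : X}
    (hm : m ∈ V) : HasDerivAt (fun τ => f (τ, m)) (deriv (fun τ => f (τ, m)) t) t :=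
  (mdifferentiableAt_iff_differentiableAt.1 (MDifferentiableAt.comp t (g := f)
    (f := fun τ => (τ, m)) ((hf.contMDiffAt ((hJ.prod hV).mem_nhds
      (x := (t, m)) ⟨ht, hm⟩)).mdifferentiableAt (by simp))
    (mdifferentiableAt_id.prodMk mdifferentiableAt_const))).hasDerivAt

variable (IX G) in
/-- The density whose integral vanishes for all `θ` if and only if the momentum evolves according
to the field equations at time `t`. -/
def sliceDefect (Λ : ℝ × X → (ℝ × EX →L[ℝ] EG) → ℝ) (ν : ℝ × X → ℝ × EX →L[ℝ] EG) (t : ℝ)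
    (θ : X → EG) (m : X) : ℝ :=
  deriv (fun τ => momentum Λ ν (τ, m)) t (θ m) -
    momentum Λ ν (t, m) (ad G (θ m) (ν (t, m) (1, 0))) -
    fderiv ℝ (Λ (t, m)) (ν (t, m)) (joinForm 0 (spatialDeriv IX G ν t θ m))

section Measure

variable [MeasurableSpace X] [OpensMeasurableSpace X] [T2Space X]
  {μ : Measure X} [IsFiniteMeasureOnCompacts μ]

/-- The terms of the evolution equation with `∂η/∂t` cancel, so that only the values of `η` on the
slice at time `t` matter. -/
theorem evolutionEquation_iff_sliceDefect (hJ : IsOpen J) (hV : IsOpen V)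
    (hΛ : FibreSmooth (𝓘(ℝ, ℝ).prod IX) (J ×ˢ V) Λ)
    (hν : SmoothFormOn (𝓘(ℝ, ℝ).prod IX) (J ×ˢ V) ν) :
    EvolutionEquation IX G μ J V Λ ν ↔
      ∀ t ∈ J, ∀ K : Set X, IsCompact K → K ⊆ V → ∀ θ : X → EG, ContMDiffOn IX 𝓘(ℝ, EG) ∞ θ V →
        (∀ m ∈ V \ K, θ m = 0) → ∫ m in K, sliceDefect IX G Λ ν t θ m ∂μ = 0 := by
  have hM := contMDiffOn_momentum hJ hV hΛ hν
  have key : ∀ t ∈ J, ∀ K : Set X, IsCompact K → K ⊆ V → ∀ η : ℝ × X → EG,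
      ContMDiffOn (𝓘(ℝ, ℝ).prod IX) 𝓘(ℝ, EG) ∞ η (J ×ˢ V) →
      (HasDerivAt (fun τ => ∫ m in K, fderiv ℝ (Λ (τ, m)) (ν (τ, m)) (joinForm (η (τ, m)) 0) ∂μ)
        (∫ m in K, firstVar (𝓘(ℝ, ℝ).prod IX) G Λ ν η (t, m) ∂μ) t ↔
      ∫ m in K, sliceDefect IX G Λ ν t (fun y => η (t, y)) m ∂μ = 0) := by
    intro t ht K hK hKV η hη
    have hφ : ContMDiffOn (𝓘(ℝ, ℝ).prod IX) 𝓘(ℝ, ℝ) ∞ (fun x => momentum Λ ν x (η x)) (J ×ˢ V) :=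
      hM.clm_apply hη
    have h1 := hasDerivAt_setIntegral (μ := μ) hJ hV
      (Φ := fun τ m => momentum Λ ν (τ, m) (η (τ, m))) hφ hK hKV ht
    simp only [momentum_apply] at h1
    have hc1 : ContinuousOn (fun m => deriv (fun τ => fderiv ℝ (Λ (τ, m)) (ν (τ, m))
        (joinForm (η (τ, m)) 0)) t) K := by
      have h2 := contMDiffOn_slice (contMDiffOn_deriv_left hJ hV
        (Φ := fun τ m => momentum Λ ν (τ, m) (η (τ, m))) hφ) ht
      simp only [momentum_apply] at h2
      exact h2.continuousOn.mono hKV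
    have hc2 : ContinuousOn (fun m => firstVar (𝓘(ℝ, ℝ).prod IX) G Λ ν η (t, m)) K :=
      (contMDiffOn_slice (contMDiffOn_firstVar (hJ.prod hV) hΛ hν hη) ht).continuousOn.mono hKV
    have h3 := integral_sub (μ := μ.restrict K) (hc1.integrableOn_compact hK)
      (hc2.integrableOn_compact hK)
    have h4 : ∫ m in K, sliceDefect IX G Λ ν t (fun y => η (t, y)) m ∂μ =
        ∫ m in K, (deriv (fun τ => fderiv ℝ (Λ (τ, m)) (ν (τ, m)) (joinForm (η (τ, m)) 0)) t -
          firstVar (𝓘(ℝ, ℝ).prod IX) G Λ ν η (t, m)) ∂μ := by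
      refine setIntegral_congr_fun hK.measurableSet fun m hm => ?_
      have h5 := ((hasDerivAt_of_contMDiffOn hJ hV hM ht (hKV hm)).clm_apply
        (hasDerivAt_of_contMDiffOn hJ hV hη ht (hKV hm))).deriv
      simp only [momentum_apply] at h5
      have h6 := firstVar_eq_slice (G := G) (Λ := Λ) (ν := ν) ((hη.contMDiffAt
        ((hJ.prod hV).mem_nhds (x := (t, m)) ⟨ht, hKV hm⟩)).mdifferentiableAt (by simp))
      rw [h5, h6, sliceDefect, map_add, ← momentum_apply]
      ring
    rw [h4, h3, sub_eq_zero]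
    constructor
    · exact fun h => h1.unique h
    · exact fun h => by rwa [h] at h1
  constructor
  · intro H t ht K hK hKV θ hθ hθK
    have hη : ContMDiffOn (𝓘(ℝ, ℝ).prod IX) 𝓘(ℝ, EG) ∞ (fun x : ℝ × X => θ x.2) (J ×ˢ V) :=
      hθ.comp contMDiffOn_snd fun x hx => hx.2
    exact (key t ht K hK hKV _ hη).1 (H K hK hKV _ hη (fun _ _ m hm => hθK m hm) t ht)
  · intro H K hK hKV η hη hηK t ht
    exact (key t ht K hK hKV _ hη).2
      (H t ht K hK hKV _ (contMDiffOn_slice hη ht) fun m hm => hηK t ht m hm)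

end Measure

end Slice

/-! ### Functional derivatives of the reduced Lagrangian -/

section AffineEquations

variable
  {EX : Type*} [NormedAddCommGroup EX] [NormedSpace ℝ EX] [FiniteDimensional ℝ EX]
  {HX : Type*} [TopologicalSpace HX] {IX : ModelWithCorners ℝ EX HX} [IX.Boundaryless]
  {X : Type*} [TopologicalSpace X] [ChartedSpace HX X] [IsManifold IX ∞ X]
  {EP : Type*} [NormedAddCommGroup EP] [NormedSpace ℝ EP]
  {HP : Type*} [TopologicalSpace HP] {IP : ModelWithCorners ℝ EP HP}
  {P : Type*} [TopologicalSpace P] [ChartedSpace HP P] [IsManifold IP ∞ P]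
  {EG : Type*} [NormedAddCommGroup EG] [NormedSpace ℝ EG] [FiniteDimensional ℝ EG]
  {G : Type*} [TopologicalSpace G] [ChartedSpace EG G] [Group G] [LieGroup 𝓘(ℝ, EG) ∞ G]
  {B : BundleMaps X P G} {V : Set X} {ξ : P → G} {e : X → P} {J : Set ℝ}
  {L : Jet (𝓘(ℝ, ℝ).prod IX) (𝓘(ℝ, ℝ).prod IP) B.timesLine → ℝ} {s : ℝ × X → ℝ × P}

namespace IsTrivialized

variable (hT : IsTrivialized IX IP EG B V ξ e)

include hT

theorem isCoadSection {N : X → EG →L[ℝ] ℝ} (hN : ContMDiffOn IX 𝓘(ℝ, EG →L[ℝ] ℝ) ∞ N V) :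
    IsCoadSection IP B V (fun p => (N (B.proj p)).comp (Ad G (ξ p))) where
  smooth := (hN.comp hT.smooth_proj.contMDiffOn fun p hp => hp).clm_comp
    (contMDiffOn_Ad_comp hT.smooth_triv)
  equivariant := by
    intro p hp g
    refine ContinuousLinearMap.ext fun v => ?_
    simp only [ContinuousLinearMap.comp_apply]
    rw [hT.triv_act p hp, hT.proj_act, Ad_mul_apply, Ad_Ad_inv]

theorem coadSection_eq {N : P → EG →L[ℝ] ℝ} (hN : IsCoadSection IP B V N) {p : P}
    (hp : p ∈ B.part V) : N p = (N (e (B.proj p))).comp (Ad G (ξ p)) := by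
  have h := hN.equivariant _ (hT.sec_mem hp) (ξ p)
  rw [hT.act_sec p hp] at h
  refine ContinuousLinearMap.ext fun v => ?_
  rw [← h]
  simp only [ContinuousLinearMap.comp_apply]
  rw [Ad_inv_Ad]

theorem isAdForm {a : X → EX →L[ℝ] EG} (ha : SmoothFormOn IX V a) :
    IsAdForm IX IP B V (fun p => (Ad G (ξ p)⁻¹).comp (a (B.proj p))) where
  smooth := by
    have h1 := ha.pullback (f := B.proj) hT.isOpen_part hT.isOpen hT.smooth_proj.contMDiffOn
      fun p hp => hp
    exact h1.clm_comp (contMDiffOn_Ad_comp hT.smooth_triv.inv)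
  equivariant := by
    intro p hp g u
    change Ad G (ξ (B.act p g))⁻¹ (a (B.proj (B.act p g)) u) = Ad G g⁻¹ (Ad G (ξ p)⁻¹ (a (B.proj p) u))
    rw [hT.triv_act p hp, hT.proj_act, mul_inv_rev, Ad_mul_apply]

/-- The form on the base which represents a section of `L(TX, Ad P)` in the trivialization. -/
theorem smoothFormOn_adForm {α : P → EX →L[ℝ] EG} (hα : IsAdForm IX IP B V α) :
    SmoothFormOn IX V (fun x => α (e x)) := by
  have h1 : SmoothFormOn IP (B.part V) (fun p => (α p).comp (der IP IX B.proj p)) := hα.smooth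
  refine (h1.pullback hT.isOpen hT.isOpen_part hT.smooth_sec fun x hx => hT.sec_mem hx).congr
    fun x hx => ?_
  have h2 : (der IP IX B.proj (e x)).comp (der IX IP e x) = ContinuousLinearMap.id ℝ EX := by
    rw [← der_comp (hT.mdiff_proj _) (hT.mdiff_sec hx), ← der_id (I := IX) x]
    refine der_congr ?_
    filter_upwards [hT.isOpen.mem_nhds hx] with y hy using hT.proj_sec y hy
  rw [ContinuousLinearMap.comp_assoc, h2, ContinuousLinearMap.comp_id]

theorem adForm_eq {α : P → EX →L[ℝ] EG} (hα : IsAdForm IX IP B V α) {p : P} (hp : p ∈ B.part V) :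
    α p = (Ad G (ξ p)⁻¹).comp (α (e (B.proj p))) := by
  refine ContinuousLinearMap.ext fun u => ?_
  have h : α (B.act (e (B.proj p)) (ξ p)) u = Ad G (ξ p)⁻¹ (α (e (B.proj p)) u) :=
    hα.equivariant _ (hT.sec_mem hp) (ξ p) u
  rw [hT.act_sec p hp] at h
  exact h

theorem Ad_comp_adForm {α : P → EX →L[ℝ] EG} (hα : IsAdForm IX IP B V α) {p : P}
    (hp : p ∈ B.part V) : (Ad G (ξ p)).comp (α p) = α (e (B.proj p)) := by
  rw [hT.adForm_eq hα hp, hT.Ad_comp_Ad_inv_comp]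

/-- The covariant derivative of a section of the adjoint bundle is represented by `spatialDeriv`. -/
theorem isAdForm_covDeriv {ν : ℝ × X → ℝ × EX →L[ℝ] EG} (hJ : IsOpen J)
    (hν : SmoothFormOn (𝓘(ℝ, ℝ).prod IX) (J ×ˢ V) ν) {t : ℝ} (ht : t ∈ J)
    {A : P → EP →L[ℝ] EG}
    (hA : ∀ p ∈ B.part V, A p = (Ad G (ξ p)⁻¹).comp (rlog IP EG ξ p -
      ((ν (t, B.proj p)).comp (ContinuousLinearMap.inr ℝ ℝ EX)).comp (der IP IX B.proj p)))
    {θ : X → EG} (hθ : ContMDiffOn IX 𝓘(ℝ, EG) ∞ θ V) {f : P → EG}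
    (hf : ∀ q ∈ B.part V, f q = Ad G (ξ q)⁻¹ (θ (B.proj q))) :
    (∀ p ∈ B.part V, covDeriv IX IP B A f p =
      (Ad G (ξ p)⁻¹).comp (spatialDeriv IX G ν t θ (B.proj p))) ∧
    IsAdForm IX IP B V (covDeriv IX IP B A f) := by
  have h1 : ∀ p ∈ B.part V, covDeriv IX IP B A f p =
      (Ad G (ξ p)⁻¹).comp (spatialDeriv IX G ν t θ (B.proj p)) := fun p hp =>
    hT.covDeriv_eq hp (hA p hp)
      ((hθ.contMDiffAt (hT.isOpen.mem_nhds hp)).mdifferentiableAt (by simp)) hf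
  refine ⟨h1, ?_⟩
  have h2 := hT.isAdForm (smoothFormOn_spatialDeriv (G := G) hJ hT.isOpen hν ht hθ)
  constructor
  · have h3 : SmoothFormOn IP (B.part V) (fun p => ((Ad G (ξ p)⁻¹).comp
        (spatialDeriv IX G ν t θ (B.proj p))).comp (der IP IX B.proj p)) := h2.smooth
    exact h3.congr fun p hp => congrArg
      (fun T : EX →L[ℝ] EG => T.comp (der IP IX B.proj p)) (h1 p hp)
  · intro p hp g u
    refine (congrArg (fun T : EX →L[ℝ] EG => T u) (h1 _ (hT.act_mem hp g))).trans
      ((h2.equivariant p hp g u).trans ?_)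
    exact congrArg (fun T : EX →L[ℝ] EG => Ad G g⁻¹ (T u)) (h1 p hp).symm

section Measure

variable [MeasurableSpace X] [OpensMeasurableSpace X] [T2Space X]
  {μ : Measure X} [IsFiniteMeasureOnCompacts μ]

/-- The derivative of the reduced Lagrangian for a variation of the velocity and of the connection,
both of which are encoded by one form `C` on space-time. -/
theorem hasDerivAt_redLagrangian (hJ : IsOpen J)
    (hL : SmoothOnJets (𝓘(ℝ, ℝ).prod IX) (𝓘(ℝ, ℝ).prod IP) B.timesLine L)
    (hinv : Invariant (𝓘(ℝ, ℝ).prod IX) (𝓘(ℝ, ℝ).prod IP) B.timesLine L)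
    (hs : IsLocalSection (𝓘(ℝ, ℝ).prod IX) (𝓘(ℝ, ℝ).prod IP) B.timesLine (J ×ˢ V) s)
    {t : ℝ} (ht : t ∈ J)
    {f₀ : P → EG} {Γ : P → EP →L[ℝ] EG}
    (hf₀ : ∀ p ∈ B.part V, f₀ p = Ad G (ξ p)⁻¹ (lineLog IX EG ξ s (t, B.proj p) (1, 0)))
    (hΓ : ∀ p ∈ B.part V, Γ p = (Ad G (ξ p)⁻¹).comp (rlog IP EG ξ p -
      ((lineLog IX EG ξ s (t, B.proj p)).comp (ContinuousLinearMap.inr ℝ ℝ EX)).comp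
        (der IP IX B.proj p)))
    {K : Set X} (hK : IsCompact K) (hKV : K ⊆ V)
    {C : X → ℝ × EX →L[ℝ] EG}
    (hC : SmoothFormOn (𝓘(ℝ, ℝ).prod IX) (J ×ˢ V) (fun x : ℝ × X => C x.2))
    {f : ℝ → P → EG} {A : ℝ → P → EP →L[ℝ] EG}
    (hf : ∀ ε, ∀ p ∈ B.part V, f ε p = f₀ p +
      ε • Ad G (ξ p)⁻¹ (C (B.proj p) (1, 0)))
    (hA : ∀ ε, ∀ p ∈ B.part V, A ε p =
      Γ p -
      ε • (Ad G (ξ p)⁻¹).comp (((C (B.proj p)).comp (ContinuousLinearMap.inr ℝ ℝ EX)).comp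
        (der IP IX B.proj p))) :
    HasDerivAt (fun ε => redLagrangian IX IP B μ
        (reduce (𝓘(ℝ, ℝ).prod IX) (𝓘(ℝ, ℝ).prod IP) B.timesLine L hinv) K t (f ε) (A ε))
      (∫ m in K, fderiv ℝ (lineLag IX IP EG B e L (t, m)) (lineLog IX EG ξ s (t, m)) (C m) ∂μ)
      0 := by
  refine ((hT.fibreSmooth_lineLag hJ hL hinv).hasDerivAt_sliceIntegral (μ := μ) hJ hT.isOpen
    (hT.smoothFormOn_lineLog hJ hs) hC ht hK hKV).congr_of_eventuallyEq
    (Eventually.of_forall fun ε => ?_)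
  refine hT.redLagrangian_eq hJ hinv ht hK hKV
    (κ := fun m => lineLog IX EG ξ s (t, m) + ε • C m) ?_ ?_
  · intro p hp
    rw [hf ε p hp, hf₀ p hp, _root_.add_apply, _root_.smul_apply,
      map_add, map_smul]
  · intro p hp
    rw [hA ε p hp, hΓ p hp]
    refine ContinuousLinearMap.ext fun v => ?_
    simp only [_root_.add_apply, _root_.smul_apply, ContinuousLinearMap.comp_apply,
      map_add, map_smul, _root_.sub_apply, map_sub]
    abel

/-- The functional derivative of the reduced Lagrangian in the velocity is the momentum. -/
theorem hasDerivAt_redLagrangian_vel (hJ : IsOpen J)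
    (hL : SmoothOnJets (𝓘(ℝ, ℝ).prod IX) (𝓘(ℝ, ℝ).prod IP) B.timesLine L)
    (hinv : Invariant (𝓘(ℝ, ℝ).prod IX) (𝓘(ℝ, ℝ).prod IP) B.timesLine L)
    (hs : IsLocalSection (𝓘(ℝ, ℝ).prod IX) (𝓘(ℝ, ℝ).prod IP) B.timesLine (J ×ˢ V) s)
    {t : ℝ} (ht : t ∈ J)
    {f₀ : P → EG} {Γ : P → EP →L[ℝ] EG}
    (hf₀ : ∀ p ∈ B.part V, f₀ p = Ad G (ξ p)⁻¹ (lineLog IX EG ξ s (t, B.proj p) (1, 0)))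
    (hΓ : ∀ p ∈ B.part V, Γ p = (Ad G (ξ p)⁻¹).comp (rlog IP EG ξ p -
      ((lineLog IX EG ξ s (t, B.proj p)).comp (ContinuousLinearMap.inr ℝ ℝ EX)).comp
        (der IP IX B.proj p)))
    {K : Set X} (hK : IsCompact K) (hKV : K ⊆ V)
    {θ : P → EG} (hθ : IsAdSection IP B V θ) :
    HasDerivAt (fun ε : ℝ => redLagrangian IX IP B μ
        (reduce (𝓘(ℝ, ℝ).prod IX) (𝓘(ℝ, ℝ).prod IP) B.timesLine L hinv) K t
        (fun p => f₀ p + ε • θ p)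
        Γ)
      (∫ m in K, momentum (lineLag IX IP EG B e L) (lineLog IX EG ξ s) (t, m) (θ (e m)) ∂μ) 0 := by
  simp only [momentum_apply]
  refine hT.hasDerivAt_redLagrangian hJ hL hinv hs ht hf₀ hΓ hK hKV
    (C := fun m => joinForm (θ (e m)) 0)
    (f := fun ε p => f₀ p + ε • θ p)
    (A := fun _ => Γ) ?_ ?_ ?_
  · exact SmoothFormOn.joinForm_left (η := fun x : ℝ × X => θ (e x.2)) (hJ.prod hT.isOpen)
      ((hT.contMDiffOn_adSection hθ).comp contMDiffOn_snd fun x hx => hx.2)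
  · intro ε p hp
    have h : joinForm (E := EX) (θ (e (B.proj p))) 0 (1, 0) = θ (e (B.proj p)) := by simp
    rw [h, ← hT.adSection_eq hθ hp]
  · intro ε p _
    have h : (joinForm (E := EX) (θ (e (B.proj p))) 0).comp (ContinuousLinearMap.inr ℝ ℝ EX) = 0 := by
      ext u
      simp
    rw [h, ContinuousLinearMap.zero_comp, ContinuousLinearMap.comp_zero, smul_zero, sub_zero]

/-- The functional derivative of the reduced Lagrangian in the connection. The sign comes from the
horizontal lift, which moves by `-α` when the connection form moves by `α`. -/
theorem hasDerivAt_redLagrangian_conn (hJ : IsOpen J)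
    (hL : SmoothOnJets (𝓘(ℝ, ℝ).prod IX) (𝓘(ℝ, ℝ).prod IP) B.timesLine L)
    (hinv : Invariant (𝓘(ℝ, ℝ).prod IX) (𝓘(ℝ, ℝ).prod IP) B.timesLine L)
    (hs : IsLocalSection (𝓘(ℝ, ℝ).prod IX) (𝓘(ℝ, ℝ).prod IP) B.timesLine (J ×ˢ V) s)
    {t : ℝ} (ht : t ∈ J)
    {f₀ : P → EG} {Γ : P → EP →L[ℝ] EG}
    (hf₀ : ∀ p ∈ B.part V, f₀ p = Ad G (ξ p)⁻¹ (lineLog IX EG ξ s (t, B.proj p) (1, 0)))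
    (hΓ : ∀ p ∈ B.part V, Γ p = (Ad G (ξ p)⁻¹).comp (rlog IP EG ξ p -
      ((lineLog IX EG ξ s (t, B.proj p)).comp (ContinuousLinearMap.inr ℝ ℝ EX)).comp
        (der IP IX B.proj p)))
    {K : Set X} (hK : IsCompact K) (hKV : K ⊆ V)
    {α : P → EX →L[ℝ] EG} (hα : IsAdForm IX IP B V α) :
    HasDerivAt (fun ε : ℝ => redLagrangian IX IP B μ
        (reduce (𝓘(ℝ, ℝ).prod IX) (𝓘(ℝ, ℝ).prod IP) B.timesLine L hinv) K t
        f₀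
        (fun p => Γ p + ε • (α p).comp (der IP IX B.proj p)))
      (- ∫ m in K, fderiv ℝ (lineLag IX IP EG B e L (t, m)) (lineLog IX EG ξ s (t, m))
        (joinForm 0 (α (e m))) ∂μ) 0 := by
  have hj : ∀ a : EX →L[ℝ] EG, joinForm (0 : EG) (-a) = - joinForm 0 a := fun a => by
    ext <;> simp
  have h := hT.hasDerivAt_redLagrangian (μ := μ) hJ hL hinv hs ht hf₀ hΓ hK hKV
    (C := fun m => joinForm 0 (-(α (e m))))
    (f := fun _ => f₀)
    (A := fun ε p => Γ p + ε • (α p).comp (der IP IX B.proj p)) ?_ ?_ ?_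
  · simp only [hj, map_neg] at h
    rwa [integral_neg] at h
  · refine (SmoothFormOn.joinForm_right hJ hT.isOpen (hT.smoothFormOn_adForm hα)).clm_comp
      (T := fun _ => -ContinuousLinearMap.id ℝ EG) contMDiffOn_const |>.congr fun x _ => ?_
    ext <;> simp
  · intro ε p _
    simp
  · intro ε p hp
    have h1 : (joinForm (0 : EG) (-(α (e (B.proj p))))).comp (ContinuousLinearMap.inr ℝ ℝ EX) =
        -(α (e (B.proj p))) := by
      ext u
      simp
    rw [h1, hT.adForm_eq hα hp]
    refine ContinuousLinearMap.ext fun v => ?_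
    simp

end Measure

end IsTrivialized

end AffineEquations

/-! ### The affine Euler–Poincaré equations -/

section AffineEulerPoincare

variable
  {EX : Type*} [NormedAddCommGroup EX] [NormedSpace ℝ EX] [FiniteDimensional ℝ EX]
  {HX : Type*} [TopologicalSpace HX] {IX : ModelWithCorners ℝ EX HX} [IX.Boundaryless]
  {X : Type*} [TopologicalSpace X] [ChartedSpace HX X] [IsManifold IX ∞ X]
  {EP : Type*} [NormedAddCommGroup EP] [NormedSpace ℝ EP]
  {HP : Type*} [TopologicalSpace HP] {IP : ModelWithCorners ℝ EP HP}
  {P : Type*} [TopologicalSpace P] [ChartedSpace HP P] [IsManifold IP ∞ P]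
  {EG : Type*} [NormedAddCommGroup EG] [NormedSpace ℝ EG] [FiniteDimensional ℝ EG]
  {G : Type*} [TopologicalSpace G] [ChartedSpace EG G] [Group G] [LieGroup 𝓘(ℝ, EG) ∞ G]
  {B : BundleMaps X P G} {V : Set X} {ξ : P → G} {e : X → P} {J : Set ℝ}
  {L : Jet (𝓘(ℝ, ℝ).prod IX) (𝓘(ℝ, ℝ).prod IP) B.timesLine → ℝ} {s : ℝ × X → ℝ × P}

/-- Continuous functions with values in the dual of the Lie algebra which represent the same
functional on compactly supported functions are equal. -/
theorem eqOn_of_integral_clm_eq [T2Space X] [SigmaCompactSpace X] [MeasurableSpace X] [BorelSpace X]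
    {μ : Measure X} [IsFiniteMeasureOnCompacts μ] [μ.IsOpenPosMeasure] (hV : IsOpen V)
    {N M : X → EG →L[ℝ] ℝ} (hN : ContinuousOn N V) (hM : ContinuousOn M V)
    (h : ∀ K : Set X, IsCompact K → K ⊆ V → ∀ θ : X → EG, ContMDiffOn IX 𝓘(ℝ, EG) ∞ θ V →
      (∀ m ∈ V \ K, θ m = 0) → ∫ m in K, N m (θ m) ∂μ = ∫ m in K, M m (θ m) ∂μ) :
    EqOn N M V := by
  have := IX.locallyCompactSpace
  have := ChartedSpace.locallyCompactSpace HX X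
  have := IX.secondCountableTopology
  have := ChartedSpace.secondCountable_of_sigmaCompact HX X
  have key : ∀ v : EG, EqOn (fun m => N m v) (fun m => M m v) V := by
    intro v
    have hNv : ContinuousOn (fun m => N m v) V := hN.clm_apply continuousOn_const
    have hMv : ContinuousOn (fun m => M m v) V := hM.clm_apply continuousOn_const
    have h0 := hV.ae_eq_zero_of_integral_contMDiff_smul_eq_zero IX (μ := μ)
      (f := fun x => N x v - M x v)
      ((hNv.sub hMv).locallyIntegrableOn hV.measurableSet) fun f hf hfc hfs => by
        have h1 := h (tsupport f) hfc.isCompact hfs (fun m => f m • v)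
          (hf.contMDiffOn.smul contMDiffOn_const)
          fun m hm => by rw [image_eq_zero_of_notMem_tsupport hm.2, zero_smul]
        simp only [map_smul, smul_eq_mul] at h1
        have hi : ∀ {c : X → ℝ}, ContinuousOn c V →
            IntegrableOn (fun m => f m * c m) (tsupport f) μ := fun hc =>
          (hf.continuous.continuousOn.mul (hc.mono hfs)).integrableOn_compact hfc.isCompact
        have h2 := integral_sub (hi hNv) (hi hMv)
        rw [h1, sub_self] at h2
        refine Eq.trans (setIntegral_eq_integral_of_forall_compl_eq_zero (s := tsupport f)
          fun m hm => ?_).symm (Eq.trans ?_ h2)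
        · rw [image_eq_zero_of_notMem_tsupport hm, zero_smul]
        · simp only [smul_eq_mul, mul_sub]
    have h1 : (fun m => N m v) =ᵐ[μ.restrict V] fun m => M m v := by
      rw [Filter.EventuallyEq, ae_restrict_iff' hV.measurableSet]
      filter_upwards [h0] with x hx hxO using sub_eq_zero.1 (hx hxO)
    exact Measure.eqOn_open_of_ae_eq h1 hV hNv hMv
  exact fun m hm => ContinuousLinearMap.ext fun v => key v hm

/-- The linear form `α ↦ -w(Ad_g ∘ α)` on forms on space, for a linear form `w` on forms on
space-time. With `w` the fibre derivative of the Lagrangian it represents the functional derivative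
in the connection. -/
def conormal (G : Type*) [TopologicalSpace G] [ChartedSpace EG G] [Group G]
    (w : (ℝ × EX →L[ℝ] EG) →L[ℝ] ℝ) (g : G) : (EX →L[ℝ] EG) →L[ℝ] ℝ :=
  -w.comp (((ContinuousLinearMap.compL ℝ (ℝ × EX) EX EG).flip
    (ContinuousLinearMap.snd ℝ ℝ EX)).comp (ContinuousLinearMap.compL ℝ EX EG EG (Ad G g)))

theorem conormal_apply (w : (ℝ × EX →L[ℝ] EG) →L[ℝ] ℝ) (g : G) (α : EX →L[ℝ] EG) :
    conormal G w g α = -w (joinForm 0 ((Ad G g).comp α)) := by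
  have h : joinForm (0 : EG) ((Ad G g).comp α) =
      ((Ad G g).comp α).comp (ContinuousLinearMap.snd ℝ ℝ EX) := by
    ext <;> simp
  rw [h]
  rfl

theorem conormal_mul (w : (ℝ × EX →L[ℝ] EG) →L[ℝ] ℝ) (g h : G) (α : EX →L[ℝ] EG) :
    conormal G w (g * h) ((Ad G h⁻¹).comp α) = conormal G w g α := by
  rw [conormal_apply, conormal_apply]
  congr 3
  refine ContinuousLinearMap.ext fun u => ?_
  simp only [ContinuousLinearMap.comp_apply]
  rw [Ad_mul_apply, Ad_Ad_inv]

namespace IsTrivialized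

variable (hT : IsTrivialized IX IP EG B V ξ e)

include hT

section Measure

variable [MeasurableSpace X] [BorelSpace X] [T2Space X] [SigmaCompactSpace X]
  {μ : Measure X} [IsFiniteMeasureOnCompacts μ] [μ.IsOpenPosMeasure]

omit [SigmaCompactSpace X] [μ.IsOpenPosMeasure] in
/-- If the slice defect integrates to zero, the affine Euler–Poincaré equations hold. -/
theorem affineEulerPoincare_of_sliceDefect (hJ : IsOpen J)
    (hL : SmoothOnJets (𝓘(ℝ, ℝ).prod IX) (𝓘(ℝ, ℝ).prod IP) B.timesLine L)
    (hinv : Invariant (𝓘(ℝ, ℝ).prod IX) (𝓘(ℝ, ℝ).prod IP) B.timesLine L)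
    (hs : IsLocalSection (𝓘(ℝ, ℝ).prod IX) (𝓘(ℝ, ℝ).prod IP) B.timesLine (J ×ˢ V) s)
    (H : ∀ t ∈ J, ∀ K : Set X, IsCompact K → K ⊆ V → ∀ θ : X → EG,
      ContMDiffOn IX 𝓘(ℝ, EG) ∞ θ V → (∀ m ∈ V \ K, θ m = 0) →
      ∫ m in K, sliceDefect IX G (lineLag IX IP EG B e L) (lineLog IX EG ξ s) t θ m ∂μ = 0) :
    AffineEulerPoincare IX IP B μ
      (reduce (𝓘(ℝ, ℝ).prod IX) (𝓘(ℝ, ℝ).prod IP) B.timesLine L hinv) J V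
      (bodyVelocity IP B V (gaugeCurve B ξ s))
      (fun t => pushForm IP B V (gaugeCurve B ξ s t) (flatConnection (EG := EG) IP ξ)) := by
  have hV := hT.isOpen
  have hΛ := hT.fibreSmooth_lineLag hJ hL hinv
  have hν := hT.smoothFormOn_lineLog hJ hs
  set Λ := lineLag IX IP EG B e L
  set ν := lineLog IX EG ξ s
  have hM := contMDiffOn_momentum hJ hV hΛ hν
  have hM' : ContMDiffOn (𝓘(ℝ, ℝ).prod IX) 𝓘(ℝ, EG →L[ℝ] ℝ) ∞
      (fun z : ℝ × X => deriv (fun τ => momentum Λ ν (τ, z.2)) z.1) (J ×ˢ V) :=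
    contMDiffOn_deriv_left hJ hV (Φ := fun τ m => momentum Λ ν (τ, m)) hM
  have hν0 : ContMDiffOn (𝓘(ℝ, ℝ).prod IX) 𝓘(ℝ, EG) ∞ (fun x => ν x (1, 0)) (J ×ˢ V) :=
    hν.contMDiffOn_apply_time
  have hD : ContMDiffOn (𝓘(ℝ, ℝ).prod IX) 𝓘(ℝ, EG →L[ℝ] ℝ) ∞ (fun x : ℝ × X =>
      deriv (fun τ => momentum Λ ν (τ, x.2)) x.1 + (momentum Λ ν x).comp (adL EG G (ν x (1, 0))))
      (J ×ˢ V) :=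
    hM'.add (hM.clm_comp ((adL EG G).contMDiff.comp_contMDiffOn hν0))
  -- The functional derivatives are the momentum and the conormal form. As divergence of the latter
  -- take the value which the equation requires; that it is the divergence is the vanishing of the
  -- slice defect.
  refine ⟨fun t p => (momentum Λ ν (t, B.proj p)).comp (Ad G (ξ p)),
    fun t p => conormal (EX := EX) G (fderiv ℝ (Λ (t, B.proj p)) (ν (t, B.proj p))) (ξ p),
    fun t p => (deriv (fun τ => momentum Λ ν (τ, B.proj p)) t +
      (momentum Λ ν (t, B.proj p)).comp (adL EG G (ν (t, B.proj p) (1, 0)))).comp (Ad G (ξ p)),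
    fun t ht => ⟨⟨hT.isCoadSection (contMDiffOn_slice hM ht), ?_⟩, ⟨⟨?_, ?_⟩, ?_⟩,
      ⟨hT.isCoadSection (contMDiffOn_slice hD ht), ?_⟩, ?_⟩⟩
  · intro K hK hKV θ hθ _
    have h := hT.hasDerivAt_redLagrangian_vel (μ := μ) hJ hL hinv hs ht
      (fun p hp => hT.bodyVelocity_gaugeCurve hJ hs ht hp)
      (fun p hp => hT.pushForm_gaugeCurve hJ hs ht hp) hK hKV hθ
    have e1 : ∫ m in K, B.descend (fun p =>
        (momentum Λ ν (t, B.proj p)).comp (Ad G (ξ p)) (θ p)) m ∂μ =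
        ∫ m in K, momentum Λ ν (t, m) (θ (e m)) ∂μ := by
      refine setIntegral_congr_fun hK.measurableSet fun m hm => ?_
      refine hT.descend_eq (hKV hm) fun p hpm => ?_
      have hp : p ∈ B.part V := by change B.proj p ∈ V; rw [hpm]; exact hKV hm
      rw [ContinuousLinearMap.comp_apply, hT.adSection_eq hθ hp, Ad_Ad_inv, hpm]
    exact h.congr_deriv e1.symm
  · intro α hα
    have h := (contMDiffOn_slice_fderiv hJ hV hΛ hν ht (hT.smoothFormOn_adForm hα)).neg.comp
      hT.smooth_proj.contMDiffOn (fun p hp => hp)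
    refine h.congr fun p hp => ?_
    refine (conormal_apply (EX := EX) _ _ (α p)).trans ?_
    exact congrArg (fun T : EX →L[ℝ] EG => -(fderiv ℝ (Λ (t, B.proj p)) (ν (t, B.proj p)))
      (joinForm 0 T)) (hT.Ad_comp_adForm hα hp)
  · intro p hp g α
    change conormal (EX := EX) G _ (ξ (B.act p g)) _ = conormal (EX := EX) G _ (ξ p) α
    rw [hT.triv_act p hp, hT.proj_act]
    exact conormal_mul _ _ _ _
  · intro K hK hKV α hα _
    have h := hT.hasDerivAt_redLagrangian_conn (μ := μ) hJ hL hinv hs ht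
      (fun p hp => hT.bodyVelocity_gaugeCurve hJ hs ht hp)
      (fun p hp => hT.pushForm_gaugeCurve hJ hs ht hp) hK hKV hα
    have e1 : ∫ m in K, B.descend (fun p =>
        conormal (EX := EX) G (fderiv ℝ (Λ (t, B.proj p)) (ν (t, B.proj p))) (ξ p) (α p)) m ∂μ =
        - ∫ m in K, fderiv ℝ (Λ (t, m)) (ν (t, m)) (joinForm 0 (α (e m))) ∂μ := by
      rw [← integral_neg]
      refine setIntegral_congr_fun hK.measurableSet fun m hm => ?_
      refine hT.descend_eq (hKV hm) fun p hpm => ?_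
      have hp : p ∈ B.part V := by change B.proj p ∈ V; rw [hpm]; exact hKV hm
      refine (conormal_apply (EX := EX) _ _ (α p)).trans ?_
      refine (congrArg (fun T : EX →L[ℝ] EG => -(fderiv ℝ (Λ (t, B.proj p)) (ν (t, B.proj p)))
        (joinForm 0 T)) (hT.Ad_comp_adForm hα hp)).trans ?_
      rw [hpm]
    exact h.congr_deriv e1.symm
  · intro K hK hKV θ hθ hθK
    have hθ0 := hT.contMDiffOn_adSection hθ
    have hcov := hT.isAdForm_covDeriv hJ hν ht
      (A := pushForm IP B V (gaugeCurve B ξ s t) (flatConnection (EG := EG) IP ξ))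
      (fun p hp => hT.pushForm_gaugeCurve hJ hs ht hp) hθ0 (fun q hq => hT.adSection_eq hθ hq)
    have e1 : ∫ m in K, B.descend (fun p => (deriv (fun τ => momentum Λ ν (τ, B.proj p)) t +
        (momentum Λ ν (t, B.proj p)).comp (adL EG G (ν (t, B.proj p) (1, 0)))).comp (Ad G (ξ p))
          (θ p)) m ∂μ =
        ∫ m in K, (deriv (fun τ => momentum Λ ν (τ, m)) t +
          (momentum Λ ν (t, m)).comp (adL EG G (ν (t, m) (1, 0)))) (θ (e m)) ∂μ := by
      refine setIntegral_congr_fun hK.measurableSet fun m hm => ?_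
      refine hT.descend_eq (hKV hm) fun p hpm => ?_
      have hp : p ∈ B.part V := by change B.proj p ∈ V; rw [hpm]; exact hKV hm
      rw [ContinuousLinearMap.comp_apply, hT.adSection_eq hθ hp, Ad_Ad_inv, hpm]
    have e2 : ∫ m in K, B.descend (fun p =>
        conormal (EX := EX) G (fderiv ℝ (Λ (t, B.proj p)) (ν (t, B.proj p))) (ξ p)
          (covDeriv IX IP B (pushForm IP B V (gaugeCurve B ξ s t)
            (flatConnection (EG := EG) IP ξ)) θ p)) m ∂μ =
        - ∫ m in K, fderiv ℝ (Λ (t, m)) (ν (t, m))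
          (joinForm 0 (spatialDeriv IX G ν t (fun y => θ (e y)) m)) ∂μ := by
      rw [← integral_neg]
      refine setIntegral_congr_fun hK.measurableSet fun m hm => ?_
      refine hT.descend_eq (hKV hm) fun p hpm => ?_
      have hp : p ∈ B.part V := by change B.proj p ∈ V; rw [hpm]; exact hKV hm
      refine (conormal_apply (EX := EX) _ _ (covDeriv IX IP B _ θ p)).trans ?_
      have e1 : (Ad G (ξ p)).comp (covDeriv IX IP B (pushForm IP B V (gaugeCurve B ξ s t)
          (flatConnection (EG := EG) IP ξ)) θ p : EX →L[ℝ] EG) =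
          spatialDeriv IX G ν t (fun y => θ (e y)) (B.proj p) :=
        (congrArg (fun T : EX →L[ℝ] EG => (Ad G (ξ p)).comp T) (hcov.1 p hp)).trans
          (hT.Ad_comp_Ad_inv_comp _ _)
      refine (congrArg (fun T : EX →L[ℝ] EG => -(fderiv ℝ (Λ (t, B.proj p)) (ν (t, B.proj p)))
        (joinForm 0 T)) e1).trans ?_
      rw [hpm]
    refine e1.trans (Eq.trans ?_ (congrArg Neg.neg e2).symm)
    rw [neg_neg, ← sub_eq_zero]
    have hc1 : ContinuousOn (fun m => (deriv (fun τ => momentum Λ ν (τ, m)) t +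
        (momentum Λ ν (t, m)).comp (adL EG G (ν (t, m) (1, 0)))) (θ (e m))) K :=
      (((contMDiffOn_slice hD ht).clm_apply hθ0).continuousOn.mono hKV)
    have hc2 := (contMDiffOn_slice_fderiv hJ hV hΛ hν ht
      (smoothFormOn_spatialDeriv (G := G) hJ hV hν ht hθ0)).continuousOn.mono hKV
    refine (integral_sub (hc1.integrableOn_compact (μ := μ) hK)
      (hc2.integrableOn_compact (μ := μ) hK)).symm.trans ?_
    rw [← H t ht K hK hKV _ hθ0 (hT.vanish_adSection hθK)]
    refine setIntegral_congr_fun hK.measurableSet fun m hm => ?_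
    simp only [sliceDefect, _root_.add_apply, ContinuousLinearMap.comp_apply]
    rw [adL_apply, ad_swap (G := G) (ν (t, m) (1, 0)), map_neg]
    ring
  · intro p hp
    have h1 := hasDerivAt_of_contMDiffOn hJ hV hM ht hp
    have h2 := (((ContinuousLinearMap.compL ℝ EG EG ℝ).flip (Ad G (ξ p))).hasFDerivAt).comp_hasDerivAt
      t h1
    refine h2.congr_deriv ?_
    rw [hT.bodyVelocity_gaugeCurve hJ hs ht hp]
    refine ContinuousLinearMap.ext fun v => ?_
    have h3 := Ad_ad (G := G) (ξ p) (Ad G (ξ p)⁻¹ (ν (t, B.proj p) (1, 0))) v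
    rw [Ad_Ad_inv] at h3
    simp only [_root_.add_apply, _root_.neg_apply, ContinuousLinearMap.comp_apply]
    rw [h3, adL_apply]
    simp

/-- The affine Euler–Poincaré equations, paired with `θ`, make the slice defect integrate to zero.
-/
theorem sliceDefect_of_affineEulerPoincare (hJ : IsOpen J)
    (hL : SmoothOnJets (𝓘(ℝ, ℝ).prod IX) (𝓘(ℝ, ℝ).prod IP) B.timesLine L)
    (hinv : Invariant (𝓘(ℝ, ℝ).prod IX) (𝓘(ℝ, ℝ).prod IP) B.timesLine L)
    (hs : IsLocalSection (𝓘(ℝ, ℝ).prod IX) (𝓘(ℝ, ℝ).prod IP) B.timesLine (J ×ˢ V) s)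
    (H : AffineEulerPoincare IX IP B μ
      (reduce (𝓘(ℝ, ℝ).prod IX) (𝓘(ℝ, ℝ).prod IP) B.timesLine L hinv) J V
      (bodyVelocity IP B V (gaugeCurve B ξ s))
      (fun t => pushForm IP B V (gaugeCurve B ξ s t) (flatConnection (EG := EG) IP ξ)))
    {t : ℝ} (ht : t ∈ J) {K : Set X} (hK : IsCompact K) (hKV : K ⊆ V) {θ : X → EG}
    (hθ : ContMDiffOn IX 𝓘(ℝ, EG) ∞ θ V) (hθK : ∀ m ∈ V \ K, θ m = 0) :
    ∫ m in K, sliceDefect IX G (lineLag IX IP EG B e L) (lineLog IX EG ξ s) t θ m ∂μ = 0 := by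
  have hV := hT.isOpen
  have hΛ := hT.fibreSmooth_lineLag hJ hL hinv
  have hν := hT.smoothFormOn_lineLog hJ hs
  set Λ := lineLag IX IP EG B e L
  set ν := lineLog IX EG ξ s
  have hM := contMDiffOn_momentum hJ hV hΛ hν
  obtain ⟨N, χ, D, H⟩ := H
  -- The functional derivative in the velocity is unique, hence equal to the momentum.
  have hN : ∀ τ ∈ J, ∀ m ∈ V, N τ (e m) = momentum Λ ν (τ, m) := by
    intro τ hτ
    have hNs := (H τ hτ).1.1
    have hNe : ContMDiffOn IX 𝓘(ℝ, EG →L[ℝ] ℝ) ∞ (fun m => N τ (e m)) V :=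
      hNs.smooth.comp hT.smooth_sec fun m hm => hT.sec_mem hm
    refine eqOn_of_integral_clm_eq (IX := IX) (μ := μ) hV hNe.continuousOn
      (contMDiffOn_slice hM hτ).continuousOn fun K hK hKV θ hθ hθK => ?_
    have hθs := hT.isAdSection hθ
    have h1 := (H τ hτ).1.2 K hK hKV _ hθs (hT.adSection_vanish hθK)
    have h2 := hT.hasDerivAt_redLagrangian_vel (μ := μ) hJ hL hinv hs hτ
      (fun p hp => hT.bodyVelocity_gaugeCurve hJ hs hτ hp)
      (fun p hp => hT.pushForm_gaugeCurve hJ hs hτ hp) hK hKV hθs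
    have h3 := h1.unique h2
    have e1 : ∫ m in K, B.descend (fun p => N τ p (Ad G (ξ p)⁻¹ (θ (B.proj p)))) m ∂μ =
        ∫ m in K, N τ (e m) (θ m) ∂μ := by
      refine setIntegral_congr_fun hK.measurableSet fun m hm => ?_
      refine hT.descend_eq (hKV hm) fun p hpm => ?_
      have hp : p ∈ B.part V := by change B.proj p ∈ V; rw [hpm]; exact hKV hm
      rw [hT.coadSection_eq hNs hp, ContinuousLinearMap.comp_apply, Ad_Ad_inv, hpm]
    have e2 : ∫ m in K, momentum Λ ν (τ, m) (Ad G (ξ (e m))⁻¹ (θ (B.proj (e m)))) ∂μ =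
        ∫ m in K, momentum Λ ν (τ, m) (θ m) ∂μ := by
      refine setIntegral_congr_fun hK.measurableSet fun m hm => ?_
      rw [hT.triv_sec m (hKV hm), hT.proj_sec m (hKV hm), inv_one, Ad_one]
      rfl
    rw [← e1, ← e2]
    exact h3
  have hθs := hT.isAdSection hθ
  have hcov := hT.isAdForm_covDeriv hJ hν ht
    (A := pushForm IP B V (gaugeCurve B ξ s t) (flatConnection (EG := EG) IP ξ))
    (fun p hp => hT.pushForm_gaugeCurve hJ hs ht hp) hθ
    (f := fun p => Ad G (ξ p)⁻¹ (θ (B.proj p))) (fun q hq => rfl)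
  have hcov0 : ∀ p ∈ B.part (V \ K), covDeriv IX IP B
      (pushForm IP B V (gaugeCurve B ξ s t) (flatConnection (EG := EG) IP ξ))
      (fun p => Ad G (ξ p)⁻¹ (θ (B.proj p))) p = 0 := by
    intro p hp
    refine (hcov.1 p hp.1).trans ?_
    have h0 : θ =ᶠ[𝓝 (B.proj p)] fun _ => 0 := by
      filter_upwards [(hV.sdiff hK.isClosed).mem_nhds hp] with y hy using hθK y hy
    rw [spatialDeriv, der_congr h0, der_const, h0.eq_of_nhds, ← adL_apply, map_zero,
      ContinuousLinearMap.zero_comp, add_zero, ContinuousLinearMap.comp_zero]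
    rfl
  -- Only the integral of the functional derivative in the connection against `∇θ` is needed, so its
  -- uniqueness plays no role.
  have h1 := ((H t ht).2.1.2 K hK hKV _ hcov.2 hcov0).unique
    (hT.hasDerivAt_redLagrangian_conn (μ := μ) hJ hL hinv hs ht
      (fun p hp => hT.bodyVelocity_gaugeCurve hJ hs ht hp)
      (fun p hp => hT.pushForm_gaugeCurve hJ hs ht hp) hK hKV hcov.2)
  have h2 := (H t ht).2.2.1.2 K hK hKV _ hθs (hT.adSection_vanish hθK)
  have hDs := (H t ht).2.2.1.1
  have e1 : ∫ m in K, B.descend (fun p => D t p (Ad G (ξ p)⁻¹ (θ (B.proj p)))) m ∂μ =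
      ∫ m in K, D t (e m) (θ m) ∂μ := by
    refine setIntegral_congr_fun hK.measurableSet fun m hm => ?_
    refine hT.descend_eq (hKV hm) fun p hpm => ?_
    have hp : p ∈ B.part V := by change B.proj p ∈ V; rw [hpm]; exact hKV hm
    rw [hT.coadSection_eq hDs hp, ContinuousLinearMap.comp_apply, Ad_Ad_inv, hpm]
  have e2 : ∫ m in K, fderiv ℝ (Λ (t, m)) (ν (t, m)) (joinForm 0 (covDeriv IX IP B
      (pushForm IP B V (gaugeCurve B ξ s t) (flatConnection (EG := EG) IP ξ))
      (fun p => Ad G (ξ p)⁻¹ (θ (B.proj p))) (e m))) ∂μ =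
      ∫ m in K, fderiv ℝ (Λ (t, m)) (ν (t, m)) (joinForm 0 (spatialDeriv IX G ν t θ m)) ∂μ := by
    refine setIntegral_congr_fun hK.measurableSet fun m hm => ?_
    refine congrArg (fun T : EX →L[ℝ] EG => fderiv ℝ (Λ (t, m)) (ν (t, m)) (joinForm 0 T))
      ((hcov.1 _ (hT.sec_mem (hKV hm))).trans ?_)
    rw [hT.triv_sec m (hKV hm), hT.proj_sec m (hKV hm), inv_one, Ad_one]
    rfl
  have h3 : ∫ m in K, D t (e m) (θ m) ∂μ =
      ∫ m in K, fderiv ℝ (Λ (t, m)) (ν (t, m)) (joinForm 0 (spatialDeriv IX G ν t θ m)) ∂μ := by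
    rw [← e1, ← e2]
    refine h2.trans ?_
    rw [← neg_neg (∫ m in K, fderiv ℝ (Λ (t, m)) (ν (t, m)) (joinForm 0 (covDeriv IX IP B
      (pushForm IP B V (gaugeCurve B ξ s t) (flatConnection (EG := EG) IP ξ))
      (fun p => Ad G (ξ p)⁻¹ (θ (B.proj p))) (e m))) ∂μ)]
    exact congrArg Neg.neg h1
  have hDe : ContMDiffOn IX 𝓘(ℝ, EG →L[ℝ] ℝ) ∞ (fun m => D t (e m)) V :=
    hDs.smooth.comp hT.smooth_sec fun m hm => hT.sec_mem hm
  have hc1 := (hDe.clm_apply hθ).continuousOn.mono hKV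
  have hc2 := (contMDiffOn_slice_fderiv hJ hV hΛ hν ht
    (smoothFormOn_spatialDeriv (G := G) hJ hV hν ht hθ)).continuousOn.mono hKV
  rw [← sub_eq_zero, ← integral_sub (hc1.integrableOn_compact (μ := μ) hK)
    (hc2.integrableOn_compact (μ := μ) hK)] at h3
  rw [← h3]
  refine setIntegral_congr_fun hK.measurableSet fun m hm => ?_
  have hm' := hKV hm
  have h4 : HasDerivAt (fun τ => momentum Λ ν (τ, m))
      (-(momentum Λ ν (t, m)).comp (ad G (ν (t, m) (1, 0))) + D t (e m)) t := by
    have h5 := (H t ht).2.2.2 (e m) (hT.sec_mem hm')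
    rw [hN t ht m hm', hT.bodyVelocity_gaugeCurve hJ hs ht (hT.sec_mem hm'), hT.triv_sec m hm',
      hT.proj_sec m hm', inv_one, Ad_one] at h5
    refine h5.congr_of_eventuallyEq ?_
    filter_upwards [hJ.mem_nhds ht] with τ hτ using (hN τ hτ m hm').symm
  simp only [sliceDefect]
  rw [h4.deriv, ad_swap (G := G) (θ m), map_neg]
  simp only [_root_.add_apply, _root_.neg_apply, ContinuousLinearMap.comp_apply]
  ring

/-- The affine Euler–Poincaré equations are the evolution equation of the momentum. -/
theorem affineEulerPoincare_iff (hJ : IsOpen J)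
    (hL : SmoothOnJets (𝓘(ℝ, ℝ).prod IX) (𝓘(ℝ, ℝ).prod IP) B.timesLine L)
    (hinv : Invariant (𝓘(ℝ, ℝ).prod IX) (𝓘(ℝ, ℝ).prod IP) B.timesLine L)
    (hs : IsLocalSection (𝓘(ℝ, ℝ).prod IX) (𝓘(ℝ, ℝ).prod IP) B.timesLine (J ×ˢ V) s) :
    AffineEulerPoincare IX IP B μ
      (reduce (𝓘(ℝ, ℝ).prod IX) (𝓘(ℝ, ℝ).prod IP) B.timesLine L hinv) J V
      (bodyVelocity IP B V (gaugeCurve B ξ s))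
      (fun t => pushForm IP B V (gaugeCurve B ξ s t) (flatConnection (EG := EG) IP ξ)) ↔
      EvolutionEquation IX G μ J V (lineLag IX IP EG B e L) (lineLog IX EG ξ s) := by
  rw [evolutionEquation_iff_sliceDefect hJ hT.isOpen (hT.fibreSmooth_lineLag hJ hL hinv)
    (hT.smoothFormOn_lineLog hJ hs)]
  exact ⟨fun H t ht K hK hKV θ hθ hθK =>
      hT.sliceDefect_of_affineEulerPoincare hJ hL hinv hs H ht hK hKV hθ hθK,
    hT.affineEulerPoincare_of_sliceDefect hJ hL hinv hs⟩

end Measure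

end IsTrivialized

end AffineEulerPoincare

/-! ### Volume forms in charts -/

section VolumeForm

variable {n : ℕ} {M : Type*} [TopologicalSpace M] [ChartedSpace (EuclideanSpace ℝ (Fin n)) M]
  [IsManifold (𝓡 n) ∞ M] {vol : ∀ m : M, TangentSpace (𝓡 n) m [⋀^Fin n]→L[ℝ] ℝ}

theorem chartCoeff_eq (m₀ : M) (y : EuclideanSpace ℝ (Fin n)) :
    chartCoeff vol m₀ y = (vol ((extChartAt (𝓡 n) m₀).symm y) : EuclideanSpace ℝ (Fin n) [⋀^Fin n]→L[ℝ] ℝ)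
      (⇑(der 𝓘(ℝ, EuclideanSpace ℝ (Fin n)) (𝓡 n) (extChartAt (𝓡 n) m₀).symm y : EuclideanSpace ℝ (Fin n) →L[ℝ] EuclideanSpace ℝ (Fin n)) ∘
        ⇑(EuclideanSpace.basisFun (Fin n) ℝ).toBasis) := by
  have h : (⇑(der 𝓘(ℝ, EuclideanSpace ℝ (Fin n)) (𝓡 n) (extChartAt (𝓡 n) m₀).symm y : EuclideanSpace ℝ (Fin n) →L[ℝ] EuclideanSpace ℝ (Fin n)) ∘
        ⇑(EuclideanSpace.basisFun (Fin n) ℝ).toBasis) =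
      fun i => der 𝓘(ℝ, EuclideanSpace ℝ (Fin n)) (𝓡 n) (extChartAt (𝓡 n) m₀).symm y (EuclideanSpace.single i (1 : ℝ)) := by
    funext i
    simp
  exact (congrArg (fun v : Fin n → EuclideanSpace ℝ (Fin n) =>
    (vol ((extChartAt (𝓡 n) m₀).symm y) : EuclideanSpace ℝ (Fin n) [⋀^Fin n]→L[ℝ] ℝ) v) h).symm

/-- An alternating form of top degree composed with a linear map. -/
theorem alternating_comp_eq (A : EuclideanSpace ℝ (Fin n) [⋀^Fin n]→L[ℝ] ℝ) (T : EuclideanSpace ℝ (Fin n) →L[ℝ] EuclideanSpace ℝ (Fin n)) (v : Fin n → EuclideanSpace ℝ (Fin n)) :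
    A (⇑T ∘ v) = LinearMap.det (T : EuclideanSpace ℝ (Fin n) →ₗ[ℝ] EuclideanSpace ℝ (Fin n)) * A v := by
  have h := AlternatingMap.eq_smul_basis_det (EuclideanSpace.basisFun (Fin n) ℝ).toBasis
    A.toAlternatingMap
  have h1 : ∀ w : Fin n → EuclideanSpace ℝ (Fin n), A w = A.toAlternatingMap (EuclideanSpace.basisFun (Fin n) ℝ).toBasis *
      (EuclideanSpace.basisFun (Fin n) ℝ).toBasis.det w := fun w =>
    congrArg (fun f : EuclideanSpace ℝ (Fin n) [⋀^Fin n]→ₗ[ℝ] ℝ => f w) h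
  rw [h1, h1 v, show (⇑T ∘ v) = (⇑(T : EuclideanSpace ℝ (Fin n) →ₗ[ℝ] EuclideanSpace ℝ (Fin n)) ∘ v) from rfl, Module.Basis.det_comp]
  ring

/-- The coefficients of a volume form in two charts differ by the Jacobian determinant. -/
theorem chartCoeff_change (x z : M) {y : EuclideanSpace ℝ (Fin n)} (hy : y ∈ (extChartAt (𝓡 n) x).target)
    (hyz : (extChartAt (𝓡 n) x).symm y ∈ (extChartAt (𝓡 n) z).source) :
    chartCoeff vol x y =
      (fderiv ℝ (fun w => extChartAt (𝓡 n) z ((extChartAt (𝓡 n) x).symm w)) y).det *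
        chartCoeff vol z (extChartAt (𝓡 n) z ((extChartAt (𝓡 n) x).symm y)) := by
  have : IsManifold (𝓡 n) 1 M := IsManifold.of_le (n := ∞) (by simp)
  have hx : MDifferentiableAt 𝓘(ℝ, EuclideanSpace ℝ (Fin n)) (𝓡 n) (extChartAt (𝓡 n) x).symm y :=
    (contMDiffAt_extChartAt_symm hy).mdifferentiableAt (by simp)
  have hz : MDifferentiableAt (𝓡 n) 𝓘(ℝ, EuclideanSpace ℝ (Fin n)) (extChartAt (𝓡 n) z)
      ((extChartAt (𝓡 n) x).symm y) := mdifferentiableAt_extChartAt (by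
    rwa [extChartAt_source] at hyz)
  have hT := der_comp hz hx
  rw [der_eq_fderiv] at hT
  have hz' : (extChartAt (𝓡 n) z).symm (extChartAt (𝓡 n) z ((extChartAt (𝓡 n) x).symm y)) =
      (extChartAt (𝓡 n) x).symm y := (extChartAt (𝓡 n) z).left_inv hyz
  have hc : der 𝓘(ℝ, EuclideanSpace ℝ (Fin n)) (𝓡 n) (extChartAt (𝓡 n) x).symm y =
      (der 𝓘(ℝ, EuclideanSpace ℝ (Fin n)) (𝓡 n) (extChartAt (𝓡 n) z).symm
        (extChartAt (𝓡 n) z ((extChartAt (𝓡 n) x).symm y))).comp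
      (fderiv ℝ (fun w => extChartAt (𝓡 n) z ((extChartAt (𝓡 n) x).symm w)) y) := by
    rw [hT, ← ContinuousLinearMap.comp_assoc, der_symm_comp_extChartAt hyz]
    exact (ContinuousLinearMap.id_comp _).symm
  rw [chartCoeff_eq, chartCoeff_eq, hc, hz']
  have h := alternating_comp_eq
    ((vol ((extChartAt (𝓡 n) x).symm y) : EuclideanSpace ℝ (Fin n) [⋀^Fin n]→L[ℝ] ℝ).compContinuousLinearMap
      (der 𝓘(ℝ, EuclideanSpace ℝ (Fin n)) (𝓡 n) (extChartAt (𝓡 n) z).symm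
        (extChartAt (𝓡 n) z ((extChartAt (𝓡 n) x).symm y))))
    (fderiv ℝ (fun w => extChartAt (𝓡 n) z ((extChartAt (𝓡 n) x).symm w)) y)
    ⇑(EuclideanSpace.basisFun (Fin n) ℝ).toBasis
  exact h

theorem chartCoeff_ne_zero (hvol : IsVolumeForm vol) (x : M) {y : EuclideanSpace ℝ (Fin n)}
    (hy : y ∈ (extChartAt (𝓡 n) x).target) : chartCoeff vol x y ≠ 0 := by
  intro h0
  refine hvol.ne_zero ((extChartAt (𝓡 n) x).symm y) ?_
  set A : EuclideanSpace ℝ (Fin n) [⋀^Fin n]→L[ℝ] ℝ := vol ((extChartAt (𝓡 n) x).symm y)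
  set D := der 𝓘(ℝ, EuclideanSpace ℝ (Fin n)) (𝓡 n) (extChartAt (𝓡 n) x).symm y
  set D' := der (𝓡 n) 𝓘(ℝ, EuclideanSpace ℝ (Fin n)) (extChartAt (𝓡 n) x) ((extChartAt (𝓡 n) x).symm y)
  have hs := (extChartAt (𝓡 n) x).map_target hy
  have hDD : D.comp D' = ContinuousLinearMap.id ℝ (EuclideanSpace ℝ (Fin n)) := by
    have h := der_symm_comp_extChartAt (I := 𝓡 n) hs
    rwa [(extChartAt (𝓡 n) x).right_inv hy] at h
  rw [chartCoeff_eq] at h0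
  have h1 : (A.compContinuousLinearMap D).toAlternatingMap = 0 :=
    (AlternatingMap.map_basis_eq_zero_iff (EuclideanSpace.basisFun (Fin n) ℝ).toBasis _).1 h0
  have h2 : A = 0 := by
    ext v
    have h3 := congrArg (fun f : EuclideanSpace ℝ (Fin n) [⋀^Fin n]→ₗ[ℝ] ℝ => f (⇑D' ∘ v)) h1
    have h4 : A (fun i => (D.comp D') (v i)) = 0 := h3
    rw [hDD] at h4
    exact h4
  exact h2

/-! ### The measure of a volume form -/

variable [MeasurableSpace M]

/-- The measure on the chart domain at `x` with the absolute value of the coefficient of the volume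
form as density. -/
def chartMeasure (vol : ∀ m : M, TangentSpace (𝓡 n) m [⋀^Fin n]→L[ℝ] ℝ) (x : M) : Measure M :=
  Measure.map (extChartAt (𝓡 n) x).symm
    ((volume.restrict (extChartAt (𝓡 n) x).target).withDensity
      (fun y => ENNReal.ofReal |chartCoeff vol x y|))

theorem volumeMeasure_eq : volumeMeasure vol = ⨆ x, chartMeasure vol x := rfl

variable [BorelSpace M]

theorem measurableSet_target (x : M) : MeasurableSet (extChartAt (𝓡 n) x).target :=
  (isOpen_extChartAt_target x).measurableSet

theorem measurableSet_source (x : M) : MeasurableSet (extChartAt (𝓡 n) x).source :=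
  (isOpen_extChartAt_source x).measurableSet

theorem aemeasurable_symm (x : M) : AEMeasurable (extChartAt (𝓡 n) x).symm
    ((volume.restrict (extChartAt (𝓡 n) x).target).withDensity
      (fun y => ENNReal.ofReal |chartCoeff vol x y|)) :=
  ((continuousOn_extChartAt_symm x).aemeasurable (measurableSet_target x)).mono_ac
    (withDensity_absolutelyContinuous _ _)

theorem image_chart_eq (x : M) {A : Set M} (hA : A ⊆ (extChartAt (𝓡 n) x).source) :
    extChartAt (𝓡 n) x '' A =
      (extChartAt (𝓡 n) x).target ∩ (extChartAt (𝓡 n) x).symm ⁻¹' A :=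
  (extChartAt (𝓡 n) x).image_eq_target_inter_inv_preimage hA

theorem measurableSet_image_chart (x : M) {A : Set M} (hA : MeasurableSet A)
    (hAs : A ⊆ (extChartAt (𝓡 n) x).source) : MeasurableSet (extChartAt (𝓡 n) x '' A) := by
  rw [image_chart_eq x hAs]
  have h := (continuousOn_extChartAt_symm (I := 𝓡 n) x).domRestrict.measurable hA
  have h2 := (measurableSet_target x).subtype_image h
  convert h2 using 1
  ext y
  simp [and_comm]

theorem chartMeasure_apply (x : M) {A : Set M} (hA : MeasurableSet A)
    (hAs : A ⊆ (extChartAt (𝓡 n) x).source) :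
    chartMeasure vol x A =
      ∫⁻ y in extChartAt (𝓡 n) x '' A, ENNReal.ofReal |chartCoeff vol x y| := by
  have hm := measurableSet_image_chart x hA hAs
  rw [chartMeasure, Measure.map_apply_of_aemeasurable (aemeasurable_symm x) hA]
  rw [withDensity_apply', Measure.restrict_restrict' (measurableSet_target x), inter_comm,
    ← image_chart_eq x hAs]

theorem chartMeasure_compl (x : M) : chartMeasure vol x (extChartAt (𝓡 n) x).sourceᶜ = 0 := by
  rw [chartMeasure, Measure.map_apply_of_aemeasurable (aemeasurable_symm x)
    (measurableSet_source x).compl]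
  refine withDensity_absolutelyContinuous _ _ ?_
  rw [Measure.restrict_apply' (measurableSet_target x)]
  convert measure_empty (μ := (volume : Measure (EuclideanSpace ℝ (Fin n))))
  ext y
  simp only [mem_inter_iff, mem_preimage, mem_compl_iff, mem_empty_iff_false, iff_false, not_and]
  exact fun h1 h2 => h1 ((extChartAt (𝓡 n) x).map_target h2)

theorem chartMeasure_inter_source (x : M) (A : Set M) :
    chartMeasure vol x (A ∩ (extChartAt (𝓡 n) x).source) = chartMeasure vol x A :=
  measure_inter_conull (chartMeasure_compl x)

/-- By the change of variables formula the measures of two charts agree on the intersection of the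
chart domains. -/
theorem chartMeasure_le (x z : M) {A : Set M} (hA : MeasurableSet A)
    (hAs : A ⊆ (extChartAt (𝓡 n) x).source) : chartMeasure vol z A ≤ chartMeasure vol x A := by
  set A' := A ∩ (extChartAt (𝓡 n) z).source with hA'
  have hm : MeasurableSet A' := hA.inter (measurableSet_source z)
  have hx : A' ⊆ (extChartAt (𝓡 n) x).source := inter_subset_left.trans hAs
  have hz : A' ⊆ (extChartAt (𝓡 n) z).source := inter_subset_right
  have h1 : chartMeasure vol z A = chartMeasure vol z A' :=
    (chartMeasure_inter_source z A).symm
  rw [h1]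
  refine le_trans (le_of_eq ?_) (measure_mono inter_subset_left : chartMeasure vol x A' ≤ _)
  rw [chartMeasure_apply z hm hz, chartMeasure_apply x hm hx]
  set T : EuclideanSpace ℝ (Fin n) → EuclideanSpace ℝ (Fin n) := fun w => extChartAt (𝓡 n) z ((extChartAt (𝓡 n) x).symm w) with hT
  have hmem : ∀ y ∈ extChartAt (𝓡 n) x '' A', y ∈ (extChartAt (𝓡 n) x).target ∧
      (extChartAt (𝓡 n) x).symm y ∈ A' := fun y hy => by
    rw [image_chart_eq x hx] at hy
    exact hy
  have himg : extChartAt (𝓡 n) z '' A' = T '' (extChartAt (𝓡 n) x '' A') := by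
    rw [image_image]
    refine image_congr fun m hm' => ?_
    rw [hT]
    simp only
    rw [(extChartAt (𝓡 n) x).left_inv (hx hm')]
  have hd : ∀ y ∈ extChartAt (𝓡 n) x '' A', HasFDerivAt T (fderiv ℝ T y) y := by
    intro y hy
    have : IsManifold (𝓡 n) 1 M := IsManifold.of_le (n := ∞) (by simp)
    refine DifferentiableAt.hasFDerivAt (mdifferentiableAt_iff_differentiableAt.1 ?_)
    refine MDifferentiableAt.comp y (g := extChartAt (𝓡 n) z) (I' := 𝓡 n)
      (mdifferentiableAt_extChartAt ?_)
      ((contMDiffAt_extChartAt_symm (hmem y hy).1).mdifferentiableAt (by simp))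
    have := hz (hmem y hy).2
    rwa [extChartAt_source] at this
  have hinj : InjOn T (extChartAt (𝓡 n) x '' A') := by
    intro y hy w hw h
    have h2 := (extChartAt (𝓡 n) z).injOn (hz (hmem y hy).2) (hz (hmem w hw).2) h
    exact (extChartAt (𝓡 n) x).symm.injOn (hmem y hy).1 (hmem w hw).1 h2
  rw [himg, lintegral_image_eq_lintegral_abs_det_fderiv_mul volume
    (measurableSet_image_chart x hm hx) (fun y hy => (hd y hy).hasFDerivWithinAt) hinj]
  refine setLIntegral_congr_fun (measurableSet_image_chart x hm hx) fun y hy => ?_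
  rw [chartCoeff_change x z (hmem y hy).1 (hz (hmem y hy).2), abs_mul,
    ENNReal.ofReal_mul (abs_nonneg _)]

/-- In the domain of a chart the supremum of the chart measures is the measure of that chart. -/
theorem volumeMeasure_apply (x : M) {A : Set M} (hA : MeasurableSet A)
    (hAs : A ⊆ (extChartAt (𝓡 n) x).source) : volumeMeasure vol A = chartMeasure vol x A := by
  have hle : ∀ z, chartMeasure vol z ≤ volumeMeasure vol := fun z =>
    le_iSup (f := fun z => chartMeasure (n := n) (M := M) vol z) z
  refine le_antisymm ?_ (Measure.le_iff'.1 (hle x) A)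
  -- It suffices to bound every chart measure by a measure which agrees with `chartMeasure vol x` on
  -- the chart domain.
  have h : volumeMeasure vol ≤ chartMeasure vol x +
      (volumeMeasure vol).restrict (extChartAt (𝓡 n) x).sourceᶜ := by
    rw [volumeMeasure_eq]
    refine iSup_le fun z => Measure.le_iff.2 fun S hS => ?_
    rw [← measure_inter_add_sdiff S (measurableSet_source (n := n) x), Measure.add_apply,
      Measure.restrict_apply hS]
    refine add_le_add ((chartMeasure_le x z (hS.inter (measurableSet_source x))
      inter_subset_right).trans (measure_mono inter_subset_left)) ?_
    exact Measure.le_iff'.1 (hle z) _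
  refine (Measure.le_iff'.1 h A).trans ?_
  rw [Measure.add_apply, Measure.restrict_apply hA,
    (disjoint_compl_right_iff_subset.2 hAs).inter_eq, measure_empty, add_zero]

theorem restrict_volumeMeasure (x : M) :
    (volumeMeasure vol).restrict (extChartAt (𝓡 n) x).source = chartMeasure vol x := by
  refine Measure.ext fun A hA => ?_
  rw [Measure.restrict_apply hA, volumeMeasure_apply x (hA.inter (measurableSet_source x))
    inter_subset_right]
  exact chartMeasure_inter_source x A

theorem isLocallyFiniteMeasure_volumeMeasure (hvol : IsVolumeForm vol) :
    IsLocallyFiniteMeasure (volumeMeasure vol) := by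
  refine ⟨fun x => ?_⟩
  obtain ⟨δ, hδ, hb⟩ := Metric.nhds_basis_closedBall.mem_iff.1
    (extChartAt_target_mem_nhds (I := 𝓡 n) x)
  set A := (extChartAt (𝓡 n) x).source ∩
    extChartAt (𝓡 n) x ⁻¹' Metric.ball (extChartAt (𝓡 n) x x) δ with hA
  have hAo : IsOpen A := (continuousOn_extChartAt x).isOpen_inter_preimage
    (isOpen_extChartAt_source x) Metric.isOpen_ball
  refine ⟨A, hAo.mem_nhds ⟨mem_extChartAt_source x, Metric.mem_ball_self hδ⟩, ?_⟩
  rw [volumeMeasure_apply x hAo.measurableSet inter_subset_left,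
    chartMeasure_apply x hAo.measurableSet inter_subset_left]
  have hc : ContinuousOn (chartCoeff vol x) (Metric.closedBall (extChartAt (𝓡 n) x x) δ) :=
    (hvol.smooth x).continuousOn.mono hb
  have hi : IntegrableOn (chartCoeff vol x) (Metric.closedBall (extChartAt (𝓡 n) x x) δ) :=
    hc.integrableOn_compact (isCompact_closedBall _ _)
  refine lt_of_le_of_lt (lintegral_mono_set ?_) hi.norm.lintegral_lt_top
  rintro _ ⟨m, hm, rfl⟩
  exact Metric.ball_subset_closedBall hm.2

theorem isOpenPosMeasure_volumeMeasure (hvol : IsVolumeForm vol) :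
    (volumeMeasure vol).IsOpenPosMeasure := by
  refine ⟨fun U hU ⟨x, hx⟩ h0 => ?_⟩
  set A := (extChartAt (𝓡 n) x).source ∩ U
  have hAo : IsOpen A := (isOpen_extChartAt_source x).inter hU
  have h1 : volumeMeasure vol A = 0 := measure_mono_null inter_subset_right h0
  rw [volumeMeasure_apply x hAo.measurableSet inter_subset_left,
    chartMeasure_apply x hAo.measurableSet inter_subset_left] at h1
  have himg := image_chart_eq x (inter_subset_left : A ⊆ (extChartAt (𝓡 n) x).source)
  have ho : IsOpen (extChartAt (𝓡 n) x '' A) := by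
    rw [himg]
    exact (continuousOn_extChartAt_symm x).isOpen_inter_preimage (isOpen_extChartAt_target x) hAo
  have hsub : extChartAt (𝓡 n) x '' A ⊆ (extChartAt (𝓡 n) x).target := by
    rw [himg]; exact inter_subset_left
  have hc : ContinuousOn (fun y => ENNReal.ofReal |chartCoeff vol x y|) (extChartAt (𝓡 n) x '' A) :=
    ENNReal.continuous_ofReal.comp_continuousOn ((hvol.smooth x).continuousOn.mono hsub).abs
  rw [lintegral_eq_zero_iff' (hc.aemeasurable ho.measurableSet), Filter.EventuallyEq,
    ae_restrict_iff' ho.measurableSet] at h1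
  have h2 : volume (extChartAt (𝓡 n) x '' A) = 0 := by
    refine measure_mono_null (fun y hy => ?_) (ae_iff.1 h1)
    simp only [mem_ofPred_eq, Pi.zero_apply, ENNReal.ofReal_eq_zero, Classical.not_imp, not_le]
    exact ⟨hy, abs_pos.2 (chartCoeff_ne_zero hvol x (hsub hy))⟩
  exact (ho.measure_pos volume ⟨_, mem_image_of_mem _ ⟨mem_extChartAt_source x, hx⟩⟩).ne' h2

theorem integral_volumeMeasure_eq (hvol : IsVolumeForm vol) (x : M) {f : M → ℝ} (hf : Continuous f)
    (hfs : ∀ m ∉ (extChartAt (𝓡 n) x).source, f m = 0) :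
    ∫ m, f m ∂(volumeMeasure vol) = ∫ y in (extChartAt (𝓡 n) x).target,
      |chartCoeff vol x y| * f ((extChartAt (𝓡 n) x).symm y) := by
  rw [← setIntegral_eq_integral_of_forall_compl_eq_zero (s := (extChartAt (𝓡 n) x).source) hfs,
    restrict_volumeMeasure, chartMeasure, integral_map (aemeasurable_symm x)
      hf.measurable.aestronglyMeasurable,
    integral_withDensity_eq_integral_toReal_smul₀]
  · refine setIntegral_congr_fun (measurableSet_target x) fun y _ => ?_
    rw [ENNReal.toReal_ofReal (abs_nonneg _), smul_eq_mul]
  · exact (ENNReal.continuous_ofReal.comp_continuousOn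
      (hvol.smooth x).continuousOn.abs).aemeasurable (measurableSet_target x)
  · exact Eventually.of_forall fun y => ENNReal.ofReal_lt_top

variable [SecondCountableTopology M]

/-- The coefficients of `dt ∧ vol` in charts are densities of the product of Lebesgue measure and
the measure of `vol`. -/
theorem hasChartDensity_spacetime (hvol : IsVolumeForm vol) :
    HasChartDensity (𝓘(ℝ, ℝ).prod (𝓡 n)) (volume : Measure (ℝ × EuclideanSpace ℝ (Fin n)))
      ((volume : Measure ℝ).prod (volumeMeasure vol)) (spacetimeCoeff vol) := by
  have := isLocallyFiniteMeasure_volumeMeasure hvol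
  have hsrc : ∀ x₀ : ℝ × M, (extChartAt (𝓘(ℝ, ℝ).prod (𝓡 n)) x₀).source =
      univ ×ˢ (extChartAt (𝓡 n) x₀.2).source := fun x₀ => by
    rw [extChartAt_prod, PartialEquiv.prod_source, extChartAt_model_space_eq_id]
    rfl
  have htgt : ∀ x₀ : ℝ × M, (extChartAt (𝓘(ℝ, ℝ).prod (𝓡 n)) x₀).target =
      univ ×ˢ (extChartAt (𝓡 n) x₀.2).target := fun x₀ => by
    rw [extChartAt_prod, PartialEquiv.prod_target, extChartAt_model_space_eq_id]
    rfl
  have hsymm : ∀ (x₀ : ℝ × M) (y : ℝ × EuclideanSpace ℝ (Fin n)), (extChartAt (𝓘(ℝ, ℝ).prod (𝓡 n)) x₀).symm y =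
      (y.1, (extChartAt (𝓡 n) x₀.2).symm y.2) := fun x₀ y => by
    rw [extChartAt_prod, extChartAt_model_space_eq_id]
    rfl
  refine ⟨fun x₀ => ?_, fun x₀ y hy => ?_, fun x₀ f hf hfc hfs => ?_⟩
  · rw [htgt]
    exact (hvol.smooth x₀.2).comp contDiff_snd.contDiffOn fun y hy => hy.2
  · rw [htgt] at hy
    exact chartCoeff_ne_zero hvol x₀.2 hy.2
  · have hi : Integrable f ((volume : Measure ℝ).prod (volumeMeasure vol)) :=
      hf.integrable_of_hasCompactSupport hfc
    rw [integral_prod _ hi]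
    have h1 : ∀ t : ℝ, ∫ m, f (t, m) ∂(volumeMeasure vol) =
        ∫ y in (extChartAt (𝓡 n) x₀.2).target,
          |chartCoeff vol x₀.2 y| * f (t, (extChartAt (𝓡 n) x₀.2).symm y) := fun t => by
      refine integral_volumeMeasure_eq hvol x₀.2 (f := fun m => f (t, m)) (by fun_prop) fun m hm => ?_
      refine image_eq_zero_of_notMem_tsupport fun h => hm ?_
      have := hfs h
      rw [hsrc] at this
      exact this.2
    simp only [h1]
    rw [htgt, Measure.volume_eq_prod]
    refine Eq.trans ?_ (setIntegral_prod (fun y : ℝ × EuclideanSpace ℝ (Fin n) => |spacetimeCoeff vol x₀ y| *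
      f ((extChartAt (𝓘(ℝ, ℝ).prod (𝓡 n)) x₀).symm y)) ?_).symm
    · rw [Measure.restrict_univ]
      simp only [hsymm]
      rfl
    · have hcomp : IsCompact (extChartAt (𝓘(ℝ, ℝ).prod (𝓡 n)) x₀ '' tsupport f) :=
        hfc.isCompact.image_of_continuousOn ((continuousOn_extChartAt x₀).mono hfs)
      have hsub : extChartAt (𝓘(ℝ, ℝ).prod (𝓡 n)) x₀ '' tsupport f ⊆
          (extChartAt (𝓘(ℝ, ℝ).prod (𝓡 n)) x₀).target := by
        rintro _ ⟨z, hz, rfl⟩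
        exact (extChartAt (𝓘(ℝ, ℝ).prod (𝓡 n)) x₀).map_source (hfs hz)
      have hc : ContinuousOn (fun y : ℝ × EuclideanSpace ℝ (Fin n) => |spacetimeCoeff vol x₀ y| *
          f ((extChartAt (𝓘(ℝ, ℝ).prod (𝓡 n)) x₀).symm y))
          (extChartAt (𝓘(ℝ, ℝ).prod (𝓡 n)) x₀).target := by
        refine ContinuousOn.mul (ContinuousOn.abs ?_)
          (hf.comp_continuousOn (continuousOn_extChartAt_symm x₀))
        rw [htgt]
        exact (hvol.smooth x₀.2).continuousOn.comp continuousOn_snd fun y hy => hy.2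
      refine ((hc.mono hsub).integrableOn_compact hcomp).of_forall_sdiff_eq_zero
        (MeasurableSet.univ.prod (measurableSet_target x₀.2)) fun y hy => ?_
      rw [← htgt] at hy
      rw [image_eq_zero_of_notMem_tsupport (f := f) fun h => hy.2
        ⟨_, h, (extChartAt (𝓘(ℝ, ℝ).prod (𝓡 n)) x₀).right_inv hy.1⟩, mul_zero]

end VolumeForm

/-! ### Trivialization by an equivariant map -/

section Principal

variable
  {EX : Type*} [NormedAddCommGroup EX] [NormedSpace ℝ EX]
  {HX : Type*} [TopologicalSpace HX] {IX : ModelWithCorners ℝ EX HX}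
  {X : Type*} [TopologicalSpace X] [ChartedSpace HX X] [IsManifold IX ∞ X]
  {EP : Type*} [NormedAddCommGroup EP] [NormedSpace ℝ EP]
  {HP : Type*} [TopologicalSpace HP] {IP : ModelWithCorners ℝ EP HP}
  {P : Type*} [TopologicalSpace P] [ChartedSpace HP P] [IsManifold IP ∞ P]
  {EG : Type*} [NormedAddCommGroup EG] [NormedSpace ℝ EG]
  {G : Type*} [TopologicalSpace G] [ChartedSpace EG G] [Group G] [LieGroup 𝓘(ℝ, EG) ∞ G]
  {B : BundleMaps X P G}

theorem IsPrincipal.exists_act_eq (hB : IsPrincipal (EG := EG) IX IP B) {p q : P}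
    (h : B.proj p = B.proj q) : ∃ g, B.act p g = q := by
  obtain ⟨W, -, hW, ξ, ψ, -, -, h1, h2, -⟩ := hB.locally_trivial (B.proj p)
  have hq : q ∈ B.part W := by
    change B.proj q ∈ W
    rwa [← h]
  refine ⟨(ξ p)⁻¹ * ξ q, ?_⟩
  have hmem : B.act p ((ξ p)⁻¹ * ξ q) ∈ B.part W := by
    change B.proj _ ∈ W
    rwa [hB.proj_act]
  rw [← h2 _ hmem, hB.proj_act, h1 p hW, mul_inv_cancel_left, h, h2 q hq]

/-- A smooth equivariant map trivializes a principal bundle; the unit section over `x` is `p · (ξ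
p)⁻¹` for any `p` over `x`, which is smooth because local sections exist. -/
theorem IsPrincipal.exists_isTrivialized (hB : IsPrincipal (EG := EG) IX IP B) {U : Set X}
    (hU : IsOpen U) {ξ : P → G} (hξ : ContMDiffOn IP 𝓘(ℝ, EG) ∞ ξ (B.part U))
    (hξeq : ∀ p ∈ B.part U, ∀ g, ξ (B.act p g) = ξ p * g) :
    ∃ e : X → P, IsTrivialized IX IP EG B U ξ e := by
  have hsurj : ∀ x : X, ∃ p, B.proj p = x := fun x => by
    obtain ⟨W, -, hW, ζ, ψ, -, -, -, -, h3⟩ := hB.locally_trivial x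
    exact ⟨ψ (x, 1), (h3 x hW 1).1⟩
  choose q hq using hsurj
  -- `act p (ξ p)⁻¹` depends only on the fibre of `p`
  have hind : ∀ p ∈ B.part U, B.act (q (B.proj p)) (ξ (q (B.proj p)))⁻¹ = B.act p (ξ p)⁻¹ := by
    intro p hp
    obtain ⟨g, hg⟩ := hB.exists_act_eq (hq (B.proj p)).symm
    rw [← hg, hξeq p hp, hB.act_mul, mul_inv_rev, mul_inv_cancel_left]
  have hqU : ∀ x ∈ U, q x ∈ B.part U := fun x hx => by
    change B.proj (q x) ∈ U
    rwa [hq]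
  refine ⟨fun x => B.act (q x) (ξ (q x))⁻¹, hU, hB.smooth_proj, hB.smooth_act, hB.act_one,
    hB.act_mul, hB.proj_act, hξ, hξeq, fun x hx => ?_, fun x _ => by rw [hB.proj_act, hq],
    fun x hx => by rw [hξeq _ (hqU x hx), mul_inv_cancel], fun p hp => ?_⟩
  · obtain ⟨W, hWo, hW, ζ, ψ, -, hψ, -, -, h3⟩ := hB.locally_trivial x
    have hσ : ContMDiffAt IX IP ∞ (fun y => ψ (y, 1)) x :=
      ((hψ (x, 1) ⟨hW, mem_univ _⟩).contMDiffAt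
        ((hWo.prod isOpen_univ).mem_nhds ⟨hW, mem_univ _⟩)).comp x
        (contMDiffAt_id.prodMk contMDiffAt_const)
    have hpart : IsOpen (B.part U) := hU.preimage hB.smooth_proj.continuous
    have hmem : ψ (x, 1) ∈ B.part U := by
      change B.proj _ ∈ U
      rwa [(h3 x hW 1).1]
    have hζ : ContMDiffAt IX 𝓘(ℝ, EG) ∞ (fun y => (ξ (ψ (y, 1)))⁻¹) x :=
      (((hξ _ hmem).contMDiffAt (hpart.mem_nhds hmem)).comp x hσ).inv
    have hall : ContMDiffAt IX IP ∞ (fun y => B.act (ψ (y, 1)) (ξ (ψ (y, 1)))⁻¹) x :=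
      (hB.smooth_act.contMDiffAt (x := (ψ (x, 1), (ξ (ψ (x, 1)))⁻¹))).comp x (hσ.prodMk hζ)
    refine (hall.congr_of_eventuallyEq ?_).contMDiffWithinAt
    filter_upwards [hWo.mem_nhds hW, hU.mem_nhds hx] with y hyW hyU
    have hp : B.proj (ψ (y, 1)) = y := (h3 y hyW 1).1
    have := hind (ψ (y, 1)) (by change B.proj _ ∈ U; rwa [hp])
    rwa [hp] at this
  · rw [hind p hp, hB.act_mul, inv_mul_cancel, hB.act_one]

end Principal

end GaugeField

end

theorem theorem6p6 {n : ℕ}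
    {M : Type*} [TopologicalSpace M] [ChartedSpace (EuclideanSpace ℝ (Fin n)) M]
    [IsManifold (𝓡 n) ∞ M] [T2Space M] [SecondCountableTopology M]
    [MeasurableSpace M] [BorelSpace M]
    {EG : Type*} [NormedAddCommGroup EG] [NormedSpace ℝ EG] [FiniteDimensional ℝ EG]
    {G : Type*} [TopologicalSpace G] [ChartedSpace EG G] [Group G] [LieGroup 𝓘(ℝ, EG) ∞ G]
    {EP : Type*} [NormedAddCommGroup EP] [NormedSpace ℝ EP] [FiniteDimensional ℝ EP]
    {P : Type*} [TopologicalSpace P] [ChartedSpace EP P] [IsManifold 𝓘(ℝ, EP) ∞ P]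
    (B : BundleMaps M P G)
    (hB : IsPrincipal (EG := EG) (𝓡 n) 𝓘(ℝ, EP) B)
    (μM : ∀ m : M, TangentSpace (𝓡 n) m [⋀^Fin n]→L[ℝ] ℝ)
    (hμM : IsVolumeForm μM)
    (L : Jet (𝓘(ℝ, ℝ).prod (𝓡 n)) (𝓘(ℝ, ℝ).prod 𝓘(ℝ, EP)) B.timesLine → ℝ)
    (hL : SmoothOnJets (𝓘(ℝ, ℝ).prod (𝓡 n)) (𝓘(ℝ, ℝ).prod 𝓘(ℝ, EP)) B.timesLine L)
    (hLinv : Invariant (𝓘(ℝ, ℝ).prod (𝓡 n)) (𝓘(ℝ, ℝ).prod 𝓘(ℝ, EP)) B.timesLine L)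
    (J : Set ℝ) (hJ : IsOpen J) (V : Set M) (hV : IsOpen V)
    (s : ℝ × M → ℝ × P)
    (hs : IsLocalSection (𝓘(ℝ, ℝ).prod (𝓡 n)) (𝓘(ℝ, ℝ).prod 𝓘(ℝ, EP))
      B.timesLine (J ×ˢ V) s)
    (ξ₀ : P → G) (hξ₀ : ContMDiffOn 𝓘(ℝ, EP) 𝓘(ℝ, EG) ∞ ξ₀ (B.part V))
    (hξ₀eq : ∀ p ∈ B.part V, ∀ g, ξ₀ (B.act p g) = ξ₀ p * g) :
    List.TFAE [
      DynamicHamilton (𝓡 n) 𝓘(ℝ, EP) B (volumeMeasure μM) L J V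
        (flatConnection (EG := EG) 𝓘(ℝ, EP) ξ₀) (gaugeCurve B ξ₀ s),
      DynamicEulerLagrange (𝓡 n) 𝓘(ℝ, EP) B (volumeMeasure μM) L J V
        (flatConnection (EG := EG) 𝓘(ℝ, EP) ξ₀) (gaugeCurve B ξ₀ s),
      AffineReducedPrinciple (𝓡 n) 𝓘(ℝ, EP) B (volumeMeasure μM)
        (reduce (𝓘(ℝ, ℝ).prod (𝓡 n)) (𝓘(ℝ, ℝ).prod 𝓘(ℝ, EP)) B.timesLine L hLinv) J V
        (bodyVelocity 𝓘(ℝ, EP) B V (gaugeCurve B ξ₀ s))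
        (fun t => pushForm 𝓘(ℝ, EP) B V (gaugeCurve B ξ₀ s t) (flatConnection (EG := EG) 𝓘(ℝ, EP) ξ₀)),
      AffineEulerPoincare (𝓡 n) 𝓘(ℝ, EP) B (volumeMeasure μM)
        (reduce (𝓘(ℝ, ℝ).prod (𝓡 n)) (𝓘(ℝ, ℝ).prod 𝓘(ℝ, EP)) B.timesLine L hLinv) J V
        (bodyVelocity 𝓘(ℝ, EP) B V (gaugeCurve B ξ₀ s))
        (fun t => pushForm 𝓘(ℝ, EP) B V (gaugeCurve B ξ₀ s t) (flatConnection (EG := EG) 𝓘(ℝ, EP) ξ₀)),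
      CovariantHamilton (𝓘(ℝ, ℝ).prod (𝓡 n)) (𝓘(ℝ, ℝ).prod 𝓘(ℝ, EP)) B.timesLine
        ((volume : Measure ℝ).prod (volumeMeasure μM)) L (J ×ˢ V) s,
      CovariantEulerLagrange (𝓘(ℝ, ℝ).prod (𝓡 n)) (𝓘(ℝ, ℝ).prod 𝓘(ℝ, EP)) B.timesLine
        (spacetimeCoeff μM) L (J ×ˢ V) s,
      CovariantReducedPrinciple (𝓘(ℝ, ℝ).prod (𝓡 n)) (𝓘(ℝ, ℝ).prod 𝓘(ℝ, EP)) B.timesLine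
        ((volume : Measure ℝ).prod (volumeMeasure μM))
        (reduce (𝓘(ℝ, ℝ).prod (𝓡 n)) (𝓘(ℝ, ℝ).prod 𝓘(ℝ, EP)) B.timesLine L hLinv) (J ×ˢ V)
        (timesLineConnection 𝓘(ℝ, EP) (flatConnection (EG := EG) 𝓘(ℝ, EP) ξ₀)) s,
      CovariantEulerPoincare (𝓘(ℝ, ℝ).prod (𝓡 n)) (𝓘(ℝ, ℝ).prod 𝓘(ℝ, EP)) B.timesLine
        (spacetimeCoeff μM)
        (reduce (𝓘(ℝ, ℝ).prod (𝓡 n)) (𝓘(ℝ, ℝ).prod 𝓘(ℝ, EP)) B.timesLine L hLinv) (J ×ˢ V)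
        (timesLineConnection 𝓘(ℝ, EP) (flatConnection (EG := EG) 𝓘(ℝ, EP) ξ₀)) s] := by
  have : LocallyCompactSpace M := ChartedSpace.locallyCompactSpace (EuclideanSpace ℝ (Fin n)) M
  have := isLocallyFiniteMeasure_volumeMeasure hμM
  have := isOpenPosMeasure_volumeMeasure hμM
  have : (volume : Measure (ℝ × EuclideanSpace ℝ (Fin n))).IsAddHaarMeasure :=
    Measure.prod.instIsAddHaarMeasure volume volume
  -- The trivialization of the bundle by `ξ₀`, and the one it induces over space-time.
  obtain ⟨e, hT⟩ := hB.exists_isTrivialized hV hξ₀ hξ₀eq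
  have hTX := hT.timesLine hJ
  have hΛ := hT.fibreSmooth_lineLag hJ hL hLinv
  have hν := hT.smoothFormOn_lineLog hJ hs
  have hμX := hasChartDensity_spacetime hμM
  have hA : ∀ p ∈ B.part V, flatConnection (EG := EG) 𝓘(ℝ, EP) ξ₀ p =
      (Ad G (ξ₀ p)⁻¹).comp (rlog 𝓘(ℝ, EP) EG ξ₀ p) := fun p hp =>
    flatConnection_eq (((hξ₀ p hp).contMDiffAt (hT.isOpen_part.mem_nhds hp)).mdifferentiableAt
      (by simp))
  have hAX := hT.timesLineConnection_eq (J := J) hA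
  -- Each principle and each system of equations as a condition on `Λ` and `ν`.
  have h1 := hT.dynamicHamilton_iff (μ := volumeMeasure μM) hJ hL hLinv hs
  have h2 := hT.dynamicEulerLagrange_iff (μ := volumeMeasure μM) hJ hL hLinv hs
  have h3 := hT.affineReducedPrinciple_iff (μ := volumeMeasure μM) hJ hL hLinv hs
  have h4 := hT.affineEulerPoincare_iff (μ := volumeMeasure μM) hJ hL hLinv hs
  have h5 := hTX.covariantHamilton_iff (μ := (volume : Measure ℝ).prod (volumeMeasure μM))
    hL hLinv hs
  have h6 := hTX.covariantEulerLagrange_iff (ρ := spacetimeCoeff μM) hL hLinv hs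
  have h7 := hTX.covariantReducedPrinciple_iff
    (μ := (volume : Measure ℝ).prod (volumeMeasure μM)) hAX hL hLinv hs
  have h8 := hTX.covariantEulerPoincare_iff (ρ := spacetimeCoeff μM) hAX hL hLinv hs
  have hWE := weakEquation_iff_strongEquation (G := G) hμX (hJ.prod hV) hΛ hν
  -- Reduced and unreduced versions become the same condition.
  tfae_have 1 ↔ 3 := h1.trans h3.symm
  tfae_have 2 ↔ 4 := h2.trans h4.symm
  tfae_have 5 ↔ 7 := h5.trans h7.symm
  tfae_have 6 ↔ 8 := h6.trans h8.symm
  -- The four conditions are equivalent.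
  tfae_have 5 ↔ 6 := h5.trans (hWE.trans h6.symm)
  tfae_have 1 → 6 := fun h => h6.2 ((h1.1 h).strongEquation hμX hJ hV hΛ hν)
  tfae_have 5 → 2 := fun h => h2.2 (WeakEquation.evolutionEquation hJ hV hΛ hν (h5.1 h))
  tfae_have 2 → 1 := fun h => h1.2 ((h2.1 h).endpointEquation hJ hV hΛ hν)
  tfae_finish
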